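/- **Theorem.** Algorithms are programs for a randomized random access machine (with fair coin tosses) whose running time is measured by logarithmic cost. An algorithm that may answer "no" or return an answer is called *Monte Carlo* if it never returns an invalid answer, and if, on every instance that has a solution, it fails to return a correct solution with probability at most $1/4$. A running time is $O^*(2^{cm})$ if, for some constants $C,k$, it is at most $C\cdot L^k\cdot 2^{cm}$ on every instance for every outcome of the coin tosses, where $L$ is the size (number of bits) of the input. (1) *Linear Sat.* There is a Monte Carlo algorithm with running time $O^*(2^{0.3399m})$ that, given integers $n,m\ge 0$, a matrix $A\in\mathbb{Z}_2^{n\times m}$, a vector $b\in\mathbb{Z}_2^n$, positive integer weights $\omega=(\omega_1,\dots,\omega_m)$ and an integer $t$, finds an $x\in\mathbb{Z}_2^m$ with $Ax\equiv b$ and $\omega\cdot x=\sum_j\omega_jx_j\le t$ (the sum is taken over the integers, with $x_j\in\{0,1\}$), if there is one. Every vector that it returns satisfies these two conditions. (2) *Minimum Set Partition.* There is a Monte Carlo algorithm with running time $O^*(2^{0.3399m})$ that, given subsets $N(f)\subseteq U$, $f\in F$, of a finite set $U$, where $|F|=m$, finds a smallest set partition and its size, if there is a set partition. Here a set partition is a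 set $S\subseteq F$ such that the sets $N(f)$, $f\in S$, are pairwise disjoint and have union $U$. Whatever it returns is a set partition together with its size; with probability at least $3/4$ it is one of minimum size, if there is any. -/

import Mathlib

open scoped Matrix

/-! ### Randomized random access machines with logarithmic cost -/

namespace RAM

/-- Binary operations on natural numbers that the machine can perform
(with the usual conventions `a - b = 0` for `a < b`, `a / 0 = 0` and `a % 0 = a`). -/
inductive BinOp
  | add | sub | mul | div | mod | land | lor | xor | lt | eq

/-- The value of an operation; comparisons return `0` or `1`,
and `land`, `lor`, `xor` are bitwise. -/
def BinOp.eval : BinOp → ℕ → ℕ → ℕ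
  | .add, a, b => a + b
  | .sub, a, b => a - b
  | .mul, a, b => a * b
  | .div, a, b => a / b
  | .mod, a, b => a % b
  | .land, a, b => a &&& b
  | .lor, a, b => a ||| b
  | .xor, a, b => a ^^^ b
  | .lt, a, b => if a < b then 1 else 0
  | .eq, a, b => if a = b then 1 else 0

/-- Structured programs for a random access machine. A program mentions only finitely many
registers; the memory is addressed indirectly, through the contents of registers. -/
inductive Prog
  /-- Do nothing. -/
  | skip
  /-- `const x k`: register `x` receives the constant `k`. -/
  | const (x k : ℕ)
  /-- `op o x y z`: register `x` receives the result of `o` on registers `y` and `z`. -/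
  | op (o : BinOp) (x y z : ℕ)
  /-- `load x y`: register `x` receives the memory cell whose address is in register `y`. -/
  | load (x y : ℕ)
  /-- `store x y`: the memory cell whose address is in register `x` receives register `y`. -/
  | store (x y : ℕ)
  /-- `flip x`: register `x` receives a fresh random bit. -/
  | flip (x : ℕ)
  /-- Sequential composition. -/
  | seq (p q : Prog)
  /-- `cond x p q`: run `p` if register `x` is nonzero, and `q` otherwise. -/
  | cond (x : ℕ) (p q : Prog)
  /-- `loop x p`: while register `x` is nonzero, run `p`. -/
  | loop (x : ℕ) (p : Prog)

/-- A state of the machine: the registers, the memory cells, and the number of coins that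
have been tossed so far. -/
structure State where
  reg : ℕ → ℕ
  mem : ℕ → ℕ
  tossed : ℕ

/-- Write `v` into register `x`. -/
def State.setReg (s : State) (x v : ℕ) : State :=
  { s with reg := Function.update s.reg x v }

/-- Write `v` into memory cell `a`. -/
def State.setMem (s : State) (a v : ℕ) : State :=
  { s with mem := Function.update s.mem a v }

/-- `Exec r p s s' c`: with the sequence `r` of coin tosses, the program `p` started in state
`s` halts in state `s'` after time `c`. Time is counted with logarithmic cost: every
elementary instruction and every test costs one plus the number of bits of all the numbers
involved, memory addresses included. -/
inductive Exec (r : ℕ → Bool) : Prog → State → State → ℕ → Prop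
  | skip (s : State) : Exec r .skip s s 1
  | const (s : State) (x k : ℕ) : Exec r (.const x k) s (s.setReg x k) (1 + k.size)
  | op (s : State) (o : BinOp) (x y z : ℕ) :
      Exec r (.op o x y z) s (s.setReg x (o.eval (s.reg y) (s.reg z)))
        (1 + (s.reg y).size + (s.reg z).size + (o.eval (s.reg y) (s.reg z)).size)
  | load (s : State) (x y : ℕ) :
      Exec r (.load x y) s (s.setReg x (s.mem (s.reg y)))
        (1 + (s.reg y).size + (s.mem (s.reg y)).size)
  | store (s : State) (x y : ℕ) :
      Exec r (.store x y) s (s.setMem (s.reg x) (s.reg y))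
        (1 + (s.reg x).size + (s.reg y).size)
  | flip (s : State) (x : ℕ) :
      Exec r (.flip x) s
        { s.setReg x (if r s.tossed then 1 else 0) with tossed := s.tossed + 1 } 2
  | seq {p q : Prog} {s s' s'' : State} {c d : ℕ} :
      Exec r p s s' c → Exec r q s' s'' d → Exec r (.seq p q) s s'' (c + d)
  | cond_true {x : ℕ} {p q : Prog} {s s' : State} {c : ℕ} :
      s.reg x ≠ 0 → Exec r p s s' c → Exec r (.cond x p q) s s' (1 + (s.reg x).size + c)
  | cond_false {x : ℕ} {p q : Prog} {s s' : State} {c : ℕ} :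
      s.reg x = 0 → Exec r q s s' c → Exec r (.cond x p q) s s' (1 + (s.reg x).size + c)
  | loop_true {x : ℕ} {p : Prog} {s s' s'' : State} {c d : ℕ} :
      s.reg x ≠ 0 → Exec r p s s' c → Exec r (.loop x p) s' s'' d →
        Exec r (.loop x p) s s'' (1 + (s.reg x).size + c + d)
  | loop_false {x : ℕ} {p : Prog} {s : State} :
      s.reg x = 0 → Exec r (.loop x p) s s (1 + (s.reg x).size)

/-- Given the coin tosses, the final state and the running time are determined. -/
theorem Exec.deterministic {r : ℕ → Bool} {p : Prog} {s s₁ s₂ : State} {c₁ c₂ : ℕ}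
    (h₁ : Exec r p s s₁ c₁) (h₂ : Exec r p s s₂ c₂) : s₁ = s₂ ∧ c₁ = c₂ := by
  induction h₁ generalizing s₂ c₂ with
  | skip | const | op | load | store | flip => cases h₂; exact ⟨rfl, rfl⟩
  | seq _ _ ih₁ ih₂ =>
    cases h₂ with
    | seq a b =>
      obtain ⟨rfl, rfl⟩ := ih₁ a
      obtain ⟨rfl, rfl⟩ := ih₂ b
      exact ⟨rfl, rfl⟩
  | cond_true hx _ ih =>
    cases h₂ with
    | cond_true _ a => obtain ⟨rfl, rfl⟩ := ih a; exact ⟨rfl, rfl⟩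
    | cond_false h _ => exact absurd h hx
  | cond_false hx _ ih =>
    cases h₂ with
    | cond_true h _ => exact absurd hx h
    | cond_false _ a => obtain ⟨rfl, rfl⟩ := ih a; exact ⟨rfl, rfl⟩
  | loop_true hx _ _ ih₁ ih₂ =>
    cases h₂ with
    | loop_true _ a b =>
      obtain ⟨rfl, rfl⟩ := ih₁ a
      obtain ⟨rfl, rfl⟩ := ih₂ b
      exact ⟨rfl, rfl⟩
    | loop_false h => exact absurd h hx
  | loop_false hx =>
    cases h₂ with
    | loop_true h _ _ => exact absurd hx h
    | loop_false _ => exact ⟨rfl, rfl⟩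

/-- The initial state: the input is written to the memory cells `0, 1, 2, …`, and all other
memory cells and all registers are zero. -/
def init (input : List ℕ) : State where
  reg := fun _ => 0
  mem := fun i => input.getD i 0
  tossed := 0

/-- The size of an input: its number of bits, plus one for each of its entries. -/
def inputSize (input : List ℕ) : ℕ :=
  (input.map fun k => k.size + 1).sum

/-- The law of an infinite sequence of independent fair coin tosses. -/
noncomputable def coins : MeasureTheory.Measure (ℕ → Bool) :=
  MeasureTheory.Measure.infinitePi fun _ => (PMF.uniformOfFintype Bool).toMeasure

/-- `IsMonteCarlo p input read valid goal T`: the program `p` is a Monte Carlo algorithm with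
running time at most `T`. An instance `I` is given to the machine as `input I`, and
`read I` turns the final state into an answer, or into `none` (the answer "no").
* For all coin tosses the program halts within time `T I`, and an answer other than "no" is
  always valid (there are no false positives).
* If some answer reaches the goal, then the probability that the answer of the program
  does not reach it is at most `1/4`. -/
def IsMonteCarlo {ι : Type} {β : ι → Type} (p : Prog) (input : ι → List ℕ)
    (read : (I : ι) → State → Option (β I)) (valid goal : (I : ι) → β I → Prop)
    (T : ι → ℝ) : Prop :=
  ∀ I : ι,
    (∀ r : ℕ → Bool, ∃ (s : State) (c : ℕ), Exec r p (init (input I)) s c ∧ (c : ℝ) ≤ T I ∧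
      ∀ a, read I s = some a → valid I a) ∧
    ((∃ a, goal I a) →
      coins {r | ¬ ∃ (s : State) (c : ℕ) (a : β I),
        Exec r p (init (input I)) s c ∧ read I s = some a ∧ goal I a} ≤ 1 / 4)

end RAM

/-! ### Linear Sat -/

/-- An instance of Linear Sat. -/
structure LinearSat where
  n : ℕ
  m : ℕ
  A : Matrix (Fin n) (Fin m) (ZMod 2)
  b : Fin n → ZMod 2
  ω : Fin m → ℕ+
  t : ℤ

namespace LinearSat

/-- `A x ≡ b` over the field with two elements, and `ω · x ≤ t` over the integers, where the
entries of `x` are read as the integers `0` and `1`. -/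
def IsSolution (I : LinearSat) (x : Fin I.m → ZMod 2) : Prop :=
  I.A *ᵥ x = I.b ∧ ∑ j, ((I.ω j : ℕ) : ℤ) * ((x j).val : ℤ) ≤ I.t

/-- The input: `n`, `m`, the positive and the negative part of `t`, the weights, the vector
`b`, and the rows of the matrix `A`. -/
def input (I : LinearSat) : List ℕ :=
  [I.n, I.m, I.t.toNat, (-I.t).toNat] ++ (List.ofFn fun j => (I.ω j : ℕ)) ++
    (List.ofFn fun i => (I.b i).val) ++
    (List.ofFn fun i => List.ofFn fun j => (I.A i j).val).flatten

/-- The answer is "no" if register `0` is zero. Otherwise it is the vector in the memory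
cells `0, …, m - 1`. -/
def read (I : LinearSat) (s : RAM.State) : Option (Fin I.m → ZMod 2) :=
  if s.reg 0 = 0 then none else some fun j => (s.mem j : ZMod 2)

end LinearSat

/-! ### Minimum Set Partition -/

/-- An instance of minimum Set Partition: a bipartite graph between a family of `m` sets and
a universe of `n` elements, where `N f` is the neighbourhood of `f`. -/
structure SetPartition where
  n : ℕ
  m : ℕ
  N : Fin m → Finset (Fin n)

namespace SetPartition

/-- The sets in `S` are pairwise disjoint and their union is the universe. -/
def IsPartition (G : SetPartition) (S : Finset (Fin G.m)) : Prop :=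
  S.biUnion G.N = Finset.univ ∧ ∀ f ∈ S, ∀ f' ∈ S, f ≠ f' → Disjoint (G.N f) (G.N f')

/-- The input: `n`, `m`, and for each of the `m` sets its incidence vector. -/
def input (G : SetPartition) : List ℕ :=
  [G.n, G.m] ++ (List.ofFn fun f => List.ofFn fun u => if u ∈ G.N f then 1 else 0).flatten

/-- The answer is "no" if register `0` is zero. Otherwise it consists of the number in
register `1` and of the subfamily marked by the nonzero cells among the memory
cells `0, …, m - 1`. -/
def read (G : SetPartition) (s : RAM.State) : Option (ℕ × Finset (Fin G.m)) :=
  if s.reg 0 = 0 then none else some (s.reg 1, Finset.univ.filter fun f => s.mem f ≠ 0)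

/-- `(k, S)` is a set partition `S` together with its size `k`. -/
def IsSizedPartition (G : SetPartition) (a : ℕ × Finset (Fin G.m)) : Prop :=
  G.IsPartition a.2 ∧ a.2.card = a.1

/-- `(k, S)` is a set partition `S` of smallest size together with its size `k`. -/
def IsMinimum (G : SetPartition) (a : ℕ × Finset (Fin G.m)) : Prop :=
  G.IsSizedPartition a ∧ ∀ S' : Finset (Fin G.m), G.IsPartition S' → a.1 ≤ S'.card

end SetPartition

/-! Linear Sat is solved by the representation technique. Let `X` be a solution of `Ax = b` of least
weight. As weights are positive, the columns in `X` are linearly independent: a nonempty `U ⊆ X`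
with column sum zero could be removed, leaving a lighter solution. Choose `w` with `16w - 15 ≤ |X| ≤
16w`; the program tries all `w`. Halve `X` four times, so that the parts at depth `d` have at most
`w * 2 ^ d` elements. The leaves are found in a list of all signatures of sets with at most `w`
elements, and the lists at the inner nodes arise by merging.

A set `Y` has about `2 ^ |Y|` balanced splits, up to a polynomial factor, and one of them is enough.
So each node prescribes a random value for the signature of one half modulo `M d = 2 ^ (2 * (w * 2 ^
d) + 7)`. The signature of a set is its column sum followed by the values of `m + 22` random linear
functionals. By independence, nonempty subsets of `X` have nonzero column sums, and therefore the
random functionals separate the subsets of `Y` modulo `M d` except with probability `2 ^ (-7)`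
(`prob_not_separates`). If they do, different splits compete for different random values, and some
split is hit with probability at least one over a polynomial. Over the 15 inner nodes this gives a
polynomially small chance that all prescriptions fit (`goodMass_le_prob`, `mean_goodMass_ge`,
`splitMass_ge`).

The work consists of the pairs that match in a merge. For two lists of sets with at most `k = w * 2
^ d` elements, matching means two random congruences, modulo `2 ^ (2k + 7)` and `2 ^ (4k + 7)`.
There are at most `8 ^ k * (9 / 8) ^ m` such sets, so the expected number of pairs is at most `(81 /
64) ^ m`, whatever `k` is (`card_smallSets_sq_le`, `mean_innerWork_le`). At the root full signatures
are compared, and each occurs only once in a list, so nothing needs to be estimated there. The list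
at the leaves is short enough by `card_smallSets_base_le`. Every merge is cut off at a budget of
`(81 / 64) ^ m` times a polynomial, which bounds the time for all coin tosses; by Markov's
inequality the cut rarely matters (`prob_trial_ge`). Polynomially many trials push the failure
probability below `1 / 4` (`coins_trials_fail_le`), and `growth_le` compares `81 / 64` with `2 ^
0.3399`.

A list keeps only the lightest set found for each signature. This loses nothing, because replacing
both halves by lighter sets of equal signature preserves the column sum and does not raise the
weight (`covers_merge`). The signature determines the column sum (`hash_injective`), and a candidate
is accepted only after its signature has been compared with that of the target, so no false answer
can occur.

Set Partition is reduced to the same search: columns are incidence vectors, the target is the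
all-ones vector, and the weight of `f` is `|N f| * (m + 1) + 1`. A solution modulo two covers every
element at least once; the weight bound `n * (m + 1) + m` then forces exactly once, and the excess
of the weight over `n * (m + 1)` is the number of sets (`isPartition_family_iff`,
`sum_wt_of_isPartition`).

To obtain a machine program, the algorithm is written in a small language whose numbers stay below a
modulus `V` with polynomially many bits. Its compiler is correct with logarithmic cost of order the
length of `V` per step (`Cmd.compile_exec`), and running times are read off the loop structure
(`Cmd.steps_le`). -/

set_option linter.constructorNameAsVariable false
set_option exponentiation.threshold 700

/-! ### A high-level language over bounded numbers, and its semantics -/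

namespace RAM

/-- The variables of the high-level language. -/
inductive Var
  | flag | best | bw | y | sg | wt | z | i | k | p | a | bk | sl | w1 | x | mA | mB | mf | cf | mo | mt
  | res | F | fl | v | w | pw | j | base | s | ad | cnt | oL | oNw | oQ | oBud | oS | step
  | c (d : ℕ) | t (d : ℕ) | A (d : ℕ) | M (d : ℕ)
  deriving DecidableEq

/-- The register number of a variable, up to a factor. -/
def Var.enc : Var → ℕ
  | flag => 0 | best => 1 | bw => 2 | y => 3 | sg => 4 | wt => 5 | z => 6 | i => 7 | k => 8
  | p => 9 | a => 10 | bk => 11 | sl => 12 | w1 => 13 | x => 14 | mA => 15 | mB => 16 | mf => 17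
  | cf => 18 | mo => 19 | mt => 20 | res => 21 | F => 22 | fl => 23 | v => 24 | w => 25 | pw => 26
  | j => 27 | base => 28 | s => 29 | ad => 30 | cnt => 31 | oL => 32 | oNw => 33 | oQ => 34
  | oBud => 35 | oS => 36 | step => 37
  | c d => 40 + 4 * d | t d => 41 + 4 * d | A d => 42 + 4 * d | M d => 43 + 4 * d

/-- Parameters: registers that a high-level program only reads. `V` is the modulus of the
arithmetic. -/
inductive Par
  | V | n | m | m1 | L | nw | q | bud | S | N
  deriving DecidableEq

def Par.enc : Par → ℕ
  | V => 0 | n => 1 | m => 2 | m1 => 3 | L => 4 | nw => 5 | q => 6 | bud => 7 | S => 8 | N => 9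

theorem Par.enc_injective : Function.Injective Par.enc := by
  intro u v h
  cases u <;> cases v <;> simp_all [Par.enc]

/-- A left inverse of `Var.enc`. -/
def Var.dec : ℕ → Var
  | 0 => flag | 1 => best | 2 => bw | 3 => y | 4 => sg | 5 => wt | 6 => z | 7 => i | 8 => k
  | 9 => p | 10 => a | 11 => bk | 12 => sl | 13 => w1 | 14 => x | 15 => mA | 16 => mB | 17 => mf
  | 18 => cf | 19 => mo | 20 => mt | 21 => res | 22 => F | 23 => fl | 24 => v | 25 => w | 26 => pw
  | 27 => j | 28 => base | 29 => s | 30 => ad | 31 => cnt | 32 => oL | 33 => oNw | 34 => oQ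
  | 35 => oBud | 36 => oS | 37 => step | 38 => step | 39 => step
  | e + 40 => if e % 4 = 0 then c (e / 4) else if e % 4 = 1 then t (e / 4) else
      if e % 4 = 2 then A (e / 4) else M (e / 4)

theorem Var.dec_enc (u : Var) : Var.dec u.enc = u := by
  cases u <;> try rfl
  case c d =>
    have : Var.enc (c d) = 4 * d + 40 := by simp [enc]; omega
    rw [this]; simp [dec]
  case t d =>
    have : Var.enc (t d) = (4 * d + 1) + 40 := by simp [enc]; omega
    rw [this]; simp only [dec]
    have h : (4 * d + 1) % 4 = 1 := by omega
    have h' : (4 * d + 1) / 4 = d := by omega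
    simp [h, h']
  case A d =>
    have : Var.enc (A d) = (4 * d + 2) + 40 := by simp [enc]; omega
    rw [this]; simp only [dec]
    have h : (4 * d + 2) % 4 = 2 := by omega
    have h' : (4 * d + 2) / 4 = d := by omega
    simp [h, h']
  case M d =>
    have : Var.enc (M d) = (4 * d + 3) + 40 := by simp [enc]; omega
    rw [this]; simp only [dec]
    have h : (4 * d + 3) % 4 = 3 := by omega
    have h' : (4 * d + 3) / 4 = d := by omega
    simp [h, h']

theorem Var.enc_injective : Function.Injective Var.enc :=
  Function.LeftInverse.injective Var.dec_enc

/-- Expressions. `get i j` reads entry `j` of array `i`. -/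
inductive Expr
  | var (x : Var)
  | par (k : Par)
  | lit (k : ℕ)
  | op (o : BinOp) (a b : Expr)
  | get (a b : Expr)

/-- Commands. The number of iterations of a loop is a parameter. -/
inductive Cmd
  | skip
  | set (x : Var) (e : Expr)
  | put (a b e : Expr)
  | flip (x : Var)
  | seq (p q : Cmd)
  | ite (e : Expr) (p q : Cmd)
  | rep (k : Par) (p : Cmd)

/-- A state of the high-level language. -/
structure St where
  v : Var → ℕ
  mem : ℕ → ℕ → ℕ
  tossed : ℕ

def St.setv (σ : St) (x : Var) (k : ℕ) : St := { σ with v := Function.update σ.v x k }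

def St.setm (σ : St) (i j k : ℕ) : St :=
  { σ with mem := Function.update σ.mem i (Function.update (σ.mem i) j k) }

/-- Results are reduced modulo `V`, so that no value ever becomes long. In the specifications below,
the point is each time that the reduction does not change the number. -/
def Expr.eval (π : Par → ℕ) (σ : St) : Expr → ℕ
  | .var x => σ.v x
  | .par k => π k % π .V
  | .lit k => k % π .V
  | .op o a b => o.eval (a.eval π σ) (b.eval π σ) % π .V
  | .get a b => σ.mem (a.eval π σ) (b.eval π σ)

/-- Loop lengths are fixed in advance, so every command terminates and its cost has a bound that
does not depend on the coins. -/
def Cmd.run (π : Par → ℕ) (r : ℕ → Bool) : Cmd → St → St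
  | .skip, σ => σ
  | .set x e, σ => σ.setv x (e.eval π σ)
  | .put a b e, σ => σ.setm (a.eval π σ) (b.eval π σ) (e.eval π σ)
  | .flip x, σ => { σ.setv x (if r σ.tossed then 1 else 0) with tossed := σ.tossed + 1 }
  | .seq p q, σ => q.run π r (p.run π r σ)
  | .ite e p q, σ => if e.eval π σ ≠ 0 then p.run π r σ else q.run π r σ
  | .rep k p, σ => (p.run π r)^[π k] σ

/-! ### Compilation -/

/-- Variables and parameters occupy the residue classes 0 and 1 modulo 3; temporaries and loop
counters share the class 2, as 2 and 5 modulo 6. Hence the four families are disjoint. The variable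
`flag` lies in register 0, where the answer is read off. -/
def regV (x : Var) : ℕ := 3 * x.enc
def regP (k : Par) : ℕ := 3 * k.enc + 1
def regT (t : ℕ) : ℕ := 6 * t + 2
def regC (d : ℕ) : ℕ := 6 * d + 5

def Prog.copy (x y : ℕ) : Prog := .op .lor x y y

/-- The number `t` is the height of a stack of temporaries: the result goes to `regT t`, and the
second operand is evaluated one level higher. Entry `j` of array `i` has the address `j * V + i`. -/
def Expr.compile : Expr → ℕ → Prog
  | .var x, t => .copy (regT t) (regV x)
  | .par k, t => .seq (.copy (regT t) (regP k)) (.op .mod (regT t) (regT t) (regP .V))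
  | .lit k, t => .seq (.const (regT t) k) (.op .mod (regT t) (regT t) (regP .V))
  | .op o a b, t => .seq (a.compile t) (.seq (b.compile (t + 1))
      (.seq (.op o (regT t) (regT t) (regT (t + 1))) (.op .mod (regT t) (regT t) (regP .V))))
  | .get a b, t => .seq (a.compile t) (.seq (b.compile (t + 1))
      (.seq (.op .mul (regT (t + 1)) (regT (t + 1)) (regP .V))
        (.seq (.op .add (regT (t + 1)) (regT (t + 1)) (regT t)) (.load (regT t) (regT (t + 1))))))

/-- The number `d` is the nesting depth of loops and selects the counter register, so that an inner
loop does not disturb an outer one. -/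
def Cmd.compile : Cmd → ℕ → Prog
  | .skip, _ => .skip
  | .set x e, _ => .seq (e.compile 0) (.copy (regV x) (regT 0))
  | .put a b e, _ => .seq (a.compile 0) (.seq (b.compile 1) (.seq (e.compile 2)
      (.seq (.op .mul (regT 1) (regT 1) (regP .V))
        (.seq (.op .add (regT 1) (regT 1) (regT 0)) (.store (regT 1) (regT 2))))))
  | .flip x, _ => .flip (regV x)
  | .seq p q, d => .seq (p.compile d) (q.compile d)
  | .ite e p q, d => .seq (e.compile 0) (.cond (regT 0) (p.compile d) (q.compile d))
  | .rep k p, d => .seq (.copy (regC d) (regP k)) (.loop (regC d)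
      (.seq (p.compile (d + 1)) (.seq (.const (regT 0) 1) (.op .sub (regC d) (regC d) (regT 0)))))

def Expr.steps : Expr → ℕ
  | .var _ => 1
  | .par _ => 2
  | .lit k => k.size + 2
  | .op _ a b => a.steps + b.steps + 2
  | .get a b => a.steps + b.steps + 3

/-- The number of machine steps of a command, up to constant factors. -/
def Cmd.steps (π : Par → ℕ) : Cmd → ℕ
  | .skip => 1
  | .set _ e => e.steps + 1
  | .put a b e => a.steps + b.steps + e.steps + 3
  | .flip _ => 1
  | .seq p q => p.steps π + q.steps π
  | .ite e p q => e.steps + 1 + p.steps π + q.steps π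
  | .rep k p => π k * (p.steps π + 3) + 2

/-! ### Correctness and cost of compiled programs -/

/-- The machine state `s` represents the high-level state `σ`. -/
structure Rep (π : Par → ℕ) (σ : St) (s : State) : Prop where
  var : ∀ x, s.reg (regV x) = σ.v x
  par : ∀ k, s.reg (regP k) = π k
  mem : ∀ i j, i < π .V → s.mem (j * π .V + i) = σ.mem i j
  tossed : s.tossed = σ.tossed

/-- All values are smaller than the modulus. -/
structure St.Bdd (π : Par → ℕ) (σ : St) : Prop where
  var : ∀ x, σ.v x < π .V
  mem : ∀ i j, σ.mem i j < π .V

/-- The parameters are at most the modulus, which is at least two. -/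
structure ParOK (π : Par → ℕ) : Prop where
  le : ∀ k, π k ≤ π .V
  two_le : 2 ≤ π .V

variable {π : Par → ℕ} {r : ℕ → Bool}

theorem Expr.eval_lt {σ : St} (hπ : ParOK π) (hσ : σ.Bdd π) (e : Expr) : e.eval π σ < π .V := by
  have h0 : 0 < π .V := by have := hπ.two_le; omega
  cases e <;> simp only [Expr.eval]
  · exact hσ.var _
  · exact Nat.mod_lt _ h0
  · exact Nat.mod_lt _ h0
  · exact Nat.mod_lt _ h0
  · exact hσ.mem _ _

theorem St.Bdd.setv {σ : St} (hσ : σ.Bdd π) {x : Var} {k : ℕ} (hk : k < π .V) :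
    (σ.setv x k).Bdd π := by
  refine ⟨fun y => ?_, hσ.mem⟩
  simp only [St.setv, Function.update_apply]
  split_ifs
  · exact hk
  · exact hσ.var y

theorem St.Bdd.setm {σ : St} (hσ : σ.Bdd π) {i j k : ℕ} (hk : k < π .V) :
    (σ.setm i j k).Bdd π := by
  refine ⟨hσ.var, fun i' j' => ?_⟩
  simp only [St.setm, Function.update_apply]
  split_ifs
  · simp only [Function.update_apply]
    split_ifs
    · exact hk
    · exact hσ.mem _ _
  · exact hσ.mem _ _

theorem Cmd.run_bdd (hπ : ParOK π) (p : Cmd) : ∀ {σ : St}, σ.Bdd π → (p.run π r σ).Bdd π := by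
  induction p with
  | skip => exact fun h => h
  | set x e => exact fun h => h.setv (e.eval_lt hπ h)
  | put a b e => exact fun h => h.setm (e.eval_lt hπ h)
  | flip x =>
    intro σ h
    have := hπ.two_le
    have h2 : (σ.setv x (if r σ.tossed then 1 else 0)).Bdd π := h.setv (by split_ifs <;> omega)
    exact ⟨h2.var, h2.mem⟩
  | seq p q hp hq => exact fun h => hq (hp h)
  | ite e p q hp hq =>
    intro σ h
    simp only [Cmd.run]
    split_ifs
    · exact hp h
    · exact hq h
  | rep k p hp =>
    intro σ h
    simp only [Cmd.run]
    generalize π k = N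
    induction N with
    | zero => exact h
    | succ N ih => rw [Function.iterate_succ_apply']; exact hp ih

theorem size_le_of_le {a b : ℕ} (h : a ≤ b) : a.size ≤ b.size := Nat.size_le_size h

theorem size_mul_le (a b : ℕ) : (a * b).size ≤ a.size + b.size := by
  rw [Nat.size_le, pow_add]
  exact Nat.mul_lt_mul'' (Nat.lt_size_self a) (Nat.lt_size_self b)

theorem size_add_le (a b : ℕ) : (a + b).size ≤ max a.size b.size + 1 := by
  rw [Nat.size_le, pow_succ]
  have h1 : a < 2 ^ max a.size b.size :=
    (Nat.lt_size_self a).trans_le (Nat.pow_le_pow_right (by norm_num) (le_max_left _ _))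
  have h2 : b < 2 ^ max a.size b.size :=
    (Nat.lt_size_self b).trans_le (Nat.pow_le_pow_right (by norm_num) (le_max_right _ _))
  omega

theorem BinOp.size_eval_le (o : BinOp) (a b : ℕ) : (o.eval a b).size ≤ a.size + b.size + 1 := by
  cases o <;> simp only [BinOp.eval]
  · have := size_add_le a b; omega
  · have := size_le_of_le (Nat.sub_le a b); omega
  · have := size_mul_le a b; omega
  · have := size_le_of_le (Nat.div_le_self a b); omega
  · have := size_le_of_le (Nat.mod_le a b); omega
  · have : a &&& b ≤ a := Nat.and_le_left
    have := size_le_of_le this; omega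
  · have h1 : a < 2 ^ (a.size + b.size) :=
      (Nat.lt_size_self a).trans_le (Nat.pow_le_pow_right (by norm_num) (by omega))
    have h2 : b < 2 ^ (a.size + b.size) :=
      (Nat.lt_size_self b).trans_le (Nat.pow_le_pow_right (by norm_num) (by omega))
    have := Nat.size_le.2 (Nat.or_lt_two_pow h1 h2)
    omega
  · have h1 : a < 2 ^ (a.size + b.size) :=
      (Nat.lt_size_self a).trans_le (Nat.pow_le_pow_right (by norm_num) (by omega))
    have h2 : b < 2 ^ (a.size + b.size) :=
      (Nat.lt_size_self b).trans_le (Nat.pow_le_pow_right (by norm_num) (by omega))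
    have := Nat.size_le.2 (Nat.xor_lt_two_pow h1 h2)
    omega
  · split_ifs
    · simp
    · simp
  · split_ifs
    · simp
    · simp

/-- The cost of a machine step, for numbers below the modulus. -/
def unit (V : ℕ) : ℕ := 10 * V.size + 10

/-- The registers that an expression does not touch. -/
def Frame (t : ℕ) (s s' : State) : Prop :=
  (∀ x, (∀ t', t ≤ t' → x ≠ regT t') → s'.reg x = s.reg x) ∧ s'.mem = s.mem ∧
    s'.tossed = s.tossed

theorem regV_ne_regT (x t) : regV x ≠ regT t := by simp only [regV, regT]; omega
theorem regP_ne_regT (x t) : regP x ≠ regT t := by simp only [regP, regT]; omega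
theorem regC_ne_regT (x t) : regC x ≠ regT t := by simp only [regC, regT]; omega
theorem regV_ne_regP (x t) : regV x ≠ regP t := by simp only [regV, regP]; omega
theorem regV_ne_regC (x t) : regV x ≠ regC t := by simp only [regV, regC]; omega
theorem regP_ne_regC (x t) : regP x ≠ regC t := by simp only [regP, regC]; omega
theorem regV_inj {x y} : regV x = regV y ↔ x = y :=
  ⟨fun h => Var.enc_injective (by simp only [regV] at h; omega), fun h => h ▸ rfl⟩
theorem regP_inj {x y} : regP x = regP y ↔ x = y :=
  ⟨fun h => Par.enc_injective (by simp only [regP] at h; omega), fun h => h ▸ rfl⟩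
theorem regT_inj {x y} : regT x = regT y ↔ x = y := by simp only [regT]; omega
theorem regC_inj {x y} : regC x = regC y ↔ x = y := by simp only [regC]; omega

theorem Frame.rep {t : ℕ} {σ : St} {s s' : State} (h : Frame t s s') (hs : Rep π σ s) :
    Rep π σ s' where
  var x := by rw [h.1 _ (fun t' _ => regV_ne_regT x t')]; exact hs.var x
  par x := by rw [h.1 _ (fun t' _ => regP_ne_regT x t')]; exact hs.par x
  mem i j hi := by rw [h.2.1]; exact hs.mem i j hi
  tossed := by rw [h.2.2]; exact hs.tossed

theorem Frame.refl (t : ℕ) (s : State) : Frame t s s := ⟨fun _ _ => rfl, rfl, rfl⟩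

theorem Frame.trans {t t' : ℕ} {s s' s'' : State} (h : Frame t s s') (h' : Frame t' s' s'')
    (ht : t ≤ t') : Frame t s s'' :=
  ⟨fun x hx => (h'.1 x fun u hu => hx u (ht.trans hu)).trans (h.1 x hx), h'.2.1.trans h.2.1,
    h'.2.2.trans h.2.2⟩

theorem Frame.setReg {t t' : ℕ} {s s' : State} (h : Frame t s s') (ht : t ≤ t') (k : ℕ) :
    Frame t s (s'.setReg (regT t') k) :=
  ⟨fun x hx => by
    rw [← h.1 x hx]; simp only [State.setReg, Function.update_apply, hx t' ht, if_false],
    h.2.1, h.2.2⟩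

theorem setReg_self (s : State) (x k : ℕ) : (s.setReg x k).reg x = k := by
  simp [State.setReg]

theorem setReg_of_ne (s : State) {x y : ℕ} (k : ℕ) (h : y ≠ x) :
    (s.setReg x k).reg y = s.reg y := by
  simp [State.setReg, h]

/-- The first operand waits in `regT t` while the second is evaluated, which touches only
temporaries from `t + 1` on; this is why the frame condition is part of the induction. The results
of single operations, addresses `j * V + i` included, have at most about twice as many bits as `V`,
which the constants in `unit` absorb. -/
theorem Expr.compile_exec (hπ : ParOK π) {σ : St} (hσ : σ.Bdd π) (e : Expr) :
    ∀ (t : ℕ) (s : State), Rep π σ s → ∃ s' c, Exec r (e.compile t) s s' c ∧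
      c ≤ e.steps * unit (π .V) ∧ s'.reg (regT t) = e.eval π σ ∧ Frame t s s' := by
  have hV : ∀ {a}, a ≤ π .V → a.size ≤ (π .V).size := fun h => size_le_of_le h
  induction e with
  | var x =>
    intro t s hs
    refine ⟨_, _, Exec.op _ _ _ _ _, ?_, (setReg_self _ _ _).trans ?_, (Frame.refl t s).setReg le_rfl _⟩
    · have h := hV (hσ.var x).le
      simp only [BinOp.eval, Nat.or_self, hs.var, Expr.steps, unit]
      omega
    · simp [BinOp.eval, hs.var, Expr.eval]
  | par k =>
    intro t s hs
    refine ⟨_, _, Exec.seq (Exec.op _ _ _ _ _) (Exec.op _ _ _ _ _), ?_, (setReg_self _ _ _).trans ?_,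
      ((Frame.refl t s).setReg le_rfl _).setReg le_rfl _⟩
    · have h1 := hV (hπ.le k)
      have h2 := hV ((Nat.mod_le (π k) (π .V)).trans (hπ.le k))
      simp only [BinOp.eval, Nat.or_self, setReg_self, setReg_of_ne _ _ (regP_ne_regT _ _), hs.par,
        Expr.steps, unit]
      omega
    · simp [BinOp.eval, setReg_self, setReg_of_ne _ _ (regP_ne_regT _ _), hs.par, Expr.eval]
  | lit k =>
    intro t s hs
    refine ⟨_, _, Exec.seq (Exec.const _ _ _) (Exec.op _ _ _ _ _), ?_, (setReg_self _ _ _).trans ?_,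
      ((Frame.refl t s).setReg le_rfl _).setReg le_rfl _⟩
    · have h0 : 0 < π .V := by have := hπ.two_le; omega
      have h2 := hV (Nat.mod_lt k h0).le
      simp only [BinOp.eval, setReg_self, setReg_of_ne _ _ (regP_ne_regT _ _), hs.par,
        Expr.steps, unit]
      nlinarith
    · simp [BinOp.eval, setReg_self, setReg_of_ne _ _ (regP_ne_regT _ _), hs.par, Expr.eval]
  | op o a b iha ihb =>
    intro t s hs
    obtain ⟨s1, c1, e1, hc1, hr1, f1⟩ := iha t s hs
    obtain ⟨s2, c2, e2, hc2, hr2, f2⟩ := ihb (t + 1) s1 (f1.rep hs)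
    have f12 := f1.trans f2 (Nat.le_succ t)
    have hs2 := f12.rep hs
    have hr1' : s2.reg (regT t) = a.eval π σ := by
      rw [f2.1 _ (fun t' ht' => by rw [Ne, regT_inj]; omega), hr1]
    refine ⟨_, _, e1.seq (e2.seq (Exec.seq (Exec.op _ _ _ _ _) (Exec.op _ _ _ _ _))), ?_,
      (setReg_self _ _ _).trans ?_, (f12.setReg le_rfl _).setReg le_rfl _⟩
    · have h0 : 0 < π .V := by have := hπ.two_le; omega
      have ha := hV (a.eval_lt hπ hσ).le
      have hb := hV (b.eval_lt hπ hσ).le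
      have ho := o.size_eval_le (a.eval π σ) (b.eval π σ)
      have h2 := hV (Nat.mod_lt (o.eval (a.eval π σ) (b.eval π σ)) h0).le
      have hmod : ∀ a b, BinOp.mod.eval a b = a % b := fun _ _ => rfl
      simp only [setReg_self, setReg_of_ne _ _ (regP_ne_regT _ _), hs2.par, hr1', hr2,
        Expr.steps, add_mul, hmod]
      unfold unit at *
      nlinarith
    · simp only [setReg_self, setReg_of_ne _ _ (regP_ne_regT _ _), hs2.par, hr1', hr2, Expr.eval]
      rfl
  | get a b iha ihb =>
    intro t s hs
    obtain ⟨s1, c1, e1, hc1, hr1, f1⟩ := iha t s hs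
    obtain ⟨s2, c2, e2, hc2, hr2, f2⟩ := ihb (t + 1) s1 (f1.rep hs)
    have f12 := f1.trans f2 (Nat.le_succ t)
    have hs2 := f12.rep hs
    have hr1' : s2.reg (regT t) = a.eval π σ := by
      rw [f2.1 _ (fun t' ht' => by rw [Ne, regT_inj]; omega), hr1]
    have hne : regT t ≠ regT (t + 1) := by rw [Ne, regT_inj]; omega
    have hlt := a.eval_lt hπ hσ
    refine ⟨_, _, e1.seq (e2.seq (Exec.seq (Exec.op _ _ _ _ _) (Exec.seq (Exec.op _ _ _ _ _)
      (Exec.load _ _ _)))), ?_, (setReg_self _ _ _).trans ?_,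
      ((f12.setReg (Nat.le_succ t) _).setReg (Nat.le_succ t) _).setReg le_rfl _⟩
    · have ha := hV (a.eval_lt hπ hσ).le
      have hb := hV (b.eval_lt hπ hσ).le
      have ho := size_mul_le (b.eval π σ) (π .V)
      have ho2 := size_add_le (b.eval π σ * π .V) (a.eval π σ)
      have h2 := hV (hσ.mem (a.eval π σ) (b.eval π σ)).le
      have hmem : ∀ (s : State) x k, (s.setReg x k).mem = s.mem := fun _ _ _ => rfl
      simp only [setReg_self, setReg_of_ne _ _ (regP_ne_regT _ _), hs2.par, hr1', hr2,
        Expr.steps, add_mul, BinOp.eval, setReg_of_ne _ _ hne, hmem, hs2.mem _ _ hlt]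
      have : max (b.eval π σ * π .V).size (a.eval π σ).size ≤ 2 * (π .V).size := by
        apply max_le <;> omega
      unfold unit at *
      nlinarith
    · simp only [setReg_self, hs2.par, hr1', hr2, Expr.eval, BinOp.eval, setReg_of_ne _ _ hne]
      exact hs2.mem _ _ hlt

theorem Rep.setReg_regC {σ : St} {s : State} (h : Rep π σ s) (d k : ℕ) :
    Rep π σ (s.setReg (regC d) k) where
  var x := by rw [setReg_of_ne _ _ (regV_ne_regC _ _)]; exact h.var x
  par x := by rw [setReg_of_ne _ _ (regP_ne_regC _ _)]; exact h.par x
  mem := h.mem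
  tossed := h.tossed

theorem Rep.setReg_regT {σ : St} {s : State} (h : Rep π σ s) (d k : ℕ) :
    Rep π σ (s.setReg (regT d) k) :=
  ((Frame.refl d s).setReg le_rfl k).rep h

theorem Rep.setReg_regV {σ : St} {s : State} (h : Rep π σ s) (x : Var) (k : ℕ) :
    Rep π (σ.setv x k) (s.setReg (regV x) k) where
  var y := by
    simp only [State.setReg, St.setv, Function.update_apply, regV_inj, h.var]
  par y := by rw [setReg_of_ne _ _ (regV_ne_regP _ _).symm]; exact h.par y
  mem := h.mem
  tossed := h.tossed

/-- The loop counters below depth `d` keep their values. -/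
def KeepC (d : ℕ) (s s' : State) : Prop := ∀ d' < d, s'.reg (regC d') = s.reg (regC d')

theorem Frame.keepC {t d : ℕ} {s s' : State} (h : Frame t s s') : KeepC d s s' :=
  fun d' _ => h.1 _ fun t' _ => regC_ne_regT d' t'

theorem Rep.setMem {σ : St} {s : State} (h : Rep π σ s) {i : ℕ} (hi : i < π .V) (j k : ℕ) :
    Rep π (σ.setm i j k) (s.setMem (j * π .V + i) k) where
  var := h.var
  par := h.par
  mem i' j' hi' := by
    -- Quotient and remainder by `V` recover index and array, so distinct entries have distinct
    -- addresses.
    have key : j' * π .V + i' = j * π .V + i ↔ i' = i ∧ j' = j := by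
      constructor
      · intro e
        have e1 := congrArg (· % π .V) e
        have e2 := congrArg (· / π .V) e
        have h0 : 0 < π .V := by omega
        simp only [Nat.mul_add_mod', Nat.mod_eq_of_lt, hi, hi'] at e1
        rw [mul_comm j', mul_comm j] at e2
        simp only [Nat.mul_add_div h0, Nat.div_eq_of_lt, hi, hi'] at e2
        exact ⟨e1, by simpa using e2⟩
      · rintro ⟨rfl, rfl⟩; rfl
    simp only [State.setMem, St.setm, Function.update_apply, key]
    by_cases h1 : i' = i
    · subst h1
      by_cases h2 : j' = j
      · simp [h2]
      · simp [h2, h.mem _ _ hi']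
    · simp [h1, h.mem _ _ hi']
  tossed := h.tossed

/-- Induction on the command. For a loop one needs that its counter survives the body: expressions
write only temporaries, and the body is compiled at depth `d + 1`, hence keeps the counters up to
`d`. -/
theorem Cmd.compile_exec (hπ : ParOK π) (p : Cmd) :
    ∀ (d : ℕ) (σ : St) (s : State), σ.Bdd π → Rep π σ s → ∃ s' c,
      Exec r (p.compile d) s s' c ∧ c ≤ p.steps π * unit (π .V) ∧ Rep π (p.run π r σ) s' ∧
        KeepC d s s' := by
  have hV : ∀ {a}, a ≤ π .V → a.size ≤ (π .V).size := fun h => size_le_of_le h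
  induction p with
  | skip =>
    intro d σ s hσ hs
    exact ⟨s, 1, .skip _, by simp [Cmd.steps, unit], hs, fun _ _ => rfl⟩
  | set x e =>
    intro d σ s hσ hs
    obtain ⟨s1, c1, e1, hc1, hr1, f1⟩ := e.compile_exec (r := r) hπ hσ 0 s hs
    have ha := hV (e.eval_lt hπ hσ).le
    refine ⟨_, _, e1.seq (Exec.op _ _ _ _ _), ?_, ?_, ?_⟩
    · simp only [BinOp.eval, Nat.or_self, hr1, Cmd.steps, add_mul, unit] at *
      nlinarith
    · simp only [BinOp.eval, Nat.or_self, hr1]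
      exact (f1.rep hs).setReg_regV x _
    · intro d' hd'
      rw [setReg_of_ne _ _ (regV_ne_regC _ _).symm]
      exact f1.keepC d' hd'
  | put a b e =>
    intro d σ s hσ hs
    obtain ⟨s1, c1, e1, hc1, hr1, f1⟩ := a.compile_exec (r := r) hπ hσ 0 s hs
    obtain ⟨s2, c2, e2, hc2, hr2, f2⟩ := b.compile_exec (r := r) hπ hσ 1 s1 (f1.rep hs)
    have f12 := f1.trans f2 (Nat.zero_le 1)
    obtain ⟨s3, c3, e3, hc3, hr3, f3⟩ := e.compile_exec (r := r) hπ hσ 2 s2 (f12.rep hs)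
    have f13 := f12.trans f3 (Nat.zero_le 2)
    have hs3 := f13.rep hs
    have hr2' : s3.reg (regT 1) = b.eval π σ := by
      rw [f3.1 _ (fun t' ht' => by rw [Ne, regT_inj]; omega), hr2]
    have hr1' : s3.reg (regT 0) = a.eval π σ := by
      rw [f3.1 _ (fun t' ht' => by rw [Ne, regT_inj]; omega),
        f2.1 _ (fun t' ht' => by rw [Ne, regT_inj]; omega), hr1]
    have hne : regT 0 ≠ regT 1 := by rw [Ne, regT_inj]; omega
    have hne2 : regT 2 ≠ regT 1 := by rw [Ne, regT_inj]; omega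
    have hlt := a.eval_lt hπ hσ
    refine ⟨_, _, e1.seq (e2.seq (e3.seq (Exec.seq (Exec.op _ _ _ _ _) (Exec.seq
      (Exec.op _ _ _ _ _) (Exec.store _ _ _))))), ?_, ?_, ?_⟩
    · have ha := hV (a.eval_lt hπ hσ).le
      have hb := hV (b.eval_lt hπ hσ).le
      have he := hV (e.eval_lt hπ hσ).le
      have ho := size_mul_le (b.eval π σ) (π .V)
      have ho2 := size_add_le (b.eval π σ * π .V) (a.eval π σ)
      simp only [setReg_self, setReg_of_ne _ _ (regP_ne_regT _ _), hs3.par, hr1', hr2', hr3,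
        Cmd.steps, add_mul, BinOp.eval, setReg_of_ne _ _ hne, setReg_of_ne _ _ hne2]
      have : max (b.eval π σ * π .V).size (a.eval π σ).size ≤ 2 * (π .V).size := by
        apply max_le <;> omega
      unfold unit at *
      nlinarith
    · simp only [setReg_self, hs3.par, hr1', hr2', hr3, BinOp.eval, setReg_of_ne _ _ hne,
        setReg_of_ne _ _ hne2]
      exact ((hs3.setReg_regT 1 _).setReg_regT 1 _).setMem hlt _ _
    · intro d' hd'
      refine Eq.trans ?_ (f13.keepC d' hd')
      simp only [State.setMem]
      rw [setReg_of_ne _ _ (regC_ne_regT _ _), setReg_of_ne _ _ (regC_ne_regT _ _)]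
  | flip x =>
    intro d σ s hσ hs
    refine ⟨_, _, .flip _ _, by simp only [Cmd.steps, unit]; omega, ?_, ?_⟩
    · rw [hs.tossed]
      have := hs.setReg_regV x (if r σ.tossed then 1 else 0)
      exact ⟨this.var, this.par, this.mem, by simp [Cmd.run]⟩
    · intro d' hd'
      exact setReg_of_ne _ _ (regV_ne_regC _ _).symm
  | seq p q ihp ihq =>
    intro d σ s hσ hs
    obtain ⟨s1, c1, e1, hc1, hr1, k1⟩ := ihp d σ s hσ hs
    obtain ⟨s2, c2, e2, hc2, hr2, k2⟩ := ihq d _ s1 (p.run_bdd hπ hσ) hr1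
    exact ⟨s2, _, e1.seq e2, by simp only [Cmd.steps, add_mul]; omega, hr2,
      fun d' hd' => (k2 d' hd').trans (k1 d' hd')⟩
  | ite e p q ihp ihq =>
    intro d σ s hσ hs
    obtain ⟨s1, c1, e1, hc1, hr1, f1⟩ := e.compile_exec (r := r) hπ hσ 0 s hs
    have ha := hV (e.eval_lt hπ hσ).le
    by_cases h : e.eval π σ = 0
    · obtain ⟨s2, c2, e2, hc2, hr2, k2⟩ := ihq d σ s1 hσ (f1.rep hs)
      refine ⟨s2, _, e1.seq (.cond_false (hr1.trans h) e2), ?_, ?_, ?_⟩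
      · simp only [Cmd.steps, add_mul, hr1, unit] at *
        nlinarith
      · simpa [Cmd.run, h] using hr2
      · exact fun d' hd' => (k2 d' hd').trans (f1.keepC d' hd')
    · obtain ⟨s2, c2, e2, hc2, hr2, k2⟩ := ihp d σ s1 hσ (f1.rep hs)
      refine ⟨s2, _, e1.seq (.cond_true (by rwa [hr1]) e2), ?_, ?_, ?_⟩
      · simp only [Cmd.steps, add_mul, hr1, unit] at *
        nlinarith
      · simpa [Cmd.run, h] using hr2
      · exact fun d' hd' => (k2 d' hd').trans (f1.keepC d' hd')
  | rep k p ihp =>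
    intro d σ s hσ hs
    -- An inner induction on the current value of the counter, for arbitrary states.
    have key : ∀ (N : ℕ) (σ : St) (s : State), N ≤ π .V → σ.Bdd π → Rep π σ s →
        s.reg (regC d) = N → ∃ s' c, Exec r (.loop (regC d)
          (.seq (p.compile (d + 1)) (.seq (.const (regT 0) 1)
            (.op .sub (regC d) (regC d) (regT 0))))) s s' c ∧
          c ≤ (N * (p.steps π + 3) + 1) * unit (π .V) ∧ Rep π ((p.run π r)^[N] σ) s' ∧
            KeepC d s s' := by
      intro N
      induction N with
      | zero =>
        intro σ s _ hσ hs h0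
        refine ⟨s, _, .loop_false h0, ?_, hs, fun _ _ => rfl⟩
        simp only [h0, Nat.size_zero, unit]
        omega
      | succ N ihN =>
        intro σ s hN hσ hs h0
        obtain ⟨s1, c1, e1, hc1, hr1, k1⟩ := ihp (d + 1) σ s hσ hs
        have hk1 : s1.reg (regC d) = N + 1 := (k1 d (Nat.lt_succ_self d)).trans h0
        have hne : regC d ≠ regT 0 := regC_ne_regT _ _
        obtain ⟨s2, c2, e2, hc2, hr2, k2⟩ := ihN (p.run π r σ)
          ((s1.setReg (regT 0) 1).setReg (regC d) N) (by omega) (p.run_bdd hπ hσ)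
          ((hr1.setReg_regT 0 1).setReg_regC d N) (setReg_self _ _ _)
        have e3 : Exec r (.seq (.const (regT 0) 1) (.op .sub (regC d) (regC d) (regT 0))) s1
            ((s1.setReg (regT 0) 1).setReg (regC d) N)
            (1 + (1 : ℕ).size + (1 + (N + 1).size + (1 : ℕ).size + N.size)) := by
          have := Exec.seq (Exec.const (r := r) s1 (regT 0) 1) (Exec.op (r := r) _ .sub (regC d) (regC d) (regT 0))
          simpa [BinOp.eval, setReg_self, setReg_of_ne _ _ hne, hk1] using this
        refine ⟨s2, _, .loop_true (by omega) (e1.seq e3) e2, ?_, ?_, ?_⟩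
        · have h1 := hV hN
          have h2 := hV (by omega : N ≤ π .V)
          have h3 : (1 : ℕ).size = 1 := Nat.size_one
          rw [h0, h3]
          unfold unit at *
          nlinarith
        · rw [Function.iterate_succ_apply]; exact hr2
        · intro d' hd'
          rw [k2 d' hd', setReg_of_ne _ _ (by rw [Ne, regC_inj]; omega),
            setReg_of_ne _ _ (regC_ne_regT _ _), k1 d' (by omega)]
    obtain ⟨s2, c2, e2, hc2, hr2, k2⟩ := key (π k) σ (s.setReg (regC d) (π k)) (hπ.le k) hσ
      (hs.setReg_regC d _) (setReg_self _ _ _)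
    have e1 : Exec r (.copy (regC d) (regP k)) s (s.setReg (regC d) (π k))
        (1 + (π k).size + (π k).size + (π k).size) := by
      have := Exec.op (r := r) s .lor (regC d) (regP k) (regP k)
      simpa [BinOp.eval, hs.par, Prog.copy] using this
    refine ⟨s2, _, e1.seq e2, ?_, hr2, ?_⟩
    · have h1 := hV (hπ.le k)
      simp only [Cmd.steps]
      unfold unit at *
      nlinarith
    · intro d' hd'
      rw [k2 d' hd', setReg_of_ne _ _ (by rw [Ne, regC_inj]; omega)]

/-! ### Polynomial bounds for the number of steps -/

/-- The nesting depth of the loops with `bud` iterations. -/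
def Cmd.deg : Cmd → ℕ
  | .seq p q => max p.deg q.deg
  | .ite _ p q => max p.deg q.deg
  | .rep k p => p.deg + if k = .bud then 1 else 0
  | _ => 0

/-- No loop is governed by the modulus or the stride. -/
def Cmd.ShortLoops : Cmd → Prop
  | .seq p q => p.ShortLoops ∧ q.ShortLoops
  | .ite _ p q => p.ShortLoops ∧ q.ShortLoops
  | .rep k p => p.ShortLoops ∧ k ≠ .V ∧ k ≠ .S
  | _ => True

/-- Here `X` stands for the polynomially bounded parameters and `R` for the exponential part of the
budget. Each ordinary loop costs a factor `X` and each loop over the budget a factor `X * R`, so a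
program without nested budget loops is linear in `R`. The constants depend on the program alone, not
on the instance. -/
theorem Cmd.steps_le (p : Cmd) (hp : p.ShortLoops) : ∃ C k : ℕ, ∀ (π : Par → ℕ) (X R : ℕ),
    1 ≤ X → 1 ≤ R → (∀ k, k ≠ .bud → k ≠ .V → k ≠ .S → π k ≤ X) → π .bud ≤ X * R →
    p.steps π ≤ C * X ^ k * R ^ p.deg := by
  have const : ∀ c : ℕ, ∃ C k : ℕ, ∀ (π : Par → ℕ) (X R : ℕ),
      1 ≤ X → 1 ≤ R → (∀ k, k ≠ .bud → k ≠ .V → k ≠ .S → π k ≤ X) → π .bud ≤ X * R →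
      c ≤ C * X ^ k * R ^ 0 := fun c => ⟨c, 0, fun _ _ _ _ _ _ _ => by simp⟩
  have two : ∀ (C₁ C₂ k₁ k₂ d₁ d₂ X R : ℕ), 1 ≤ X → 1 ≤ R →
      C₁ * X ^ k₁ * R ^ d₁ + C₂ * X ^ k₂ * R ^ d₂ ≤
        (C₁ + C₂) * X ^ (k₁ + k₂) * R ^ max d₁ d₂ := by
    intro C₁ C₂ k₁ k₂ d₁ d₂ X R hX hR
    rw [add_mul, add_mul]
    gcongr <;> first | omega | assumption | exact le_max_left _ _ | exact le_max_right _ _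
  induction p with
  | skip => exact const _
  | set x e => exact const _
  | put a b e => exact const _
  | flip x => exact const _
  | seq p q ihp ihq =>
    obtain ⟨C₁, k₁, h₁⟩ := ihp hp.1
    obtain ⟨C₂, k₂, h₂⟩ := ihq hp.2
    refine ⟨C₁ + C₂, k₁ + k₂, fun π X R hX hR h h' => ?_⟩
    exact (add_le_add (h₁ π X R hX hR h h') (h₂ π X R hX hR h h')).trans (two _ _ _ _ _ _ _ _ hX hR)
  | ite e p q ihp ihq =>
    obtain ⟨C₁, k₁, h₁⟩ := ihp hp.1
    obtain ⟨C₂, k₂, h₂⟩ := ihq hp.2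
    refine ⟨e.steps + 1 + (C₁ + C₂), k₁ + k₂, fun π X R hX hR h h' => ?_⟩
    have h1 := (add_le_add (h₁ π X R hX hR h h') (h₂ π X R hX hR h h')).trans
      (two _ _ _ _ _ _ _ _ hX hR)
    have h2 : e.steps + 1 ≤ (e.steps + 1) * X ^ (k₁ + k₂) * R ^ max p.deg q.deg := by
      rw [mul_assoc]
      exact Nat.le_mul_of_pos_right _ (Nat.mul_pos (Nat.pow_pos hX) (Nat.pow_pos hR))
    simp only [Cmd.steps, Cmd.deg]
    rw [add_mul, add_mul]
    omega
  | rep j p ihp =>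
    obtain ⟨C₁, k₁, h₁⟩ := ihp hp.1
    refine ⟨C₁ + 5, k₁ + 1, fun π X R hX hR h h' => ?_⟩
    have h1 := h₁ π X R hX hR h h'
    have hP : 1 ≤ X ^ k₁ * R ^ p.deg := Nat.mul_pos (Nat.pow_pos hX) (Nat.pow_pos hR)
    have h3 : p.steps π + 3 ≤ (C₁ + 3) * (X ^ k₁ * R ^ p.deg) := by nlinarith
    simp only [Cmd.steps, Cmd.deg]
    by_cases hj : j = .bud
    · subst hj
      have h4 : π .bud * (p.steps π + 3) ≤ (X * R) * ((C₁ + 3) * (X ^ k₁ * R ^ p.deg)) :=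
        Nat.mul_le_mul h' h3
      have h5 : 1 ≤ X * R * (X ^ k₁ * R ^ p.deg) := Nat.mul_pos (Nat.mul_pos hX hR) hP
      simp only [if_true, pow_succ]
      nlinarith
    · have h4 : π j * (p.steps π + 3) ≤ X * ((C₁ + 3) * (X ^ k₁ * R ^ p.deg)) :=
        Nat.mul_le_mul (h j hj hp.2.1 hp.2.2) h3
      have h5 : 1 ≤ X * (X ^ k₁ * R ^ p.deg) := Nat.mul_pos hX hP
      simp only [if_neg hj, pow_succ, add_zero]
      nlinarith

end RAM

/-! ### Sets of columns as bit masks -/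

namespace SplitSearch

/-- The elements of the set with bit mask `y`. -/
def supp (m y : ℕ) : Finset ℕ := (Finset.range m).filter fun i => y.testBit i

/-- The exclusive or of `f` over a set. -/
def xorF (f : ℕ → ℕ) (S : Finset ℕ) : ℕ := S.fold (· ^^^ ·) 0 f

/-- The exclusive or of `f` over the set with bit mask `y`. -/
def xsum (f : ℕ → ℕ) (m y : ℕ) : ℕ := xorF f (supp m y)

/-- The weight of the set with bit mask `y`. -/
def wsum (ω : ℕ → ℕ) (m y : ℕ) : ℕ := ∑ i ∈ supp m y, ω i

@[simp] theorem mem_supp {m y i : ℕ} : i ∈ supp m y ↔ i < m ∧ y.testBit i = true := by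
  simp [supp]

@[simp] theorem xorF_empty (f : ℕ → ℕ) : xorF f ∅ = 0 := rfl

theorem xorF_insert (f : ℕ → ℕ) {S : Finset ℕ} {i : ℕ} (h : i ∉ S) :
    xorF f (insert i S) = f i ^^^ xorF f S := Finset.fold_insert h

theorem xorF_disjUnion (f : ℕ → ℕ) {S T : Finset ℕ} (h : Disjoint S T) :
    xorF f (S ∪ T) = xorF f S ^^^ xorF f T := by
  rw [← Finset.disjUnion_eq_union _ _ h]
  exact Finset.fold_disjUnion (op := fun a b : ℕ => a ^^^ b) (b₁ := 0) (b₂ := 0) h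

theorem xorF_sdiff (f : ℕ → ℕ) {S T : Finset ℕ} (h : T ⊆ S) :
    xorF f (S \ T) = xorF f S ^^^ xorF f T := by
  conv_rhs => rw [← Finset.sdiff_union_of_subset h, xorF_disjUnion f Finset.sdiff_disjoint]
  rw [Nat.xor_assoc, Nat.xor_self, Nat.xor_zero]

theorem xorF_symmDiff (f : ℕ → ℕ) (S T : Finset ℕ) :
    xorF f (symmDiff S T) = xorF f S ^^^ xorF f T := by
  have h1 : xorF f (symmDiff S T) = xorF f (S \ T) ^^^ xorF f (T \ S) :=
    xorF_disjUnion f disjoint_sdiff_sdiff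
  have h2 : xorF f S = xorF f (S \ T) ^^^ xorF f (S ∩ T) := by
    rw [← xorF_disjUnion f (Finset.disjoint_sdiff_inter S T), Finset.sdiff_union_inter]
  have h3 : xorF f T = xorF f (T \ S) ^^^ xorF f (S ∩ T) := by
    rw [Finset.inter_comm, ← xorF_disjUnion f (Finset.disjoint_sdiff_inter T S),
      Finset.sdiff_union_inter]
  rw [h1, h2, h3, Nat.xor_comm (xorF f (T \ S)), Nat.xor_assoc,
    ← Nat.xor_assoc (xorF f (S ∩ T)), Nat.xor_self, Nat.zero_xor]

theorem xorF_lt (f : ℕ → ℕ) (n : ℕ) (S : Finset ℕ) (h : ∀ i ∈ S, f i < 2 ^ n) :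
    xorF f S < 2 ^ n := by
  induction S using Finset.induction_on with
  | empty => simp
  | insert i S hi ih =>
    rw [xorF_insert f hi]
    exact Nat.xor_lt_two_pow (h i (Finset.mem_insert_self _ _))
      (ih fun j hj => h j (Finset.mem_insert_of_mem hj))

theorem xorF_congr {f g : ℕ → ℕ} {S : Finset ℕ} (h : ∀ i ∈ S, f i = g i) :
    xorF f S = xorF g S := Finset.fold_congr h

theorem supp_xor (m a b : ℕ) : supp m (a ^^^ b) = symmDiff (supp m a) (supp m b) := by
  ext i
  simp only [mem_supp, Finset.mem_symmDiff, Nat.testBit_xor]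
  cases a.testBit i <;> cases b.testBit i <;> simp

theorem xsum_xor (f : ℕ → ℕ) (m a b : ℕ) : xsum f m (a ^^^ b) = xsum f m a ^^^ xsum f m b := by
  simp only [xsum, supp_xor, xorF_symmDiff]

theorem wsum_xor_le (ω : ℕ → ℕ) (m a b : ℕ) : wsum ω m (a ^^^ b) ≤ wsum ω m a + wsum ω m b := by
  simp only [wsum, supp_xor]
  refine (Finset.sum_le_sum_of_subset (Finset.union_subset_union Finset.sdiff_subset Finset.sdiff_subset)).trans ?_
  rw [← Finset.sum_union_inter]
  exact Nat.le_add_right _ _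

theorem card_supp_xor_le (m a b : ℕ) :
    (supp m (a ^^^ b)).card ≤ (supp m a).card + (supp m b).card := by
  simpa [wsum] using wsum_xor_le (fun _ => 1) m a b

theorem supp_succ (m y : ℕ) : supp (m + 1) y = if y.testBit m then insert m (supp m y) else supp m y := by
  rw [supp, Finset.range_add_one, Finset.filter_insert]; rfl

theorem not_mem_supp_self (m y : ℕ) : m ∉ supp m y := by simp

theorem xsum_succ (f : ℕ → ℕ) (m y : ℕ) :
    xsum f (m + 1) y = if y.testBit m then xsum f m y ^^^ f m else xsum f m y := by
  rw [xsum, supp_succ]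
  split_ifs
  · rw [xorF_insert f (not_mem_supp_self m y), Nat.xor_comm]; rfl
  · rfl

theorem wsum_succ (ω : ℕ → ℕ) (m y : ℕ) :
    wsum ω (m + 1) y = if y.testBit m then wsum ω m y + ω m else wsum ω m y := by
  rw [wsum, supp_succ]
  split_ifs
  · rw [Finset.sum_insert (not_mem_supp_self m y), add_comm]; rfl
  · rfl

theorem supp_two_pow {m i : ℕ} (h : i < m) : supp m (2 ^ i) = {i} := by
  ext j
  simp only [mem_supp, Nat.testBit_two_pow, decide_eq_true_eq, Finset.mem_singleton]
  constructor
  · rintro ⟨_, rfl⟩; rfl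
  · rintro rfl; exact ⟨h, rfl⟩

theorem supp_zero (m : ℕ) : supp m 0 = ∅ := by ext; simp

theorem supp_injOn (m : ℕ) {a b : ℕ} (ha : a < 2 ^ m) (hb : b < 2 ^ m) (h : supp m a = supp m b) :
    a = b := by
  refine Nat.eq_of_testBit_eq fun i => ?_
  by_cases hi : i < m
  · have := Finset.ext_iff.1 h i
    simp only [mem_supp, hi, true_and] at this
    exact Bool.eq_iff_iff.2 this
  · have h2 : 2 ^ m ≤ 2 ^ i := Nat.pow_le_pow_right (by norm_num) (by omega)
    rw [Nat.testBit_lt_two_pow (ha.trans_le h2), Nat.testBit_lt_two_pow (hb.trans_le h2)]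

/-! ### Lists of partial solutions -/

section merge

variable (sig wt : ℕ → ℕ)

/-- Insert a candidate; of candidates with the same signature, keep the lightest. -/
def ins : List ℕ → ℕ → List ℕ
  | [], y => [y]
  | z :: L, y => if sig z = sig y then (if wt y < wt z then y :: L else z :: L) else z :: ins L y

theorem mem_ins {L : List ℕ} {y z : ℕ} (h : z ∈ ins sig wt L y) : z ∈ L ∨ z = y := by
  induction L with
  | nil => simp_all [ins]
  | cons u L ih =>
    simp only [ins] at h
    split_ifs at h
    · rcases List.mem_cons.1 h with h | h
      · exact .inr h
      · exact .inl (List.mem_cons_of_mem _ h)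
    · exact .inl h
    · rcases List.mem_cons.1 h with h | h
      · exact .inl (h ▸ List.mem_cons_self)
      · exact (ih h).imp_left (List.mem_cons_of_mem _)

theorem ins_self (L : List ℕ) (y : ℕ) : ∃ z ∈ ins sig wt L y, sig z = sig y ∧ wt z ≤ wt y := by
  induction L with
  | nil => exact ⟨y, by simp [ins], rfl, le_rfl⟩
  | cons u L ih =>
    simp only [ins]
    split_ifs with h1 h2
    · exact ⟨y, List.mem_cons_self, rfl, le_rfl⟩
    · exact ⟨u, List.mem_cons_self, h1, by omega⟩
    · obtain ⟨z, hz, h⟩ := ih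
      exact ⟨z, List.mem_cons_of_mem _ hz, h⟩

theorem ins_old {L : List ℕ} {x : ℕ} (y : ℕ) (hx : x ∈ L) :
    ∃ z ∈ ins sig wt L y, sig z = sig x ∧ wt z ≤ wt x := by
  induction L with
  | nil => simp at hx
  | cons u L ih =>
    simp only [ins]
    rcases List.mem_cons.1 hx with rfl | hx
    · split_ifs with h1 h2
      · exact ⟨y, List.mem_cons_self, h1.symm, h2.le⟩
      · exact ⟨x, List.mem_cons_self, rfl, le_rfl⟩
      · exact ⟨x, List.mem_cons_self, rfl, le_rfl⟩
    · split_ifs with h1 h2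
      · exact ⟨x, List.mem_cons_of_mem _ hx, rfl, le_rfl⟩
      · exact ⟨x, List.mem_cons_of_mem _ hx, rfl, le_rfl⟩
      · obtain ⟨z, hz, h⟩ := ih hx
        exact ⟨z, List.mem_cons_of_mem _ hz, h⟩

/-- A lighter set takes the very place of the one it replaces, so the sequence of signatures can
only grow at its end. -/
theorem map_sig_ins (L : List ℕ) (y : ℕ) : (ins sig wt L y).map sig =
    if sig y ∈ L.map sig then L.map sig else L.map sig ++ [sig y] := by
  induction L with
  | nil => simp [ins]
  | cons u L ih =>
    simp only [ins]
    by_cases h1 : sig u = sig y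
    · split_ifs with h2 <;> simp_all
    · have : sig y ≠ sig u := fun h => h1 h.symm
      simp only [if_neg h1, List.map_cons, ih, List.mem_cons, this, false_or]
      split_ifs <;> simp

theorem nodup_ins {L : List ℕ} (y : ℕ) (h : (L.map sig).Nodup) :
    ((ins sig wt L y).map sig).Nodup := by
  rw [map_sig_ins]
  split_ifs with h1
  · exact h
  · rw [List.nodup_append]
    refine ⟨h, List.nodup_singleton _, ?_⟩
    rintro a ha b hb rfl
    exact h1 (List.mem_singleton.1 hb ▸ ha)

theorem ins_of_not_mem {L : List ℕ} {y : ℕ} (h : ∀ z ∈ L, sig z ≠ sig y) :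
    ins sig wt L y = L ++ [y] := by
  induction L with
  | nil => rfl
  | cons u L ih =>
    simp only [ins, if_neg (h u List.mem_cons_self), List.cons_append,
      ih fun z hz => h z (List.mem_cons_of_mem _ hz)]

/-- Since signatures are distinct, the search through the list can be replaced by a single access at
a known position; the machine gets this position from a table. -/
theorem ins_of_get {L : List ℕ} {y k : ℕ} (hL : (L.map sig).Nodup) (hk : k < L.length)
    (h : sig L[k] = sig y) :
    ins sig wt L y = if wt y < wt L[k] then L.set k y else L := by
  induction L generalizing k with
  | nil => simp at hk
  | cons u L ih =>
    simp only [List.map_cons, List.nodup_cons] at hL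
    cases k with
    | zero =>
      simp only [List.getElem_cons_zero] at h ⊢
      simp only [ins, if_pos h, List.set_cons_zero]
    | succ k =>
      simp only [List.getElem_cons_succ, List.set_cons_succ] at h ⊢
      have hk' : k < L.length := by simpa using hk
      have hne : sig u ≠ sig y := fun e => hL.1 (by
        rw [e, ← h]; exact List.mem_map_of_mem (List.getElem_mem hk'))
      simp only [ins, if_neg hne, ih hL.2 hk' h]
      split_ifs <;> rfl

/-- The work list of a merge: `none` stands for looking at an element of the first list, and
`some y` for a matching pair with exclusive or `y`. -/
def events (mf cf mo tg : ℕ) (A B : List ℕ) : List (Option ℕ) :=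
  A.flatMap fun a => none :: if sig a % mf = cf % mf then
    ((B.filter fun b => sig b % mo = (sig a ^^^ tg) % mo).reverse.map fun b => some (a ^^^ b))
    else []

def insOpt (L : List ℕ) : Option ℕ → List ℕ
  | none => L
  | some y => ins sig wt L y

/-- The exclusive ors of the matching pairs, computed within a budget of work. -/
def merge (bud mf cf mo tg : ℕ) (A B : List ℕ) : List ℕ :=
  ((events sig mf cf mo tg A (B.take bud)).take bud).foldl (insOpt sig wt) []

theorem mem_foldl_ins {E : List (Option ℕ)} : ∀ {L : List ℕ} {z : ℕ},
    z ∈ E.foldl (insOpt sig wt) L → z ∈ L ∨ some z ∈ E := by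
  induction E with
  | nil => exact fun h => .inl h
  | cons e E ih =>
    intro L z h
    rcases ih h with h | h
    · cases e with
      | none => exact .inl h
      | some y =>
        rcases mem_ins sig wt h with h | rfl
        · exact .inl h
        · exact .inr List.mem_cons_self
    · exact .inr (List.mem_cons_of_mem _ h)

theorem nodup_foldl_ins {E : List (Option ℕ)} : ∀ {L : List ℕ}, (L.map sig).Nodup →
    ((E.foldl (insOpt sig wt) L).map sig).Nodup := by
  induction E with
  | nil => exact fun h => h
  | cons e E ih =>
    intro L h
    refine ih ?_
    cases e with
    | none => exact h
    | some y => exact nodup_ins sig wt y h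

theorem foldl_ins_old {E : List (Option ℕ)} : ∀ {L : List ℕ} {x : ℕ}, x ∈ L →
    ∃ z ∈ E.foldl (insOpt sig wt) L, sig z = sig x ∧ wt z ≤ wt x := by
  induction E with
  | nil => exact fun {L x} h => ⟨x, h, rfl, le_rfl⟩
  | cons e E ih =>
    intro L x h
    have : ∃ z ∈ insOpt sig wt L e, sig z = sig x ∧ wt z ≤ wt x := by
      cases e with
      | none => exact ⟨x, h, rfl, le_rfl⟩
      | some y => exact ins_old sig wt y h
    obtain ⟨z, hz, h1, h2⟩ := this
    obtain ⟨u, hu, h3, h4⟩ := ih hz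
    exact ⟨u, hu, h3.trans h1, h4.trans h2⟩

theorem foldl_ins_new {E : List (Option ℕ)} : ∀ {L : List ℕ} {y : ℕ}, some y ∈ E →
    ∃ z ∈ E.foldl (insOpt sig wt) L, sig z = sig y ∧ wt z ≤ wt y := by
  induction E with
  | nil => intro L y h; simp at h
  | cons e E ih =>
    intro L y h
    rcases List.mem_cons.1 h with rfl | h
    · obtain ⟨z, hz, h1, h2⟩ := ins_self sig wt L y
      obtain ⟨u, hu, h3, h4⟩ := foldl_ins_old sig wt (E := E) hz
      exact ⟨u, hu, h3.trans h1, h4.trans h2⟩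
    · exact ih h

theorem length_ins_le (L : List ℕ) (y : ℕ) : (ins sig wt L y).length ≤ L.length + 1 := by
  have := congrArg List.length (map_sig_ins sig wt L y)
  simp only [List.length_map] at this
  rw [this]
  split_ifs <;> simp

theorem length_foldl_ins_le {E : List (Option ℕ)} : ∀ {L : List ℕ},
    (E.foldl (insOpt sig wt) L).length ≤ L.length + (E.filter (·.isSome)).length := by
  induction E with
  | nil => intro L; simp
  | cons e E ih =>
    intro L
    refine ih.trans ?_
    cases e with
    | none => simp [insOpt]
    | some y =>
      have := length_ins_le sig wt L y
      simp only [insOpt, List.filter_cons, Option.isSome_some, if_true, List.length_cons]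
      omega

/-- The number of matching pairs in a finite set. -/
def pairCount (D : Finset ℕ) (mf cf mo tg : ℕ) : ℕ :=
  ((D ×ˢ D).filter fun x => sig x.1 % mf = cf % mf ∧ sig x.2 % mo = (sig x.1 ^^^ tg) % mo).card

theorem mem_events {mf cf mo tg : ℕ} {A B : List ℕ} {y : ℕ} :
    some y ∈ events sig mf cf mo tg A B ↔ ∃ a ∈ A, ∃ b ∈ B, sig a % mf = cf % mf ∧
      sig b % mo = (sig a ^^^ tg) % mo ∧ y = a ^^^ b := by
  simp only [events, List.mem_flatMap, List.mem_cons]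
  constructor
  · rintro ⟨a, ha, h | h⟩
    · simp at h
    · split_ifs at h with h1
      · obtain ⟨b, hb, h2⟩ := List.mem_map.1 h
        simp only [List.mem_reverse, List.mem_filter, decide_eq_true_eq] at hb
        exact ⟨a, ha, b, hb.1, h1, hb.2, (Option.some.inj h2).symm⟩
      · simp at h
  · rintro ⟨a, ha, b, hb, h1, h2, rfl⟩
    refine ⟨a, ha, .inr ?_⟩
    rw [if_pos h1]
    exact List.mem_map.2 ⟨b, by simp [hb, h2], rfl⟩

/-- Each element of the first list contributes exactly one `none`; all other events are matching
pairs. -/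
theorem length_events (mf cf mo tg : ℕ) (A B : List ℕ) :
    (events sig mf cf mo tg A B).length =
      A.length + ((events sig mf cf mo tg A B).filter (·.isSome)).length := by
  induction A with
  | nil => rfl
  | cons a A ih =>
    have h1 : ∃ X : List (Option ℕ), (∀ e ∈ X, e.isSome) ∧
        events sig mf cf mo tg (a :: A) B = (none :: X) ++ events sig mf cf mo tg A B :=
      ⟨if sig a % mf = cf % mf then ((B.filter fun b => sig b % mo = (sig a ^^^ tg) % mo).reverse.map
        fun b => some (a ^^^ b)) else [], by
        split_ifs
        · intro e he
          obtain ⟨b, _, rfl⟩ := List.mem_map.1 he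
          rfl
        · simp, rfl⟩
    obtain ⟨X, hX, h1⟩ := h1
    rw [h1, List.filter_append, List.length_append, List.length_append, ih,
      List.filter_cons_of_neg (by simp), List.filter_eq_self.2 hX]
    simp only [List.length_cons]
    omega

/-- Without repetitions in the lists, matching pairs of positions are matching pairs of elements of
`D`. This bound no longer mentions the lists, so its expectation can be computed. -/
theorem length_filter_events_le {mf cf mo tg : ℕ} {A B : List ℕ} {D : Finset ℕ} (hA : A.Nodup)
    (hB : B.Nodup) (hAD : ∀ a ∈ A, a ∈ D) (hBD : ∀ b ∈ B, b ∈ D) :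
    ((events sig mf cf mo tg A B).filter (·.isSome)).length ≤ pairCount sig D mf cf mo tg := by
  have h1 : ((events sig mf cf mo tg A B).filter (·.isSome)).length ≤
      ((A ×ˢ B).filter fun x =>
        sig x.1 % mf = cf % mf ∧ sig x.2 % mo = (sig x.1 ^^^ tg) % mo).length := by
    clear hA hAD
    induction A with
    | nil => simp [events]
    | cons a A ih =>
      simp only [events, List.flatMap_cons, List.filter_append, List.length_append,
        List.filter_cons, Option.isSome_none, List.product_cons, Bool.false_eq_true, if_false] at ih ⊢
      refine add_le_add ?_ ih
      split_ifs with h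
      · simp [List.filter_map, Function.comp_def, h]
      · simp
  refine h1.trans ?_
  rw [← List.toFinset_card_of_nodup ((hA.product hB).filter _), pairCount]
  refine Finset.card_le_card ?_
  rintro ⟨a, b⟩ hx
  simp only [List.mem_toFinset, List.mem_filter, decide_eq_true_eq] at hx
  have h2 := List.pair_mem_product.1 hx.1
  exact Finset.mem_filter.2 ⟨Finset.mem_product.2 ⟨hAD _ h2.1, hBD _ h2.2⟩, hx.2⟩

theorem mem_merge {bud mf cf mo tg : ℕ} {A B : List ℕ} {y : ℕ}
    (h : y ∈ merge sig wt bud mf cf mo tg A B) : ∃ a ∈ A, ∃ b ∈ B, sig a % mf = cf % mf ∧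
      sig b % mo = (sig a ^^^ tg) % mo ∧ y = a ^^^ b := by
  rcases mem_foldl_ins sig wt h with h | h
  · simp at h
  · obtain ⟨a, ha, b, hb, h⟩ := (mem_events sig).1 (List.mem_of_mem_take h)
    exact ⟨a, ha, b, List.mem_of_mem_take hb, h⟩

theorem nodup_merge (bud mf cf mo tg : ℕ) (A B : List ℕ) :
    ((merge sig wt bud mf cf mo tg A B).map sig).Nodup :=
  nodup_foldl_ins sig wt List.nodup_nil

theorem length_merge_le {bud mf cf mo tg : ℕ} {A B : List ℕ} (hB : B.length ≤ bud)
    (hE : (events sig mf cf mo tg A B).length ≤ bud) :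
    (merge sig wt bud mf cf mo tg A B).length ≤
      ((events sig mf cf mo tg A B).filter (·.isSome)).length := by
  rw [merge, List.take_of_length_le hB, List.take_of_length_le hE]
  simpa using length_foldl_ins_le sig wt (E := events sig mf cf mo tg A B) (L := [])

/-- Within the budget nothing is truncated; a matching pair may be displaced only by an equally
signed set that is no heavier. -/
theorem merge_complete {bud mf cf mo tg : ℕ} {A B : List ℕ} (hB : B.length ≤ bud)
    (hE : (events sig mf cf mo tg A B).length ≤ bud) {a b : ℕ} (ha : a ∈ A) (hb : b ∈ B)
    (h1 : sig a % mf = cf % mf) (h2 : sig b % mo = (sig a ^^^ tg) % mo) :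
    ∃ z ∈ merge sig wt bud mf cf mo tg A B, sig z = sig (a ^^^ b) ∧ wt z ≤ wt (a ^^^ b) := by
  rw [merge, List.take_of_length_le hB, List.take_of_length_le hE]
  exact foldl_ins_new sig wt ((mem_events sig).2 ⟨a, ha, b, hb, h1, h2, rfl⟩)

/-- The lightest representatives of the sets with at most `k` elements. -/
def baseList (bud m : ℕ) : ℕ → List ℕ
  | 0 => [0]
  | k + 1 => merge sig wt bud 1 0 1 0 (baseList bud m k) (0 :: (List.range m).map (2 ^ ·))

end merge

/-! ### The tree of random prescriptions -/

/-- A binary tree of depth `d` with `L` random bits in every inner node. -/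
def Tree (L : ℕ) : ℕ → Type
  | 0 => Unit
  | d + 1 => Fin (2 ^ L) × Tree L d × Tree L d

section node

variable (sig wt : ℕ → ℕ) (bud : ℕ) (M : ℕ → ℕ) (base : List ℕ) {L : ℕ}

/-- The representation technique: every set in question is split into two halves, whose
signatures are prescribed by the random bits. -/
def node : (d : ℕ) → Tree L d → ℕ → List ℕ
  | 0, _, _ => base
  | d + 1, (c, l, r), tg => merge sig wt bud (M d) c (M (d + 1)) tg (node d l c)
      (node d r (c ^^^ tg))

end node

end SplitSearch

namespace RAM

/-! ### Notation for programs -/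

instance : Add Expr := ⟨.op .add⟩
instance : Sub Expr := ⟨.op .sub⟩
instance : Mul Expr := ⟨.op .mul⟩
instance : Div Expr := ⟨.op .div⟩
instance : Mod Expr := ⟨.op .mod⟩
instance : XorOp Expr := ⟨.op .xor⟩
instance : AndOp Expr := ⟨.op .land⟩
instance (k : ℕ) : OfNat Expr k := ⟨.lit k⟩
instance : Coe Var Expr := ⟨.var⟩
instance : Coe Par Expr := ⟨.par⟩

/-- Sequential composition of a list of commands. -/
def Cmd.block : List Cmd → Cmd
  | [] => .skip
  | [p] => p
  | p :: q :: l => .seq p (block (q :: l))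

variable {π : Par → ℕ} {r : ℕ → Bool} {σ : St}

section eval
variable (a b : Expr)
@[simp] theorem eval_var (x : Var) : (Expr.var x).eval π σ = σ.v x := rfl
@[simp] theorem eval_par (k : Par) : (Expr.par k).eval π σ = π k % π .V := rfl
@[simp] theorem eval_lit (k : ℕ) :
    (no_index (OfNat.ofNat k : Expr)).eval π σ = (OfNat.ofNat k : ℕ) % π .V := rfl
@[simp] theorem eval_add : (a + b).eval π σ = (a.eval π σ + b.eval π σ) % π .V := rfl
@[simp] theorem eval_sub : (a - b).eval π σ = (a.eval π σ - b.eval π σ) % π .V := rfl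
@[simp] theorem eval_mul : (a * b).eval π σ = (a.eval π σ * b.eval π σ) % π .V := rfl
@[simp] theorem eval_div : (a / b).eval π σ = (a.eval π σ / b.eval π σ) % π .V := rfl
@[simp] theorem eval_mod : (a % b).eval π σ = (a.eval π σ % b.eval π σ) % π .V := rfl
@[simp] theorem eval_xor : (a ^^^ b).eval π σ = (a.eval π σ ^^^ b.eval π σ) % π .V := rfl
@[simp] theorem eval_and : (a &&& b).eval π σ = (a.eval π σ &&& b.eval π σ) % π .V := rfl
@[simp] theorem eval_lt' : (Expr.op .lt a b).eval π σ =
  (if a.eval π σ < b.eval π σ then 1 else 0) % π .V := rfl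
@[simp] theorem eval_eq' : (Expr.op .eq a b).eval π σ =
  (if a.eval π σ = b.eval π σ then 1 else 0) % π .V := rfl
@[simp] theorem eval_get : (Expr.get a b).eval π σ = σ.mem (a.eval π σ) (b.eval π σ) := rfl
end eval

section run
@[simp] theorem run_block_one (p : Cmd) : (Cmd.block [p]).run π r σ = p.run π r σ := rfl
@[simp] theorem run_block_cons (p q : Cmd) (l : List Cmd) :
    (Cmd.block (p :: q :: l)).run π r σ = (Cmd.block (q :: l)).run π r (p.run π r σ) := rfl
@[simp] theorem run_skip : Cmd.skip.run π r σ = σ := rfl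
@[simp] theorem run_set (x : Var) (e : Expr) :
    (Cmd.set x e).run π r σ = σ.setv x (e.eval π σ) := rfl
@[simp] theorem run_put (a b e : Expr) :
    (Cmd.put a b e).run π r σ = σ.setm (a.eval π σ) (b.eval π σ) (e.eval π σ) := rfl
theorem run_ite (e : Expr) (p q : Cmd) :
    (Cmd.ite e p q).run π r σ = if e.eval π σ ≠ 0 then p.run π r σ else q.run π r σ := rfl
@[simp] theorem setv_v (x y : Var) (k : ℕ) : (σ.setv x k).v y = if y = x then k else σ.v y := by
  simp [St.setv, Function.update_apply]
@[simp] theorem setv_mem (x : Var) (k : ℕ) : (σ.setv x k).mem = σ.mem := rfl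
@[simp] theorem setv_tossed (x : Var) (k : ℕ) : (σ.setv x k).tossed = σ.tossed := rfl
@[simp] theorem setm_v (i j k : ℕ) : (σ.setm i j k).v = σ.v := rfl
@[simp] theorem setm_tossed (i j k : ℕ) : (σ.setm i j k).tossed = σ.tossed := rfl
theorem setm_mem (i j k i' j' : ℕ) :
    (σ.setm i j k).mem i' j' = if i' = i ∧ j' = j then k else σ.mem i' j' := by
  by_cases h : i' = i
  · subst h; by_cases h' : j' = j
    · subst h'; simp [St.setm]
    · simp [St.setm, h']
  · simp [St.setm, h]
theorem setm_mem_of_ne {i j k i' : ℕ} (h : i' ≠ i) : (σ.setm i j k).mem i' = σ.mem i' := by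
  simp [St.setm, h]

/-- The rule of loop invariants, with the number of completed rounds as an argument of the
invariant. All programs with loops are verified by it. -/
theorem run_rep (P : ℕ → St → Prop) {k : Par} {p : Cmd} (h0 : P 0 σ)
    (hs : ∀ j < π k, ∀ τ, P j τ → P (j + 1) (p.run π r τ)) : P (π k) ((Cmd.rep k p).run π r σ) := by
  have : ∀ j ≤ π k, P j ((p.run π r)^[j] σ) := by
    intro j
    induction j with
    | zero => exact fun _ => h0
    | succ j ih =>
      intro hj
      rw [Function.iterate_succ_apply']
      exact hs j hj _ (ih (by omega))
  exact this _ le_rfl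
end run

/-- Whether a command may write to a variable. -/
def Cmd.writes : Cmd → Var → Prop
  | .skip, _ => False
  | .set x _, y => y = x
  | .put _ _ _, _ => False
  | .flip x, y => y = x
  | .seq p q, y => p.writes y ∨ q.writes y
  | .ite _ p q, y => p.writes y ∨ q.writes y
  | .rep _ p, y => p.writes y

/-- The frame rule: a syntactic check replaces carrying untouched variables through every invariant.
-/
theorem Cmd.run_of_not_writes (p : Cmd) {x : Var} : ∀ {σ : St}, ¬ p.writes x →
    (p.run π r σ).v x = σ.v x := by
  induction p with
  | skip => intros; rfl
  | set y e => intro σ h; simp only [writes] at h; simp [h]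
  | put a b e => intros; rfl
  | flip y => intro σ h; simp only [writes] at h; simp [Cmd.run, h]
  | seq p q hp hq =>
    intro σ h
    simp only [writes, not_or] at h
    exact (hq h.2).trans (hp h.1)
  | ite e p q hp hq =>
    intro σ h
    simp only [writes, not_or] at h
    simp only [Cmd.run]
    split_ifs
    · exact hp h.1
    · exact hq h.2
  | rep k p hp =>
    intro σ h
    exact run_rep (fun _ τ => τ.v x = σ.v x) (p := p) rfl fun _ _ τ hτ => (hp h).trans hτ

@[simp] theorem writes_block_one (p : Cmd) : (Cmd.block [p]).writes = p.writes := rfl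
@[simp] theorem writes_block_cons (p q : Cmd) (l : List Cmd) (x : Var) :
    (Cmd.block (p :: q :: l)).writes x = (p.writes x ∨ (Cmd.block (q :: l)).writes x) := rfl

/-! ### The signature and the weight of a set -/

open SplitSearch

/-- The arrays with the columns, the weights, the extended columns and the singletons. -/
def idCol : Expr := Par.N
def idWt : Expr := Par.N + 1
def idExt : Expr := Par.N + 2
def idSing : Expr := Par.N + 3

/-- Compute the signature `sg` and the weight `wt` of the set `y`. -/
def analyze : Cmd := .block
  [.set .sg 0, .set .wt 0, .set .z Var.y, .set .i 0,
   .rep .m (.block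
     [.ite (Var.z % 2) (.block
        [.set .sg (Var.sg ^^^ .get idExt Var.i), .set .wt (Var.wt + .get idWt Var.i)]) .skip,
      .set .z (Var.z / 2), .set .i (Var.i + 1)])]

/-- The parameters of the search. -/
structure Setting (π : Par → ℕ) : Prop where
  ok : ParOK π
  m1 : π .m1 = π .m + 1
  S : π .S = 2 ^ (π .n + π .L) + 2
  big : 1000 < π .V
  m : 2 ^ π .m < π .V
  sig : 4 * 2 ^ (π .n + π .L) + 4 < π .V
  bud : π .bud + 2 < π .V
  N : π .N + 5 < π .V

theorem Setting.m_lt (h : Setting π) : π .m + 1 < π .V :=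
  lt_of_le_of_lt (Nat.lt_two_pow_self) h.m

/-- The arrays of extended columns and of weights. -/
structure Cols (π : Par → ℕ) (e ω : ℕ → ℕ) (mem : ℕ → ℕ → ℕ) : Prop where
  ext : ∀ i ≤ π .m, mem (π .N + 2) i = e i
  wt : ∀ i < π .m, mem (π .N + 1) i = ω i
  ext_lt : ∀ i ≤ π .m, e i < 2 ^ (π .n + π .L)
  wt_lt : ∑ i ∈ Finset.range (π .m), ω i < π .V

theorem wsum_le_sum (ω : ℕ → ℕ) (m y : ℕ) : wsum ω m y ≤ ∑ i ∈ Finset.range m, ω i :=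
  Finset.sum_le_sum_of_subset (Finset.filter_subset _ _)

theorem testBit_eq_mod (y j : ℕ) : y.testBit j = decide (y / 2 ^ j % 2 = 1) := by
  rw [Nat.testBit_eq_decide_div_mod_eq]

variable {e ω : ℕ → ℕ}

theorem Cols.sig_lt (hC : Cols π e ω σ.mem) {j : ℕ} (hj : j ≤ π .m) (y : ℕ) :
    xsum e j y < 2 ^ (π .n + π .L) :=
  xorF_lt _ _ _ fun i hi => hC.ext_lt i (by simp at hi; omega)

theorem Cols.wsum_lt (hC : Cols π e ω σ.mem) {j : ℕ} (hj : j ≤ π .m) (y : ℕ) :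
    wsum ω j y < π .V :=
  (wsum_le_sum ω j y).trans_lt (lt_of_le_of_lt (Finset.sum_le_sum_of_subset (by simpa using hj))
    hC.wt_lt)

/-- The mask is shifted right bit by bit, and after `j` rounds the accumulators hold the
contribution of the first `j` columns. -/
theorem analyze_spec (hS : Setting π) (hσ : σ.Bdd π) (hC : Cols π e ω σ.mem) :
    (analyze.run π r σ).v .sg = xsum e (π .m) (σ.v .y) ∧
    (analyze.run π r σ).v .wt = wsum ω (π .m) (σ.v .y) ∧
    (analyze.run π r σ).mem = σ.mem ∧ (analyze.run π r σ).tossed = σ.tossed := by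
  have hbig := hS.big
  have hN := hS.N
  have hm := hS.m_lt
  have hsig := hS.sig
  have m0 : 0 % π .V = 0 := Nat.zero_mod _
  have m1 : 1 % π .V = 1 := Nat.mod_eq_of_lt (by omega)
  have m2 : 2 % π .V = 2 := Nat.mod_eq_of_lt (by omega)
  have mN : π .N % π .V = π .N := Nat.mod_eq_of_lt (by omega)
  have mN1 : (π .N + 1) % π .V = π .N + 1 := Nat.mod_eq_of_lt (by omega)
  have mN2 : (π .N + 2) % π .V = π .N + 2 := Nat.mod_eq_of_lt (by omega)
  simp only [analyze, run_block_cons, run_block_one, run_set]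
  set σ0 := (((σ.setv .sg (Expr.eval π σ 0)).setv .wt _).setv .z _).setv .i _ with hσ0
  have key := run_rep (π := π) (r := r) (σ := σ0) (k := .m) (fun j τ =>
    τ.v .sg = xsum e j (σ.v .y) ∧ τ.v .wt = wsum ω j (σ.v .y) ∧ τ.v .z = σ.v .y / 2 ^ j ∧
    τ.v .i = j ∧ τ.mem = σ.mem ∧ τ.tossed = σ.tossed)
    (p := .block
     [.ite (Var.z % 2) (.block
        [.set .sg (Var.sg ^^^ .get idExt Var.i), .set .wt (Var.wt + .get idWt Var.i)]) .skip,
      .set .z (Var.z / 2), .set .i (Var.i + 1)]) ?_ ?_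
  · exact ⟨key.1, key.2.1, key.2.2.2.2⟩
  · simp [hσ0, xsum, wsum, supp]
  · rintro j hj τ ⟨h1, h2, h3, h4, h5, h6⟩
    have hy : σ.v .y / 2 ^ j < π .V := (Nat.div_le_self _ _).trans_lt (hσ.var .y)
    have hy2 : σ.v .y / 2 ^ j / 2 % π .V = σ.v .y / 2 ^ j / 2 :=
      Nat.mod_eq_of_lt ((Nat.div_le_self _ _).trans_lt hy)
    have hj1 : (j + 1) % π .V = j + 1 := Nat.mod_eq_of_lt (by omega)
    have hz : σ.v .y / 2 ^ j % 2 % π .V = σ.v .y / 2 ^ j % 2 := Nat.mod_eq_of_lt (by omega)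
    have hpow : σ.v .y / 2 ^ (j + 1) = σ.v .y / 2 ^ j / 2 := by
      rw [pow_succ, Nat.div_div_eq_div_mul]
    simp only [run_block_cons, run_block_one, run_ite, run_set, run_skip, eval_mod, eval_var,
      eval_lit, m2, h3, hz]
    -- The bounds for the next partial sums show that the reductions modulo `V` are vacuous.
    have hx := hC.sig_lt (j := j + 1) (by omega) (σ.v .y)
    have hw := hC.wsum_lt (j := j + 1) (by omega) (σ.v .y)
    rw [xsum_succ, testBit_eq_mod] at hx
    rw [wsum_succ, testBit_eq_mod] at hw
    rw [xsum_succ, wsum_succ, testBit_eq_mod, hpow]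
    by_cases hb : σ.v .y / 2 ^ j % 2 = 1
    · simp only [hb, decide_true, if_true] at hx hw
      have hx' : (xsum e j (σ.v .y) ^^^ e j) % π .V = xsum e j (σ.v .y) ^^^ e j :=
        Nat.mod_eq_of_lt (by omega)
      have hw' : (wsum ω j (σ.v .y) + ω j) % π .V = wsum ω j (σ.v .y) + ω j :=
        Nat.mod_eq_of_lt hw
      simp [hb, h1, h2, h3, h4, h5, h6, idExt, idWt, mN, mN1, mN2, m1, m2, hC.ext j hj.le,
        hC.wt j hj, hx', hw', hy2, hj1]
    · have hb0 : σ.v .y / 2 ^ j % 2 = 0 := by omega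
      simp [hb0, h1, h2, h3, h4, h5, h6, m1, m2, hy2, hj1]

theorem analyze_frame {x : Var} (h1 : x ≠ .sg) (h2 : x ≠ .wt) (h3 : x ≠ .z) (h4 : x ≠ .i) :
    (analyze.run π r σ).v x = σ.v x :=
  Cmd.run_of_not_writes _ (by simp [analyze, Cmd.writes, h1, h2, h3, h4])

end RAM

namespace RAM

open SplitSearch

variable {π : Par → ℕ} {r : ℕ → Bool} {σ : St} {e ω : ℕ → ℕ}

/-! ### Lists in memory -/

/-- The array `id` holds the length and the entries of a list. -/
def IsList (mem : ℕ → ℕ → ℕ) (id : ℕ) (l : List ℕ) : Prop :=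
  mem id 0 = l.length ∧ ∀ k (h : k < l.length), mem id (k + 1) = l[k]

/-- Append an entry to the list in array `id`. -/
def pushMem (mem : ℕ → ℕ → ℕ) (id y : ℕ) : ℕ → ℕ → ℕ :=
  Function.update mem id (Function.update (Function.update (mem id) (mem id 0 + 1) y) 0
    (mem id 0 + 1))

theorem pushMem_of_ne (mem : ℕ → ℕ → ℕ) {id id' : ℕ} (y : ℕ) (h : id' ≠ id) :
    pushMem mem id y id' = mem id' := by simp [pushMem, h]

theorem IsList.push {mem : ℕ → ℕ → ℕ} {id : ℕ} {l : List ℕ} (h : IsList mem id l) (y : ℕ) :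
    IsList (pushMem mem id y) id (l ++ [y]) := by
  refine ⟨by simp [pushMem, h.1], fun k hk => ?_⟩
  simp only [List.length_append, List.length_singleton] at hk
  have h0 : k + 1 ≠ 0 := by omega
  simp only [pushMem, Function.update_self, Function.update_apply, h0, if_false, h.1]
  by_cases hkl : k = l.length
  · subst hkl; simp
  · have hk' : k < l.length := by omega
    have h1 : k + 1 ≠ l.length + 1 := by omega
    rw [if_neg h1, h.2 k hk', List.getElem_append_left hk']

theorem IsList.congr {mem mem' : ℕ → ℕ → ℕ} {id : ℕ} {l : List ℕ} (h : IsList mem id l)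
    (hm : mem' id = mem id) : IsList mem' id l := by
  simpa [IsList, hm] using h

theorem IsList.set {mem : ℕ → ℕ → ℕ} {id : ℕ} {l : List ℕ} (h : IsList mem id l) (k y : ℕ) :
    IsList (Function.update mem id (Function.update (mem id) (k + 1) y)) id (l.set k y) := by
  refine ⟨by simp [h.1], fun i hi => ?_⟩
  have hi' : i < l.length := by simpa using hi
  rw [List.getElem_set]
  simp only [Function.update_self, Function.update_apply, add_left_inj]
  by_cases hik : i = k
  · simp [hik]
  · rw [if_neg hik, if_neg (Ne.symm hik), h.2 i hi']

/-- Append `y` to the list in array `s`. -/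
def pushC : Cmd := .block
  [.set .sl (.get Var.s 0 + 1), .put Var.s Var.sl Var.y, .put Var.s 0 Var.sl]

theorem pushC_spec (hV : 1000 < π .V) (h : σ.mem (σ.v .s) 0 + 1 < π .V) :
    (pushC.run π r σ).mem = pushMem σ.mem (σ.v .s) (σ.v .y) ∧
    (pushC.run π r σ).v .sl = σ.mem (σ.v .s) 0 + 1 ∧
    (∀ x, x ≠ .sl → (pushC.run π r σ).v x = σ.v x) ∧
    (pushC.run π r σ).tossed = σ.tossed := by
  have m0 : 0 % π .V = 0 := Nat.zero_mod _
  have m1 : 1 % π .V = 1 := Nat.mod_eq_of_lt (by omega)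
  refine ⟨?_, ?_, ?_, rfl⟩
  · simp [pushC, m1, Nat.mod_eq_of_lt h, St.setm, pushMem]
  · simp [pushC, m1, Nat.mod_eq_of_lt h]
  · intro x hx
    simp [pushC, hx]

/-! ### Merging two lists -/

/-- A merge owns the arrays from `F` on: `F` is the result, `F + 1` the table of signatures, and `F
+ 2 + key` the bucket of the elements of the second list with signature `key` modulo `mo`. One round
files one element. -/
def bucketBody : Cmd := .ite (.op .lt Var.k (.get Var.mB 0)) (.block
  [.set .k (Var.k + 1), .set .y (.get Var.mB Var.k), analyze,
   .set .s (Var.F + 2 + Var.sg % Var.mo), pushC]) .skip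

/-- A table entry is the position of the signature in the result list plus one; zero means that the
signature is new. Insertion thus needs no search. -/
def insertC : Cmd := .block
  [.set .sl (.get (Var.F + 1) Var.sg),
   .ite Var.sl
    (.block [.set .x Var.y, .set .w1 Var.wt, .set .y (.get Var.F Var.sl), analyze,
      .ite (.op .lt Var.w1 Var.wt) (.put Var.F Var.sl Var.x) .skip])
    (.block [.set .s Var.F, pushC, .put (Var.F + 1) Var.sg Var.sl])]

/-- One round handles one event: it takes an entry of the current bucket, counting `p` down, or,
when the bucket is used up, turns to the next element of the first list. Counting down is the reason
for the reversal in `events`. -/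
def pairBody : Cmd := .ite Var.p
  (.block [.set .y (Var.a ^^^ .get Var.bk Var.p), .set .p (Var.p - 1), analyze, insertC])
  (.ite (.op .lt Var.k (.get Var.mA 0)) (.block
    [.set .k (Var.k + 1), .set .y (.get Var.mA Var.k), .set .a Var.y, analyze,
     .ite (.op .eq (Var.sg % Var.mf) (Var.cf % Var.mf)) (.block
      [.set .bk (Var.F + 2 + (Var.sg ^^^ Var.mt) % Var.mo), .set .p (.get Var.bk 0)]) .skip]) .skip)

/-- Merge the lists in the arrays `mA` and `mB`. The result is put into a new array. -/
def mergeC : Cmd := .block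
  [.set .k 0, .rep .bud bucketBody, .set .k 0, .set .p 0, .rep .bud pairBody,
   .set .res Var.F, .set .F (Var.F + Par.S)]

/-- The data of a call of `mergeC`. -/
structure MergeData (π : Par → ℕ) (e ω : ℕ → ℕ) (σ : St) (A B : List ℕ) : Prop where
  bdd : σ.Bdd π
  cols : Cols π e ω σ.mem
  lA : IsList σ.mem (σ.v .mA) A
  lB : IsList σ.mem (σ.v .mB) B
  A_lt : ∀ a ∈ A, a < 2 ^ π .m
  B_lt : ∀ b ∈ B, b < 2 ^ π .m
  mA : σ.v .mA < σ.v .F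
  mB : σ.v .mB < σ.v .F
  F_ge : π .N + 4 ≤ σ.v .F
  F_lt : σ.v .F + π .S < π .V
  fresh : ∀ i, σ.v .F ≤ i → ∀ j, σ.mem i j = 0
  mo_pos : 0 < σ.v .mo
  mo : σ.v .mo ≤ 2 ^ (π .n + π .L)
  mt : σ.v .mt < 2 ^ (π .n + π .L)

/-- The variables that are fixed during a merge. -/
def SameArgs (σ τ : St) : Prop :=
  ∀ x ∈ [Var.F, .mA, .mB, .mf, .cf, .mo, .mt], τ.v x = σ.v x

theorem SameArgs.of_not_writes {τ : St} (h : SameArgs σ τ) (p : Cmd)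
    (hp : ∀ x ∈ [Var.F, .mA, .mB, .mf, .cf, .mo, .mt], ¬ p.writes x) :
    SameArgs σ (p.run π r τ) :=
  fun x hx => (p.run_of_not_writes (hp x hx)).trans (h x hx)

theorem Cols.congr {mem mem' : ℕ → ℕ → ℕ} (h : Cols π e ω mem)
    (hm : ∀ i < π .N + 4, mem' i = mem i) : Cols π e ω mem' where
  ext i hi := by rw [hm _ (by omega)]; exact h.ext i hi
  wt i hi := by rw [hm _ (by omega)]; exact h.wt i hi
  ext_lt := h.ext_lt
  wt_lt := h.wt_lt

/-- After `j` rounds of the first phase. -/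
structure BucketInv (π : Par → ℕ) (e : ℕ → ℕ) (σ : St) (B : List ℕ) (j : ℕ) (τ : St) : Prop where
  bdd : τ.Bdd π
  args : SameArgs σ τ
  tossed : τ.tossed = σ.tossed
  k : τ.v .k = min j B.length
  low : ∀ i < σ.v .F + 2, τ.mem i = σ.mem i
  high : ∀ i, σ.v .F + π .S ≤ i → τ.mem i = σ.mem i
  bucket : ∀ key < 2 ^ (π .n + π .L), IsList τ.mem (σ.v .F + 2 + key)
    ((B.take j).filter fun b => xsum e (π .m) b % σ.v .mo = key)

/-- Exactly one bucket grows, that of the signature of the new element. After the end of the second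
list the rounds are idle. -/
theorem bucketBody_spec (hS : Setting π) {A B : List ℕ} (h : MergeData π e ω σ A B) {j : ℕ}
    {τ : St} (hτ : BucketInv π e σ B j τ) : BucketInv π e σ B (j + 1) (bucketBody.run π r τ) := by
  have hbig := hS.big
  have m0 : 0 % π .V = 0 := Nat.zero_mod _
  have m1 : 1 % π .V = 1 := Nat.mod_eq_of_lt (by omega)
  have m2 : 2 % π .V = 2 := Nat.mod_eq_of_lt (by omega)
  have hSS := hS.S
  have hFl := h.F_lt
  have hbdd := bucketBody.run_bdd (r := r) hS.ok hτ.bdd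
  have hargs : SameArgs σ (bucketBody.run π r τ) := hτ.args.of_not_writes _ (by
    simp [bucketBody, Cmd.writes, analyze, pushC])
  have hmB : τ.v .mB = σ.v .mB := hτ.args _ (by simp)
  have hF : τ.v .F = σ.v .F := hτ.args _ (by simp)
  have hmo : τ.v .mo = σ.v .mo := hτ.args _ (by simp)
  have hlB : IsList τ.mem (σ.v .mB) B := h.lB.congr (hτ.low _ (by have := h.mB; omega))
  have hcols : Cols π e ω τ.mem := h.cols.congr fun i hi => hτ.low i (by have := h.F_ge; omega)
  have hlen : B.length < π .V := by rw [← h.lB.1]; exact h.bdd.mem _ _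
  by_cases hj : j < B.length
  · have hk : τ.v .k = j := by rw [hτ.k]; omega
    have hk1 : (j + 1) % π .V = j + 1 := Nat.mod_eq_of_lt (by omega)
    have hcond : bucketBody.run π r τ = (Cmd.block [Cmd.set .s (Var.F + 2 + Var.sg % Var.mo),
        pushC]).run π r (analyze.run π r ((τ.setv .k (j + 1)).setv .y B[j])) := by
      rw [bucketBody, run_ite]
      simp [m0, hmB, hlB.1, hlB.2 j hj, hk, hj, m1, hk1]
    set τ1 := (τ.setv .k (j + 1)).setv .y B[j] with hτ1
    have hBj : B[j] < 2 ^ π .m := h.B_lt _ (List.getElem_mem hj)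
    have hb1 : τ1.Bdd π := (hτ.bdd.setv (by omega)).setv (hBj.trans hS.m)
    obtain ⟨a1, a2, a3, a4⟩ := analyze_spec (r := r) (ω := ω) hS hb1 (e := e) hcols
    have hb2 := analyze.run_bdd (r := r) hS.ok hb1
    have af : ∀ {x}, x ≠ .sg → x ≠ .wt → x ≠ .z → x ≠ .i → (analyze.run π r τ1).v x = τ1.v x :=
      fun h1 h2 h3 h4 => analyze_frame h1 h2 h3 h4
    set τ2 := analyze.run π r τ1 with hτ2
    set key := xsum e (π .m) B[j] % σ.v .mo with hkey
    have hkey_lt : key < 2 ^ (π .n + π .L) := (Nat.mod_lt _ h.mo_pos).trans_le h.mo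
    have a1' : τ2.v .sg = xsum e (π .m) B[j] := by rw [a1]; simp [hτ1]
    have hs : (Var.F + 2 + Var.sg % Var.mo : Expr).eval π τ2 = σ.v .F + 2 + key := by
      simp only [eval_add, eval_var, eval_lit, eval_mod, a1', m2]
      have e1 : τ2.v .F = σ.v .F := by rw [af] <;> simp [hτ1, hF]
      have e2 : τ2.v .mo = σ.v .mo := by rw [af] <;> simp [hτ1, hmo]
      rw [e1, e2, ← hkey, Nat.mod_eq_of_lt (by omega : σ.v .F + 2 < π .V),
        Nat.mod_eq_of_lt (by omega : key < π .V), Nat.mod_eq_of_lt (by omega)]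
    set τ3 := τ2.setv .s (σ.v .F + 2 + key) with hτ3
    have hbk := hτ.bucket key hkey_lt
    have hmem3 : τ3.mem = τ.mem := by rw [hτ3, setv_mem, a3]; rfl
    have hs3 : τ3.v .s = σ.v .F + 2 + key := by simp [hτ3]
    have hy3 : τ3.v .y = B[j] := by
      rw [hτ3, setv_v, if_neg (by simp), af] <;> simp [hτ1]
    obtain ⟨p1, p2, p3, p4⟩ := pushC_spec (π := π) (r := r) (σ := τ3) (by omega) (by
      rw [hs3, hmem3, hbk.1]
      have := List.length_filter_le (fun b => decide (xsum e (π .m) b % σ.v .mo = key)) (B.take j)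
      rw [List.length_take] at this
      omega)
    have hrun : bucketBody.run π r τ = pushC.run π r τ3 := by
      rw [hcond]
      simp only [run_block_cons, run_block_one, run_set, hs, hτ3]
    rw [hrun] at hbdd hargs ⊢
    rw [hs3, hmem3, hy3] at p1
    refine ⟨hbdd, hargs, ?_, ?_, ?_, ?_, ?_⟩
    · rw [p4, hτ3, setv_tossed, a4]; exact hτ.tossed
    · rw [p3 _ (by simp), hτ3, setv_v, if_neg (by simp), af] <;> simp [hτ1]
      omega
    · intro i hi
      rw [p1, pushMem_of_ne _ _ (by omega), hτ.low i hi]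
    · intro i hi
      rw [p1, pushMem_of_ne _ _ (by omega), hτ.high i hi]
    · intro key' hkey'
      rw [p1, List.take_add_one, List.getElem?_eq_getElem hj, List.filter_append]
      by_cases hkk : key' = key
      · subst hkk
        have : List.filter (fun b => decide (xsum e (π .m) b % σ.v .mo = key)) (some B[j]).toList
            = [B[j]] := by simp [hkey]
        rw [this]
        exact hbk.push _
      · have : List.filter (fun b => decide (xsum e (π .m) b % σ.v .mo = key')) (some B[j]).toList
            = [] := by simp [hkey] at hkk ⊢; exact fun h => hkk h.symm
        rw [this, List.append_nil]
        exact (hτ.bucket key' hkey').congr (pushMem_of_ne _ _ (by omega))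
  · have hk : τ.v .k = B.length := by rw [hτ.k]; omega
    have hrun : bucketBody.run π r τ = τ := by
      rw [bucketBody, run_ite]
      simp [m0, hmB, hlB.1, hk]
    rw [hrun]
    refine ⟨hτ.bdd, hτ.args, hτ.tossed, by rw [hk]; omega, hτ.low, hτ.high, ?_⟩
    rw [List.take_of_length_le (by omega), ← List.take_of_length_le (by omega : B.length ≤ j)]
    exact hτ.bucket

theorem MergeData.bucketInv {A B : List ℕ} (h : MergeData π e ω σ A B) (hV : 1000 < π .V)  :
    BucketInv π e σ B 0 (σ.setv .k 0) where
  bdd := h.bdd.setv (by omega)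
  args x hx := by
    simp only [List.mem_cons, List.not_mem_nil, or_false] at hx
    rcases hx with rfl | rfl | rfl | rfl | rfl | rfl | rfl <;> simp
  tossed := rfl
  k := by simp
  low _ _ := rfl
  high _ _ := rfl
  bucket key _ := by
    have := h.fresh (σ.v .F + 2 + key) (by omega)
    exact ⟨by simp [this], by simp⟩

/-- The table of signatures. -/
def IsTable (sig : ℕ → ℕ) (t : ℕ → ℕ) (R : List ℕ) : Prop :=
  ∀ s, (t s = 0 ∧ ∀ z ∈ R, sig z ≠ s) ∨ ∃ k, ∃ h : k < R.length, t s = k + 1 ∧ sig R[k] = s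

/-- The situation when a candidate is about to be inserted. -/
structure InsertData (π : Par → ℕ) (e ω : ℕ → ℕ) (τ : St) (R : List ℕ) : Prop where
  bdd : τ.Bdd π
  cols : Cols π e ω τ.mem
  F_ge : π .N + 4 ≤ τ.v .F
  F_lt : τ.v .F + 2 < π .V
  list : IsList τ.mem (τ.v .F) R
  table : IsTable (xsum e (π .m)) (τ.mem (τ.v .F + 1)) R
  nodup : (R.map (xsum e (π .m))).Nodup
  length : R.length + 1 < π .V
  R_lt : ∀ z ∈ R, z < 2 ^ π .m
  sg : τ.v .sg = xsum e (π .m) (τ.v .y)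
  wt : τ.v .wt = wsum ω (π .m) (τ.v .y)

/-- The table decides between the two descriptions of `ins`: `ins_of_not_mem` for a new signature,
and `ins_of_get` for a known one. -/
theorem insertC_spec (hS : Setting π) {τ : St} {R : List ℕ} (h : InsertData π e ω τ R) :
    IsList (insertC.run π r τ).mem (τ.v .F) (ins (xsum e (π .m)) (wsum ω (π .m)) R (τ.v .y)) ∧
    IsTable (xsum e (π .m)) ((insertC.run π r τ).mem (τ.v .F + 1))
      (ins (xsum e (π .m)) (wsum ω (π .m)) R (τ.v .y)) ∧
    (∀ i, i ≠ τ.v .F → i ≠ τ.v .F + 1 → (insertC.run π r τ).mem i = τ.mem i) ∧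
    (insertC.run π r τ).tossed = τ.tossed := by
  have hbig := hS.big
  have m0 : 0 % π .V = 0 := Nat.zero_mod _
  have m1 : 1 % π .V = 1 := Nat.mod_eq_of_lt (by omega)
  have hF1 : (τ.v .F + 1) % π .V = τ.v .F + 1 := Nat.mod_eq_of_lt (by have := h.F_lt; omega)
  have hrun : insertC.run π r τ = (Cmd.ite Var.sl
    (.block [.set .x Var.y, .set .w1 Var.wt, .set .y (.get Var.F Var.sl), analyze,
      .ite (.op .lt Var.w1 Var.wt) (.put Var.F Var.sl Var.x) .skip])
    (.block [.set .s Var.F, pushC, .put (Var.F + 1) Var.sg Var.sl])).run π r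
      (τ.setv .sl (τ.mem (τ.v .F + 1) (τ.v .sg))) := by
    simp [insertC, m1, hF1]
  rw [hrun, run_ite]
  clear hrun
  -- Either the signature is new and is appended, or the stored set is analyzed again and its weight
  -- compared.
  rcases h.table (τ.v .sg) with ⟨ht, hz⟩ | ⟨k, hk, ht, hz⟩
  · have hins : ins (xsum e (π .m)) (wsum ω (π .m)) R (τ.v .y) = R ++ [τ.v .y] :=
      ins_of_not_mem _ _ fun z hz' => by rw [← h.sg]; exact hz z hz'
    rw [hins, ht, if_neg (by simp)]
    simp only [run_block_cons, run_block_one, run_set, run_put]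
    set τ1 := (τ.setv .sl 0).setv .s (Expr.eval π (τ.setv .sl 0) Var.F) with hτ1
    have hs1 : τ1.v .s = τ.v .F := by simp [hτ1]
    have hmem1 : τ1.mem = τ.mem := rfl
    have hy1 : τ1.v .y = τ.v .y := by simp [hτ1]
    obtain ⟨p1, p2, p3, p4⟩ := pushC_spec (π := π) (r := r) (σ := τ1) (by omega) (by
      rw [hs1, hmem1, h.list.1]; exact h.length)
    rw [hs1, hmem1] at p2
    rw [hs1, hmem1, hy1] at p1
    have hFe : (pushC.run π r τ1).v .F = τ.v .F := by rw [p3 _ (by simp)]; simp [hτ1]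
    have hsge : (pushC.run π r τ1).v .sg = τ.v .sg := by rw [p3 _ (by simp)]; simp [hτ1]
    simp only [eval_add, eval_var, eval_lit, m1, hFe, hF1, hsge, p2, h.list.1]
    have hne : τ.v .F ≠ τ.v .F + 1 := by omega
    refine ⟨?_, ?_, ?_, ?_⟩
    · refine IsList.congr ?_ (setm_mem_of_ne hne)
      rw [p1]
      exact h.list.push _
    · intro s
      rw [setm_mem]
      by_cases hs : s = τ.v .sg
      · right
        refine ⟨R.length, by simp, by simp [hs], by simp [hs, h.sg]⟩
      · rw [if_neg (by simp [hs]), p1, pushMem_of_ne _ _ hne.symm]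
        rcases h.table s with ⟨h1, h2⟩ | ⟨k, hk, h1, h2⟩
        · left
          refine ⟨h1, fun z hz => ?_⟩
          rcases List.mem_append.1 hz with hz | hz
          · exact h2 z hz
          · rw [List.mem_singleton.1 hz, ← h.sg]; exact Ne.symm hs
        · right
          refine ⟨k, by simp; omega, h1, by rw [List.getElem_append_left hk]; exact h2⟩
    · intro i h1 h2
      rw [setm_mem_of_ne h2, p1, pushMem_of_ne _ _ h1]
    · rw [setm_tossed, p4]; rfl
  · have hget : xsum e (π .m) R[k] = xsum e (π .m) (τ.v .y) := by rw [hz, h.sg]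
    rw [ins_of_get _ _ h.nodup hk hget, ht, if_pos (by simp)]
    simp only [run_block_cons, run_block_one]
    set τ1 := ((Cmd.set .y (.get Var.F Var.sl)).run π r
      ((Cmd.set .w1 Var.wt).run π r ((Cmd.set .x Var.y).run π r (τ.setv .sl (k + 1))))) with hτ1
    have hmem1 : τ1.mem = τ.mem := rfl
    have hkV : k + 1 < π .V := by have := h.length; omega
    have hb1 : τ1.Bdd π := Cmd.run_bdd hS.ok _ (Cmd.run_bdd hS.ok _ (Cmd.run_bdd hS.ok _
      (h.bdd.setv hkV)))
    obtain ⟨a1, a2, a3, a4⟩ := analyze_spec (r := r) (ω := ω) hS hb1 (e := e) h.cols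
    have af : ∀ {x}, x ≠ .sg → x ≠ .wt → x ≠ .z → x ≠ .i → (analyze.run π r τ1).v x = τ1.v x :=
      fun h1 h2 h3 h4 => analyze_frame h1 h2 h3 h4
    have hy1 : τ1.v .y = R[k] := by simp [hτ1, h.list.2 k hk]
    rw [hy1] at a2
    have f1 : (analyze.run π r τ1).v .w1 = wsum ω (π .m) (τ.v .y) := by
      rw [af] <;> simp [hτ1, h.wt]
    have f2 : (analyze.run π r τ1).v .x = τ.v .y := by rw [af] <;> simp [hτ1]
    have f3 : (analyze.run π r τ1).v .sl = k + 1 := by rw [af] <;> simp [hτ1]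
    have f4 : (analyze.run π r τ1).v .F = τ.v .F := by rw [af] <;> simp [hτ1]
    rw [run_ite]
    simp only [eval_lt', eval_var, f1, a2, run_put, f2, f3, f4, run_skip]
    by_cases hlt : wsum ω (π .m) (τ.v .y) < wsum ω (π .m) R[k]
    · rw [if_pos hlt, if_pos hlt, if_pos (by simp [m1])]
      have hmem : ((analyze.run π r τ1).setm (τ.v .F) (k + 1) (τ.v .y)).mem =
          Function.update τ.mem (τ.v .F) (Function.update (τ.mem (τ.v .F)) (k + 1) (τ.v .y)) := by
        simp only [St.setm, a3, hmem1]
      rw [hmem]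
      have hne : τ.v .F + 1 ≠ τ.v .F := by omega
      refine ⟨h.list.set k _, ?_, ?_, ?_⟩
      · intro s
        simp only [Function.update_of_ne hne]
        rcases h.table s with ⟨h1, h2⟩ | ⟨k', hk', h1, h2⟩
        · left
          refine ⟨h1, fun z hz' => ?_⟩
          rcases List.mem_or_eq_of_mem_set hz' with hz' | rfl
          · exact h2 z hz'
          · rw [← hget]; exact h2 _ (List.getElem_mem hk)
        · right
          refine ⟨k', by simpa using hk', h1, ?_⟩
          rw [List.getElem_set]
          split_ifs with hkk
          · subst hkk; rw [← hget]; exact h2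
          · exact h2
      · intro i h1 _
        rw [Function.update_of_ne h1]
      · rw [setm_tossed, a4]; rfl
    · rw [if_neg hlt, if_neg hlt, if_neg (by simp)]
      rw [a3, a4, hmem1]
      exact ⟨h.list, h.table, fun _ _ _ => rfl, rfl⟩

end RAM

namespace RAM

open SplitSearch

variable {π : Par → ℕ} {r : ℕ → Bool} {σ : St} {e ω : ℕ → ℕ}

/-! ### The second phase of a merge: enumerating the matching pairs -/

/-- After `j` rounds of the second phase; `μ` is the memory after the first phase. -/
structure PairInv (π : Par → ℕ) (e ω : ℕ → ℕ) (σ : St) (μ : ℕ → ℕ → ℕ) (A B : List ℕ) (j : ℕ)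
    (τ : St) : Prop where
  bdd : τ.Bdd π
  args : SameArgs σ τ
  tossed : τ.tossed = σ.tossed
  mem : ∀ i, i ≠ σ.v .F → i ≠ σ.v .F + 1 → τ.mem i = μ i
  list : IsList τ.mem (σ.v .F) (((events (xsum e (π .m)) (σ.v .mf) (σ.v .cf) (σ.v .mo) (σ.v .mt)
    A B).take j).foldl (insOpt (xsum e (π .m)) (wsum ω (π .m))) [])
  table : IsTable (xsum e (π .m)) (τ.mem (σ.v .F + 1)) (((events (xsum e (π .m)) (σ.v .mf)
    (σ.v .cf) (σ.v .mo) (σ.v .mt) A B).take j).foldl (insOpt (xsum e (π .m)) (wsum ω (π .m))) [])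
  rest : (events (xsum e (π .m)) (σ.v .mf) (σ.v .cf) (σ.v .mo) (σ.v .mt) A B).drop j =
    ((List.range (τ.v .p)).reverse.map fun i => some (τ.v .a ^^^ μ (τ.v .bk) (i + 1))) ++
      events (xsum e (π .m)) (σ.v .mf) (σ.v .cf) (σ.v .mo) (σ.v .mt) (A.drop (τ.v .k)) B
  ptr : τ.v .p ≠ 0 → σ.v .F + 2 ≤ τ.v .bk ∧ τ.v .a < 2 ^ π .m ∧
    ∀ i < τ.v .p, μ (τ.v .bk) (i + 1) < 2 ^ π .m

/-- The memory between the two phases. -/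
structure Mid (π : Par → ℕ) (e ω : ℕ → ℕ) (σ : St) (μ : ℕ → ℕ → ℕ) (A B : List ℕ) : Prop where
  lA : IsList μ (σ.v .mA) A
  cols : Cols π e ω μ
  bucket : ∀ key < 2 ^ (π .n + π .L), IsList μ (σ.v .F + 2 + key)
    (B.filter fun b => xsum e (π .m) b % σ.v .mo = key)

theorem take_succ_eq {α : Type*} {l l' : List α} {j : ℕ} {x : α} (h : l.drop j = x :: l') :
    l.take (j + 1) = l.take j ++ [x] ∧ l.drop (j + 1) = l' := by
  have hj : j < l.length := by
    by_contra hj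
    rw [List.drop_eq_nil_of_le (by omega)] at h
    simp at h
  rw [List.drop_eq_getElem_cons hj] at h
  simp only [List.cons.injEq] at h
  rw [List.take_add_one, List.getElem?_eq_getElem hj, h.1]
  exact ⟨rfl, h.2⟩

/-- The entries still to come from a bucket are described by positions, as the machine reads them
from the last to the first. -/
theorem reverse_map_eq (l : List ℕ) (f : ℕ → Option ℕ) (g : ℕ → ℕ)
    (h : ∀ k (hk : k < l.length), g k = l[k]) :
    l.reverse.map f = (List.range l.length).reverse.map fun i => f (g i) := by
  rw [List.map_reverse, List.map_reverse]
  congr 1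
  apply List.ext_getElem
  · simp
  · intro i h1 h2
    simp only [List.getElem_map, List.getElem_range]
    rw [h i (by simpa using h1)]

/-- The invariant splits the work list into a processed part, which determines the result list, and
a remaining part, which is what the pointers `p`, `bk` and `k` still have to visit. A round moves
one event from the second part to the first. -/
theorem pairBody_spec (hS : Setting π) {A B : List ℕ} {μ : ℕ → ℕ → ℕ}
    (h : MergeData π e ω σ A B) (hμ : Mid π e ω σ μ A (B.take (π .bud))) {j : ℕ}
    (hjb : j < π .bud) {τ : St} (hτ : PairInv π e ω σ μ A (B.take (π .bud)) j τ) :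
    PairInv π e ω σ μ A (B.take (π .bud)) (j + 1) (pairBody.run π r τ) := by
  have hbig := hS.big
  have m0 : 0 % π .V = 0 := Nat.zero_mod _
  have m1 : 1 % π .V = 1 := Nat.mod_eq_of_lt (by omega)
  have m2 : 2 % π .V = 2 := Nat.mod_eq_of_lt (by omega)
  have hSS := hS.S
  have hFl := h.F_lt
  have hFg := h.F_ge
  have hsigV := hS.sig
  have hmV := hS.m
  have hbud := hS.bud
  have hbdd := pairBody.run_bdd (r := r) hS.ok hτ.bdd
  have hargs : SameArgs σ (pairBody.run π r τ) := hτ.args.of_not_writes _ (by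
    simp [pairBody, Cmd.writes, analyze, pushC, insertC])
  have hmA : τ.v .mA = σ.v .mA := hτ.args _ (by simp)
  have hF : τ.v .F = σ.v .F := hτ.args _ (by simp)
  have hmo : τ.v .mo = σ.v .mo := hτ.args _ (by simp)
  have hmf : τ.v .mf = σ.v .mf := hτ.args _ (by simp)
  have hcf : τ.v .cf = σ.v .cf := hτ.args _ (by simp)
  have hmt : τ.v .mt = σ.v .mt := hτ.args _ (by simp)
  have hcols : Cols π e ω τ.mem := hμ.cols.congr fun i hi => hτ.mem i (by omega) (by omega)
  have hlen : A.length < π .V := by rw [← h.lA.1]; exact h.bdd.mem _ _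
  have hB' : ∀ b ∈ B.take (π .bud), b < 2 ^ π .m := fun b hb => h.B_lt b (List.mem_of_mem_take hb)
  generalize B.take (π .bud) = B' at *
  obtain ⟨sig, hsig⟩ : ∃ s, s = xsum e (π .m) := ⟨_, rfl⟩
  obtain ⟨wt, hwt⟩ : ∃ s, s = wsum ω (π .m) := ⟨_, rfl⟩
  have hlist := hτ.list
  have htable := hτ.table
  have hrest := hτ.rest
  rw [← hsig] at hlist htable hrest
  rw [← hwt] at hlist htable
  set E := events sig (σ.v .mf) (σ.v .cf) (σ.v .mo) (σ.v .mt) A B' with hE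
  set R := (E.take j).foldl (insOpt sig wt) [] with hR
  -- At most one set is stored per round, so positions stay below the budget and hence below `V`.
  have hRlen : R.length ≤ j := by
    refine (length_foldl_ins_le sig wt).trans ?_
    simp only [List.length_nil, zero_add]
    exact (List.length_filter_le _ _).trans (List.length_take_le _ _)
  have hAlt := h.A_lt
  have hRlt : ∀ z ∈ R, z < 2 ^ π .m := by
    intro z hz
    rcases mem_foldl_ins sig wt hz with hz | hz
    · simp at hz
    · obtain ⟨a, ha, b, hb, _, _, rfl⟩ := (mem_events sig).1 (List.mem_of_mem_take hz)
      exact Nat.xor_lt_two_pow (hAlt a ha) (hB' b hb)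
  -- If the current bucket is exhausted, the next event is a `none`; otherwise it is a pair.
  by_cases hp : τ.v .p = 0
  · have hrun : pairBody.run π r τ = (Cmd.ite (.op .lt Var.k (.get Var.mA 0)) (.block
      [.set .k (Var.k + 1), .set .y (.get Var.mA Var.k), .set .a Var.y, analyze,
       .ite (.op .eq (Var.sg % Var.mf) (Var.cf % Var.mf)) (.block
        [.set .bk (Var.F + 2 + (Var.sg ^^^ Var.mt) % Var.mo), .set .p (.get Var.bk 0)]) .skip])
       .skip).run π r τ := by
      rw [pairBody, run_ite]; simp [hp]
    have hlA : IsList τ.mem (σ.v .mA) A :=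
      hμ.lA.congr (hτ.mem _ (by have := h.mA; omega) (by have := h.mA; omega))
    rw [hp] at hrest
    simp only [List.range_zero, List.reverse_nil, List.map_nil, List.nil_append] at hrest
    by_cases hk : τ.v .k < A.length
    · have hk1 : (τ.v .k + 1) % π .V = τ.v .k + 1 := Nat.mod_eq_of_lt (by omega)
      set a := A[τ.v .k] with ha
      have haltm : a < 2 ^ π .m := h.A_lt _ (List.getElem_mem hk)
      set τ1 := ((τ.setv .k (τ.v .k + 1)).setv .y a).setv .a a with hτ1
      have hrun2 : pairBody.run π r τ = (Cmd.ite (.op .eq (Var.sg % Var.mf) (Var.cf % Var.mf))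
          (.block [.set .bk (Var.F + 2 + (Var.sg ^^^ Var.mt) % Var.mo), .set .p (.get Var.bk 0)])
          .skip).run π r (analyze.run π r τ1) := by
        rw [hrun, run_ite]
        simp [hmA, hlA.1, m1, hk, hk1, hlA.2 _ hk, hτ1, ha]
      have hb1 : τ1.Bdd π := ((hτ.bdd.setv (by omega)).setv (by omega)).setv (by omega)
      obtain ⟨a1, a2, a3, a4⟩ := analyze_spec (r := r) (ω := ω) hS hb1 (e := e) hcols
      have af : ∀ {x}, x ≠ .sg → x ≠ .wt → x ≠ .z → x ≠ .i → (analyze.run π r τ1).v x = τ1.v x :=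
        fun h1 h2 h3 h4 => analyze_frame h1 h2 h3 h4
      have hb2 := analyze.run_bdd (r := r) hS.ok hb1
      set τ2 := analyze.run π r τ1 with hτ2
      have a1' : τ2.v .sg = sig a := by rw [a1, hsig]; simp [hτ1]
      have f1 : τ2.v .mf = σ.v .mf := by rw [af] <;> simp [hτ1, hmf]
      have f2 : τ2.v .cf = σ.v .cf := by rw [af] <;> simp [hτ1, hcf]
      have f3 : τ2.v .mo = σ.v .mo := by rw [af] <;> simp [hτ1, hmo]
      have f4 : τ2.v .mt = σ.v .mt := by rw [af] <;> simp [hτ1, hmt]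
      have f5 : τ2.v .F = σ.v .F := by rw [af] <;> simp [hτ1, hF]
      have f6 : τ2.v .k = τ.v .k + 1 := by rw [af] <;> simp [hτ1]
      have f7 : τ2.v .a = a := by rw [af] <;> simp [hτ1]
      have f8 : τ2.v .p = 0 := by rw [af] <;> simp [hτ1, hp]
      have hdrop : A.drop (τ.v .k) = a :: A.drop (τ.v .k + 1) := List.drop_eq_getElem_cons hk
      have hev : E.drop j = none :: ((if sig a % σ.v .mf = σ.v .cf % σ.v .mf then
          ((B'.filter fun b => sig b % σ.v .mo = (sig a ^^^ σ.v .mt) % σ.v .mo).reverse.map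
            fun b => some (a ^^^ b)) else []) ++
          events sig (σ.v .mf) (σ.v .cf) (σ.v .mo) (σ.v .mt) (A.drop (τ.v .k + 1)) B') := by
        rw [hrest, hdrop]; rfl
      obtain ⟨ht, hd⟩ := take_succ_eq hev
      have hR' : (E.take (j + 1)).foldl (insOpt sig wt) [] = R := by
        rw [ht, List.foldl_append]; rfl
      have hsa : sig a % σ.v .mf % π .V = sig a % σ.v .mf := by
        refine Nat.mod_eq_of_lt ((Nat.mod_le _ _).trans_lt ?_)
        rw [← a1']; exact hb2.var _
      have hsc : σ.v .cf % σ.v .mf % π .V = σ.v .cf % σ.v .mf :=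
        Nat.mod_eq_of_lt ((Nat.mod_le _ _).trans_lt (h.bdd.var _))
      rw [hrun2] at hbdd hargs ⊢
      have hcond : (Expr.op .eq (Var.sg % Var.mf) (Var.cf % Var.mf) : Expr).eval π τ2 ≠ 0 ↔
          sig a % σ.v .mf = σ.v .cf % σ.v .mf := by
        simp only [eval_eq', eval_mod, eval_var, a1', f1, f2, hsa, hsc]
        split_ifs with hc <;> simp [m1, hc]
      rw [run_ite] at hbdd hargs ⊢
      by_cases hc : sig a % σ.v .mf = σ.v .cf % σ.v .mf
      · rw [if_pos (hcond.2 hc)] at hbdd hargs ⊢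
        rw [if_pos hc] at hd
        set key := (sig a ^^^ σ.v .mt) % σ.v .mo with hkey
        have hkey_lt : key < 2 ^ (π .n + π .L) := (Nat.mod_lt _ h.mo_pos).trans_le h.mo
        have hxor : sig a ^^^ σ.v .mt < 2 ^ (π .n + π .L) :=
          Nat.xor_lt_two_pow (by rw [hsig]; exact hcols.sig_lt le_rfl a) h.mt
        have hbk : (Var.F + 2 + (Var.sg ^^^ Var.mt) % Var.mo : Expr).eval π τ2 =
            σ.v .F + 2 + key := by
          simp only [eval_add, eval_var, eval_lit, eval_mod, eval_xor, a1', m2, f3, f4, f5]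
          rw [Nat.mod_eq_of_lt (by omega : σ.v .F + 2 < π .V),
            Nat.mod_eq_of_lt (by omega : sig a ^^^ σ.v .mt < π .V), ← hkey,
            Nat.mod_eq_of_lt (by omega : key < π .V), Nat.mod_eq_of_lt (by omega)]
        have hbl := hμ.bucket key hkey_lt
        have hmem2 : τ2.mem (σ.v .F + 2 + key) = μ (σ.v .F + 2 + key) := by
          rw [a3]; exact hτ.mem _ (by omega) (by omega)
        have hrun3 : (Cmd.block [.set .bk (Var.F + 2 + (Var.sg ^^^ Var.mt) % Var.mo),
            .set .p (.get Var.bk 0)]).run π r τ2 = (τ2.setv .bk (σ.v .F + 2 + key)).setv .p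
              (B'.filter fun b => xsum e (π .m) b % σ.v .mo = key).length := by
          simp only [run_block_cons, run_block_one, run_set, hbk]
          simp [m0, hmem2, hbl.1]
        rw [hrun3] at hbdd hargs ⊢
        have hpe : ((τ2.setv .bk (σ.v .F + 2 + key)).setv .p
              (B'.filter fun b => xsum e (π .m) b % σ.v .mo = key).length).v .p =
              (B'.filter fun b => xsum e (π .m) b % σ.v .mo = key).length := by simp
        have hbe : ((τ2.setv .bk (σ.v .F + 2 + key)).setv .p
              (B'.filter fun b => xsum e (π .m) b % σ.v .mo = key).length).v .bk =
              σ.v .F + 2 + key := by simp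
        have hae : ((τ2.setv .bk (σ.v .F + 2 + key)).setv .p
              (B'.filter fun b => xsum e (π .m) b % σ.v .mo = key).length).v .a = a := by
          simp [f7]
        have hke : ((τ2.setv .bk (σ.v .F + 2 + key)).setv .p
              (B'.filter fun b => xsum e (π .m) b % σ.v .mo = key).length).v .k = τ.v .k + 1 := by
          simp [f6]
        refine ⟨hbdd, hargs, a4.trans hτ.tossed, ?_, ?_, ?_, ?_, ?_⟩
        · intro i h1 h2
          rw [setv_mem, setv_mem, a3]; exact hτ.mem i h1 h2
        · rw [← hsig, ← hwt, hR', setv_mem, setv_mem, a3]; exact hlist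
        · rw [← hsig, ← hwt, hR', setv_mem, setv_mem, a3]; exact htable
        · rw [hpe, hbe, hae, hke, ← hsig, hd]
          congr 1
          exact reverse_map_eq _ (fun b => some (a ^^^ b)) (fun i => μ (σ.v .F + 2 + key) (i + 1))
            (by rw [hsig]; exact hbl.2)
        · rw [hpe, hbe, hae]
          refine fun _ => ⟨by omega, haltm, fun i hi => ?_⟩
          rw [hbl.2 i hi]
          exact hB' _ (List.mem_of_mem_filter (List.getElem_mem hi))
      · rw [if_neg (fun h => hc (hcond.1 h))] at hbdd hargs ⊢
        rw [if_neg hc] at hd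
        rw [run_skip] at hbdd hargs ⊢
        refine ⟨hbdd, hargs, a4.trans hτ.tossed, ?_, ?_, ?_, ?_, ?_⟩
        · intro i h1 h2
          rw [a3]; exact hτ.mem i h1 h2
        · rw [← hsig, ← hwt, hR', a3]; exact hlist
        · rw [← hsig, ← hwt, hR', a3]; exact htable
        · rw [f8, f6, ← hsig, hd]; simp
        · rw [f8]; exact fun h => absurd rfl h
    -- The first list is exhausted too, so no events are left and the state is stationary.
    · have hrun2 : pairBody.run π r τ = τ := by
        rw [hrun, run_ite]
        simp [hmA, hlA.1, hk]
      have hnil : E.drop j = [] := by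
        rw [hrest, List.drop_eq_nil_of_le (by omega)]; rfl
      have hjE : E.length ≤ j := by simpa using hnil
      rw [hrun2]
      refine ⟨hτ.bdd, hτ.args, hτ.tossed, hτ.mem, ?_, ?_, ?_, hτ.ptr⟩
      · rw [← hsig, ← hwt, List.take_of_length_le (by omega : E.length ≤ j + 1),
          ← List.take_of_length_le hjE]
        exact hlist
      · rw [← hsig, ← hwt, List.take_of_length_le (by omega : E.length ≤ j + 1),
          ← List.take_of_length_le hjE]
        exact htable
      · rw [← hsig, List.drop_eq_nil_of_le (by omega : E.length ≤ j + 1), hp,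
          List.drop_eq_nil_of_le (by omega : A.length ≤ τ.v .k)]
        rfl
  · obtain ⟨hbk, ha, hlt⟩ := hτ.ptr hp
    obtain ⟨q, hq⟩ : ∃ q, τ.v .p = q + 1 := Nat.exists_eq_succ_of_ne_zero hp
    set b := μ (τ.v .bk) (q + 1) with hb
    set y := τ.v .a ^^^ b with hy
    have hblt : b < 2 ^ π .m := hlt q (by omega)
    have hylt : y < 2 ^ π .m := Nat.xor_lt_two_pow ha hblt
    have hpV : q + 1 < π .V := by rw [← hq]; exact hτ.bdd.var _
    set τ1 := (τ.setv .y y).setv .p q with hτ1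
    have hrun : pairBody.run π r τ = insertC.run π r (analyze.run π r τ1) := by
      rw [pairBody, run_ite, if_pos (by simpa using hp)]
      have hmb : τ.mem (τ.v .bk) (q + 1) = b := by rw [hτ.mem _ (by omega) (by omega)]
      have hmy : (τ.v .a ^^^ b) % π .V = y := Nat.mod_eq_of_lt (by omega)
      have hmq : q % π .V = q := Nat.mod_eq_of_lt (by omega)
      simp only [run_block_cons, run_block_one, run_set, eval_xor, eval_var, eval_get, hq, hmb,
        hmy, eval_sub, eval_lit, m1, setv_v]
      rw [if_neg (by simp)]
      simp [hmq, hτ1]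
    have hb1 : τ1.Bdd π := (hτ.bdd.setv (by omega)).setv (by omega)
    obtain ⟨a1, a2, a3, a4⟩ := analyze_spec (r := r) (ω := ω) hS hb1 (e := e) hcols
    have af : ∀ {x}, x ≠ .sg → x ≠ .wt → x ≠ .z → x ≠ .i → (analyze.run π r τ1).v x = τ1.v x :=
      fun h1 h2 h3 h4 => analyze_frame h1 h2 h3 h4
    have hb2 := analyze.run_bdd (r := r) hS.ok hb1
    set τ2 := analyze.run π r τ1 with hτ2
    have f1 : τ2.v .y = y := by rw [af] <;> simp [hτ1]
    have f2 : τ2.v .F = σ.v .F := by rw [af] <;> simp [hτ1, hF]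
    have f3 : τ2.v .p = q := by rw [af] <;> simp [hτ1]
    have f4 : τ2.v .k = τ.v .k := by rw [af] <;> simp [hτ1]
    have f5 : τ2.v .a = τ.v .a := by rw [af] <;> simp [hτ1]
    have f6 : τ2.v .bk = τ.v .bk := by rw [af] <;> simp [hτ1]
    have hy1 : τ1.v .y = y := by simp [hτ1]
    have hI : InsertData π e ω τ2 R := {
      bdd := hb2
      cols := by rw [a3]; exact hcols
      F_ge := by omega
      F_lt := by omega
      list := by rw [a3, f2]; exact hlist
      table := by rw [a3, f2, ← hsig]; exact htable
      nodup := by rw [← hsig]; exact nodup_foldl_ins sig wt List.nodup_nil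
      length := by omega
      R_lt := hRlt
      sg := by rw [a1, f1, hy1]
      wt := by rw [a2, f1, hy1] }
    obtain ⟨i1, i2, i3, i4⟩ := insertC_spec (r := r) hS hI
    have hif : ∀ {x}, ¬ insertC.writes x → (insertC.run π r τ2).v x = τ2.v x :=
      fun hx => insertC.run_of_not_writes hx
    have g3 : (insertC.run π r τ2).v .p = q := by
      rw [hif (by simp [insertC, Cmd.writes, analyze, pushC]), f3]
    have g4 : (insertC.run π r τ2).v .k = τ.v .k := by
      rw [hif (by simp [insertC, Cmd.writes, analyze, pushC]), f4]
    have g5 : (insertC.run π r τ2).v .a = τ.v .a := by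
      rw [hif (by simp [insertC, Cmd.writes, analyze, pushC]), f5]
    have g6 : (insertC.run π r τ2).v .bk = τ.v .bk := by
      rw [hif (by simp [insertC, Cmd.writes, analyze, pushC]), f6]
    rw [hq, List.range_succ, List.reverse_append, List.reverse_singleton, List.singleton_append,
      List.map_cons, List.cons_append] at hrest
    obtain ⟨ht, hd⟩ := take_succ_eq hrest
    have hR' : (E.take (j + 1)).foldl (insOpt sig wt) [] = ins sig wt R y := by
      rw [ht, List.foldl_append]; rfl
    rw [f1, f2, ← hsig, ← hwt] at i1 i2
    rw [f2] at i3
    rw [hrun] at hbdd hargs ⊢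
    refine ⟨hbdd, hargs, i4.trans (a4.trans hτ.tossed), ?_, ?_, ?_, ?_, ?_⟩
    · intro i h1 h2
      rw [i3 i h1 h2, a3]; exact hτ.mem i h1 h2
    · rw [← hsig, ← hwt, hR']; exact i1
    · rw [← hsig, ← hwt, hR']; exact i2
    · rw [← hsig, hd, g3, g4, g5, g6]
    · rw [g3, g5, g6]
      exact fun _ => ⟨hbk, ha, fun i hi => hlt i (by omega)⟩

/-- The result of a merge. -/
structure MergeSpec (π : Par → ℕ) (σ τ : St) (R : List ℕ) : Prop where
  bdd : τ.Bdd π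
  tossed : τ.tossed = σ.tossed
  res : τ.v .res = σ.v .F
  F : τ.v .F = σ.v .F + π .S
  list : IsList τ.mem (σ.v .F) R
  low : ∀ i < σ.v .F, τ.mem i = σ.mem i
  fresh : ∀ i, τ.v .F ≤ i → ∀ j, τ.mem i j = 0

/-- Both phases run for exactly `bud` rounds, which produces the two truncations in `merge`. The
arrays used are never cleared: `F` advances by `S`, and the next merge finds fresh arrays. -/
theorem mergeC_spec (hS : Setting π) {A B : List ℕ} (h : MergeData π e ω σ A B) :
    MergeSpec π σ (mergeC.run π r σ) (merge (xsum e (π .m)) (wsum ω (π .m)) (π .bud)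
      (σ.v .mf) (σ.v .cf) (σ.v .mo) (σ.v .mt) A B) := by
  have hbig := hS.big
  have m0 : 0 % π .V = 0 := Nat.zero_mod _
  have hSS := hS.S
  have hFl := h.F_lt
  have hS2 : 2 ≤ π .S := hSS ▸ Nat.le_add_left _ _
  have hbdd := mergeC.run_bdd (r := r) hS.ok h.bdd
  have hrun : mergeC.run π r σ = (Cmd.block [.set .res Var.F, .set .F (Var.F + Par.S)]).run π r
      ((Cmd.rep .bud pairBody).run π r ((((Cmd.rep .bud bucketBody).run π r
        (σ.setv .k 0)).setv .k 0).setv .p 0)) := by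
    simp [mergeC, m0]
  have h1 := run_rep (π := π) (r := r) (k := .bud) (fun j τ => BucketInv π e σ B j τ)
    (p := bucketBody) (h.bucketInv hbig) (fun j _ τ hτ => bucketBody_spec hS h hτ)
  set τ1 := (Cmd.rep .bud bucketBody).run π r (σ.setv .k 0) with hτ1
  have hF1 : σ.v .F < σ.v .F + 2 := by omega
  have hmid : Mid π e ω σ τ1.mem A (B.take (π .bud)) := {
    lA := h.lA.congr (h1.low _ (by have := h.mA; omega))
    cols := h.cols.congr fun i hi => h1.low i (by have := h.F_ge; omega)
    bucket := h1.bucket }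
  have hz : ∀ i, i < σ.v .F + 2 → σ.v .F ≤ i → ∀ j, τ1.mem i j = 0 := fun i hi hi' j => by
    rw [h1.low i hi]; exact h.fresh i hi' j
  have h2 := run_rep (π := π) (r := r) (k := .bud) (σ := (τ1.setv .k 0).setv .p 0)
    (fun j τ => PairInv π e ω σ τ1.mem A (B.take (π .bud)) j τ)
    (p := pairBody) ?_ (fun j hj τ hτ => pairBody_spec hS h hmid hj hτ)
  · set τ2 := (Cmd.rep .bud pairBody).run π r ((τ1.setv .k 0).setv .p 0) with hτ2
    have hF2 : τ2.v .F = σ.v .F := h2.args _ (by simp)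
    have hrun2 : mergeC.run π r σ = (τ2.setv .res (σ.v .F)).setv .F (σ.v .F + π .S) := by
      rw [hrun]
      have e1 : π .S % π .V = π .S := Nat.mod_eq_of_lt (by omega)
      have e2 : (σ.v .F + π .S) % π .V = σ.v .F + π .S := Nat.mod_eq_of_lt (by omega)
      simp [hF2, e1, e2]
    have hF3 : (mergeC.run π r σ).v .F = σ.v .F + π .S := by rw [hrun2]; simp
    have hm3 : (mergeC.run π r σ).mem = τ2.mem := by rw [hrun2]; rfl
    refine ⟨hbdd, ?_, ?_, hF3, ?_, ?_, ?_⟩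
    · rw [hrun2]; exact h2.tossed
    · rw [hrun2]; simp
    · rw [hm3]; exact h2.list
    · intro i hi
      rw [hm3, h2.mem i (by omega) (by omega), h1.low i (by omega)]
    · intro i hi j
      have hi' : σ.v .F + π .S ≤ i := hF3 ▸ hi
      rw [hm3, h2.mem i (by omega) (by omega), h1.high i hi']
      exact h.fresh i (by omega) j
  · refine ⟨(h1.bdd.setv (by omega)).setv (by omega), ?_, h1.tossed, fun _ _ _ => rfl, ?_, ?_,
      ?_, ?_⟩
    · intro x hx
      rw [← h1.args x hx]
      simp only [List.mem_cons, List.not_mem_nil, or_false] at hx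
      rcases hx with rfl | rfl | rfl | rfl | rfl | rfl | rfl <;> simp
    · exact ⟨by simp [hz _ (by omega : σ.v .F < _) le_rfl], by simp⟩
    · intro s
      exact .inl ⟨hz _ (by omega) (by omega) s, by simp⟩
    · simp
    · simp

end RAM

namespace SplitSearch

/-! ### Random numbers, random trees and random hash functions -/

/-- The number whose `k` binary digits are the coins `off, …, off + k - 1`. -/
def draw (r : ℕ → Bool) (off : ℕ) : ℕ → ℕ
  | 0 => 0
  | k + 1 => 2 * draw r off k + if r (off + k) then 1 else 0

theorem draw_lt (r : ℕ → Bool) (off k : ℕ) : draw r off k < 2 ^ k := by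
  induction k with
  | zero => simp [draw]
  | succ k ih => simp only [draw, pow_succ]; split_ifs <;> omega

/-- The number of coins in a random tree. -/
def treeCoins (L : ℕ) : ℕ → ℕ
  | 0 => 0
  | d + 1 => L + 2 * treeCoins L d

def readTree (r : ℕ → Bool) (L : ℕ) : (off d : ℕ) → Tree L d
  | _, 0 => ()
  | off, d + 1 => (⟨draw r off L, draw_lt r off L⟩, readTree r L (off + L) d,
      readTree r L (off + L + treeCoins L d) d)

/-- Lists of length `k`. -/
def Pow (α : Type) : ℕ → Type
  | 0 => Unit
  | k + 1 => Pow α k × α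

def readHash (r : ℕ → Bool) (off n : ℕ) : (k : ℕ) → Pow (Fin (2 ^ n)) k
  | 0 => ()
  | k + 1 => (readHash r off n k, ⟨draw r (off + k * n) n, draw_lt _ _ _⟩)

/-- The parity of the number of ones among the lowest `n` bits. -/
def parity : ℕ → ℕ → ℕ
  | 0, _ => 0
  | n + 1, z => (parity n z + z / 2 ^ n) % 2

/-- Append the values of random linear functionals to a column. -/
def hash (n : ℕ) : (k : ℕ) → Pow (Fin (2 ^ n)) k → ℕ → ℕ
  | 0, _, z => z
  | k + 1, (vs, v), z => 2 * hash n k vs z + parity n (v &&& z)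

theorem hash_succ {n k : ℕ} (vs : Pow (Fin (2 ^ n)) (k + 1)) (z : ℕ) :
    hash n (k + 1) vs z = 2 * hash n k vs.1 z + parity n (vs.2 &&& z) := rfl

theorem parity_lt (n z : ℕ) : parity n z < 2 := by
  cases n with
  | zero => simp [parity]
  | succ n => exact Nat.mod_lt _ (by norm_num)

theorem hash_lt {n k z : ℕ} (vs : Pow (Fin (2 ^ n)) k) (hz : z < 2 ^ n) :
    hash n k vs z < 2 ^ (n + k) := by
  induction k with
  | zero => simpa [hash] using hz
  | succ k ih =>
    have := ih vs.1
    have h2 := parity_lt n (vs.2 &&& z)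
    rw [hash_succ, ← add_assoc, pow_succ]
    omega

/-- The moduli that define the hash values at the various depths. -/
def modu (n L w d : ℕ) : ℕ := if d < 4 then 2 ^ (2 * (w * 2 ^ d) + 7) else 2 ^ (n + L)

end SplitSearch

namespace RAM

open SplitSearch

variable {π : Par → ℕ} {r : ℕ → Bool} {σ : St} {e ω : ℕ → ℕ}

/-- Draw a random number with `k` digits. -/
def drawC (x : Var) (k : Par) : Cmd := .block
  [.set x 0, .rep k (.block [.flip .fl, .set x (2 * (x : Expr) + Var.fl)])]

theorem drawC_spec (hV : 1000 < π .V) {x : Var} (hx : x ≠ .fl) {k : Par}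
    (hk : 2 ^ π k ≤ π .V) :
    ((drawC x k).run π r σ).v x = draw r σ.tossed (π k) ∧
    ((drawC x k).run π r σ).mem = σ.mem ∧
    ((drawC x k).run π r σ).tossed = σ.tossed + π k := by
  have m0 : 0 % π .V = 0 := Nat.zero_mod _
  have m2 : 2 % π .V = 2 := Nat.mod_eq_of_lt (by omega)
  refine run_rep (π := π) (r := r) (k := k) (σ := σ.setv x (Expr.eval π σ 0)) (fun j τ =>
    τ.v x = draw r σ.tossed j ∧ τ.mem = σ.mem ∧ τ.tossed = σ.tossed + j)
    (p := .block [.flip .fl, .set x (2 * (x : Expr) + Var.fl)]) ?_ ?_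
  · simp [draw]
  · rintro j hj τ ⟨h1, h2, h3⟩
    have hd := draw_lt r σ.tossed (j + 1)
    have hpow : 2 ^ (j + 1) ≤ 2 ^ π k := Nat.pow_le_pow_right (by norm_num) hj
    simp only [draw] at hd
    have e1 : 2 * draw r σ.tossed j % π .V = 2 * draw r σ.tossed j :=
      Nat.mod_eq_of_lt (by omega)
    refine ⟨?_, h2, by simp [Cmd.run, h3]; omega⟩
    simp only [run_block_cons, run_block_one, Cmd.run, setv_v, eval_add, eval_mul, eval_lit,
      eval_var, m2, if_true, if_neg hx, h1, h3, draw, e1]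
    exact Nat.mod_eq_of_lt (by omega)

theorem drawC_frame {x y : Var} {k : Par} (h1 : y ≠ x) (h2 : y ≠ .fl) :
    ((drawC x k).run π r σ).v y = σ.v y :=
  Cmd.run_of_not_writes _ (by simp [drawC, Cmd.writes, h1, h2])

/-! ### The recursion -/

/-- The recursion is unrolled when the program is built, and the variables `c d`, `t d`, `A d` carry
the depth, so no stack is needed. A call at depth `d` expects its target in `t d`. -/
def nodeC : ℕ → Cmd
  | 0 => .set .res Var.base
  | d + 1 => .block [drawC (.c d) .L, .set (.t d) (Var.c d), nodeC d, .set (.A d) Var.res,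
      .set (.t d) ((Var.c d : Expr) ^^^ Var.t (d + 1)), nodeC d, .set .mA (Var.A d),
      .set .mB Var.res, .set .mf (Var.M d), .set .cf (Var.c d), .set .mo (Var.M (d + 1)),
      .set .mt (Var.t (d + 1)), mergeC]

/-- Variables of depth `d` and above are safe during a call at depth `d`; thus the random number,
the target and the first list survive the recursive calls. -/
theorem nodeC_writes {d : ℕ} : ∀ {x : Var}, (nodeC d).writes x →
    (∃ d' < d, x = .c d' ∨ x = .t d' ∨ x = .A d') ∨ x ∈ [Var.sg, .wt, .z, .i, .k, .p, .a, .bk,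
      .sl, .w1, .x, .y, .s, .mA, .mB, .mf, .cf, .mo, .mt, .res, .F, .fl] := by
  induction d with
  | zero => intro x h; simp only [nodeC, Cmd.writes] at h; simp [h]
  | succ d ih =>
    intro x h
    simp only [nodeC, writes_block_cons, writes_block_one, Cmd.writes, drawC, mergeC, bucketBody,
      pairBody, insertC, analyze, pushC, or_false] at h
    by_cases h1 : (nodeC d).writes x
    · rcases ih h1 with ⟨d', hd', h2⟩ | h2
      · exact .inl ⟨d', by omega, h2⟩
      · exact .inr h2
    · simp only [h1, false_or] at h
      by_cases h2 : x = .c d ∨ x = .t d ∨ x = .A d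
      · exact .inl ⟨d, by omega, h2⟩
      · right
        simp only [not_or] at h2
        simp only [h2, false_or] at h
        simp only [List.mem_cons, List.not_mem_nil, or_false]
        tauto

/-- The data of a call of `nodeC`. -/
structure NodeData (π : Par → ℕ) (e ω : ℕ → ℕ) (σ : St) (base : List ℕ) (d : ℕ) : Prop where
  bdd : σ.Bdd π
  cols : Cols π e ω σ.mem
  list : IsList σ.mem (σ.v .base) base
  base_lt : ∀ a ∈ base, a < 2 ^ π .m
  base_id : σ.v .base < σ.v .F
  F_ge : π .N + 4 ≤ σ.v .F
  F_lt : σ.v .F + 2 ^ d * π .S < π .V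
  fresh : ∀ i, σ.v .F ≤ i → ∀ j, σ.mem i j = 0
  M_pos : ∀ d' ≤ d, 0 < σ.v (.M d')
  M_le : ∀ d' ≤ d, σ.v (.M d') ≤ 2 ^ (π .n + π .L)
  t : σ.v (.t d) < 2 ^ (π .n + π .L)

/-- The result of a call of `nodeC`. -/
structure NodeSpec (π : Par → ℕ) (σ τ : St) (d : ℕ) (R : List ℕ) : Prop where
  bdd : τ.Bdd π
  tossed : τ.tossed = σ.tossed + treeCoins (π .L) d
  res : τ.v .res < τ.v .F
  F_le : τ.v .F ≤ σ.v .F + (2 ^ d - 1) * π .S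
  F_ge : σ.v .F ≤ τ.v .F
  list : IsList τ.mem (τ.v .res) R
  R_lt : ∀ a ∈ R, a < 2 ^ π .m
  low : ∀ i < σ.v .F, τ.mem i = σ.mem i
  fresh : ∀ i, τ.v .F ≤ i → ∀ j, τ.mem i j = 0

theorem NodeData.of_spec {σ τ : St} {base : List ℕ} {d : ℕ} {R : List ℕ}
    (hσ : NodeData π e ω σ base (d + 1)) (h : NodeSpec π σ τ d R)
    (hb : τ.v .base = σ.v .base) (hM : ∀ d, τ.v (.M d) = σ.v (.M d))
    (ht : τ.v (.t d) < 2 ^ (π .n + π .L)) : NodeData π e ω τ base d where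
  bdd := h.bdd
  cols := hσ.cols.congr fun i hi => h.low i (by have := hσ.F_ge; omega)
  list := by
    rw [hb]; exact hσ.list.congr (h.low _ hσ.base_id)
  base_lt := hσ.base_lt
  base_id := by rw [hb]; exact hσ.base_id.trans_le h.F_ge
  F_ge := hσ.F_ge.trans h.F_ge
  F_lt := by
    have h1 := hσ.F_lt
    have h2 := h.F_le
    have h3 : (2 ^ d - 1) * π .S + π .S = 2 ^ d * π .S := by
      rw [← Nat.succ_mul]; congr 1; have := Nat.one_le_two_pow (n := d); omega
    rw [pow_succ, mul_comm _ 2, mul_assoc] at h1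
    omega
  fresh := h.fresh
  M_pos d' hd' := by rw [hM]; exact hσ.M_pos d' (by omega)
  M_le d' hd' := by rw [hM]; exact hσ.M_le d' (by omega)
  t := ht

theorem node_lt {sig wt : ℕ → ℕ} {bud m : ℕ} {M : ℕ → ℕ} {base : List ℕ} {L : ℕ}
    (hb : ∀ a ∈ base, a < 2 ^ m) : ∀ {d : ℕ} {T : Tree L d} {t : ℕ},
    ∀ a ∈ node sig wt bud M base d T t, a < 2 ^ m := by
  intro d
  induction d with
  | zero => exact fun a ha => hb a ha
  | succ d ih =>
    rintro ⟨c, l, r⟩ t y hy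
    obtain ⟨a, ha, b, hb, _, _, rfl⟩ := mem_merge _ _ hy
    exact Nat.xor_lt_two_pow (ih a ha) (ih b hb)

theorem NodeData.update {base : List ℕ} {d : ℕ} (h : NodeData π e ω σ base d) {d' : ℕ} {τ : St}
    (hd : d' ≤ d) (hb : τ.Bdd π) (hm : τ.mem = σ.mem) (h1 : τ.v .base = σ.v .base)
    (h2 : τ.v .F = σ.v .F) (h3 : ∀ d, τ.v (.M d) = σ.v (.M d))
    (ht : τ.v (.t d') < 2 ^ (π .n + π .L)) : NodeData π e ω τ base d' where
  bdd := hb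
  cols := by rw [hm]; exact h.cols
  list := by rw [hm, h1]; exact h.list
  base_lt := h.base_lt
  base_id := by rw [h1, h2]; exact h.base_id
  F_ge := by rw [h2]; exact h.F_ge
  F_lt := by
    rw [h2]
    exact lt_of_le_of_lt (Nat.add_le_add_left (Nat.mul_le_mul_right _ (Nat.pow_le_pow_right (by norm_num) hd)) _) h.F_lt
  fresh := by rw [hm, h2]; exact h.fresh
  M_pos d₁ hd₁ := by rw [h3]; exact h.M_pos d₁ (by omega)
  M_le d₁ hd₁ := by rw [h3]; exact h.M_le d₁ (by omega)
  t := ht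

/-- The recursive calls consume coins in the order in which `readTree` reads them: the node first,
then the left and the right subtree. A tree of depth `d` performs `2 ^ d - 1` merges, which bounds
the arrays used. -/
theorem nodeC_spec (hS : Setting π) {base : List ℕ} : ∀ {d : ℕ} {σ : St},
    NodeData π e ω σ base d → NodeSpec π σ ((nodeC d).run π r σ) d
      (node (xsum e (π .m)) (wsum ω (π .m)) (π .bud) (fun d => σ.v (.M d)) base d
        (readTree r (π .L) σ.tossed d) (σ.v (.t d))) := by
  have hbig := hS.big
  have hsig := hS.sig
  have hLp : 2 ^ π .L ≤ 2 ^ (π .n + π .L) := Nat.pow_le_pow_right (by norm_num) (by omega)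
  intro d
  induction d with
  | zero =>
    intro σ h
    exact ⟨Cmd.run_bdd hS.ok _ h.bdd, rfl, by simpa [nodeC] using h.base_id, by simp [nodeC],
      by simp [nodeC], by
        have : ((nodeC 0).run π r σ).v .res = σ.v .base := by simp [nodeC]
        rw [this]; exact h.list, h.base_lt, fun _ _ => rfl,
      by simpa [nodeC] using h.fresh⟩
  | succ d ih =>
    intro σ h
    -- the random number
    obtain ⟨d1, d2, d3⟩ := drawC_spec (π := π) (r := r) (σ := σ) hbig (x := .c d) (k := .L)
      (by simp) (by omega)
    have df : ∀ {x}, x ≠ .c d → x ≠ .fl → ((drawC (.c d) .L).run π r σ).v x = σ.v x :=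
      fun h1 h2 => drawC_frame h1 h2
    have hb1 := (drawC (.c d) .L).run_bdd (r := r) hS.ok h.bdd
    set σ1 := (drawC (.c d) .L).run π r σ with hσ1
    set c := draw r σ.tossed (π .L) with hc
    have hcL : c < 2 ^ π .L := draw_lt _ _ _
    set σ2 := σ1.setv (.t d) c with hσ2
    -- the first half
    have hN2 : NodeData π e ω σ2 base d := h.update (Nat.le_succ d) (hb1.setv (by omega)) d2
      (by simp [hσ2, df]) (by simp [hσ2, df]) (fun d => by simp [hσ2, df])
      (by simp only [hσ2, setv_v, if_true]; omega)
    have h3 := ih hN2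
    set σ3 := (nodeC d).run π r σ2 with hσ3
    have nf : ∀ {x : Var} {τ : St}, x ∉ [Var.sg, .wt, .z, .i, .k, .p, .a, .bk,
      .sl, .w1, .x, .y, .s, .mA, .mB, .mf, .cf, .mo, .mt, .res, .F, .fl] →
      (∀ d' < d, x ≠ .c d' ∧ x ≠ .t d' ∧ x ≠ .A d') → ((nodeC d).run π r τ).v x = τ.v x := by
      intro x τ h1 h2
      refine Cmd.run_of_not_writes _ fun hw => ?_
      rcases nodeC_writes hw with ⟨d', hd', h4⟩ | h4
      · have := h2 d' hd'; tauto
      · exact h1 h4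
    have hbase3 : σ3.v .base = σ.v .base := by
      rw [hσ3, nf (by simp) (by simp)]; simp [hσ2, df]
    have hM3 : ∀ d, σ3.v (.M d) = σ.v (.M d) := fun d => by
      rw [hσ3, nf (by simp) (by simp)]; simp [hσ2, df]
    have hc3 : σ3.v (.c d) = c := by
      rw [hσ3, nf (by simp) (by simp; omega)]; simp [hσ2, d1]
    have ht3 : σ3.v (.t (d + 1)) = σ.v (.t (d + 1)) := by
      rw [hσ3, nf (by simp) (by simp; omega)]; simp [hσ2, df]
    have hF2 : σ2.v .F = σ.v .F := by simp [hσ2, df]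
    set u := c ^^^ σ.v (.t (d + 1)) with hu
    have hult : u < 2 ^ (π .n + π .L) := Nat.xor_lt_two_pow (by omega) h.t
    set σ4 := (σ3.setv (.A d) (σ3.v .res)).setv (.t d) u with hσ4
    -- the second half
    have h2' : NodeData π e ω σ2 base (d + 1) :=
      h.update le_rfl (hb1.setv (by omega)) d2 (by simp [hσ2, df]) (by simp [hσ2, df])
        (fun d => by simp [hσ2, df]) (by simp [hσ2, df]; exact h.t)
    have hN4 : NodeData π e ω σ4 base d := by
      have hF4 : σ4.v .F = σ3.v .F := by simp [hσ4]
      exact h2'.of_spec (τ := σ4) ⟨(h3.bdd.setv (h3.bdd.var _)).setv (by omega), h3.tossed,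
          by simpa [hσ4] using h3.res, by rw [hF4]; exact h3.F_le, by rw [hF4]; exact h3.F_ge,
          by simpa [hσ4] using h3.list, h3.R_lt, h3.low, by rw [hF4]; exact h3.fresh⟩
          (by simp [hσ4, hbase3, hσ2, df]) (fun d => by simp [hσ4, hM3, hσ2, df])
          (by simp [hσ4, hult])
    have h5 := ih hN4
    set σ5 := (nodeC d).run π r σ4 with hσ5
    have hM5 : ∀ d, σ5.v (.M d) = σ.v (.M d) := fun d => by
      rw [hσ5, nf (by simp) (by simp)]; simp [hσ4, hM3]
    have hc5 : σ5.v (.c d) = c := by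
      rw [hσ5, nf (by simp) (by simp; omega)]; simp [hσ4, hc3]
    have ht5 : σ5.v (.t (d + 1)) = σ.v (.t (d + 1)) := by
      rw [hσ5, nf (by simp) (by simp; omega)]; simp [hσ4, ht3]
    have hA5 : σ5.v (.A d) = σ3.v .res := by
      rw [hσ5, nf (by simp) (by simp; omega)]; simp [hσ4]
    -- the merge
    obtain ⟨σ6, hσ6⟩ : ∃ τ, τ = (((((σ5.setv .mA (σ3.v .res)).setv .mB (σ5.v .res)).setv .mf
      (σ.v (.M d))).setv .cf c).setv .mo (σ.v (.M (d + 1)))).setv .mt (σ.v (.t (d + 1))) := ⟨_, rfl⟩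
    have hrun : (nodeC (d + 1)).run π r σ = mergeC.run π r σ6 := by
      have hmu : (c ^^^ σ.v (.t (d + 1))) % π .V = u := Nat.mod_eq_of_lt (by omega)
      simp only [nodeC, run_block_cons, run_block_one, run_set, eval_var, ← hσ1, d1]
      rw [← hσ2, ← hσ3]
      simp only [setv_v, eval_xor, eval_var, reduceCtorEq, if_false, hc3, ht3, hmu]
      rw [← hσ4, ← hσ5]
      simp only [hA5, hM5, hc5, ht5, hσ6]
    have hF4 : σ4.v .F = σ3.v .F := by simp [hσ4]
    have hF34 := h3.F_ge
    have hF5 := h5.F_ge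
    have hF6 : σ6.v .F = σ5.v .F := by simp [hσ6]
    have hm6 : σ6.mem = σ5.mem := by simp [hσ6]
    have hpow : (2 ^ d - 1) + 1 = 2 ^ d := by have := Nat.one_le_two_pow (n := d); omega
    have hFle : σ5.v .F + π .S ≤ σ.v .F + (2 ^ (d + 1) - 1) * π .S := by
      have h6 := h3.F_le
      have h7 := h5.F_le
      have h8 : (2 ^ (d + 1) - 1) = (2 ^ d - 1) + (2 ^ d - 1) + 1 := by rw [pow_succ]; omega
      rw [h8, add_mul, add_mul, one_mul]
      omega
    have hMD : MergeData π e ω σ6 (node (xsum e (π .m)) (wsum ω (π .m)) (π .bud)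
        (fun d => σ2.v (.M d)) base d (readTree r (π .L) σ2.tossed d) (σ2.v (.t d)))
        (node (xsum e (π .m)) (wsum ω (π .m)) (π .bud)
        (fun d => σ4.v (.M d)) base d (readTree r (π .L) σ4.tossed d) (σ4.v (.t d))) := {
      bdd := by
        rw [hσ6]
        exact (((((h5.bdd.setv (h3.bdd.var _)).setv (h5.bdd.var _)).setv (h.bdd.var _)).setv
          (by omega)).setv (h.bdd.var _)).setv (h.bdd.var _)
      cols := by
        rw [hm6]; exact hN4.cols.congr fun i hi => h5.low i (by have := h.F_ge; omega)
      lA := by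
        have : σ6.v .mA = σ3.v .res := by simp [hσ6]
        rw [hm6, this]
        exact h3.list.congr (h5.low _ (by have := h3.res; omega))
      lB := by
        have : σ6.v .mB = σ5.v .res := by simp [hσ6]
        rw [hm6, this]
        exact h5.list
      A_lt := h3.R_lt
      B_lt := h5.R_lt
      mA := by
        have : σ6.v .mA = σ3.v .res := by simp [hσ6]
        have := h3.res; omega
      mB := by
        have : σ6.v .mB = σ5.v .res := by simp [hσ6]
        have := h5.res; omega
      F_ge := by have := h.F_ge; omega
      F_lt := by
        have h1 := h.F_lt
        have h2 : (2 ^ (d + 1) - 1) * π .S ≤ 2 ^ (d + 1) * π .S :=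
          Nat.mul_le_mul_right _ (Nat.sub_le _ _)
        omega
      fresh := by rw [hm6, hF6]; exact h5.fresh
      mo_pos := by simp only [hσ6, setv_v]; simpa using h.M_pos _ le_rfl
      mo := by simp only [hσ6, setv_v]; simpa using h.M_le _ le_rfl
      mt := by simp only [hσ6, setv_v]; simpa using h.t }
    have hfin := mergeC_spec (r := r) hS hMD
    rw [← hrun] at hfin
    have e1 : σ6.v .mf = σ.v (.M d) := by simp [hσ6]
    have e2 : σ6.v .cf = c := by simp [hσ6]
    have e3 : σ6.v .mo = σ.v (.M (d + 1)) := by simp [hσ6]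
    have e4 : σ6.v .mt = σ.v (.t (d + 1)) := by simp [hσ6]
    have t2 : σ2.tossed = σ.tossed + π .L := d3
    have t4 : σ4.tossed = σ.tossed + π .L + treeCoins (π .L) d := by
      have : σ4.tossed = σ3.tossed := rfl
      rw [this, h3.tossed, t2]
    have g2 : (fun d => σ2.v (.M d)) = fun d => σ.v (.M d) := by funext d; simp [hσ2, df]
    have g4 : (fun d => σ4.v (.M d)) = fun d => σ.v (.M d) := by funext d; simp [hσ4, hM3]
    have k2 : σ2.v (.t d) = c := by simp [hσ2]
    have k4 : σ4.v (.t d) = u := by simp [hσ4]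
    have hlist := hfin.list
    rw [e1, e2, e3, e4, t2, t4, g2, g4, k2, k4] at hlist
    refine ⟨hfin.bdd, ?_, ?_, ?_, ?_, ?_, ?_, ?_, hfin.fresh⟩
    · rw [hfin.tossed]
      have : σ6.tossed = σ5.tossed := by rw [hσ6]; rfl
      rw [this, h5.tossed, t4, treeCoins]
      omega
    · rw [hfin.res, hfin.F, hS.S]
      have := Nat.le_add_left 2 (2 ^ (π .n + π .L))
      generalize 2 ^ (π .n + π .L) + 2 = X at *
      omega
    · rw [hfin.F, hF6]; exact hFle
    · rw [hfin.F, hF6]; omega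
    · rw [hfin.res]; exact hlist
    · intro a ha
      exact node_lt (m := π .m) (sig := xsum e (π .m)) (wt := wsum ω (π .m)) (bud := π .bud)
        (M := fun d => σ.v (.M d)) h.base_lt a ha
    · intro i hi
      rw [hfin.low i (by omega), hm6, h5.low i (by omega)]
      have : σ4.mem = σ3.mem := rfl
      rw [this, h3.low i (by omega)]
      exact congrFun d2 i

end RAM

namespace RAM

open SplitSearch

variable {π : Par → ℕ} {r : ℕ → Bool} {σ : St} {e ω : ℕ → ℕ}

/-! ### Hashing the columns -/

/-- The parity of the bits of `z`. -/
def parityC : Cmd := .block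
  [.set .p 0, .rep .n (.block [.set .p ((Var.p + Var.z) % 2), .set .z (Var.z / 2)])]

theorem parityC_spec (hS : Setting π) (hz : σ.v .z < 2 ^ π .n) :
    (parityC.run π r σ).v .p = parity (π .n) (σ.v .z) ∧
    (parityC.run π r σ).mem = σ.mem ∧ (parityC.run π r σ).tossed = σ.tossed := by
  have hbig := hS.big
  have hsig := hS.sig
  have hn : 2 ^ π .n ≤ 2 ^ (π .n + π .L) := Nat.pow_le_pow_right (by norm_num) (by omega)
  have m2 : 2 % π .V = 2 := Nat.mod_eq_of_lt (by omega)
  have key := run_rep (π := π) (r := r) (k := .n) (σ := σ.setv .p (Expr.eval π σ 0)) (fun j τ =>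
    τ.v .p = parity j (σ.v .z) ∧ τ.v .z = σ.v .z / 2 ^ j ∧ τ.mem = σ.mem ∧ τ.tossed = σ.tossed)
    (p := .block [.set .p ((Var.p + Var.z) % 2), .set .z (Var.z / 2)]) ?_ ?_
  · exact ⟨key.1, key.2.2⟩
  · simp [parity]
  · rintro j hj τ ⟨h1, h2, h3, h4⟩
    have hp := parity_lt j (σ.v .z)
    have hd := Nat.div_le_self (σ.v .z) (2 ^ j)
    have e1 : (parity j (σ.v .z) + σ.v .z / 2 ^ j) % π .V = parity j (σ.v .z) + σ.v .z / 2 ^ j :=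
      Nat.mod_eq_of_lt (by omega)
    have e2 : (parity j (σ.v .z) + σ.v .z / 2 ^ j) % 2 % π .V =
      (parity j (σ.v .z) + σ.v .z / 2 ^ j) % 2 := Nat.mod_eq_of_lt (by omega)
    have e3 : σ.v .z / 2 ^ j / 2 % π .V = σ.v .z / 2 ^ (j + 1) := by
      rw [pow_succ, ← Nat.div_div_eq_div_mul, Nat.mod_eq_of_lt (by omega)]
    simp [h1, h2, h3, h4, m2, parity, e1, e2, e3]

/-- Append the value of the linear functional `v` to every extended column. -/
def appendC : Cmd := .block
  [.set .i 0, .rep .m1 (.block [.set .z (Var.v &&& .get idCol Var.i), parityC,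
    .put idExt Var.i (2 * .get idExt Var.i + Var.p), .set .i (Var.i + 1)])]

/-- Extend the columns by the values of random linear functionals. -/
def hashC : Cmd := .block
  [.set .i 0, .rep .m1 (.block [.put idExt Var.i (.get idCol Var.i), .set .i (Var.i + 1)]),
   .rep .L (.block [drawC .v .n, appendC])]

theorem eval_ids (hS : Setting π) : idCol.eval π σ = π .N ∧ idWt.eval π σ = π .N + 1 ∧
    idExt.eval π σ = π .N + 2 ∧ idSing.eval π σ = π .N + 3 := by
  have hN := hS.N
  have h1 : 1 % π .V = 1 := Nat.mod_eq_of_lt (by omega)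
  have h2 : 2 % π .V = 2 := Nat.mod_eq_of_lt (by omega)
  have h3 : 3 % π .V = 3 := Nat.mod_eq_of_lt (by omega)
  have h4 : π .N % π .V = π .N := Nat.mod_eq_of_lt (by omega)
  have h5 : (π .N + 1) % π .V = π .N + 1 := Nat.mod_eq_of_lt (by omega)
  have h6 : (π .N + 2) % π .V = π .N + 2 := Nat.mod_eq_of_lt (by omega)
  have h7 : (π .N + 3) % π .V = π .N + 3 := Nat.mod_eq_of_lt (by omega)
  simp [idCol, idWt, idExt, idSing, h1, h2, h3, h4, h5, h6, h7]

theorem appendC_spec (hS : Setting π) {col ext : ℕ → ℕ}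
    (hc : ∀ i ≤ π .m, σ.mem (π .N) i = col i) (hcl : ∀ i ≤ π .m, col i < 2 ^ π .n)
    (he : ∀ i ≤ π .m, σ.mem (π .N + 2) i = ext i)
    (hel : ∀ i ≤ π .m, 2 * ext i + 2 ≤ π .V) :
    (∀ i ≤ π .m, (appendC.run π r σ).mem (π .N + 2) i =
      2 * ext i + parity (π .n) (σ.v .v &&& col i)) ∧
    (∀ i, i ≠ π .N + 2 → (appendC.run π r σ).mem i = σ.mem i) ∧
    (appendC.run π r σ).tossed = σ.tossed := by
  have hbig := hS.big
  have hsig := hS.sig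
  have hm := hS.m_lt
  have hn : 2 ^ π .n ≤ 2 ^ (π .n + π .L) := Nat.pow_le_pow_right (by norm_num) (by omega)
  have m1 : 1 % π .V = 1 := Nat.mod_eq_of_lt (by omega)
  have m2 : 2 % π .V = 2 := Nat.mod_eq_of_lt (by omega)
  have key := run_rep (π := π) (r := r) (k := .m1) (σ := σ.setv .i (Expr.eval π σ 0)) (fun j τ =>
    τ.v .i = j ∧ τ.v .v = σ.v .v ∧ (∀ i ≤ π .m, τ.mem (π .N + 2) i =
      if i < j then 2 * ext i + parity (π .n) (σ.v .v &&& col i) else ext i) ∧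
    (∀ i, i ≠ π .N + 2 → τ.mem i = σ.mem i) ∧ τ.tossed = σ.tossed)
    (p := .block [.set .z (Var.v &&& .get idCol Var.i), parityC,
      .put idExt Var.i (2 * .get idExt Var.i + Var.p), .set .i (Var.i + 1)]) ?_ ?_
  · refine ⟨fun i hi => ?_, key.2.2.2⟩
    have h1 := key.2.2.1 i hi
    rw [if_pos (by rw [hS.m1]; omega)] at h1
    exact h1
  · simp only [eval_lit, setv_v, setv_mem, setv_tossed]
    refine ⟨by simp, by simp, fun i hi => by simp [he i hi], by simp⟩
  · rintro j hj τ ⟨h1, h2, h3, h4, h5⟩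
    rw [hS.m1] at hj
    have hjm : j ≤ π .m := by omega
    have hcj : τ.mem (π .N) j = col j := by rw [h4 _ (by omega)]; exact hc j hjm
    have hz : σ.v .v &&& col j < 2 ^ π .n := lt_of_le_of_lt Nat.and_le_right (hcl j hjm)
    set τ1 := τ.setv .z (σ.v .v &&& col j) with hτ1
    have hset : (Cmd.set .z (Var.v &&& .get idCol Var.i)).run π r τ = τ1 := by
      simp only [run_set, eval_and, eval_var, eval_get, (eval_ids hS).1, h1, h2, hcj,
        Nat.mod_eq_of_lt (by omega : σ.v .v &&& col j < π .V), hτ1]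
    have hz1 : τ1.v .z = σ.v .v &&& col j := by simp [hτ1]
    obtain ⟨p1, p2, p3⟩ := parityC_spec (r := r) hS (σ := τ1) (by rw [hz1]; exact hz)
    have pf : ∀ {x}, x ≠ .p → x ≠ .z → (parityC.run π r τ1).v x = τ1.v x := fun h1 h2 =>
      Cmd.run_of_not_writes _ (by simp [parityC, Cmd.writes, h1, h2])
    rw [hz1] at p1
    have hi2 : (parityC.run π r τ1).v .i = j := by rw [pf] <;> simp [hτ1, h1]
    have hv2 : (parityC.run π r τ1).v .v = σ.v .v := by rw [pf] <;> simp [hτ1, h2]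
    simp only [run_block_cons, run_block_one, hset]
    set τ2 := parityC.run π r τ1 with hτ2
    have hmem2 : τ2.mem = τ.mem := p2
    have hpl := parity_lt (π .n) (σ.v .v &&& col j)
    have hej := hel j hjm
    have hext : τ.mem (π .N + 2) j = ext j := by rw [h3 j hjm, if_neg (by omega)]
    simp only [run_put, run_set, eval_add, eval_mul, eval_lit, eval_var, eval_get,
      (eval_ids hS).2.2.1, hi2, m1, m2, hmem2, hext, p1, setm_v,
      Nat.mod_eq_of_lt (by omega : 2 * ext j < π .V),
      Nat.mod_eq_of_lt (by omega : 2 * ext j + parity (π .n) (σ.v .v &&& col j) < π .V),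
      Nat.mod_eq_of_lt (by omega : j + 1 < π .V)]
    refine ⟨by simp, by simp [hv2], fun i hi => ?_, fun i hi => ?_, ?_⟩
    · rw [setv_mem, setm_mem, hmem2]
      by_cases hij : i = j
      · subst hij; simp
      · rw [if_neg (by simp [hij]), h3 i hi]
        by_cases h' : i < j
        · rw [if_pos h', if_pos (by omega)]
        · rw [if_neg h', if_neg (by omega)]
    · rw [setv_mem, setm_mem_of_ne hi, hmem2, h4 i hi]
    · rw [setv_tossed, setm_tossed, p3]; exact h5

/-- Each round draws one functional and appends its value to all `m + 1` columns; the target is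
hashed along with the others as column `m`. -/
theorem hashC_spec (hS : Setting π) {col : ℕ → ℕ}
    (hc : ∀ i ≤ π .m, σ.mem (π .N) i = col i) (hcl : ∀ i ≤ π .m, col i < 2 ^ π .n) :
    (∀ i ≤ π .m, (hashC.run π r σ).mem (π .N + 2) i =
      hash (π .n) (π .L) (readHash r σ.tossed (π .n) (π .L)) (col i)) ∧
    (∀ i, i ≠ π .N + 2 → (hashC.run π r σ).mem i = σ.mem i) ∧
    (hashC.run π r σ).tossed = σ.tossed + π .L * π .n := by
  have hbig := hS.big
  have hsig := hS.sig
  have hm := hS.m_lt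
  have hn : 2 ^ π .n ≤ 2 ^ (π .n + π .L) := Nat.pow_le_pow_right (by norm_num) (by omega)
  have m1 : 1 % π .V = 1 := Nat.mod_eq_of_lt (by omega)
  have key := run_rep (π := π) (r := r) (k := .m1) (σ := σ.setv .i (Expr.eval π σ 0)) (fun j τ =>
    τ.v .i = j ∧ (∀ i < j, τ.mem (π .N + 2) i = col i) ∧
    (∀ i, i ≠ π .N + 2 → τ.mem i = σ.mem i) ∧ τ.tossed = σ.tossed)
    (p := .block [.put idExt Var.i (.get idCol Var.i), .set .i (Var.i + 1)]) ?_ ?_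
  · set σ1 := (Cmd.rep .m1 (.block [.put idExt Var.i (.get idCol Var.i),
      .set .i (Var.i + 1)])).run π r (σ.setv .i (Expr.eval π σ 0)) with hσ1
    have hrun : hashC.run π r σ = (Cmd.rep .L (.block [drawC .v .n, appendC])).run π r σ1 := rfl
    rw [hrun]
    obtain ⟨_, k2, k3, k4⟩ := key
    rw [hS.m1] at k2
    refine run_rep (π := π) (r := r) (k := .L) (σ := σ1) (fun j τ =>
      (∀ i ≤ π .m, τ.mem (π .N + 2) i =
        hash (π .n) j (readHash r σ.tossed (π .n) j) (col i)) ∧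
      (∀ i, i ≠ π .N + 2 → τ.mem i = σ.mem i) ∧ τ.tossed = σ.tossed + j * π .n)
      (p := .block [drawC .v .n, appendC]) ?_ ?_
    · exact ⟨fun i hi => k2 i (by omega), k3, by simp [k4]⟩
    · rintro j hj τ ⟨h1, h2, h3⟩
      obtain ⟨d1, d2, d3⟩ := drawC_spec (π := π) (r := r) (σ := τ) hbig (x := .v) (k := .n)
        (by simp) (by omega)
      rw [run_block_cons, run_block_one]
      set τ1 := (drawC .v .n).run π r τ with hτ1
      obtain ⟨a1, a2, a3⟩ := appendC_spec (r := r) (σ := τ1) hS (col := col)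
        (ext := fun i => hash (π .n) j (readHash r σ.tossed (π .n) j) (col i))
        (fun i hi => by rw [d2, h2 _ (by omega)]; exact hc i hi) hcl
        (fun i hi => by rw [d2]; exact h1 i hi) (fun i hi => by
          have := hash_lt (readHash r σ.tossed (π .n) j) (hcl i hi)
          have h4 : 2 ^ (π .n + j) ≤ 2 ^ (π .n + π .L) :=
            Nat.pow_le_pow_right (by norm_num) (by omega)
          omega)
      refine ⟨fun i hi => ?_, fun i hi => ?_, ?_⟩
      · rw [a1 i hi, d1, h3]
        rfl
      · rw [a2 i hi, d2, h2 i hi]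
      · rw [a3, d3, h3, Nat.succ_mul]; omega
  · simp
  · rintro j hj τ ⟨h1, h2, h3, h4⟩
    rw [hS.m1] at hj
    have hcj : τ.mem (π .N) j = col j := by rw [h3 _ (by omega)]; exact hc j (by omega)
    simp only [run_block_cons, run_block_one, run_put, run_set, eval_add, eval_lit, eval_var,
      eval_get, (eval_ids hS).2.2.1, (eval_ids hS).1, h1, hcj, m1, setm_v,
      Nat.mod_eq_of_lt (by omega : j + 1 < π .V)]
    refine ⟨by simp, fun i hi => ?_, fun i hi => ?_, h4⟩
    · rw [setv_mem, setm_mem]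
      by_cases hij : i = j
      · subst hij; simp
      · rw [if_neg (by simp [hij]), h2 i (by omega)]
    · rw [setv_mem, setm_mem_of_ne hi, h3 i hi]

/-! ### The lightest representatives of small sets -/

/-- Only parameters can bound a loop, so there are always `nw` rounds and those from `w` on are
idle. The moduli 1 impose no condition: every list element is combined with every singleton and with
the empty set. -/
def baseStep : Cmd := .block [.ite (.op .lt Var.j Var.w) (.block
    [.set .mA Var.base, .set .mB idSing, .set .mf 1, .set .cf 0, .set .mo 1, .set .mt 0, mergeC,
     .set .base Var.res]) .skip, .set .j (Var.j + 1)]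

def baseC : Cmd := .block
  [.put Var.F 0 1, .set .base Var.F, .set .F (Var.F + Par.S), .set .j 0, .rep .nw baseStep]

/-- The list of the singletons and of the empty set. -/
def singles (m : ℕ) : List ℕ := 0 :: (List.range m).map (2 ^ ·)

theorem singles_lt {m a : ℕ} (h : a ∈ singles m) : a < 2 ^ m := by
  rcases List.mem_cons.1 h with rfl | h
  · positivity
  · obtain ⟨i, hi, rfl⟩ := List.mem_map.1 h
    exact Nat.pow_lt_pow_right (by norm_num) (List.mem_range.1 hi)

theorem baseList_lt {sig wt : ℕ → ℕ} {bud m : ℕ} : ∀ {k a : ℕ},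
    a ∈ baseList sig wt bud m k → a < 2 ^ m := by
  intro k
  induction k with
  | zero => intro a h; rw [List.mem_singleton.1 h]; positivity
  | succ k ih =>
    intro y hy
    obtain ⟨a, ha, b, hb, _, _, rfl⟩ := mem_merge _ _ hy
    exact Nat.xor_lt_two_pow (ih ha) (singles_lt hb)

/-- The state during the construction of the base list. -/
structure BaseInv (π : Par → ℕ) (e ω : ℕ → ℕ) (σ : St) (j : ℕ) (τ : St) : Prop where
  bdd : τ.Bdd π
  tossed : τ.tossed = σ.tossed
  j_eq : τ.v .j = j
  w_eq : τ.v .w = σ.v .w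
  list : IsList τ.mem (τ.v .base) (baseList (xsum e (π .m)) (wsum ω (π .m)) (π .bud) (π .m)
    (min j (σ.v .w)))
  base_lt : τ.v .base < τ.v .F
  F_ge : σ.v .F ≤ τ.v .F
  F_le : τ.v .F ≤ σ.v .F + (j + 1) * π .S
  low : ∀ i < σ.v .F, τ.mem i = σ.mem i
  fresh : ∀ i, τ.v .F ≤ i → ∀ j, τ.mem i j = 0

theorem baseStep_spec (hS : Setting π) (hC : Cols π e ω σ.mem)
    (hs : IsList σ.mem (π .N + 3) (singles (π .m))) (hF : π .N + 4 ≤ σ.v .F)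
    (hFl : σ.v .F + (π .nw + 1) * π .S < π .V) {j : ℕ} (hj : j < π .nw) {τ : St}
    (h : BaseInv π e ω σ j τ) : BaseInv π e ω σ (j + 1) (baseStep.run π r τ) := by
  have hbig := hS.big
  have hsig := hS.sig
  have m0 : 0 % π .V = 0 := Nat.zero_mod _
  have m1 : 1 % π .V = 1 := Nat.mod_eq_of_lt (by omega)
  have hS2 : 2 ≤ π .S := hS.S ▸ Nat.le_add_left _ _
  have hjS : (j + 1) * π .S + π .S ≤ (π .nw + 1) * π .S := by
    rw [← Nat.succ_mul]; exact Nat.mul_le_mul_right _ (by omega)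
  have hjV : j + 1 < π .V := by nlinarith
  have hj1 : (j + 1) % π .V = j + 1 := Nat.mod_eq_of_lt hjV
  by_cases hw : j < σ.v .w
  · obtain ⟨τ1, hτ1⟩ : ∃ τ', τ' = (((((τ.setv .mA (τ.v .base)).setv .mB (π .N + 3)).setv
      .mf 1).setv .cf 0).setv .mo 1).setv .mt 0 := ⟨_, rfl⟩
    have hrun : baseStep.run π r τ = (Cmd.block [.set .base Var.res,
        .set .j (Var.j + 1)]).run π r (mergeC.run π r τ1) := by
      simp only [baseStep, run_block_cons, run_block_one, run_ite, eval_lt', eval_var, h.j_eq, h.w_eq,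
        if_pos hw, m1, ne_eq, one_ne_zero, not_false_eq_true, if_true]
      congr 2
      simp only [run_set, eval_var, (eval_ids hS).2.2.2, eval_lit, m0, m1, ← hτ1]
    have hF1 : τ1.v .F = τ.v .F := by simp [hτ1]
    have hm1 : τ1.mem = τ.mem := by simp [hτ1]
    have hMD : MergeData π e ω τ1 (baseList (xsum e (π .m)) (wsum ω (π .m)) (π .bud) (π .m)
        (min j (σ.v .w))) (singles (π .m)) := {
      bdd := by
        have := hS.N
        rw [hτ1]
        exact (((((h.bdd.setv (h.bdd.var _)).setv (by omega)).setv (by omega)).setv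
          (by omega)).setv (by omega)).setv (by omega)
      cols := by rw [hm1]; exact hC.congr fun i hi => h.low i (by omega)
      lA := by
        have : τ1.v .mA = τ.v .base := by simp [hτ1]
        rw [hm1, this]; exact h.list
      lB := by
        have : τ1.v .mB = π .N + 3 := by simp [hτ1]
        rw [hm1, this]; exact hs.congr (h.low _ (by omega))
      A_lt := fun a ha => baseList_lt ha
      B_lt := fun a ha => singles_lt ha
      mA := by
        have : τ1.v .mA = τ.v .base := by simp [hτ1]
        have := h.base_lt; omega
      mB := by
        have : τ1.v .mB = π .N + 3 := by simp [hτ1]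
        have := h.F_ge; omega
      F_ge := by have := h.F_ge; omega
      F_lt := by have := h.F_le; omega
      fresh := by rw [hm1, hF1]; exact h.fresh
      mo_pos := by simp [hτ1]
      mo := by simp only [hτ1, setv_v]; simpa using Nat.one_le_two_pow
      mt := by simp [hτ1] }
    have hfin := mergeC_spec (r := r) hS hMD
    have mf : ∀ {x}, ¬ mergeC.writes x → (mergeC.run π r τ1).v x = τ1.v x :=
      fun hx => mergeC.run_of_not_writes hx
    have hjm : (mergeC.run π r τ1).v .j = j := by
      rw [mf (by simp [mergeC, bucketBody, pairBody, insertC, pushC, analyze, Cmd.writes])]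
      simp [hτ1, h.j_eq]
    have hwm : (mergeC.run π r τ1).v .w = σ.v .w := by
      rw [mf (by simp [mergeC, bucketBody, pairBody, insertC, pushC, analyze, Cmd.writes])]
      simp [hτ1, h.w_eq]
    set τ2 := mergeC.run π r τ1 with hτ2
    have hrun2 : baseStep.run π r τ = (τ2.setv .base (τ.v .F)).setv .j (j + 1) := by
      rw [hrun]
      simp [hfin.res, hF1, hjm, m1, hj1]
    have hF2 : ((τ2.setv .base (τ.v .F)).setv .j (j + 1)).v .F = τ.v .F + π .S := by
      simp [hfin.F, hF1]
    have hb2 : ((τ2.setv .base (τ.v .F)).setv .j (j + 1)).v .base = τ.v .F := by simp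
    have hl := hfin.list
    have e1 : τ1.v .mf = 1 := by simp [hτ1]
    have e2 : τ1.v .cf = 0 := by simp [hτ1]
    have e3 : τ1.v .mo = 1 := by simp [hτ1]
    have e4 : τ1.v .mt = 0 := by simp [hτ1]
    rw [e1, e2, e3, e4, hF1] at hl
    rw [hrun2]
    refine ⟨(hfin.bdd.setv (h.bdd.var _)).setv hjV, ?_, by simp, by simp [hwm], ?_, ?_, ?_, ?_,
      ?_, ?_⟩
    · rw [setv_tossed, setv_tossed, hfin.tossed, ← h.tossed, hτ1]; rfl
    · rw [hb2]
      have e5 : min (j + 1) (σ.v .w) = min j (σ.v .w) + 1 := by omega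
      rw [e5]
      exact hl
    · rw [hb2, hF2]; omega
    · rw [hF2]; have := h.F_ge; omega
    · rw [hF2, Nat.succ_mul]; have := h.F_le; omega
    · intro i hi
      rw [setv_mem, setv_mem, hfin.low i (by have := h.F_ge; omega), hm1, h.low i hi]
    · intro i hi j'
      rw [setv_mem, setv_mem]
      exact hfin.fresh i (by rw [hF2] at hi; rw [hfin.F, hF1]; exact hi) j'
  · have hrun : baseStep.run π r τ = τ.setv .j (j + 1) := by
      simp only [baseStep, run_block_cons, run_block_one, run_ite, eval_lt', eval_var, h.j_eq, h.w_eq,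
        if_neg hw, m0, ne_eq, not_true_eq_false, if_false]
      simp [h.j_eq, m1, hj1]
    have e5 : min (j + 1) (σ.v .w) = min j (σ.v .w) := by omega
    have hFj : (j + 1) * π .S ≤ (j + 1 + 1) * π .S := Nat.mul_le_mul_right _ (by omega)
    rw [hrun]
    refine ⟨h.bdd.setv hjV, h.tossed, by simp, by simp [h.w_eq], ?_, ?_, ?_, ?_, h.low, ?_⟩
    · rw [e5]; simpa using h.list
    · simpa using h.base_lt
    · simpa using h.F_ge
    · have := h.F_le
      simp only [setv_v, reduceCtorEq, if_false]; omega
    · simpa using h.fresh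

theorem baseC_spec (hS : Setting π) (hσ : σ.Bdd π) (hC : Cols π e ω σ.mem)
    (hs : IsList σ.mem (π .N + 3) (singles (π .m))) (hF : π .N + 4 ≤ σ.v .F)
    (hFl : σ.v .F + (π .nw + 1) * π .S < π .V)
    (hfr : ∀ i, σ.v .F ≤ i → ∀ j, σ.mem i j = 0) :
    BaseInv π e ω σ (π .nw) (baseC.run π r σ) := by
  have hbig := hS.big
  have m0 : 0 % π .V = 0 := Nat.zero_mod _
  have m1 : 1 % π .V = 1 := Nat.mod_eq_of_lt (by omega)
  have hS2 : 2 ≤ π .S := hS.S ▸ Nat.le_add_left _ _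
  have hS3 : π .S ≤ (π .nw + 1) * π .S := Nat.le_mul_of_pos_left _ (by omega)
  have e1 : π .S % π .V = π .S := Nat.mod_eq_of_lt (by omega)
  have e2 : (σ.v .F + π .S) % π .V = σ.v .F + π .S := Nat.mod_eq_of_lt (by omega)
  have hrun : baseC.run π r σ = (Cmd.rep .nw baseStep).run π r ((((σ.setm (σ.v .F) 0 1).setv
      .base (σ.v .F)).setv .F (σ.v .F + π .S)).setv .j 0) := by
    simp [baseC, m1, e1, e2]
  rw [hrun]
  refine run_rep (π := π) (r := r) (k := .nw) (fun j τ => BaseInv π e ω σ j τ) (p := baseStep) ?_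
    (fun j hj τ hτ => baseStep_spec hS hC hs hF hFl hj hτ)
  have hfr0 := hfr (σ.v .F) le_rfl
  refine ⟨(((hσ.setm (by omega)).setv (hσ.var _)).setv (by omega)).setv (by omega), rfl, by simp,
    by simp, ?_, ?_, ?_, ?_, ?_, ?_⟩
  · simp only [setv_mem, setv_v, Nat.zero_min, baseList, reduceCtorEq, if_false, if_true]
    refine ⟨by simp [setm_mem], fun k hk => ?_⟩
    have hk0 : k = 0 := by simpa using hk
    subst hk0
    simp [setm_mem, hfr0]
  · simp; omega
  · simp
  · simp
  · intro i hi
    exact setm_mem_of_ne (by omega)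
  · intro i hi j'
    simp only [setv_v, reduceCtorEq, if_false, if_true] at hi
    rw [setv_mem, setv_mem, setv_mem, setm_mem_of_ne (by omega)]
    exact hfr i (by omega) j'

end RAM

/-! ### Linearity of the hash functions -/

namespace SplitSearch

theorem div_two_pow_mod_two (z n : ℕ) : z / 2 ^ n % 2 = (z.testBit n).toNat := by
  rw [Nat.testBit_eq_decide_div_mod_eq]
  rcases Nat.mod_two_eq_zero_or_one (z / 2 ^ n) with h | h <;> simp [h]

theorem parity_xor (n a b : ℕ) : parity n (a ^^^ b) = parity n a ^^^ parity n b := by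
  induction n with
  | zero => simp [parity]
  | succ n ih =>
    have ha := parity_lt n a
    have hb := parity_lt n b
    simp only [parity]
    rw [Nat.add_mod, Nat.add_mod (parity n a), Nat.add_mod (parity n b), ih,
      div_two_pow_mod_two, div_two_pow_mod_two, div_two_pow_mod_two, Nat.testBit_xor]
    interval_cases parity n a <;> interval_cases parity n b <;> cases a.testBit n <;>
      cases b.testBit n <;> rfl

theorem two_mul_add_xor {a b p q : ℕ} (hp : p < 2) (hq : q < 2) :
    (2 * a + p) ^^^ (2 * b + q) = 2 * (a ^^^ b) + (p ^^^ q) := by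
  have h1 : ((2 * a + p) ^^^ (2 * b + q)) / 2 = a ^^^ b := by
    rw [Nat.xor_div_two]; congr 1 <;> omega
  have h2 : ((2 * a + p) ^^^ (2 * b + q)) % 2 = p ^^^ q := by
    rw [show 2 = 2 ^ 1 from rfl, Nat.xor_mod_two_pow]
    congr 1 <;> omega
  omega

/-- Each appended bit is a linear functional, so the whole map is linear over the field with two
elements. Therefore hashing the columns hashes all column sums consistently. -/
theorem hash_xor {n k : ℕ} (vs : Pow (Fin (2 ^ n)) k) (a b : ℕ) :
    hash n k vs (a ^^^ b) = hash n k vs a ^^^ hash n k vs b := by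
  induction k with
  | zero => rfl
  | succ k ih =>
    rw [hash_succ, hash_succ, hash_succ, ih, Nat.and_xor_distrib_left, parity_xor,
      two_mul_add_xor (parity_lt _ _) (parity_lt _ _)]

/-- The original column remains as the leading digits, which makes the signature injective whatever
the coins are; randomness sits only in the lowest `k` digits. -/
theorem hash_div {n k : ℕ} (vs : Pow (Fin (2 ^ n)) k) (a : ℕ) : hash n k vs a / 2 ^ k = a := by
  induction k with
  | zero => simp [hash]
  | succ k ih =>
    have := parity_lt n (vs.2 &&& a)
    rw [hash_succ, pow_succ', ← Nat.div_div_eq_div_mul,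
      show (2 * hash n k vs.1 a + parity n (vs.2 &&& a)) / 2 = hash n k vs.1 a by omega, ih]

theorem hash_injective {n k : ℕ} (vs : Pow (Fin (2 ^ n)) k) : Function.Injective (hash n k vs) :=
  fun a b h => by rw [← hash_div vs a, h, hash_div]

theorem hash_zero {n k : ℕ} (vs : Pow (Fin (2 ^ n)) k) : hash n k vs 0 = 0 := by
  have := hash_xor vs 0 0
  rwa [Nat.xor_self, Nat.xor_self] at this

theorem xsum_hash {n k : ℕ} (vs : Pow (Fin (2 ^ n)) k) (col : ℕ → ℕ) (m y : ℕ) :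
    xsum (fun i => hash n k vs (col i)) m y = hash n k vs (xsum col m y) := by
  rw [xsum, xsum]
  induction supp m y using Finset.induction_on with
  | empty => exact (hash_zero vs).symm
  | insert i S hi ih => rw [xorF_insert _ hi, xorF_insert _ hi, hash_xor, ih]

/-- The outcome of one trial of the algorithm for sets of size `w`. -/
def rootList (col ω : ℕ → ℕ) (n m L bud : ℕ) (H : Pow (Fin (2 ^ n)) L) (T : Tree L 4) (w : ℕ) :
    List ℕ :=
  node (xsum (fun i => hash n L H (col i)) m) (wsum ω m) bud (modu n L w)
    (baseList (xsum (fun i => hash n L H (col i)) m) (wsum ω m) bud m w) 4 T (hash n L H (col m))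

def trialCoins (n L : ℕ) : ℕ := L * n + treeCoins L 4

theorem node_congr {sig wt : ℕ → ℕ} {bud : ℕ} {M M' : ℕ → ℕ} {base : List ℕ} {L d : ℕ}
    {T : Tree L d} {t : ℕ} (h : ∀ d' ≤ d, M d' = M' d') :
    node sig wt bud M base d T t = node sig wt bud M' base d T t := by
  induction d generalizing t with
  | zero => rfl
  | succ d ih =>
    obtain ⟨c, l, r⟩ := T
    simp only [node]
    rw [ih fun d' hd' => h d' (by omega), ih fun d' hd' => h d' (by omega), h d (by omega),
      h (d + 1) le_rfl]

/-- The modulus `2 ^ (n + L)` at the root exceeds all signatures, so matching is equality and all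
elements have the signature of the target. As signatures in a list are distinct, at most one element
remains. -/
theorem rootList_spec {col ω : ℕ → ℕ} {n m L bud : ℕ} {H : Pow (Fin (2 ^ n)) L} {T : Tree L 4}
    {w : ℕ} (hc : ∀ i ≤ m, col i < 2 ^ n) : rootList col ω n m L bud H T w = [] ∨
    ∃ z, rootList col ω n m L bud H T w = [z] ∧
      xsum (fun i => hash n L H (col i)) m z = hash n L H (col m) := by
  obtain ⟨c, l, r⟩ := T
  have hlt : ∀ y, xsum (fun i => hash n L H (col i)) m y < 2 ^ (n + L) := fun y =>
    xorF_lt _ _ _ fun i hi => hash_lt H (hc i (by simp at hi; omega))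
  have h1 : ∀ y ∈ rootList col ω n m L bud H (c, l, r) w,
      xsum (fun i => hash n L H (col i)) m y = hash n L H (col m) := by
    intro y hy
    obtain ⟨a, _, b, _, _, h2, rfl⟩ := mem_merge _ _ hy
    rw [show modu n L w (3 + 1) = 2 ^ (n + L) from if_neg (by omega), Nat.mod_eq_of_lt (hlt b),
      Nat.mod_eq_of_lt (Nat.xor_lt_two_pow (hlt a) (hash_lt H (hc m le_rfl)))] at h2
    rw [xsum_xor, h2, ← Nat.xor_assoc, Nat.xor_self, Nat.zero_xor]
  have h2 : ((rootList col ω n m L bud H (c, l, r) w).map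
      (xsum (fun i => hash n L H (col i)) m)).Nodup := nodup_merge _ _ _ _ _ _ _ _ _
  -- A second element would repeat the signature of the first.
  rcases h : rootList col ω n m L bud H (c, l, r) w with _ | ⟨x, _ | ⟨y, l⟩⟩
  · exact .inl rfl
  · exact .inr ⟨x, rfl, h1 x (by simp [h])⟩
  · rw [h] at h2
    have hx := h1 x (by simp [h])
    have hy := h1 y (by simp [h])
    simp [hx, hy] at h2

end SplitSearch

namespace RAM

open SplitSearch

variable {π : Par → ℕ} {r : ℕ → Bool} {σ : St} {col ω : ℕ → ℕ}

/-! ### The search -/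

/-- Keep the set `y` as the best solution so far. -/
def keepC : Cmd := .block [.set .best Var.y, .set .bw Var.wt, .set .flag 1]

/-- The first cell of the list is inspected even if the list is empty. This is harmless, since any
mask that passes the test of the signature is a solution. -/
def updateC : Cmd := .block [.set .y (.get Var.res 1), analyze,
  .ite (.op .eq Var.sg (.get idExt Par.m))
    (.ite Var.flag (.ite (.op .lt Var.wt Var.bw) keepC .skip) keepC) .skip]

def trialC : Cmd := .block
  [hashC, baseC, .set (.t 4) (.get idExt Par.m), nodeC 4, updateC]

/-- The state after `c` trials. -/
structure SearchInv (π : Par → ℕ) (r : ℕ → Bool) (col ω : ℕ → ℕ) (σ : St) (c : ℕ) (τ : St) :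
    Prop where
  bdd : τ.Bdd π
  tossed : τ.tossed = σ.tossed + c * trialCoins (π .n) (π .L)
  col_eq : ∀ i ≤ π .m, τ.mem (π .N) i = col i
  wt_eq : ∀ i < π .m, τ.mem (π .N + 1) i = ω i
  sing : IsList τ.mem (π .N + 3) (singles (π .m))
  F_ge : π .N + 4 ≤ τ.v .F
  F_le : τ.v .F ≤ σ.v .F + c * ((π .nw + 16) * π .S)
  fresh : ∀ i, τ.v .F ≤ i → ∀ j, τ.mem i j = 0
  low : ∀ i < π .N, τ.mem i = σ.mem i
  flag : τ.v .flag ≠ 0 → xsum col (π .m) (τ.v .best) = col (π .m) ∧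
    τ.v .bw = wsum ω (π .m) (τ.v .best)
  found : ∀ c' < c, ∀ z ∈ rootList col ω (π .n) (π .m) (π .L) (π .bud)
    (readHash r (σ.tossed + c' * trialCoins (π .n) (π .L)) (π .n) (π .L))
    (readTree r (π .L) (σ.tossed + c' * trialCoins (π .n) (π .L) + π .L * π .n) 4) (c' / π .q),
    τ.v .flag ≠ 0 ∧ τ.v .bw ≤ wsum ω (π .m) z

theorem keepC_v {x : Var} : (keepC.run π r σ).v x = if x = .flag then 1 % π .V else
    if x = .bw then σ.v .wt else if x = .best then σ.v .y else σ.v x := by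
  simp only [keepC, run_block_cons, run_block_one, run_set, setv_v, eval_var, eval_lit,
    reduceCtorEq, if_false]

/-- Soundness comes from the test alone (`he`), independently of how the list arose; the list
matters only for the claim that its element is taken into account. -/
theorem updateC_spec (hS : Setting π) {e : ℕ → ℕ} (hσ : σ.Bdd π) (hC : Cols π e ω σ.mem)
    {P : ℕ → Prop} (he : ∀ y, xsum e (π .m) y = e (π .m) → P y) {l : List ℕ}
    (hl : IsList σ.mem (σ.v .res) l)
    (hl1 : l = [] ∨ ∃ z, l = [z] ∧ xsum e (π .m) z = e (π .m))
    (hf : σ.v .flag ≠ 0 → P (σ.v .best) ∧ σ.v .bw = wsum ω (π .m) (σ.v .best)) :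
    let τ := updateC.run π r σ
    (τ.v .flag ≠ 0 → P (τ.v .best) ∧ τ.v .bw = wsum ω (π .m) (τ.v .best)) ∧
    (∀ z ∈ l, τ.v .flag ≠ 0 ∧ τ.v .bw ≤ wsum ω (π .m) z) ∧
    (σ.v .flag ≠ 0 → τ.v .flag ≠ 0 ∧ τ.v .bw ≤ σ.v .bw) ∧ τ.mem = σ.mem ∧
    τ.tossed = σ.tossed ∧ τ.v .F = σ.v .F := by
  have hbig := hS.big
  have hm := hS.m_lt
  have m1 : 1 % π .V = 1 := Nat.mod_eq_of_lt (by omega)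
  have m0 : 0 % π .V = 0 := Nat.zero_mod _
  have mm : π .m % π .V = π .m := Nat.mod_eq_of_lt (by omega)
  intro τ
  set y := σ.mem (σ.v .res) 1 with hy
  set σ1 := σ.setv .y y with hσ1
  have hb1 : σ1.Bdd π := hσ.setv (hσ.mem _ _)
  obtain ⟨a1, a2, a3, a4⟩ := analyze_spec (r := r) hS hb1 hC
  set σ2 := analyze.run π r σ1 with hσ2
  have af : ∀ {x : Var}, x ≠ .sg → x ≠ .wt → x ≠ .z → x ≠ .i → σ2.v x = σ1.v x :=
    fun h1 h2 h3 h4 => analyze_frame h1 h2 h3 h4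
  have hflag : σ2.v .flag = σ.v .flag := by rw [af] <;> simp [hσ1]
  have hbw : σ2.v .bw = σ.v .bw := by rw [af] <;> simp [hσ1]
  have hbest : σ2.v .best = σ.v .best := by rw [af] <;> simp [hσ1]
  have hF : σ2.v .F = σ.v .F := by rw [af] <;> simp [hσ1]
  have hy2 : σ2.v .y = y := by rw [af] <;> simp [hσ1]
  have hy1 : σ1.v .y = y := by simp [hσ1]
  rw [hy1] at a1 a2
  have hext : σ2.mem (π .N + 2) (π .m) = e (π .m) := by rw [a3]; exact hC.ext _ le_rfl
  -- For an empty list nothing is claimed about `y`.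
  have hly : ∀ z ∈ l, y = z ∧ xsum e (π .m) z = e (π .m) := by
    intro z hz
    rcases hl1 with rfl | ⟨u, rfl, hu⟩
    · simp at hz
    · obtain rfl := List.mem_singleton.1 hz
      exact ⟨hl.2 0 (by simp), hu⟩
  have hrun : τ = if xsum e (π .m) y = e (π .m) then
      (if σ.v .flag ≠ 0 then (if wsum ω (π .m) y < σ.v .bw then keepC.run π r σ2 else σ2)
        else keepC.run π r σ2) else σ2 := by
    simp only [τ, updateC, run_block_cons, run_block_one, run_set, eval_get, eval_var, eval_lit,
      m1, ← hy, ← hσ1, ← hσ2, run_ite, eval_eq', eval_lt', eval_par, mm, (eval_ids hS).2.2.1, a1,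
      hext, hflag, a2, hbw, run_skip]
    by_cases h1 : xsum e (π .m) y = e (π .m) <;> by_cases h2 : wsum ω (π .m) y < σ.v .bw <;>
      simp [h1, h2, m1]
  have hkm : (keepC.run π r σ2).mem = σ2.mem ∧ (keepC.run π r σ2).tossed = σ2.tossed := ⟨rfl, rfl⟩
  rw [hrun]
  by_cases h1 : xsum e (π .m) y = e (π .m)
  · rw [if_pos h1]
    have hP := he y h1
    by_cases h2 : σ.v .flag = 0
    · simp only [h2, ne_eq, not_true_eq_false, if_false, keepC_v, hkm, a2, a3, a4, m1, hy2, hF]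
      refine ⟨fun _ => ⟨by simpa using hP, by simp⟩, fun z hz => ⟨by simp, ?_⟩, by simp, rfl, rfl,
        by simp⟩
      simp [(hly z hz).1]
    · rw [if_pos h2]
      by_cases h3 : wsum ω (π .m) y < σ.v .bw
      · simp only [if_pos h3, keepC_v, hkm, a2, a3, a4, m1, hy2, hF]
        refine ⟨fun _ => ⟨by simpa using hP, by simp⟩, fun z hz => ⟨by simp, ?_⟩,
          fun _ => ⟨by simp, by simpa using h3.le⟩, rfl, rfl, by simp⟩
        simp [(hly z hz).1]
      · simp only [if_neg h3, hflag, hbest, hbw, hF, a3, a4]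
        refine ⟨hf, fun z hz => ⟨h2, ?_⟩, fun _ => ⟨h2, le_rfl⟩, rfl, rfl, trivial⟩
        rw [← (hly z hz).1]; omega
  · simp only [if_neg h1, hflag, hbest, hbw, hF, a3, a4]
    refine ⟨hf, fun z hz => ?_, fun h => ⟨h, le_rfl⟩, rfl, rfl, trivial⟩
    exact absurd ((hly z hz).1 ▸ (hly z hz).2) h1

/-- A trial takes up at most `nw + 1` blocks of `S` arrays for the base list and 15 for the tree,
and it always tosses `trialCoins` coins. Hence trial `c` reads the coins from `c * trialCoins` on,
which later makes the trials independent. -/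
theorem trialC_spec (hS : Setting π) (hcl : ∀ i ≤ π .m, col i < 2 ^ π .n)
    (hw : ∑ i ∈ Finset.range (π .m), ω i < π .V) (hL : 16 * π .nw ≤ π .L + 9) {c : ℕ} {τ : St}
    (hF : σ.v .F + (c + 1) * ((π .nw + 16) * π .S) + π .S < π .V)
    (h : SearchInv π r col ω σ c τ) (hcw : τ.v .w = c / π .q) (hlw : τ.v .w < π .nw)
    (hM : ∀ d ≤ 4, τ.v (.M d) = modu (π .n) (π .L) (τ.v .w) d) :
    SearchInv π r col ω σ (c + 1) (trialC.run π r τ) := by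
  have hbig := hS.big
  have hsig := hS.sig
  have hm := hS.m_lt
  have mm : π .m % π .V = π .m := Nat.mod_eq_of_lt (by omega)
  rw [Nat.succ_mul, add_mul (π .nw) 16] at hF
  have hFle := h.F_le
  have hFge := h.F_ge
  rw [add_mul (π .nw) 16] at hFle
  -- the hash function
  set H := readHash r τ.tossed (π .n) (π .L) with hH
  set e : ℕ → ℕ := fun i => hash (π .n) (π .L) H (col i) with he
  obtain ⟨h1, h2, h3⟩ := hashC_spec (r := r) hS h.col_eq hcl
  have hf1 : ∀ {x : Var}, ¬ hashC.writes x → (hashC.run π r τ).v x = τ.v x :=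
    fun hx => hashC.run_of_not_writes hx
  have hb1 := hashC.run_bdd (r := r) hS.ok h.bdd
  rw [trialC, run_block_cons, run_block_cons]
  set τ1 := hashC.run π r τ with hτ1
  have hw1 : τ1.v .w = τ.v .w := hf1 (by simp [hashC, drawC, appendC, parityC, Cmd.writes])
  have hF1 : τ1.v .F = τ.v .F := hf1 (by simp [hashC, drawC, appendC, parityC, Cmd.writes])
  have hM1 : ∀ d, τ1.v (.M d) = τ.v (.M d) :=
    fun d => hf1 (by simp [hashC, drawC, appendC, parityC, Cmd.writes])
  have hflag1 : τ1.v .flag = τ.v .flag := hf1 (by simp [hashC, drawC, appendC, parityC, Cmd.writes])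
  have hbest1 : τ1.v .best = τ.v .best := hf1 (by simp [hashC, drawC, appendC, parityC, Cmd.writes])
  have hbw1 : τ1.v .bw = τ.v .bw := hf1 (by simp [hashC, drawC, appendC, parityC, Cmd.writes])
  have hC1 : Cols π e ω τ1.mem := ⟨h1, fun i hi => by rw [h2 _ (by omega)]; exact h.wt_eq i hi,
    fun i hi => hash_lt H (hcl i hi), hw⟩
  -- the base list
  have hB := baseC_spec (r := r) hS hb1 hC1 (by exact h.sing.congr (h2 _ (by omega)))
    (by rw [hF1]; exact hFge) (by rw [hF1, add_mul, one_mul]; omega)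
    (fun i hi j => by rw [h2 i (by omega)]; exact h.fresh i (by omega) j)
  have hf2 : ∀ {x : Var}, ¬ baseC.writes x → (baseC.run π r τ1).v x = τ1.v x :=
    fun hx => baseC.run_of_not_writes hx
  have hM2 : ∀ d, (baseC.run π r τ1).v (.M d) = τ1.v (.M d) := fun d => hf2 (by
    simp [baseC, baseStep, mergeC, bucketBody, pairBody, insertC, pushC, analyze, Cmd.writes])
  have hflag2 : (baseC.run π r τ1).v .flag = τ1.v .flag := hf2 (by
    simp [baseC, baseStep, mergeC, bucketBody, pairBody, insertC, pushC, analyze, Cmd.writes])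
  have hbest2 : (baseC.run π r τ1).v .best = τ1.v .best := hf2 (by
    simp [baseC, baseStep, mergeC, bucketBody, pairBody, insertC, pushC, analyze, Cmd.writes])
  have hbw2 : (baseC.run π r τ1).v .bw = τ1.v .bw := hf2 (by
    simp [baseC, baseStep, mergeC, bucketBody, pairBody, insertC, pushC, analyze, Cmd.writes])
  set τ2 := baseC.run π r τ1 with hτ2
  have hC2 : Cols π e ω τ2.mem := hC1.congr fun i hi => hB.low i (by omega)
  rw [run_block_cons, run_set, eval_get, eval_par, mm, (eval_ids hS).2.2.1, hC2.ext _ le_rfl]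
  have heL : e (π .m) < 2 ^ (π .n + π .L) := hash_lt H (hcl _ le_rfl)
  set τ3 := τ2.setv (.t 4) (e (π .m)) with hτ3
  have hF2 := hB.F_le
  have hF2' := hB.F_ge
  rw [hF1] at hF2 hF2'
  rw [add_mul, one_mul] at hF2
  have hM3 : ∀ d, τ3.v (.M d) = τ.v (.M d) := fun d => by simp [hτ3, hM2, hM1]
  have hF3 : τ3.v .F = τ2.v .F := by simp [hτ3]
  have hbase3 : τ3.v .base = τ2.v .base := by simp [hτ3]
  have hN : NodeData π e ω τ3 (baseList (xsum e (π .m)) (wsum ω (π .m)) (π .bud) (π .m)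
      (min (π .nw) (τ1.v .w))) 4 := {
    bdd := hB.bdd.setv (by omega)
    cols := hC2
    list := by rw [hbase3]; exact hB.list
    base_lt := fun a ha => baseList_lt ha
    base_id := by rw [hbase3, hF3]; exact hB.base_lt
    F_ge := by omega
    F_lt := by rw [hF3]; omega
    fresh := by rw [hF3]; exact hB.fresh
    M_pos := fun d hd => by rw [hM3, hM d hd, modu]; split_ifs <;> positivity
    -- For `d ≤ 3` the exponent is at most `16 * w + 7`, and `w < nw` keeps this below `L` by `hL`.
    M_le := fun d hd => by
      rw [hM3, hM d hd, modu]
      split_ifs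
      · refine Nat.pow_le_pow_right (by norm_num) ?_
        have : 2 ^ d ≤ 2 ^ 3 := Nat.pow_le_pow_right (by norm_num) (by omega)
        have := Nat.mul_le_mul_left (τ.v .w) this
        omega
      · exact le_rfl
    t := by simpa [hτ3] using heL }
  have hD := nodeC_spec (r := r) hS hN
  have hf4 : ∀ {x : Var}, ¬ (nodeC 4).writes x → ((nodeC 4).run π r τ3).v x = τ3.v x :=
    fun hx => (nodeC 4).run_of_not_writes hx
  have hnw : ∀ x ∈ [Var.flag, .best, .bw], ¬ (nodeC 4).writes x := by
    intro x hx hw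
    rcases nodeC_writes hw with ⟨d', _, h5⟩ | h5 <;>
      (simp only [List.mem_cons, List.not_mem_nil, or_false] at hx
       rcases hx with rfl | rfl | rfl <;> simp at h5)
  have hflag4 : ((nodeC 4).run π r τ3).v .flag = τ.v .flag := by
    rw [hf4 (hnw _ (by simp))]; simp [hτ3, hflag2, hflag1]
  have hbest4 : ((nodeC 4).run π r τ3).v .best = τ.v .best := by
    rw [hf4 (hnw _ (by simp))]; simp [hτ3, hbest2, hbest1]
  have hbw4 : ((nodeC 4).run π r τ3).v .bw = τ.v .bw := by
    rw [hf4 (hnw _ (by simp))]; simp [hτ3, hbw2, hbw1]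
  rw [run_block_cons, run_block_one]
  have ht3 : τ3.tossed = τ.tossed + π .L * π .n := by
    rw [hτ3, setv_tossed, hB.tossed, h3]
  have hroot : node (xsum e (π .m)) (wsum ω (π .m)) (π .bud) (fun d => τ3.v (.M d))
      (baseList (xsum e (π .m)) (wsum ω (π .m)) (π .bud) (π .m) (min (π .nw) (τ1.v .w))) 4
      (readTree r (π .L) τ3.tossed 4) (τ3.v (.t 4)) = rootList col ω (π .n) (π .m) (π .L) (π .bud)
      (readHash r (σ.tossed + c * trialCoins (π .n) (π .L)) (π .n) (π .L))
      (readTree r (π .L) (σ.tossed + c * trialCoins (π .n) (π .L) + π .L * π .n) 4) (c / π .q) := by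
    have e1 : min (π .nw) (τ1.v .w) = c / π .q := by rw [hw1]; omega
    have e2 : τ3.v (.t 4) = e (π .m) := by simp [hτ3]
    rw [rootList, e1, ht3, ← h.tossed, e2]
    exact node_congr fun d hd => by rw [hM3, hM d hd, hcw]
  rw [hroot] at hD
  set τ4 := (nodeC 4).run π r τ3 with hτ4
  have hC4 : Cols π e ω τ4.mem := hC2.congr fun i hi => hD.low i (by omega)
  have hU := updateC_spec (r := r) hS hD.bdd hC4
    (P := fun y => xsum col (π .m) y = col (π .m)) (fun y hy => by
      rw [he, xsum_hash] at hy
      exact hash_injective H hy) hD.list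
    (by
      have := rootList_spec (ω := ω) (L := π .L) (bud := π .bud) (H := H)
        (T := readTree r (π .L) (σ.tossed + c * trialCoins (π .n) (π .L) + π .L * π .n) 4)
        (w := c / π .q) hcl
      rw [hH, h.tossed] at this
      rw [he, hH, h.tossed]
      exact this)
    (by rw [hflag4, hbest4, hbw4]; exact h.flag)
  obtain ⟨u1, u2, u3, u4, u5, u6⟩ := hU
  have hb5 := updateC.run_bdd (r := r) hS.ok hD.bdd
  set τ5 := updateC.run π r τ4 with hτ5
  have hF4 := hD.F_le
  have hF4' := hD.F_ge
  rw [hF3] at hF4 hF4'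
  have hlow : ∀ i < π .N + 4, i ≠ π .N + 2 → τ5.mem i = τ.mem i := by
    intro i hi hi2
    rw [u4, hD.low i (by omega), hτ3, setv_mem, hB.low i (by omega), h2 i hi2]
  refine ⟨hb5, ?_, ?_, ?_, ?_, by omega, ?_, ?_, ?_, u1, ?_⟩
  · rw [u5, hD.tossed, ht3, h.tossed, Nat.succ_mul, trialCoins]; omega
  · intro i hi; rw [hlow _ (by omega) (by omega)]; exact h.col_eq i hi
  · intro i hi; rw [hlow _ (by omega) (by omega)]; exact h.wt_eq i hi
  · exact h.sing.congr (hlow _ (by omega) (by omega))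
  · rw [u6, Nat.succ_mul, add_mul (π .nw) 16]; omega
  · rw [u4, u6]; exact hD.fresh
  · intro i hi; rw [hlow _ (by omega) (by omega)]; exact h.low i hi
  · intro c' hc' z hz
    rcases Nat.lt_succ_iff_lt_or_eq.1 hc' with hc' | rfl
    · obtain ⟨g1, g2⟩ := h.found c' hc' z hz
      rw [hflag4, hbw4] at u3
      exact ⟨(u3 g1).1, (u3 g1).2.trans g2⟩
    · exact u2 z hz

end RAM

namespace RAM

open SplitSearch

variable {π : Par → ℕ} {r : ℕ → Bool} {σ : St} {col ω : ℕ → ℕ}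

/-- Compute the moduli. -/
def moduC : Cmd := .block
  [.set .s (Var.pw * Var.pw), .set (.M 0) (Var.s * 128), .set .s (Var.s * Var.s),
   .set (.M 1) (Var.s * 128), .set .s (Var.s * Var.s), .set (.M 2) (Var.s * 128),
   .set .s (Var.s * Var.s), .set (.M 3) (Var.s * 128), .set (.M 4) (Par.S - 2)]

def roundC : Cmd := .block
  [moduC, .rep .q trialC, .set .w (Var.w + 1), .set .pw (2 * Var.pw)]

/-- Search for solutions of all sizes. -/
def searchC : Cmd := .block [.set .w 0, .set .pw 1, .rep .nw roundC]

theorem SearchInv.congr {c : ℕ} {τ τ' : St} (h : SearchInv π r col ω σ c τ) (hb : τ'.Bdd π)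
    (hm : τ'.mem = τ.mem) (ht : τ'.tossed = τ.tossed) (hF : τ'.v .F = τ.v .F)
    (hf : τ'.v .flag = τ.v .flag) (hbest : τ'.v .best = τ.v .best) (hbw : τ'.v .bw = τ.v .bw) :
    SearchInv π r col ω σ c τ' where
  bdd := hb
  tossed := ht ▸ h.tossed
  col_eq := hm ▸ h.col_eq
  wt_eq := hm ▸ h.wt_eq
  sing := hm ▸ h.sing
  F_ge := hF ▸ h.F_ge
  F_le := hF ▸ h.F_le
  fresh := by rw [hm, hF]; exact h.fresh
  low := hm ▸ h.low
  flag := by rw [hf, hbest, hbw]; exact h.flag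
  found := by rw [hf, hbw]; exact h.found

/-- There is no exponentiation: from `2 ^ w`, repeated squaring gives `2 ^ (2 * (w * 2 ^ d))`, and
`128` accounts for the 7 extra bits. The modulus of the root is `S - 2`. -/
theorem moduC_spec (hS : Setting π) {w : ℕ} (hw : 16 * w + 7 ≤ π .L) (hpw : σ.v .pw = 2 ^ w) :
    (∀ d ≤ 4, (moduC.run π r σ).v (.M d) = modu (π .n) (π .L) w d) ∧
    (moduC.run π r σ).mem = σ.mem ∧ (moduC.run π r σ).tossed = σ.tossed := by
  have hbig := hS.big
  have hsig := hS.sig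
  have hSV : π .S % π .V = 2 ^ (π .n + π .L) + 2 := by
    rw [hS.S]; exact Nat.mod_eq_of_lt (by omega)
  have m128 : 128 % π .V = 128 := Nat.mod_eq_of_lt (by omega)
  have m2 : 2 % π .V = 2 := Nat.mod_eq_of_lt (by omega)
  have mp : ∀ k ≤ π .L, 2 ^ k % π .V = 2 ^ k := fun k hk => Nat.mod_eq_of_lt (by
    have : 2 ^ k ≤ 2 ^ (π .n + π .L) := Nat.pow_le_pow_right (by norm_num) (by omega)
    omega)
  have e1 : 2 ^ w * 2 ^ w % π .V = 2 ^ (2 * w) := by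
    rw [← pow_add, ← two_mul]; exact mp _ (by omega)
  have e2 : 2 ^ (2 * w) * 2 ^ (2 * w) % π .V = 2 ^ (4 * w) := by
    rw [← pow_add, ← two_mul, ← mul_assoc]; exact mp _ (by omega)
  have e3 : 2 ^ (4 * w) * 2 ^ (4 * w) % π .V = 2 ^ (8 * w) := by
    rw [← pow_add, ← two_mul, ← mul_assoc]; exact mp _ (by omega)
  have e4 : 2 ^ (8 * w) * 2 ^ (8 * w) % π .V = 2 ^ (16 * w) := by
    rw [← pow_add, ← two_mul, ← mul_assoc]; exact mp _ (by omega)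
  have g : ∀ k, k + 7 ≤ π .L → 2 ^ k * 128 % π .V = 2 ^ (k + 7) := fun k hk => by
    rw [show 128 = 2 ^ 7 by norm_num, ← pow_add]; exact mp _ hk
  have e5 : 2 ^ (π .n + π .L) % π .V = 2 ^ (π .n + π .L) := Nat.mod_eq_of_lt (by omega)
  refine ⟨fun d hd => ?_, by simp [moduC], by simp [moduC]⟩
  simp only [moduC, run_block_cons, run_block_one, run_set, eval_mul, eval_var, eval_lit, eval_sub,
    eval_par, m128, m2, setv_v, hpw, e1, e2, e3, e4, hSV, Nat.add_sub_cancel, e5, if_true, reduceCtorEq, if_false,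
    g (2 * w) (by omega), g (4 * w) (by omega), g (8 * w) (by omega), g (16 * w) (by omega)]
  interval_cases d <;> simp [modu] <;> ring_nf

theorem trialC_frame {x : Var} (hx : x = .w ∨ x = .pw ∨ ∃ d, x = .M d) :
    (trialC.run π r σ).v x = σ.v x := by
  have h4 : ¬ (nodeC 4).writes x := by
    intro hw
    rcases nodeC_writes hw with ⟨d', _, h5⟩ | h5 <;>
      (rcases hx with rfl | rfl | ⟨d, rfl⟩ <;> simp at h5)
  refine Cmd.run_of_not_writes _ ?_
  simp only [trialC, writes_block_cons, h4, false_or]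
  rcases hx with rfl | rfl | ⟨d, rfl⟩ <;>
    simp [hashC, drawC, appendC, parityC, baseC, baseStep, mergeC, bucketBody, pairBody, insertC,
      pushC, analyze, updateC, keepC, Cmd.writes]

/-- Trials are numbered consecutively over all sizes, so the size belonging to trial `c` is `c / q`.
-/
theorem searchC_spec (hS : Setting π) (hcl : ∀ i ≤ π .m, col i < 2 ^ π .n)
    (hw : ∑ i ∈ Finset.range (π .m), ω i < π .V) (hL : 16 * π .nw ≤ π .L + 9)
    (hF : σ.v .F + (π .nw * π .q + 1) * ((π .nw + 16) * π .S) < π .V)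
    (h : SearchInv π r col ω σ 0 σ) :
    SearchInv π r col ω σ (π .nw * π .q) (searchC.run π r σ) := by
  have hbig := hS.big
  have hsig := hS.sig
  have m0 : 0 % π .V = 0 := Nat.zero_mod _
  have m1 : 1 % π .V = 1 := Nat.mod_eq_of_lt (by omega)
  have m2 : 2 % π .V = 2 := Nat.mod_eq_of_lt (by omega)
  have hSS : π .S ≤ (π .nw + 16) * π .S := Nat.le_mul_of_pos_left _ (by omega)
  have hrun : searchC.run π r σ = (Cmd.rep .nw roundC).run π r ((σ.setv .w 0).setv .pw 1) := by
    simp only [searchC, run_block_cons, run_block_one, run_set, eval_lit, m0, m1]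
  rw [hrun]
  refine (run_rep (π := π) (r := r) (k := .nw) (fun j τ => SearchInv π r col ω σ (j * π .q) τ ∧
    τ.v .w = j ∧ τ.v .pw = 2 ^ j) (p := roundC) ?_ ?_).1
  · refine ⟨?_, by simp, by simp⟩
    rw [Nat.zero_mul]
    exact h.congr ((h.bdd.setv (by omega)).setv (by omega)) rfl rfl (by simp) (by simp) (by simp)
      (by simp)
  · rintro j hj τ ⟨h1, h2, h3⟩
    obtain ⟨n1, n2, n3⟩ := moduC_spec (r := r) (σ := τ) hS (w := j) (by omega) h3
    have nf : ∀ {x : Var}, ¬ moduC.writes x → (moduC.run π r τ).v x = τ.v x :=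
      fun hx => moduC.run_of_not_writes hx
    have hi1 := h1.congr (moduC.run_bdd (r := r) hS.ok h1.bdd) n2 n3
      (nf (by simp [moduC, Cmd.writes])) (nf (by simp [moduC, Cmd.writes]))
      (nf (by simp [moduC, Cmd.writes])) (nf (by simp [moduC, Cmd.writes]))
    have hw1 : (moduC.run π r τ).v .w = j := (nf (by simp [moduC, Cmd.writes])).trans h2
    have hp1 : (moduC.run π r τ).v .pw = 2 ^ j := (nf (by simp [moduC, Cmd.writes])).trans h3
    rw [roundC, run_block_cons, run_block_cons]
    set τ1 := moduC.run π r τ with hτ1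
    have key := run_rep (π := π) (r := r) (k := .q) (σ := τ1) (fun c τ' =>
      SearchInv π r col ω σ (j * π .q + c) τ' ∧ τ'.v .w = j ∧ τ'.v .pw = 2 ^ j ∧
      ∀ d ≤ 4, τ'.v (.M d) = modu (π .n) (π .L) j d) (p := trialC) ?_ ?_
    · obtain ⟨k1, k2, k3, _⟩ := key
      set τ2 := (Cmd.rep .q trialC).run π r τ1 with hτ2
      have hjV : j + 1 < π .V := by
        have : j < 2 ^ j := Nat.lt_two_pow_self
        have : 2 ^ j ≤ 2 ^ (π .n + π .L) := Nat.pow_le_pow_right (by norm_num) (by omega)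
        omega
      have hpV : 2 * 2 ^ j < π .V := by
        have : 2 ^ j ≤ 2 ^ (π .n + π .L) := Nat.pow_le_pow_right (by norm_num) (by omega)
        omega
      have hrun2 : (Cmd.block [.set .w (Var.w + 1), .set .pw (2 * Var.pw)]).run π r τ2 =
          (τ2.setv .w (j + 1)).setv .pw (2 ^ (j + 1)) := by
        simp [k2, k3, m1, m2, Nat.mod_eq_of_lt hjV, Nat.mod_eq_of_lt hpV, pow_succ']
      rw [hrun2, Nat.succ_mul]
      exact ⟨k1.congr ((k1.bdd.setv hjV).setv (by rw [pow_succ']; exact hpV)) rfl rfl (by simp)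
        (by simp) (by simp) (by simp), by simp, by simp⟩
    · exact ⟨hi1, hw1, hp1, n1⟩
    · rintro c hc τ' ⟨k1, k2, k3, k4⟩
      have hq : 0 < π .q := by omega
      have hjc : (j * π .q + c) / π .q = j := by
        rw [mul_comm, Nat.mul_add_div hq, Nat.div_eq_of_lt hc, Nat.add_zero]
      have hjq : j * π .q + c + 1 ≤ π .nw * π .q := by
        calc j * π .q + c + 1 ≤ j * π .q + π .q := by omega
          _ = (j + 1) * π .q := (Nat.succ_mul _ _).symm
          _ ≤ π .nw * π .q := Nat.mul_le_mul_right _ hj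
      refine ⟨trialC_spec hS hcl hw hL (c := j * π .q + c) ?_ k1 (by rw [hjc, k2])
        (by rw [k2]; exact hj) (by rw [k2]; exact k4), (trialC_frame (by simp)).trans k2,
        (trialC_frame (by simp)).trans k3, fun d hd => (trialC_frame (by simp)).trans (k4 d hd)⟩
      have := Nat.mul_le_mul_right ((π .nw + 16) * π .S) hjq
      rw [Nat.succ_mul] at hF
      omega

end RAM

/-! ### Completeness of the lists -/

namespace SplitSearch

/-- The bit masks of the sets with at most `k` elements. -/
def smallSets (m k : ℕ) : Finset ℕ := (Finset.range (2 ^ m)).filter fun y => (supp m y).card ≤ k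

theorem mem_smallSets {m k y : ℕ} : y ∈ smallSets m k ↔ y < 2 ^ m ∧ (supp m y).card ≤ k := by
  simp [smallSets]

theorem smallSets_mono {m k k' : ℕ} (h : k ≤ k') : smallSets m k ⊆ smallSets m k' := fun y hy => by
  rw [mem_smallSets] at *; exact ⟨hy.1, hy.2.trans h⟩

/-- The list contains a set with the signature of `Y` that is at most as heavy. -/
def Covers (e ω : ℕ → ℕ) (m : ℕ) (l : List ℕ) (Y : Finset ℕ) : Prop :=
  ∃ z ∈ l, xsum e m z = xorF e Y ∧ wsum ω m z ≤ ∑ i ∈ Y, ω i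

section lists

variable {e ω : ℕ → ℕ} {m bud : ℕ}

/-- The lists need not contain `Z` and `Y \ Z` themselves. Substitutes with the same signatures
match equally well, and their symmetric difference has the signature of `Y`; if they overlap,
cancellation only lowers the weight. -/
theorem covers_merge {mf cf mo tg : ℕ} {A B : List ℕ} (hB : B.length ≤ bud)
    (hE : (events (xsum e m) mf cf mo tg A B).length ≤ bud) {Y Z : Finset ℕ} (hZ : Z ⊆ Y)
    (hcA : Covers e ω m A Z) (hcB : Covers e ω m B (Y \ Z)) (h1 : xorF e Z % mf = cf % mf)
    (h2 : xorF e (Y \ Z) % mo = (xorF e Z ^^^ tg) % mo) :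
    Covers e ω m (merge (xsum e m) (wsum ω m) bud mf cf mo tg A B) Y := by
  obtain ⟨a, ha, ha1, ha2⟩ := hcA
  obtain ⟨b, hb, hb1, hb2⟩ := hcB
  obtain ⟨z, hz, hz1, hz2⟩ := merge_complete (xsum e m) (wsum ω m) hB hE ha hb (by rwa [ha1])
    (by rwa [ha1, hb1])
  refine ⟨z, hz, ?_, ?_⟩
  · rw [hz1, xsum_xor, ha1, hb1, ← xorF_disjUnion e Finset.disjoint_sdiff,
      Finset.union_sdiff_of_subset hZ]
  · have := wsum_xor_le ω m a b
    have := Finset.sum_sdiff (f := ω) hZ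
    omega

theorem length_le_card {l : List ℕ} {D : Finset ℕ} {sig : ℕ → ℕ} (h : (l.map sig).Nodup)
    (hD : ∀ a ∈ l, a ∈ D) : l.length ≤ D.card := by
  rw [← List.toFinset_card_of_nodup h.of_map]
  exact Finset.card_le_card fun a ha => hD a (List.mem_toFinset.1 ha)

/-! ### The base list -/

theorem card_supp_singles {a : ℕ} (h : a ∈ RAM.singles m) : (supp m a).card ≤ 1 := by
  rcases List.mem_cons.1 h with rfl | h
  · simp [supp_zero]
  · obtain ⟨i, hi, rfl⟩ := List.mem_map.1 h
    rw [supp_two_pow (List.mem_range.1 hi), Finset.card_singleton]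

theorem baseList_mem {k : ℕ} : ∀ a ∈ baseList (xsum e m) (wsum ω m) bud m k, a ∈ smallSets m k := by
  induction k with
  | zero =>
    intro a ha
    obtain rfl := List.mem_singleton.1 ha
    simp [mem_smallSets, supp_zero]
  | succ k ih =>
    intro y hy
    obtain ⟨a, ha, b, hb, _, _, rfl⟩ := mem_merge _ _ hy
    have h1 := mem_smallSets.1 (ih a ha)
    exact mem_smallSets.2 ⟨Nat.xor_lt_two_pow h1.1 (RAM.singles_lt hb),
      (card_supp_xor_le m a b).trans (add_le_add h1.2 (card_supp_singles hb))⟩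

theorem baseList_succ {k : ℕ} : baseList (xsum e m) (wsum ω m) bud m (k + 1) =
    merge (xsum e m) (wsum ω m) bud 1 0 1 0 (baseList (xsum e m) (wsum ω m) bud m k)
      (RAM.singles m) := rfl

theorem baseList_nodup {k : ℕ} :
    ((baseList (xsum e m) (wsum ω m) bud m k).map (xsum e m)).Nodup := by
  cases k with
  | zero => simp [baseList]
  | succ k => exact nodup_merge _ _ _ _ _ _ _ _ _

/-- A deterministic bound for the two merges that need no expectation: those of the base list, and
the one at the root. -/
theorem length_filter_events_le_mul {sig : ℕ → ℕ} {mf cf mo tg : ℕ} {A B : List ℕ} {N : ℕ}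
    (h : ∀ t, (B.filter fun b => sig b % mo = t).length ≤ N) :
    ((events sig mf cf mo tg A B).filter (·.isSome)).length ≤ A.length * N := by
  induction A with
  | nil => simp [events]
  | cons a A ih =>
    simp only [events, List.flatMap_cons, List.filter_append, List.length_append,
      List.filter_cons, Option.isSome_none, Bool.false_eq_true, if_false, List.length_cons,
      Nat.succ_mul] at ih ⊢
    rw [add_comm (A.length * N)]
    refine add_le_add ?_ ih
    split_ifs
    · refine (List.length_filter_le _ _).trans ?_
      simpa using h _
    · simp

/-- Induction by splitting off one element. Each of at most `|smallSets m w|` masks is combined with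
`m + 1` others and costs one further event for itself, whence the factor `m + 2`. -/
theorem covers_baseList {w : ℕ} (hbud : (smallSets m w).card * (m + 2) ≤ bud) :
    ∀ {k : ℕ}, k ≤ w → ∀ Y ⊆ Finset.range m, Y.card ≤ k →
      Covers e ω m (baseList (xsum e m) (wsum ω m) bud m k) Y := by
  have hpos : 1 ≤ (smallSets m w).card :=
    Finset.card_pos.2 ⟨0, mem_smallSets.2 ⟨by positivity, by simp [supp_zero]⟩⟩
  have hm : m + 2 ≤ bud := (Nat.le_mul_of_pos_left _ hpos).trans hbud
  intro k
  induction k with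
  | zero =>
    intro _ Y _ hc
    obtain rfl := Finset.card_eq_zero.1 (Nat.le_zero.1 hc)
    exact ⟨0, by simp [baseList], by simp [xsum, supp_zero], by simp [wsum, supp_zero]⟩
  | succ k ih =>
    intro hk Y hY hc
    have hlen : (baseList (xsum e m) (wsum ω m) bud m k).length ≤ (smallSets m w).card :=
      length_le_card baseList_nodup fun a ha => smallSets_mono (by omega) (baseList_mem a ha)
    have hs : (RAM.singles m).length = m + 1 := by simp [RAM.singles]
    have hE : (events (xsum e m) 1 0 1 0 (baseList (xsum e m) (wsum ω m) bud m k)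
        (RAM.singles m)).length ≤ bud := by
      rw [length_events]
      have h1 := length_filter_events_le_mul (sig := xsum e m) (mf := 1) (cf := 0) (mo := 1)
        (tg := 0) (A := baseList (xsum e m) (wsum ω m) bud m k) (B := RAM.singles m) (N := m + 1)
        fun t => (List.length_filter_le _ _).trans hs.le
      have h2 := Nat.mul_le_mul_right (m + 2) hlen
      have h3 : (baseList (xsum e m) (wsum ω m) bud m k).length * (m + 2) =
        (baseList (xsum e m) (wsum ω m) bud m k).length * (m + 1) +
          (baseList (xsum e m) (wsum ω m) bud m k).length := by ring
      omega
    rw [baseList_succ]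
    -- Smaller sets must stay covered as well; the empty set is obtained with the mask 0 among the
    -- singletons.
    rcases Y.eq_empty_or_nonempty with rfl | ⟨i, hi⟩
    · exact covers_merge (by omega) hE (Finset.Subset.refl ∅)
        (ih (by omega) ∅ (by simp) (by simp))
        ⟨0, by simp [RAM.singles], by simp [xsum, supp_zero], by simp [wsum, supp_zero]⟩
        (by rw [Nat.mod_one, Nat.mod_one]) (by rw [Nat.mod_one, Nat.mod_one])
    · have him : i < m := Finset.mem_range.1 (hY hi)
      have he : Y \ Y.erase i = {i} := Finset.sdiff_erase_self hi
      refine covers_merge (by omega) hE (Finset.erase_subset i Y)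
        (ih (by omega) _ ((Finset.erase_subset i Y).trans hY) ?_) ?_ ?_
        (by rw [Nat.mod_one, Nat.mod_one])
      · rw [Finset.card_erase_of_mem hi]; omega
      · rw [he]
        exact ⟨2 ^ i, by simp [RAM.singles, him], by rw [xsum, supp_two_pow him],
          by rw [wsum, supp_two_pow him]⟩
      · rw [Nat.mod_one, Nat.mod_one]

/-! ### The recursion -/

variable {L : ℕ}

/-- The random bits in the tree are those of a way to split the set `Y`. -/
def Good (e : ℕ → ℕ) (w : ℕ) (M : ℕ → ℕ) : (d : ℕ) → Finset ℕ → Tree L d → ℕ → Prop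
  | 0, _, _, _ => True
  | d + 1, Y, (c, l, r), tg => ∃ Z ⊆ Y, Z.card ≤ w * 2 ^ d ∧ (Y \ Z).card ≤ w * 2 ^ d ∧
      xorF e Z % M d = c % M d ∧ Good e w M d Z l c ∧ Good e w M d (Y \ Z) r (c ^^^ tg)

/-- The number of pairs that match in all nodes of the tree. -/
def work (sig : ℕ → ℕ) (m w : ℕ) (M : ℕ → ℕ) : (d : ℕ) → Tree L d → ℕ → ℕ
  | 0, _, _ => 0
  | d + 1, (c, l, r), tg => pairCount sig (smallSets m (w * 2 ^ d)) (M d) c (M (d + 1)) tg +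
      (work sig m w M d l c + work sig m w M d r (c ^^^ tg))

variable {M : ℕ → ℕ} {w : ℕ}

/-- The list computed in a node. -/
abbrev nodeList (e ω : ℕ → ℕ) (m bud w : ℕ) (M : ℕ → ℕ) (d : ℕ) (T : Tree L d) (tg : ℕ) : List ℕ :=
  node (xsum e m) (wsum ω m) bud M (baseList (xsum e m) (wsum ω m) bud m w) d T tg

theorem nodeList_mem {d : ℕ} : ∀ {T : Tree L d} {tg : ℕ}, ∀ a ∈ nodeList e ω m bud w M d T tg,
    a ∈ smallSets m (w * 2 ^ d) := by
  induction d with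
  | zero => intro T tg a ha; rw [pow_zero, mul_one]; exact baseList_mem a ha
  | succ d ih =>
    rintro ⟨c, l, r⟩ tg y hy
    obtain ⟨a, ha, b, hb, _, _, rfl⟩ := mem_merge _ _ hy
    have h1 := mem_smallSets.1 (ih a ha)
    have h2 := mem_smallSets.1 (ih b hb)
    refine mem_smallSets.2 ⟨Nat.xor_lt_two_pow h1.1 h2.1, (card_supp_xor_le m a b).trans ?_⟩
    rw [pow_succ, ← mul_assoc]
    omega

theorem nodeList_nodup {d : ℕ} {T : Tree L d} {tg : ℕ} :
    ((nodeList e ω m bud w M d T tg).map (xsum e m)).Nodup := by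
  cases d with
  | zero => exact baseList_nodup
  | succ d => obtain ⟨c, l, r⟩ := T; exact nodup_merge _ _ _ _ _ _ _ _ _

/-- Half of the budget pays for running through the first list, and half for the matching pairs. -/
theorem length_events_nodeList_le {d : ℕ} {l r : Tree L d} {c tg tg' mf mo : ℕ}
    (hA : 2 * (nodeList e ω m bud w M d l c).length ≤ bud)
    (hp : 2 * pairCount (xsum e m) (smallSets m (w * 2 ^ d)) mf c mo tg ≤ bud) :
    (events (xsum e m) mf c mo tg (nodeList e ω m bud w M d l c)
      (nodeList e ω m bud w M d r tg')).length ≤ bud := by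
  rw [length_events]
  have := length_filter_events_le (xsum e m) (mf := mf) (cf := c) (mo := mo) (tg := tg)
    (A := nodeList e ω m bud w M d l c) (B := nodeList e ω m bud w M d r tg')
    nodeList_nodup.of_map nodeList_nodup.of_map nodeList_mem nodeList_mem
  omega

/-- A merged list is no longer than the number of its matching pairs, so the bound on the work in
the subtree also bounds the list that is passed upwards. -/
theorem length_nodeList_le (hbud : 2 * (smallSets m w).card ≤ bud) {d : ℕ} :
    ∀ {T : Tree L d} {tg : ℕ}, 2 * work (xsum e m) m w M d T tg ≤ bud →
      2 * (nodeList e ω m bud w M d T tg).length ≤ bud := by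
  induction d with
  | zero =>
    intro T tg _
    have := length_le_card (baseList_nodup (e := e) (ω := ω) (bud := bud) (m := m) (k := w))
      baseList_mem
    exact (Nat.mul_le_mul_left 2 this).trans hbud
  | succ d ih =>
    rintro ⟨c, l, r⟩ tg h
    simp only [work] at h
    have hA := ih (T := l) (tg := c) (by omega)
    have hB := ih (T := r) (tg := c ^^^ tg) (by omega)
    have hE := length_events_nodeList_le (r := r) (tg := tg) (tg' := c ^^^ tg) (mf := M d)
      (mo := M (d + 1)) hA (by omega)
    have h1 := length_merge_le (xsum e m) (wsum ω m) (by omega) hE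
    have h2 := length_filter_events_le (xsum e m) (mf := M d) (cf := c) (mo := M (d + 1)) (tg := tg)
      (A := nodeList e ω m bud w M d l c) (B := nodeList e ω m bud w M d r (c ^^^ tg))
      nodeList_nodup.of_map nodeList_nodup.of_map nodeList_mem nodeList_mem
    have h3 := h1.trans h2
    refine (Nat.mul_le_mul_left 2 h3).trans ?_
    omega

theorem mod_dvd_congr {a b u v : ℕ} (h : a % v = b % v) (huv : u ∣ v) : a % u = b % u := by
  rw [← Nat.mod_mod_of_dvd a huv, h, Nat.mod_mod_of_dvd b huv]

theorem xor_mod_congr {a b a' b' k : ℕ} (h : a % 2 ^ k = a' % 2 ^ k) (h' : b % 2 ^ k = b' % 2 ^ k) :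
    (a ^^^ b) % 2 ^ k = (a' ^^^ b') % 2 ^ k := by
  rw [Nat.xor_mod_two_pow, Nat.xor_mod_two_pow, h, h']

/-- If `Y` meets its target and `Z` is one half, then the signature of the other half is forced. -/
theorem split_target {Y Z : Finset ℕ} (hZ : Z ⊆ Y) {k tg : ℕ}
    (h : xorF e Y % 2 ^ k = tg % 2 ^ k) :
    xorF e (Y \ Z) % 2 ^ k = (xorF e Z ^^^ tg) % 2 ^ k := by
  rw [xorF_sdiff e hZ, Nat.xor_comm]
  exact xor_mod_congr rfl h

/-- The recursion `Good` supplies at each node a split that agrees with the random value, and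
`covers_merge` puts the two halves together. The second half meets its target modulo `M d` because
it meets it modulo the multiple `M (d + 1)`. -/
theorem covers_nodeList (hbud : 2 * ((smallSets m w).card * (m + 2)) ≤ bud) {μ : ℕ → ℕ}
    (hM : ∀ d, M d = 2 ^ μ d) {d : ℕ} (hμ : ∀ d' < d, μ d' ≤ μ (d' + 1)) :
    ∀ {T : Tree L d} {tg : ℕ} {Y : Finset ℕ}, Y ⊆ Finset.range m → Y.card ≤ w * 2 ^ d →
      xorF e Y % M d = tg % M d → Good e w M d Y T tg →
      2 * work (xsum e m) m w M d T tg ≤ bud → Covers e ω m (nodeList e ω m bud w M d T tg) Y := by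
  have hb2 : 2 * (smallSets m w).card ≤ bud := by nlinarith
  induction d with
  | zero =>
    intro T tg Y hY hc _ _ _
    exact covers_baseList (by omega) le_rfl Y hY (by simpa using hc)
  | succ d ih =>
    rintro ⟨c, l, r⟩ tg Y hY hc ht ⟨Z, hZ, hc1, hc2, h1, hg1, hg2⟩ hwork
    simp only [work] at hwork
    have hA := length_nodeList_le (ω := ω) hb2 (T := l) (tg := c) (M := M) (e := e) (by omega)
    have hB := length_nodeList_le (ω := ω) hb2 (T := r) (tg := c ^^^ tg) (M := M) (e := e) (by omega)
    have hd : M d ∣ M (d + 1) := by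
      rw [hM, hM]; exact Nat.pow_dvd_pow 2 (hμ d (by omega))
    have h2 : xorF e (Y \ Z) % M (d + 1) = (xorF e Z ^^^ tg) % M (d + 1) := by
      rw [hM] at ht ⊢; exact split_target hZ ht
    refine covers_merge (by omega) (length_events_nodeList_le hA (by omega)) hZ
      (ih (fun d' hd' => hμ d' (by omega)) (hZ.trans hY) hc1 h1 hg1 (by omega))
      (ih (fun d' hd' => hμ d' (by omega)) (Finset.sdiff_subset.trans hY) hc2 ?_ hg2 (by omega))
      h1 h2
    rw [mod_dvd_congr h2 hd, hM]
    exact xor_mod_congr (by rwa [← hM]) rfl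

/-- The number of pairs that match in all nodes except for the root. -/
def innerWork (sig : ℕ → ℕ) (m w : ℕ) (M : ℕ → ℕ) : {d : ℕ} → Tree L d → ℕ → ℕ
  | 0, _, _ => 0
  | d + 1, (c, l, r), tg => work sig m w M d l c + work sig m w M d r (c ^^^ tg)

/-- The target of the root is not random, so the expected number of pairs there is not available. It
is not needed: full signatures are compared. -/
theorem covers_root (hbud : 2 * ((smallSets m w).card * (m + 2)) ≤ bud) {μ : ℕ → ℕ}
    (hM : ∀ d, M d = 2 ^ μ d) {d : ℕ} (hμ : ∀ d' < d + 1, μ d' ≤ μ (d' + 1))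
    (he : ∀ y, xsum e m y < M (d + 1)) {T : Tree L (d + 1)} {Y : Finset ℕ}
    (hY : Y ⊆ Finset.range m) (hg : Good e w M (d + 1) Y T (xorF e Y))
    (hwork : 2 * innerWork (xsum e m) m w M T (xorF e Y) ≤ bud) :
    Covers e ω m (nodeList e ω m bud w M (d + 1) T (xorF e Y)) Y := by
  have hb2 : 2 * (smallSets m w).card ≤ bud := by nlinarith
  obtain ⟨c, l, r⟩ := T
  obtain ⟨Z, hZ, hc1, hc2, h1, hg1, hg2⟩ := hg
  simp only [innerWork] at hwork
  have hA := length_nodeList_le (ω := ω) hb2 (T := l) (tg := c) (M := M) (e := e) (by omega)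
  have hB := length_nodeList_le (ω := ω) hb2 (T := r) (tg := c ^^^ xorF e Y) (M := M) (e := e)
    (by omega)
  have hd : M d ∣ M (d + 1) := by
    rw [hM, hM]; exact Nat.pow_dvd_pow 2 (hμ d (by omega))
  have h2 : xorF e (Y \ Z) % M (d + 1) = (xorF e Z ^^^ xorF e Y) % M (d + 1) := by
    rw [hM]; exact split_target hZ rfl
  have hE : (events (xsum e m) (M d) c (M (d + 1)) (xorF e Y) (nodeList e ω m bud w M d l c)
      (nodeList e ω m bud w M d r (c ^^^ xorF e Y))).length ≤ bud := by
    rw [length_events]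
    -- Since `M (d + 1)` exceeds all signatures and these are distinct, each element of the first
    -- list has at most one partner.
    have := length_filter_events_le_mul (sig := xsum e m) (mf := M d) (cf := c) (mo := M (d + 1))
      (tg := xorF e Y) (A := nodeList e ω m bud w M d l c)
      (B := nodeList e ω m bud w M d r (c ^^^ xorF e Y)) (N := 1) fun t => by
        have hn : ((nodeList e ω m bud w M d r (c ^^^ xorF e Y)).map (xsum e m)).Nodup :=
          nodeList_nodup
        have h5 := List.nodup_iff_count_le_one.1 hn t
        rw [List.count_eq_length_filter, List.filter_map, List.length_map] at h5
        refine le_trans (le_of_eq ?_) h5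
        congr 1
        refine List.filter_congr fun b _ => ?_
        rw [Nat.mod_eq_of_lt (he b)]
        by_cases h6 : xsum e m b = t <;> simp [h6]
    omega
  refine covers_merge (by omega) hE hZ
    (covers_nodeList hbud hM (fun d' hd' => hμ d' (by omega)) (hZ.trans hY) hc1 h1 hg1 (by omega))
    (covers_nodeList hbud hM (fun d' hd' => hμ d' (by omega)) (Finset.sdiff_subset.trans hY) hc2 ?_
      hg2 (by omega)) h1 h2
  rw [mod_dvd_congr h2 hd, hM]
  exact xor_mod_congr (by rwa [← hM]) rfl

end lists

end SplitSearch

/-! ### Random trees and random hash functions -/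

namespace SplitSearch

open scoped BigOperators

instance instFintypeTree (L : ℕ) : (d : ℕ) → Fintype (Tree L d)
  | 0 => inferInstanceAs (Fintype Unit)
  | d + 1 => by
    have := instFintypeTree L d
    exact inferInstanceAs (Fintype (Fin (2 ^ L) × Tree L d × Tree L d))

instance instNonemptyTree (L : ℕ) : (d : ℕ) → Nonempty (Tree L d)
  | 0 => inferInstanceAs (Nonempty Unit)
  | d + 1 => by
    have := instNonemptyTree L d
    exact inferInstanceAs (Nonempty (Fin (2 ^ L) × Tree L d × Tree L d))

instance instFintypePow (α : Type) [Fintype α] : (k : ℕ) → Fintype (Pow α k)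
  | 0 => inferInstanceAs (Fintype Unit)
  | k + 1 => by
    have := instFintypePow α k
    exact inferInstanceAs (Fintype (Pow α k × α))

instance instNonemptyPow (α : Type) [Nonempty α] : (k : ℕ) → Nonempty (Pow α k)
  | 0 => inferInstanceAs (Nonempty Unit)
  | k + 1 => by
    have := instNonemptyPow α k
    exact inferInstanceAs (Nonempty (Pow α k × α))

/-- The mean of a function under the uniform distribution. -/
noncomputable abbrev mean {α : Type} [Fintype α] (f : α → ℝ) : ℝ := Finset.univ.expect f

open Classical in
/-- The probability of an event under the uniform distribution. -/
noncomputable def prob {α : Type} [Fintype α] (P : α → Prop) : ℝ :=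
  mean fun a => if P a then (1 : ℝ) else 0

section basics

variable {α β : Type} [Fintype α] [Fintype β]

theorem mean_prod (f : α × β → ℝ) : mean f = mean fun a => mean fun b => f (a, b) := by
  rw [mean, ← Finset.univ_product_univ, Finset.expect_product]

theorem mean_mono {f g : α → ℝ} (h : ∀ a, f a ≤ g a) : mean f ≤ mean g :=
  Finset.expect_le_expect fun a _ => h a

theorem mean_nonneg {f : α → ℝ} (h : ∀ a, 0 ≤ f a) : 0 ≤ mean f :=
  Finset.expect_nonneg fun a _ => h a

theorem mean_sum {ι : Type} (s : Finset ι) (f : ι → α → ℝ) :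
    mean (fun a => ∑ i ∈ s, f i a) = ∑ i ∈ s, mean (f i) := by
  rw [mean, Finset.expect_sum_comm]

theorem mean_mul_left (c : ℝ) (f : α → ℝ) : mean (fun a => c * f a) = c * mean f :=
  (Finset.mul_expect _ _ _).symm

theorem mean_mul_right (c : ℝ) (f : α → ℝ) : mean (fun a => f a * c) = mean f * c :=
  (Finset.expect_mul _ _ _).symm

theorem mean_add (f g : α → ℝ) : mean (fun a => f a + g a) = mean f + mean g :=
  Finset.expect_add_distrib _ _ _

theorem mean_sub (f g : α → ℝ) : mean (fun a => f a - g a) = mean f - mean g :=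
  Finset.expect_sub_distrib _ _ _

theorem mean_const [Nonempty α] (c : ℝ) : mean (fun _ : α => c) = c := Fintype.expect_const c

theorem mean_comm (f : α → β → ℝ) :
    (mean fun a => mean fun b => f a b) = mean fun b => mean fun a => f a b :=
  Finset.expect_comm _ _ _

theorem mean_equiv (e : α ≃ β) (f : β → ℝ) : mean (fun a => f (e a)) = mean f :=
  Fintype.expect_equiv e _ _ fun _ => rfl

theorem mean_tree {L d : ℕ} (f : Tree L (d + 1) → ℝ) :
    mean f = mean fun c : Fin (2 ^ L) => mean fun l : Tree L d => mean fun r : Tree L d =>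
      f (c, l, r) := by
  refine (mean_prod (α := Fin (2 ^ L)) (β := Tree L d × Tree L d) f).trans ?_
  exact congrArg mean (funext fun c => mean_prod _)

theorem prob_eq_mean (P : α → Prop) [DecidablePred P] :
    prob P = mean fun a => if P a then (1 : ℝ) else 0 :=
  congrArg mean (funext fun a => by by_cases h : P a <;> simp [h])

theorem prob_nonneg (P : α → Prop) : 0 ≤ prob P :=
  mean_nonneg fun a => by split_ifs <;> norm_num

theorem prob_mono {P Q : α → Prop} (h : ∀ a, P a → Q a) : prob P ≤ prob Q :=
  mean_mono fun a => by
    by_cases h1 : P a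
    · simp [h1, h a h1]
    · rw [if_neg h1]; split_ifs <;> norm_num

theorem prob_le_sum {ι : Type} (s : Finset ι) {P : α → Prop} {Q : ι → α → Prop}
    (h : ∀ a, P a → ∃ i ∈ s, Q i a) : prob P ≤ ∑ i ∈ s, prob (Q i) := by
  classical
  refine le_trans ?_ (mean_sum s fun i a => if Q i a then (1 : ℝ) else 0).le
  refine mean_mono fun a => ?_
  have h0 : ∀ i ∈ s, (0 : ℝ) ≤ if Q i a then 1 else 0 := fun i _ => by split_ifs <;> norm_num
  by_cases h1 : P a
  · obtain ⟨i, hi, hq⟩ := h a h1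
    refine le_trans ?_ (Finset.single_le_sum h0 hi)
    simp [h1, hq]
  · rw [if_neg h1]; exact Finset.sum_nonneg h0

theorem prob_eq_card_div (P : α → Prop) [DecidablePred P] :
    prob P = (Finset.univ.filter P).card / Fintype.card α := by
  rw [prob, mean, Finset.expect_eq_sum_div_card, Finset.card_univ]
  congr 1
  rw [Finset.card_filter]
  push_cast
  exact Finset.sum_congr rfl fun a _ => by split_ifs <;> rfl

/-- Markov's inequality. -/
theorem prob_lt_le (f : α → ℝ) (hf : ∀ a, 0 ≤ f a) {c : ℝ} (hc : 0 < c) :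
    prob (fun a => c < f a) ≤ mean f / c := by
  rw [mean, Finset.expect_div]
  refine mean_mono fun a => ?_
  split_ifs with h
  · rw [le_div_iff₀ hc]; linarith
  · exact div_nonneg (hf a) hc.le

theorem prob_and_ge (P Q : α → Prop) : prob P - prob (fun a => ¬ Q a) ≤ prob fun a => P a ∧ Q a := by
  rw [sub_le_iff_le_add, prob, prob, prob, ← mean_add]
  refine mean_mono fun a => ?_
  by_cases h1 : P a <;> by_cases h2 : Q a <;> simp [h1, h2]

theorem prob_prod_mul (P : α → Prop) (Q : β → Prop) :
    prob (fun x : α × β => P x.1 ∧ Q x.2) = prob P * prob Q := by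
  rw [prob, mean_prod, prob, prob, ← mean_mul_right]
  refine congrArg mean (funext fun a => ?_)
  by_cases h : P a
  · rw [if_pos h, one_mul]
    exact congrArg mean (funext fun b => by by_cases h' : Q b <;> simp [h, h'])
  · rw [if_neg h, zero_mul]
    exact (congrArg mean (funext fun b => if_neg fun h' => h h'.1)).trans
      (Finset.expect_const_zero _)

end basics

/-- A random number is equidistributed modulo a power of two. -/
theorem prob_mod {L k : ℕ} (hk : k ≤ L) (s : ℕ) :
    prob (fun c : Fin (2 ^ L) => s % 2 ^ k = c % 2 ^ k) = 1 / 2 ^ k := by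
  classical
  rw [prob_eq_card_div, Fintype.card_fin]
  have h1 : (Finset.univ.filter fun c : Fin (2 ^ L) => s % 2 ^ k = c % 2 ^ k).card =
      Nat.count (· ≡ s [MOD 2 ^ k]) (2 ^ L) := by
    rw [Nat.count_eq_card_filter_range, Finset.card_filter, Finset.card_filter,
      ← Fin.sum_univ_eq_sum_range (fun i => if i ≡ s [MOD 2 ^ k] then 1 else 0)]
    exact Finset.sum_congr rfl fun c _ => by simp only [Nat.ModEq, eq_comm]
  rw [h1, Nat.count_modEq_card _ (by positivity)]
  have h2 : (2 : ℕ) ^ L = 2 ^ k * 2 ^ (L - k) := by rw [← pow_add]; congr 1; omega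
  have h3 : 2 ^ L % 2 ^ k = 0 := by rw [h2]; exact Nat.mul_mod_right _ _
  have h4 : 2 ^ L / 2 ^ k = 2 ^ (L - k) := by
    rw [h2]; exact Nat.mul_div_cancel_left _ (by positivity)
  rw [h3, h4, if_neg (by omega), add_zero, h2]
  push_cast
  field_simp

/-! ### The probability that the random bits of a tree are good -/

section good

variable {e : ℕ → ℕ} {w L : ℕ} {M : ℕ → ℕ}

/-- The ways to split the set `Y` into two halves of bounded size. -/
def splits (w d : ℕ) (Y : Finset ℕ) : Finset (Finset ℕ) :=
  Y.powerset.filter fun Z => Z.card ≤ w * 2 ^ d ∧ (Y \ Z).card ≤ w * 2 ^ d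

/-- The signatures of the subsets of `Y` are distinct modulo `N`. -/
def Separates (e : ℕ → ℕ) (N : ℕ) (Y : Finset ℕ) : Prop :=
  ∀ Z ⊆ Y, ∀ Z' ⊆ Y, xorF e Z % N = xorF e Z' % N → Z = Z'

open Classical in
/-- A lower bound for the probability that a tree is good. -/
noncomputable def goodMass (e : ℕ → ℕ) (w : ℕ) (M : ℕ → ℕ) : ℕ → Finset ℕ → ℝ
  | 0, _ => 1
  | d + 1, Y => if Separates e (M d) Y then
      ∑ Z ∈ splits w d Y, goodMass e w M d Z * goodMass e w M d (Y \ Z) / M d else 0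

/-- The value of `goodMass` for an injective hash function. -/
noncomputable def splitMass (w : ℕ) (M : ℕ → ℕ) : ℕ → Finset ℕ → ℝ
  | 0, _ => 1
  | d + 1, Y => ∑ Z ∈ splits w d Y, splitMass w M d Z * splitMass w M d (Y \ Z) / M d

theorem goodMass_nonneg (d : ℕ) (Y : Finset ℕ) : 0 ≤ goodMass e w M d Y := by
  induction d generalizing Y with
  | zero => exact zero_le_one
  | succ d ih =>
    rw [goodMass]
    split_ifs
    · exact Finset.sum_nonneg fun Z _ => div_nonneg (mul_nonneg (ih _) (ih _)) (Nat.cast_nonneg _)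
    · exact le_rfl

theorem splitMass_nonneg (d : ℕ) (Y : Finset ℕ) : 0 ≤ splitMass w M d Y := by
  induction d generalizing Y with
  | zero => exact zero_le_one
  | succ d ih =>
    exact Finset.sum_nonneg fun Z _ => div_nonneg (mul_nonneg (ih _) (ih _)) (Nat.cast_nonneg _)

theorem goodMass_le (d : ℕ) (Y : Finset ℕ) : goodMass e w M d Y ≤ splitMass w M d Y := by
  induction d generalizing Y with
  | zero => exact le_rfl
  | succ d ih =>
    rw [goodMass]
    split_ifs
    · refine Finset.sum_le_sum fun Z _ => ?_
      have := mul_le_mul (ih Z) (ih (Y \ Z)) (goodMass_nonneg _ _) (splitMass_nonneg _ _)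
      gcongr
    · exact splitMass_nonneg (d + 1) Y

/-- The random number at the node agrees with a given `Z` with probability `1 / M d`, and the
subtrees are independent of it and of each other. If the signatures separate the subsets of `Y`, no
two splits agree with the same number, so the probabilities add up. -/
theorem goodMass_le_prob {μ : ℕ → ℕ} {d : ℕ} (hM : ∀ d' < d, M d' = 2 ^ μ d')
    (hμ : ∀ d' < d, μ d' ≤ L) : ∀ (Y : Finset ℕ) (tg : ℕ),
    goodMass e w M d Y ≤ prob fun T : Tree L d => Good e w M d Y T tg := by
  induction d with
  | zero =>
    intro Y tg
    exact (mean_const (α := Tree L 0) 1).ge.trans (mean_mono fun T => by simp [Good])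
  | succ d ih =>
    intro Y tg
    specialize ih (fun d' hd' => hM d' (by omega)) (fun d' hd' => hμ d' (by omega))
    rw [goodMass]
    split_ifs with hs
    swap
    · exact prob_nonneg _
    classical
    calc ∑ Z ∈ splits w d Y, goodMass e w M d Z * goodMass e w M d (Y \ Z) / M d
        ≤ ∑ Z ∈ splits w d Y, mean fun T : Tree L (d + 1) =>
          if xorF e Z % M d = (T.1 : ℕ) % M d ∧ Good e w M d Z T.2.1 T.1 ∧
            Good e w M d (Y \ Z) T.2.2 (T.1 ^^^ tg) then (1 : ℝ) else 0 := by
          refine Finset.sum_le_sum fun Z _ => ?_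
          rw [mean_tree, mul_div_assoc, div_eq_mul_one_div, ← mul_assoc, hM d (by omega)]
          push_cast
          rw [← prob_mod (hμ d (by omega)) (xorF e Z), prob, ← mean_mul_left]
          refine mean_mono fun c => ?_
          by_cases hc : xorF e Z % 2 ^ μ d = (c : ℕ) % 2 ^ μ d
          · rw [if_pos hc, mul_one]
            refine (mul_le_mul (ih Z c) (ih (Y \ Z) (c ^^^ tg)) (goodMass_nonneg _ _)
              (prob_nonneg _)).trans (le_of_eq ?_)
            rw [← prob_prod_mul, prob, mean_prod]
            refine congrArg mean (funext fun l => congrArg mean (funext fun r => ?_))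
            simp only [hc, true_and]
            congr
          · rw [if_neg hc, mul_zero]
            exact mean_nonneg fun l => mean_nonneg fun r => by split_ifs <;> norm_num
      _ = mean fun T : Tree L (d + 1) => ∑ Z ∈ splits w d Y,
          if xorF e Z % M d = (T.1 : ℕ) % M d ∧ Good e w M d Z T.2.1 T.1 ∧
            Good e w M d (Y \ Z) T.2.2 (T.1 ^^^ tg) then (1 : ℝ) else 0 := (mean_sum _ _).symm
      _ ≤ prob fun T : Tree L (d + 1) => Good e w M (d + 1) Y T tg := by
          refine mean_mono fun T => ?_
          obtain ⟨c, l, r⟩ := T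
          by_cases h : ∃ Z ∈ splits w d Y, xorF e Z % M d = (c : ℕ) % M d ∧ Good e w M d Z l c ∧
            Good e w M d (Y \ Z) r (c ^^^ tg)
          · obtain ⟨Z, hZ, h1⟩ := h
            have hZ' := Finset.mem_filter.1 hZ
            have hZY := Finset.mem_powerset.1 hZ'.1
            -- By separation the random number determines the split, so a single indicator survives.
            rw [Finset.sum_eq_single_of_mem Z hZ fun Z' hZ1 hne => if_neg fun h2 => hne
              (hs _ (Finset.mem_powerset.1 (Finset.mem_filter.1 hZ1).1) _ hZY (h2.1.trans h1.1.symm))]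
            rw [if_pos (show Good e w M (d + 1) Y (c, l, r) tg from
              ⟨Z, hZY, hZ'.2.1, hZ'.2.2, h1⟩)]
            split_ifs <;> norm_num
          · rw [Finset.sum_eq_zero fun Z hZ => if_neg fun h1 => h ⟨Z, hZ, h1⟩]
            split_ifs <;> norm_num

end good

end SplitSearch

namespace SplitSearch

/-! ### The random hash function separates the subsets of a small set -/

theorem parity_two_pow {n i : ℕ} (h : i < n) : parity n (2 ^ i) = 1 := by
  have h1 : ∀ k, parity k (2 ^ i) = if i < k then 1 else 0 := by
    intro k
    induction k with
    | zero => simp [parity]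
    | succ k ih =>
      rw [parity, ih, Nat.add_mod, div_two_pow_mod_two, Nat.testBit_two_pow]
      by_cases h1 : i < k
      · simp [h1, show i < k + 1 by omega, show i ≠ k by omega]
      · by_cases h2 : i = k
        · simp [h2]
        · simp [h1, h2, show ¬ i < k + 1 by omega]
  rw [h1, if_pos h]

/-- Exclusive or with a fixed number. -/
def xorEquiv {L : ℕ} (a : Fin (2 ^ L)) : Fin (2 ^ L) ≃ Fin (2 ^ L) where
  toFun v := ⟨v ^^^ a, Nat.xor_lt_two_pow v.2 a.2⟩
  invFun v := ⟨v ^^^ a, Nat.xor_lt_two_pow v.2 a.2⟩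
  left_inv v := Fin.ext (by simp)
  right_inv v := Fin.ext (by simp)

/-- Some bit `i` of `z` is set. Flipping bit `i` of `v` is a measure-preserving involution that
changes the parity, so both parities are equally likely. -/
theorem prob_parity {n z : ℕ} (hz : z < 2 ^ n) (h0 : z ≠ 0) :
    prob (fun v : Fin (2 ^ n) => parity n (v &&& z) = 0) = 1 / 2 := by
  obtain ⟨i, hi⟩ : ∃ i, z.testBit i = true := by
    by_contra h
    push Not at h
    exact h0 (Nat.eq_of_testBit_eq fun i => by simpa using h i)
  have hin : i < n := by
    by_contra h
    rw [Nat.testBit_lt_two_pow (hz.trans_le (Nat.pow_le_pow_right (by norm_num) (by omega)))] at hi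
    simp at hi
  have h1 : 2 ^ i &&& z = 2 ^ i := by
    rw [Nat.and_comm, Nat.and_two_pow, hi]; simp
  have h2 : ∀ v : Fin (2 ^ n), (if parity n ((xorEquiv ⟨2 ^ i,
      Nat.pow_lt_pow_right (by norm_num) hin⟩ v : Fin (2 ^ n)) &&& z) = 0 then (1 : ℝ) else 0) =
      1 - if parity n (v &&& z) = 0 then (1 : ℝ) else 0 := by
    intro v
    have h3 : parity n ((v ^^^ 2 ^ i) &&& z) = parity n (v &&& z) ^^^ 1 := by
      rw [Nat.and_xor_distrib_right, h1, parity_xor, parity_two_pow hin]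
    have h4 := parity_lt n (v &&& z)
    simp only [xorEquiv, Equiv.coe_fn_mk, h3]
    interval_cases parity n (v &&& z) <;> simp
  classical
  have h5 := mean_equiv (xorEquiv ⟨2 ^ i, Nat.pow_lt_pow_right (by norm_num) hin⟩)
    (fun v : Fin (2 ^ n) => if parity n (v &&& z) = 0 then (1 : ℝ) else 0)
  simp only [h2] at h5
  rw [mean_sub, mean_const] at h5
  rw [prob_eq_mean]
  linarith

/-- The lowest `k` digits are the values of `k` independent functionals, each of which vanishes at
`z` with probability one half. -/
theorem prob_hash {n z : ℕ} (hz : z < 2 ^ n) (h0 : z ≠ 0) : ∀ {L k : ℕ}, k ≤ L →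
    prob (fun H : Pow (Fin (2 ^ n)) L => hash n L H z % 2 ^ k = 0) ≤ 1 / 2 ^ k := by
  intro L
  induction L with
  | zero =>
    intro k hk
    obtain rfl : k = 0 := by omega
    refine (mean_mono fun a => ?_).trans (mean_const (α := Pow (Fin (2 ^ n)) 0) (1 / 2 ^ 0)).le
    split_ifs <;> norm_num
  | succ L ih =>
    intro k hk
    cases k with
    | zero =>
      refine (mean_mono fun a => ?_).trans
        (mean_const (α := Pow (Fin (2 ^ n)) (L + 1)) (1 / 2 ^ 0)).le
      split_ifs <;> norm_num
    | succ k =>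
      have h1 : ∀ H : Pow (Fin (2 ^ n)) (L + 1), hash n (L + 1) H z % 2 ^ (k + 1) = 0 →
          hash n L H.1 z % 2 ^ k = 0 ∧ parity n (H.2 &&& z) = 0 := by
        intro H h
        have hp := parity_lt n (H.2 &&& z)
        rw [hash_succ, pow_succ'] at h
        have h2 : (2 * hash n L H.1 z + parity n (H.2 &&& z)) % 2 = 0 := by
          rw [← Nat.mod_mod_of_dvd _ (Dvd.intro (2 ^ k) rfl), h]
        have h3 : parity n (H.2 &&& z) = 0 := by omega
        rw [h3, add_zero, Nat.mul_mod_mul_left] at h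
        exact ⟨by omega, h3⟩
      refine (prob_mono h1).trans ?_
      rw [show prob (fun H : Pow (Fin (2 ^ n)) (L + 1) => hash n L H.1 z % 2 ^ k = 0 ∧
          parity n (H.2 &&& z) = 0) = prob (fun H : Pow (Fin (2 ^ n)) L =>
          hash n L H z % 2 ^ k = 0) * prob (fun v : Fin (2 ^ n) => parity n (v &&& z) = 0) from
        prob_prod_mul (α := Pow (Fin (2 ^ n)) L) (β := Fin (2 ^ n))
          (fun H => hash n L H z % 2 ^ k = 0) (fun v => parity n (v &&& z) = 0), prob_parity hz h0]
      calc _ ≤ 1 / 2 ^ k * (1 / 2 : ℝ) := by gcongr; exact ih (by omega)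
        _ = _ := by rw [pow_succ]; ring

variable {n L m : ℕ} {col : ℕ → ℕ}

/-- The columns in `Y` are linearly independent. -/
def Indep (col : ℕ → ℕ) (Y : Finset ℕ) : Prop := ∀ U ⊆ Y, xorF col U = 0 → U = ∅

theorem xorF_hash (H : Pow (Fin (2 ^ n)) L) (S : Finset ℕ) :
    xorF (fun i => hash n L H (col i)) S = hash n L H (xorF col S) := by
  induction S using Finset.induction_on with
  | empty => exact (hash_zero H).symm
  | insert i S hi ih => rw [xorF_insert _ hi, xorF_insert _ hi, hash_xor, ih]

/-- If two subsets collide, their symmetric difference is nonempty and hashes to zero. Its column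
sum is nonzero by independence, so `prob_hash` and a union bound over the subsets of `Y` apply. -/
theorem prob_not_separates {Y : Finset ℕ} (hc : ∀ i ∈ Y, col i < 2 ^ n) (hY : Indep col Y) {k : ℕ}
    (hk : k ≤ L) : prob (fun H : Pow (Fin (2 ^ n)) L =>
      ¬ Separates (fun i => hash n L H (col i)) (2 ^ k) Y) ≤ 2 ^ Y.card / 2 ^ k := by
  classical
  refine (prob_le_sum (Y.powerset.erase ∅) (Q := fun U H =>
    hash n L H (xorF col U) % 2 ^ k = 0) fun H h => ?_).trans ?_
  · simp only [Separates, not_forall] at h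
    obtain ⟨Z, hZ, Z', hZ', h1, h2⟩ := h
    refine ⟨symmDiff Z Z', ?_, ?_⟩
    · rw [Finset.mem_erase, Finset.mem_powerset]
      refine ⟨fun h => h2 (symmDiff_eq_bot.1 h), ?_⟩
      exact Finset.union_subset (Finset.sdiff_subset.trans hZ) (Finset.sdiff_subset.trans hZ')
    · rw [← xorF_hash, xorF_symmDiff, Nat.xor_mod_two_pow, h1, Nat.xor_self]
  · calc ∑ U ∈ Y.powerset.erase ∅, prob (fun H : Pow (Fin (2 ^ n)) L =>
          hash n L H (xorF col U) % 2 ^ k = 0)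
        ≤ ∑ U ∈ Y.powerset.erase ∅, (1 / 2 ^ k : ℝ) := by
          refine Finset.sum_le_sum fun U hU => ?_
          rw [Finset.mem_erase, Finset.mem_powerset] at hU
          exact prob_hash (xorF_lt _ _ _ fun i hi => hc i (hU.2 hi))
            (fun h => hU.1 (hY U hU.2 h)) hk
      _ = (Y.powerset.erase ∅).card * (1 / 2 ^ k : ℝ) := by rw [Finset.sum_const, nsmul_eq_mul]
      _ ≤ 2 ^ Y.card * (1 / 2 ^ k : ℝ) := by
          gcongr
          have := Finset.card_erase_le (s := Y.powerset) (a := ∅)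
          rw [Finset.card_powerset] at this
          exact_mod_cast this
      _ = _ := by ring

/-! ### The mass of the splits and the part of it that survives hashing -/

section mass

variable {w : ℕ} {M : ℕ → ℕ}

/-- The fraction of the mass that is lost because the hash function is not injective. -/
noncomputable def loss : ℕ → ℝ
  | 0 => 0
  | d + 1 => 1 / 2 ^ 7 + 2 * loss d

/-- At a node, mass is lost if the subsets of `Y` are not separated, which has probability at most
`2 ^ (-7)`, and through the losses of the two halves. These add up by linearity of expectation,
although all nodes share one hash function; no independence is used. -/
theorem mean_goodMass_ge {d : ℕ} (hM : ∀ d' < d, M d' = 2 ^ (2 * (w * 2 ^ d') + 7))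
    (hL : ∀ d' < d, 2 * (w * 2 ^ d') + 7 ≤ L) : ∀ Y : Finset ℕ, Y.card ≤ w * 2 ^ d →
    (∀ i ∈ Y, col i < 2 ^ n) → Indep col Y →
    mean (fun H : Pow (Fin (2 ^ n)) L => splitMass w M d Y -
      goodMass (fun i => hash n L H (col i)) w M d Y) ≤ loss d * splitMass w M d Y := by
  induction d with
  | zero =>
    intro Y _ _ _
    simp only [splitMass, goodMass, sub_self, loss, zero_mul]
    exact (Finset.expect_const_zero _).le
  | succ d ih =>
    intro Y hc hcol hY
    specialize ih (fun d' hd' => hM d' (by omega)) (fun d' hd' => hL d' (by omega))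
    classical
    have hS := splitMass_nonneg (w := w) (M := M)
    have hG := fun H : Pow (Fin (2 ^ n)) L =>
      goodMass_nonneg (e := fun i => hash n L H (col i)) (w := w) (M := M)
    have hle := fun H : Pow (Fin (2 ^ n)) L =>
      goodMass_le (e := fun i => hash n L H (col i)) (w := w) (M := M)
    set G : Pow (Fin (2 ^ n)) L → ℕ → Finset ℕ → ℝ :=
      fun H => goodMass (fun i => hash n L H (col i)) w M with hGdef
    set N := splitMass w M with hN
    -- For each split, with `N'` and `G'` for the complementary half: `N N' - G G' ≤ (N - G) N' +
    -- (N' - G') N`, the difference being `(N - G) (N' - G') ≥ 0`.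
    have hpt : ∀ H : Pow (Fin (2 ^ n)) L, N (d + 1) Y - G H (d + 1) Y ≤
        (if ¬ Separates (fun i => hash n L H (col i)) (M d) Y then 1 else 0) * N (d + 1) Y +
        ∑ Z ∈ splits w d Y, ((N d Z - G H d Z) * (N d (Y \ Z) / M d) +
          (N d (Y \ Z) - G H d (Y \ Z)) * (N d Z / M d)) := by
      intro H
      have hnn : 0 ≤ ∑ Z ∈ splits w d Y, ((N d Z - G H d Z) * (N d (Y \ Z) / M d) +
          (N d (Y \ Z) - G H d (Y \ Z)) * (N d Z / M d)) := by
        refine Finset.sum_nonneg fun Z _ => ?_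
        have h1 := sub_nonneg.2 (hle H d Z)
        have h2 := sub_nonneg.2 (hle H d (Y \ Z))
        have h3 := hS d Z
        have h4 := hS d (Y \ Z)
        positivity
      by_cases hs : Separates (fun i => hash n L H (col i)) (M d) Y
      · rw [if_neg (not_not.2 hs), zero_mul, zero_add]
        simp only [hGdef, hN, goodMass, splitMass, if_pos hs]
        rw [← Finset.sum_sub_distrib]
        refine Finset.sum_le_sum fun Z _ => ?_
        have h1 := hle H d Z
        have h2 := hle H d (Y \ Z)
        have h3 := hG H d Z
        have h4 := hG H d (Y \ Z)
        have h5 : (0 : ℝ) ≤ (M d : ℝ)⁻¹ := by positivity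
        simp only [div_eq_mul_inv, hN]
        have h6 : (N d Z - G H d Z) * (N d (Y \ Z) - G H d (Y \ Z)) ≥ 0 :=
          mul_nonneg (sub_nonneg.2 h1) (sub_nonneg.2 h2)
        have h7 := mul_nonneg h6 h5
        simp only [hGdef, hN] at h7
        nlinarith [h7]
      · rw [if_pos hs, one_mul]
        have := hG H (d + 1) Y
        simp only [hGdef] at *
        linarith
    refine (mean_mono hpt).trans ?_
    rw [mean_add, mean_mul_right, mean_sum]
    simp only [mean_add, mean_mul_right]
    have h1 : mean (fun H : Pow (Fin (2 ^ n)) L =>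
        if ¬ Separates (fun i => hash n L H (col i)) (M d) Y then (1 : ℝ) else 0) ≤ 1 / 2 ^ 7 := by
      have h2 := prob_not_separates (L := L) hcol hY (hL d (by omega))
      rw [hM d (by omega)]
      rw [prob_eq_mean] at h2
      refine h2.trans ?_
      · rw [div_le_div_iff₀ (by positivity) (by positivity), one_mul, ← pow_add]
        refine pow_le_pow_right₀ (by norm_num) ?_
        rw [pow_succ, ← mul_assoc] at hc
        omega
    have h3 : ∀ Z ∈ splits w d Y,
        mean (fun H : Pow (Fin (2 ^ n)) L => N d Z - G H d Z) * (N d (Y \ Z) / M d) +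
          mean (fun H : Pow (Fin (2 ^ n)) L => N d (Y \ Z) - G H d (Y \ Z)) * (N d Z / M d) ≤
        2 * loss d * (N d Z * N d (Y \ Z) / M d) := by
      intro Z hZ
      have hZ1 := Finset.mem_filter.1 hZ
      have hZY := Finset.mem_powerset.1 hZ1.1
      have i1 := ih Z hZ1.2.1 (fun i hi => hcol i (hZY hi)) fun U hU => hY U (hU.trans hZY)
      have i2 := ih (Y \ Z) hZ1.2.2 (fun i hi => hcol i (Finset.sdiff_subset hi))
        fun U hU => hY U (hU.trans Finset.sdiff_subset)
      have j1 : 0 ≤ N d (Y \ Z) / M d := div_nonneg (hS d _) (Nat.cast_nonneg _)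
      have j2 : 0 ≤ N d Z / M d := div_nonneg (hS d _) (Nat.cast_nonneg _)
      calc _ ≤ loss d * N d Z * (N d (Y \ Z) / M d) + loss d * N d (Y \ Z) * (N d Z / M d) :=
            add_le_add (mul_le_mul_of_nonneg_right i1 j1) (mul_le_mul_of_nonneg_right i2 j2)
        _ = _ := by ring
    refine (add_le_add (mul_le_mul_of_nonneg_right h1 (hS (d + 1) Y))
      (Finset.sum_le_sum h3)).trans (le_of_eq ?_)
    rw [← Finset.mul_sum]
    simp only [hN, splitMass, loss]
    ring

/-- The exactly balanced subsets suffice: the middle binomial coefficient is the largest of the `|Y|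
+ 1` that sum to `2 ^ |Y|`. -/
theorem card_splits_ge {d : ℕ} {Y : Finset ℕ} (h1 : Y.card ≤ w * 2 ^ (d + 1)) :
    2 ^ Y.card ≤ (Y.card + 1) * (splits w d Y).card := by
  have h2 : (Y.powersetCard (Y.card / 2)) ⊆ splits w d Y := by
    intro Z hZ
    rw [Finset.mem_powersetCard] at hZ
    rw [pow_succ, ← mul_assoc] at h1
    refine Finset.mem_filter.2 ⟨Finset.mem_powerset.2 hZ.1, by omega, ?_⟩
    rw [Finset.card_sdiff_of_subset hZ.1]
    omega
  have h3 := Finset.card_le_card h2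
  rw [Finset.card_powersetCard] at h3
  calc 2 ^ Y.card = ∑ i ∈ Finset.range (Y.card + 1), Y.card.choose i :=
        (Nat.sum_range_choose _).symm
    _ ≤ ∑ i ∈ Finset.range (Y.card + 1), Y.card.choose (Y.card / 2) :=
        Finset.sum_le_sum fun i _ => Nat.choose_le_middle i _
    _ = (Y.card + 1) * Y.card.choose (Y.card / 2) := by simp
    _ ≤ _ := Nat.mul_le_mul_left _ h3

/-- Each of the `2 ^ d - 1` inner nodes costs a factor of the number of splits over `M d`. The
deficit of at most 15 against the full size `w * 2 ^ d` is inherited by both halves, since neither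
half exceeds its own full size. -/
theorem splitMass_ge {X : ℕ} {d : ℕ} (hM : ∀ d' < d, M d' = 2 ^ (2 * (w * 2 ^ d') + 7))
    (hX : w * 2 ^ d + 1 ≤ X) : ∀ Y : Finset ℕ, Y.card ≤ w * 2 ^ d → w * 2 ^ d ≤ Y.card + 15 →
    (1 / (2 ^ 22 * X : ℝ)) ^ (2 ^ d - 1) ≤ splitMass w M d Y := by
  induction d with
  | zero => intro Y _ _; simp [splitMass]
  | succ d ih =>
    intro Y hc1 hc2
    have hd : w * 2 ^ d * 2 = w * 2 ^ (d + 1) := by rw [pow_succ, mul_assoc]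
    specialize ih (fun d' hd' => hM d' (by omega)) (by omega)
    have hXpos : (0 : ℝ) < X := by exact_mod_cast (by omega : 0 < X)
    set a : ℝ := 1 / (2 ^ 22 * X : ℝ) with ha
    have hapos : 0 < a := by positivity
    have h1 : ∀ Z ∈ splits w d Y, a ^ (2 ^ d - 1) * a ^ (2 ^ d - 1) / M d ≤
        splitMass w M d Z * splitMass w M d (Y \ Z) / M d := by
      intro Z hZ
      have hZ1 := Finset.mem_filter.1 hZ
      have hZY := Finset.mem_powerset.1 hZ1.1
      have hcard := Finset.card_sdiff_add_card_eq_card hZY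
      have i1 := ih Z hZ1.2.1 (by omega)
      have i2 := ih (Y \ Z) hZ1.2.2 (by omega)
      have := splitMass_nonneg (w := w) (M := M) d Z
      gcongr
    refine le_trans ?_ (Finset.sum_le_sum h1)
    rw [Finset.sum_const, nsmul_eq_mul, hM d (by omega)]
    have h2 : a ≤ (splits w d Y).card / (2 ^ (2 * (w * 2 ^ d) + 7) : ℝ) := by
      rw [ha, div_le_div_iff₀ (by positivity) (by positivity), one_mul]
      have h3 := card_splits_ge hc1
      have h4 : 2 ^ (2 * (w * 2 ^ d) + 7) ≤ (splits w d Y).card * (2 ^ 22 * X) := by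
        -- The 22 is the deficit 15 plus the 7 extra bits of the modulus.
        calc 2 ^ (2 * (w * 2 ^ d) + 7) ≤ 2 ^ (Y.card + 22) :=
              Nat.pow_le_pow_right (by norm_num) (by omega)
          _ = 2 ^ Y.card * 2 ^ 22 := by rw [pow_add]
          _ ≤ (Y.card + 1) * (splits w d Y).card * 2 ^ 22 := Nat.mul_le_mul_right _ h3
          _ ≤ X * (splits w d Y).card * 2 ^ 22 := by gcongr; omega
          _ = _ := by ring
      exact_mod_cast h4
    have h5 : 2 ^ (d + 1) - 1 = (2 ^ d - 1) + (2 ^ d - 1) + 1 := by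
      have := Nat.one_le_two_pow (n := d); rw [pow_succ]; omega
    rw [h5, pow_succ, pow_add]
    push_cast
    calc a ^ (2 ^ d - 1) * a ^ (2 ^ d - 1) * a
        ≤ a ^ (2 ^ d - 1) * a ^ (2 ^ d - 1) *
          ((splits w d Y).card / (2 ^ (2 * (w * 2 ^ d) + 7) : ℝ)) := by gcongr
      _ = _ := by ring

end mass

/-! ### The expected work -/

/-- All moduli divide `2 ^ L`, so a target with more digits may be replaced by its residue, over
which one can average. -/
theorem work_congr {sig : ℕ → ℕ} {w : ℕ} {M μ : ℕ → ℕ} {d : ℕ} (hM : ∀ d' ≤ d, M d' = 2 ^ μ d')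
    (hμ : ∀ d' ≤ d, μ d' ≤ L) : ∀ {T : Tree L d} {t t' : ℕ}, t % 2 ^ L = t' % 2 ^ L →
    work sig m w M d T t = work sig m w M d T t' := by
  induction d with
  | zero => intros; rfl
  | succ d ih =>
    rintro ⟨c, l, r⟩ t t' h
    have h1 : ∀ a, (sig a ^^^ t) % M (d + 1) = (sig a ^^^ t') % M (d + 1) := fun a => by
      rw [hM _ le_rfl]
      exact xor_mod_congr rfl (mod_dvd_congr h (Nat.pow_dvd_pow 2 (hμ _ le_rfl)))
    simp only [work, pairCount, h1]
    rw [ih (fun d' hd' => hM d' (by omega)) (fun d' hd' => hμ d' (by omega))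
      (t := c ^^^ t) (t' := c ^^^ t') (xor_mod_congr rfl h)]

/-- A fixed pair matches if its first signature agrees with `c` and the exclusive or of both agrees
with `t`. For independent uniform `c` and `t` these conditions are independent; no randomness of the
signatures is needed. -/
theorem mean_pairCount {sig : ℕ → ℕ} {D : Finset ℕ} {k k' : ℕ} (hk : k ≤ L) (hk' : k' ≤ L) :
    (mean fun t : Fin (2 ^ L) => mean fun c : Fin (2 ^ L) =>
      (pairCount sig D (2 ^ k) c (2 ^ k') t : ℝ)) = (D.card : ℝ) ^ 2 / (2 ^ k * 2 ^ k') := by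
  classical
  have h1 : ∀ t c : Fin (2 ^ L), (pairCount sig D (2 ^ k) c (2 ^ k') t : ℝ) =
      ∑ x ∈ D ×ˢ D, (if sig x.1 % 2 ^ k = (c : ℕ) % 2 ^ k then (1 : ℝ) else 0) *
        (if (sig x.1 ^^^ sig x.2) % 2 ^ k' = (t : ℕ) % 2 ^ k' then (1 : ℝ) else 0) := by
    intro t c
    rw [pairCount, Finset.card_filter]
    push_cast
    refine Finset.sum_congr rfl fun x _ => ?_
    have h2 : sig x.2 % 2 ^ k' = (sig x.1 ^^^ t) % 2 ^ k' ↔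
        (sig x.1 ^^^ sig x.2) % 2 ^ k' = (t : ℕ) % 2 ^ k' := by
      constructor
      · intro h
        have := xor_mod_congr (rfl : sig x.1 % 2 ^ k' = sig x.1 % 2 ^ k') h
        rwa [← Nat.xor_assoc, Nat.xor_self, Nat.zero_xor] at this
      · intro h
        have := xor_mod_congr (rfl : sig x.1 % 2 ^ k' = sig x.1 % 2 ^ k') h
        rwa [← Nat.xor_assoc, Nat.xor_self, Nat.zero_xor] at this
    by_cases h3 : sig x.1 % 2 ^ k = (c : ℕ) % 2 ^ k <;> simp [h2, h3]
  have hp : ∀ {k : ℕ}, k ≤ L → ∀ s : ℕ, (mean fun c : Fin (2 ^ L) =>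
      if s % 2 ^ k = (c : ℕ) % 2 ^ k then (1 : ℝ) else 0) = 1 / 2 ^ k := fun hk s => by
    rw [← prob_mod hk s, prob_eq_mean]
  simp only [h1, mean_sum, mean_mul_right, mean_mul_left, hp hk, hp hk']
  rw [Finset.sum_const, Finset.card_product, nsmul_eq_mul]
  push_cast
  field_simp

/-- With a uniform target `t` at a node, the targets `c` and `c ^^^ t` of the children are again
uniform, so the average passes down the tree. There are `2 ^ d - 1` inner nodes. -/
theorem mean_work_le {sig : ℕ → ℕ} {w : ℕ} {M μ : ℕ → ℕ} {B : ℝ} {d : ℕ}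
    (hM : ∀ d' ≤ d, M d' = 2 ^ μ d') (hμ : ∀ d' ≤ d, μ d' ≤ L)
    (hB : ∀ d' < d, ((smallSets m (w * 2 ^ d')).card : ℝ) ^ 2 ≤ B * (2 ^ μ d' * 2 ^ μ (d' + 1))) :
    (mean fun t : Fin (2 ^ L) => mean fun T : Tree L d => (work sig m w M d T t : ℝ)) ≤
      ((2 : ℝ) ^ d - 1) * B := by
  induction d with
  | zero =>
    simp only [work, Nat.cast_zero, pow_zero, sub_self, zero_mul]
    exact le_of_eq ((congrArg mean (funext fun _ => Finset.expect_const_zero _)).trans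
      (Finset.expect_const_zero _))
  | succ d ih =>
    specialize ih (fun d' hd' => hM d' (by omega)) (fun d' hd' => hμ d' (by omega))
      (fun d' hd' => hB d' (by omega))
    have h1 : (mean fun t : Fin (2 ^ L) => mean fun T : Tree L (d + 1) =>
        (work sig m w M (d + 1) T t : ℝ)) =
        (mean fun t : Fin (2 ^ L) => mean fun c : Fin (2 ^ L) =>
          (pairCount sig (smallSets m (w * 2 ^ d)) (2 ^ μ d) c (2 ^ μ (d + 1)) t : ℝ)) +
        ((mean fun t : Fin (2 ^ L) => mean fun T : Tree L d => (work sig m w M d T t : ℝ)) +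
          mean fun t : Fin (2 ^ L) => mean fun T : Tree L d => (work sig m w M d T t : ℝ)) := by
      simp only [mean_tree, work, Nat.cast_add, mean_add, mean_const, hM d (by omega),
        hM (d + 1) le_rfl]
      congr 2
      rw [mean_comm]
      -- For fixed `c` the substitution of `c ^^^ t` for `t` is a bijection.
      have h2 : ∀ c : Fin (2 ^ L), (mean fun t : Fin (2 ^ L) => mean fun T : Tree L d =>
          (work sig m w M d T (c ^^^ t) : ℝ)) =
          mean fun t : Fin (2 ^ L) => mean fun T : Tree L d => (work sig m w M d T t : ℝ) := by
        intro c
        refine Eq.trans (congrArg mean (funext fun t => ?_)) (mean_equiv (xorEquiv c)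
          fun t => mean fun T : Tree L d => (work sig m w M d T t : ℝ))
        simp only [xorEquiv, Equiv.coe_fn_mk, Nat.xor_comm]
      simp only [h2, mean_const]
    rw [h1, mean_pairCount (hμ d (by omega)) (hμ (d + 1) le_rfl)]
    have h3 : ((smallSets m (w * 2 ^ d)).card : ℝ) ^ 2 / (2 ^ μ d * 2 ^ μ (d + 1)) ≤ B := by
      rw [div_le_iff₀ (by positivity)]; exact hB d (by omega)
    rw [pow_succ (2 : ℝ) d]
    linarith

/-- Although the target of the root is fixed, the random number at the root makes the target of
either child uniform. -/
theorem mean_innerWork_le {sig : ℕ → ℕ} {w : ℕ} {M μ : ℕ → ℕ} {B : ℝ} {d : ℕ}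
    (hM : ∀ d' ≤ d, M d' = 2 ^ μ d') (hμ : ∀ d' ≤ d, μ d' ≤ L)
    (hB : ∀ d' < d, ((smallSets m (w * 2 ^ d')).card : ℝ) ^ 2 ≤ B * (2 ^ μ d' * 2 ^ μ (d' + 1)))
    (tg : ℕ) : (mean fun T : Tree L (d + 1) => (innerWork sig m w M T tg : ℝ)) ≤
      2 * (((2 : ℝ) ^ d - 1) * B) := by
  have h1 : (mean fun T : Tree L (d + 1) => (innerWork sig m w M T tg : ℝ)) =
      (mean fun t : Fin (2 ^ L) => mean fun T : Tree L d => (work sig m w M d T t : ℝ)) +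
        mean fun t : Fin (2 ^ L) => mean fun T : Tree L d => (work sig m w M d T t : ℝ) := by
    simp only [mean_tree, innerWork, Nat.cast_add, mean_add, mean_const]
    congr 1
    refine Eq.trans (congrArg mean (funext fun t => congrArg mean (funext fun T => ?_)))
      (mean_equiv (xorEquiv ⟨tg % 2 ^ L, Nat.mod_lt _ (by positivity)⟩)
        fun t => mean fun T : Tree L d => (work sig m w M d T t : ℝ))
    simp only [xorEquiv, Equiv.coe_fn_mk]
    exact congrArg _ (work_congr hM hμ (xor_mod_congr rfl (Nat.mod_mod _ _).symm))
  rw [h1]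
  have := mean_work_le (sig := sig) hM hμ hB
  linarith

end SplitSearch

namespace SplitSearch

/-! ### The success probability of a trial -/

/-- Give each set `S` with `|S| ≤ k` the weight `b ^ (k - |S|) ≥ 1` and sum over all subsets by the
binomial theorem. The number `b` is to be optimized. -/
theorem card_smallSets_le (m k : ℕ) {b : ℝ} (hb : 1 ≤ b) :
    ((smallSets m k).card : ℝ) ≤ b ^ k * (b⁻¹ + 1) ^ m := by
  have hb0 : 0 < b := by linarith
  have h1 : (smallSets m k).card = ((smallSets m k).image (supp m)).card := by
    refine (Finset.card_image_of_injOn fun x hx y hy h => ?_).symm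
    exact supp_injOn m (mem_smallSets.1 hx).1 (mem_smallSets.1 hy).1 h
  have h2 : (smallSets m k).image (supp m) ⊆ (Finset.range m).powerset := by
    intro S hS
    obtain ⟨y, _, rfl⟩ := Finset.mem_image.1 hS
    exact Finset.mem_powerset.2 (Finset.filter_subset _ _)
  calc ((smallSets m k).card : ℝ) = ∑ S ∈ (smallSets m k).image (supp m), (1 : ℝ) := by
        rw [h1]; simp
    _ ≤ ∑ S ∈ (smallSets m k).image (supp m), b ^ k * (b⁻¹ ^ S.card * 1 ^ (m - S.card)) := by
        refine Finset.sum_le_sum fun S hS => ?_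
        obtain ⟨y, hy, rfl⟩ := Finset.mem_image.1 hS
        have := (mem_smallSets.1 hy).2
        rw [one_pow, mul_one, inv_pow, ← div_eq_mul_inv, le_div_iff₀ (by positivity), one_mul]
        exact pow_le_pow_right₀ hb this
    _ ≤ ∑ S ∈ (Finset.range m).powerset, b ^ k * (b⁻¹ ^ S.card * 1 ^ (m - S.card)) :=
        Finset.sum_le_sum_of_subset_of_nonneg h2 fun S _ _ => by positivity
    _ = b ^ k * (b⁻¹ + 1) ^ m := by
        rw [← Finset.mul_sum]
        congr 1
        have := Finset.sum_pow_mul_eq_add_pow b⁻¹ 1 (Finset.range m)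
        rwa [Finset.card_range] at this

/-- With `b = 8` the square contributes `8 ^ (2 * w) = 2 ^ (2 * w) * 2 ^ (4 * w)`, which is what the
two moduli of a merge provide, and `(9 / 8) ^ 2 = 81 / 64` remains. The size `w` cancels, so the
same bound serves at all depths. -/
theorem card_smallSets_sq_le (m w : ℕ) : ((smallSets m w).card : ℝ) ^ 2 ≤
    (81 / 64) ^ m * (2 ^ (2 * w + 7) * 2 ^ (2 * (w * 2) + 7)) := by
  have h := card_smallSets_le m w (b := 8) (by norm_num)
  calc ((smallSets m w).card : ℝ) ^ 2 ≤ (8 ^ w * (8⁻¹ + 1) ^ m) ^ 2 := by gcongr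
    _ = (81 / 64) ^ m * (2 ^ (2 * w) * 2 ^ (2 * (w * 2))) := by
        rw [mul_pow, ← pow_mul, ← pow_mul, mul_comm w 2, mul_comm m 2, pow_mul, pow_mul _ 2 m,
          ← pow_add, show 2 * w + 2 * (2 * w) = 6 * w by ring, pow_mul 2 6 w]
        norm_num [mul_comm]
    _ ≤ _ := by gcongr <;> norm_num

theorem card_smallSets_base_le {m w : ℕ} (hw : 16 * w ≤ m + 15) :
    ((smallSets m w).card : ℝ) ≤ 15 * (81 / 64) ^ m := by
  have h := card_smallSets_le m w (b := 15) (by norm_num)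
  -- Taking sixteenth powers makes `16 * w ≤ m + 15` applicable. What remains is the numerical
  -- inequality `15 * (16 / 15) ^ 16 ≤ (81 / 64) ^ 16`.
  refine le_of_pow_le_pow_left₀ (n := 16) (by norm_num) (by positivity) ?_
  calc ((smallSets m w).card : ℝ) ^ 16 ≤ (15 ^ w * (15⁻¹ + 1) ^ m) ^ 16 := by gcongr
    _ = 15 ^ (16 * w) * ((16 / 15) ^ 16) ^ m := by
        rw [mul_pow, ← pow_mul, ← pow_mul, mul_comm w, mul_comm m, pow_mul _ 16 m]
        norm_num
    _ ≤ 15 ^ (m + 15) * ((16 / 15) ^ 16) ^ m := by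
        gcongr
        norm_num
    _ = 15 ^ 15 * (15 * (16 / 15) ^ 16) ^ m := by rw [pow_add, mul_pow]; ring
    _ ≤ 15 ^ 16 * ((81 / 64) ^ 16) ^ m := by gcongr <;> norm_num
    _ = _ := by rw [mul_pow, ← pow_mul, ← pow_mul, mul_comm 16 m]

/-- The number of trials for each size. -/
@[irreducible] def trials (m : ℕ) : ℕ := 2 ^ 400 * (m + 16) ^ 15

/-- The bound for the work in each merge. -/
@[irreducible] def budget (m : ℕ) : ℕ := trials m * (81 ^ m / 64 ^ m + 1)

theorem le_budget (m : ℕ) : (trials m : ℝ) * (81 / 64) ^ m ≤ budget m := by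
  rw [budget]
  push_cast
  gcongr
  rw [div_pow, div_le_iff₀ (by positivity)]
  have := Nat.lt_mul_div_succ (81 ^ m) (show 0 < 64 ^ m by positivity)
  rw [mul_comm]
  exact_mod_cast this.le

theorem le_trials (m : ℕ) : (2 : ℝ) ^ 400 * ((m : ℝ) + 16) ≤ trials m := by
  rw [trials]
  push_cast
  norm_num only
  have : (1 : ℝ) ≤ (m : ℝ) + 16 := by linarith [(Nat.cast_nonneg m : (0 : ℝ) ≤ m)]
  exact mul_le_mul_of_nonneg_left (le_self_pow₀ this (by norm_num)) (by norm_num)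

/-- A lower bound for the success probability of a trial. -/
noncomputable def successRate (m : ℕ) : ℝ := (1 / (2 ^ 22 * (m + 16))) ^ 15 / 4

theorem successRate_mul_trials (m : ℕ) : successRate m * trials m = 2 ^ 68 := by
  rw [successRate, trials]
  push_cast
  have : (0 : ℝ) < m + 16 := by positivity
  field_simp
  norm_num

/-- From `1 - x ≤ exp (-x)`; the expected number of successes is the constant `2 ^ 68`. -/
theorem pow_trials_le (m : ℕ) : (1 - successRate m) ^ trials m ≤ 1 / 4 := by
  have hX : (1 : ℝ) ≤ 2 ^ 22 * (m + 16) := by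
    linarith [(Nat.cast_nonneg m : (0 : ℝ) ≤ m)]
  have h1 : successRate m ≤ 1 := by
    have : (1 / (2 ^ 22 * (m + 16)) : ℝ) ^ 15 ≤ 1 :=
      pow_le_one₀ (by positivity) ((div_le_one (by positivity)).2 hX)
    rw [successRate]; linarith
  calc (1 - successRate m) ^ trials m ≤ (Real.exp (-successRate m)) ^ trials m := by
        refine pow_le_pow_left₀ (by linarith) ?_ _
        have := Real.add_one_le_exp (-successRate m)
        linarith
    _ = Real.exp (-(2 ^ 68)) := by
        rw [← Real.exp_nat_mul, ← successRate_mul_trials m]; ring_nf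
    _ = 1 / Real.exp (2 ^ 68) := by rw [Real.exp_neg, one_div]
    _ ≤ 1 / 4 := by
        have := Real.add_one_le_exp ((2 : ℝ) ^ 68)
        exact one_div_le_one_div_of_le (by norm_num) (by linarith)

/-- The deterministic part of the analysis: good random bits and little work imply that the trial
finds a set no heavier than `X`. The `m + 22` functionals are enough because `16 * w + 7 ≤ m + 22`.
-/
theorem covers_rootList {m n w : ℕ} {col ω : ℕ → ℕ} (hcol : ∀ i ≤ m, col i < 2 ^ n)
    {X : Finset ℕ} (hX : X ⊆ Finset.range m) (hsol : xorF col X = col m)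
    (hw : 16 * w ≤ m + 15) {H : Pow (Fin (2 ^ n)) (m + 22)} {T : Tree (m + 22) 4}
    (hg : Good (fun i => hash n (m + 22) H (col i)) w (modu n (m + 22) w) 4 X T
      (hash n (m + 22) H (col m)))
    (hwork : 2 * innerWork (xsum (fun i => hash n (m + 22) H (col i)) m) m w (modu n (m + 22) w) T
      (hash n (m + 22) H (col m)) ≤ budget m) :
    ∃ z ∈ rootList col ω n m (m + 22) (budget m) H T w, wsum ω m z ≤ ∑ i ∈ X, ω i := by
  have hb : 2 * ((smallSets m w).card * (m + 2)) ≤ budget m := by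
    have h1 := card_smallSets_base_le hw
    have h2 := le_budget m
    have h3 := le_trials m
    have h4 : (0 : ℝ) < (81 / 64) ^ m := by positivity
    have h5 : (2 * ((smallSets m w).card * (m + 2)) : ℝ) ≤ budget m := by
      calc (2 * ((smallSets m w).card * (m + 2)) : ℝ)
          ≤ 2 * (15 * (81 / 64) ^ m * (m + 2)) := by gcongr
        _ = 30 * (m + 2) * (81 / 64) ^ m := by ring
        _ ≤ 2 ^ 400 * (m + 16) * (81 / 64) ^ m := by gcongr <;> norm_num
        _ ≤ trials m * (81 / 64) ^ m := by gcongr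
        _ ≤ _ := h2
    exact_mod_cast h5
  have he : xorF (fun i => hash n (m + 22) H (col i)) X = hash n (m + 22) H (col m) := by
    rw [xorF_hash, hsol]
  rw [← he] at hg hwork
  obtain ⟨z, hz, _, h⟩ := covers_root (ω := ω) hb
    (μ := fun d => if d < 4 then 2 * (w * 2 ^ d) + 7 else n + (m + 22))
    (fun d => by rw [modu]; split_ifs <;> rfl) (d := 3)
    (fun d hd => by interval_cases d <;> simp <;> omega)
    (fun y => by
      rw [modu, if_neg (by norm_num)]
      exact xorF_lt _ _ _ fun i hi => hash_lt H (hcol i (by simp at hi; omega))) hX hg hwork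
  refine ⟨z, ?_, h⟩
  rw [rootList]
  rw [he] at hz
  exact hz

/-- For each hash function, the tree is good with probability at least `goodMass`, and too much work
has probability at most `α / 4` by Markov's inequality. Subtracting, and then averaging over the
hash functions, leaves a constant fraction of `α`. -/
theorem prob_trial_ge {m n w : ℕ} {col ω : ℕ → ℕ} (hcol : ∀ i ≤ m, col i < 2 ^ n)
    {X : Finset ℕ} (hX : X ⊆ Finset.range m) (hsol : xorF col X = col m) (hind : Indep col X)
    (hw : 16 * w ≤ m + 15) (hw1 : X.card ≤ 16 * w) (hw2 : 16 * w ≤ X.card + 15) :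
    successRate m ≤ prob fun x : Pow (Fin (2 ^ n)) (m + 22) × Tree (m + 22) 4 =>
      ∃ z ∈ rootList col ω n m (m + 22) (budget m) x.1 x.2 w, wsum ω m z ≤ ∑ i ∈ X, ω i := by
  classical
  set α : ℝ := (1 / (2 ^ 22 * (m + 16))) ^ 15 with hα
  have hpos : (0 : ℝ) < m + 16 := by positivity
  have hMd : ∀ d < 4, modu n (m + 22) w d = 2 ^ (2 * (w * 2 ^ d) + 7) := fun d hd => if_pos hd
  have hμL : ∀ d < 4, 2 * (w * 2 ^ d) + 7 ≤ m + 22 := fun d hd => by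
    have : 2 ^ d ≤ 2 ^ 3 := Nat.pow_le_pow_right (by norm_num) (by omega)
    have := Nat.mul_le_mul_left w this
    omega
  have hT : (trials m : ℝ) = 2 ^ 400 * (m + 16) ^ 15 := by rw [trials]; push_cast; norm_num only
  have hbud : (0 : ℝ) < budget m := lt_of_lt_of_le (by rw [hT]; positivity) (le_budget m)
  -- too much work is unlikely
  have h1 : ∀ H : Pow (Fin (2 ^ n)) (m + 22), prob (fun T : Tree (m + 22) 4 =>
      ¬ 2 * innerWork (xsum (fun i => hash n (m + 22) H (col i)) m) m w (modu n (m + 22) w) T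
        (hash n (m + 22) H (col m)) ≤ budget m) ≤ α / 4 := by
    intro H
    set sig := xsum (fun i => hash n (m + 22) H (col i)) m
    set tg := hash n (m + 22) H (col m)
    have h2 := mean_innerWork_le (m := m) (sig := sig) (w := w) (M := modu n (m + 22) w)
      (μ := fun d => 2 * (w * 2 ^ d) + 7) (L := m + 22) (B := (81 / 64) ^ m) (d := 3)
      (fun d hd => hMd d (by omega)) (fun d hd => hμL d (by omega))
      (fun d hd => by
        have := card_smallSets_sq_le m (w * 2 ^ d)
        rwa [mul_assoc, ← pow_succ] at this) tg
    have h3 := prob_lt_le (fun T : Tree (m + 22) 4 =>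
      2 * (innerWork sig m w (modu n (m + 22) w) T tg : ℝ)) (fun T => by positivity) hbud
    rw [mean_mul_left] at h3
    refine (prob_mono fun T hT => ?_).trans (h3.trans ?_)
    · push Not at hT; exact_mod_cast hT
    · rw [div_le_iff₀ hbud]
      have h4 := le_budget m
      have h5 : (0 : ℝ) < (81 / 64) ^ m := by positivity
      have h6 : α / 4 * trials m = 2 ^ 68 := successRate_mul_trials m
      have h7 : 0 < α / 4 := by positivity
      -- Two subtrees with seven inner nodes each and the factor two from `covers_root` give 28, far
      -- below the `2 ^ 68` built into the number of trials.
      calc _ ≤ 2 * (2 * (((2 : ℝ) ^ 3 - 1) * (81 / 64) ^ m)) := by linarith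
        _ = 28 * (81 / 64) ^ m := by ring
        _ ≤ 2 ^ 68 * (81 / 64) ^ m := by gcongr; norm_num
        _ = α / 4 * (trials m * (81 / 64) ^ m) := by rw [← h6]; ring
        _ ≤ _ := by gcongr
  -- good trees are likely
  have h2 : (113 / 128 : ℝ) * α ≤ mean fun H : Pow (Fin (2 ^ n)) (m + 22) =>
      goodMass (fun i => hash n (m + 22) H (col i)) w (modu n (m + 22) w) 4 X := by
    have h3 := mean_goodMass_ge (n := n) (L := m + 22) (col := col) (w := w)
      (M := modu n (m + 22) w) (d := 4) hMd hμL X (by omega)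
      (fun i hi => hcol i (Finset.mem_range.1 (hX hi)).le) hind
    have h4 := splitMass_ge (w := w) (M := modu n (m + 22) w) (d := 4) (X := m + 16) hMd
      (by omega) X (by omega) (by omega)
    rw [mean_sub, mean_const] at h3
    -- Each of the 15 inner nodes loses `1 / 128`. Thus `113 / 128` of the mass survives, and more
    -- than a quarter is left after subtracting `α / 4`.
    have h5 : loss 4 = 15 / 128 := by norm_num [loss]
    rw [h5] at h3
    push_cast at h4
    norm_num only at h4
    have h6 : α ≤ splitMass w (modu n (m + 22) w) 4 X := by rw [hα]; norm_num only; exact h4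
    linarith
  rw [prob_eq_mean, mean_prod]
  have h3 : ∀ H : Pow (Fin (2 ^ n)) (m + 22),
      goodMass (fun i => hash n (m + 22) H (col i)) w (modu n (m + 22) w) 4 X - α / 4 ≤
      mean fun T : Tree (m + 22) 4 => if ∃ z ∈ rootList col ω n m (m + 22) (budget m) H T w,
        wsum ω m z ≤ ∑ i ∈ X, ω i then (1 : ℝ) else 0 := by
    intro H
    have h4 := goodMass_le_prob (e := fun i => hash n (m + 22) H (col i)) (w := w) (L := m + 22)
      (M := modu n (m + 22) w) (μ := fun d => 2 * (w * 2 ^ d) + 7) (d := 4) hMd hμL X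
      (hash n (m + 22) H (col m))
    rw [← prob_eq_mean]
    refine le_trans (sub_le_sub h4 (h1 H)) ((prob_and_ge _ _).trans (prob_mono fun T hT => ?_))
    exact covers_rootList hcol hX hsol hw hT.1 hT.2
  refine le_trans ?_ (mean_mono h3)
  rw [mean_sub, mean_const, successRate, ← hα]
  have : 0 < α := by positivity
  linarith

end SplitSearch

namespace SplitSearch

open RAM

/-! ### Reading random objects off the coins -/

/-- The function `f` turns `K` coin tosses into a uniformly distributed element. -/
def IsSampler {α : Type} (K : ℕ) (f : (ℕ → Bool) → ℕ → α) : Prop :=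
  ∃ e : (Fin K → Bool) → α, Function.Bijective e ∧ ∀ r off, f r off = e fun i => r (off + i)

section sampler

variable {α β : Type}

theorem isSampler_unit : IsSampler 0 fun _ _ => () :=
  ⟨fun _ => (), ⟨fun _ _ _ => Subsingleton.elim _ _, fun _ => ⟨fun _ => false, rfl⟩⟩,
    fun _ _ => rfl⟩

theorem isSampler_coin : IsSampler 1 fun r off => r off :=
  ⟨fun x => x 0, ⟨fun x y h => funext fun i => by rw [Subsingleton.elim i 0]; exact h,
    fun b => ⟨fun _ => b, rfl⟩⟩, fun r off => by simp⟩

theorem IsSampler.prod {K K' : ℕ} {f : (ℕ → Bool) → ℕ → α} {g : (ℕ → Bool) → ℕ → β}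
    (hf : IsSampler K f) (hg : IsSampler K' g) :
    IsSampler (K + K') fun r off => (f r off, g r (off + K)) := by
  obtain ⟨e, he, h1⟩ := hf
  obtain ⟨e', he', h2⟩ := hg
  refine ⟨fun x => (e fun i => x (Fin.castAdd K' i), e' fun i => x (Fin.natAdd K i)), ?_, ?_⟩
  · exact (Function.Bijective.prodMap he he').comp (Fin.appendEquiv K K').symm.bijective
  · intro r off
    simp only [h1, h2]
    congr 2
    funext i
    simp [add_assoc]

theorem IsSampler.map {K : ℕ} {f : (ℕ → Bool) → ℕ → α} (hf : IsSampler K f) {h : α → β}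
    (hh : Function.Bijective h) : IsSampler K fun r off => h (f r off) := by
  obtain ⟨e, he, h1⟩ := hf
  exact ⟨fun x => h (e x), hh.comp he, fun r off => by simp only [h1]⟩

theorem isSampler_draw (k : ℕ) :
    IsSampler k fun r off => (⟨draw r off k, draw_lt r off k⟩ : Fin (2 ^ k)) := by
  induction k with
  | zero =>
    refine ⟨fun _ => 0, ⟨fun _ _ _ => Subsingleton.elim _ _, fun x => ⟨fun _ => false, ?_⟩⟩, ?_⟩
    · exact Subsingleton.elim (α := Fin 1) _ _
    · exact fun _ _ => rfl
  | succ k ih =>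
    have h := (ih.prod isSampler_coin).map (h := fun x : Fin (2 ^ k) × Bool =>
      (⟨2 * x.1 + if x.2 then 1 else 0, by
        have := x.1.2; rw [pow_succ]; split_ifs <;> omega⟩ : Fin (2 ^ (k + 1)))) ?_
    · exact h
    · rw [Fintype.bijective_iff_injective_and_card]
      refine ⟨?_, by simp [pow_succ]⟩
      rintro ⟨x, b⟩ ⟨y, c⟩ h
      simp only [Fin.mk.injEq] at h
      cases b <;> cases c <;> simp only [if_true, Bool.false_eq_true, if_false] at h
      · exact Prod.ext (Fin.ext (by simp only; omega)) rfl
      · omega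
      · omega
      · exact Prod.ext (Fin.ext (by simp only; omega)) rfl

/-- Read a list of independent random objects. -/
def readPow (f : (ℕ → Bool) → ℕ → α) (K : ℕ) (r : ℕ → Bool) (off : ℕ) : (k : ℕ) → Pow α k
  | 0 => ()
  | k + 1 => (readPow f K r off k, f r (off + k * K))

theorem IsSampler.pow {K : ℕ} {f : (ℕ → Bool) → ℕ → α} (hf : IsSampler K f) (k : ℕ) :
    IsSampler (k * K) fun r off => readPow f K r off k := by
  induction k with
  | zero => rw [Nat.zero_mul]; exact isSampler_unit
  | succ k ih => rw [Nat.succ_mul]; exact ih.prod hf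

theorem readHash_eq (r : ℕ → Bool) (off n k : ℕ) : readHash r off n k =
    readPow (fun r off => (⟨draw r off n, draw_lt r off n⟩ : Fin (2 ^ n))) n r off k := by
  induction k with
  | zero => rfl
  | succ k ih => rw [readHash, ih]; rfl

theorem isSampler_hash (n k : ℕ) : IsSampler (k * n) fun r off => readHash r off n k := by
  simp only [readHash_eq]
  exact (isSampler_draw n).pow k

theorem isSampler_tree (L d : ℕ) : IsSampler (treeCoins L d) fun r off => readTree r L off d := by
  induction d with
  | zero => exact isSampler_unit
  | succ d ih =>
    have h := (isSampler_draw L).prod (ih.prod ih)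
    rw [treeCoins, two_mul]
    exact h

theorem isSampler_trial (n L : ℕ) : IsSampler (trialCoins n L) fun r off =>
    (readHash r off n L, readTree r L (off + L * n) 4) :=
  (isSampler_hash n L).prod (isSampler_tree L 4)

/-- Prescribing finitely many coins is a finite product set, whose measure is the product of the
measures of its factors. -/
theorem coins_cylinder {K : ℕ} (off : ℕ) (x : Fin K → Bool) :
    coins {r | (fun i : Fin K => r (off + i)) = x} = (1 / 2) ^ K := by
  classical
  have h1 : {r : ℕ → Bool | (fun i : Fin K => r (off + i)) = x} =
      Set.pi ((Finset.range K).image (off + ·) : Finset ℕ)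
        (fun j => {if h : j - off < K then x ⟨j - off, h⟩ else false}) := by
    ext r
    simp only [Set.mem_ofPred_eq, Finset.coe_image, Set.mem_pi, Set.mem_image, Finset.mem_coe,
      Finset.mem_range, Set.mem_singleton_iff, funext_iff]
    constructor
    · rintro h _ ⟨i, hi, rfl⟩
      rw [dif_pos (by omega), show r (off + i) = x ⟨i, hi⟩ from h ⟨i, hi⟩]
      congr 1
      exact Fin.ext (by simp)
    · intro h i
      have := h (off + i) ⟨i, i.2, rfl⟩
      rw [this, dif_pos (by have := i.2; omega)]
      congr 1
      exact Fin.ext (by simp)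
  rw [h1, coins, MeasureTheory.Measure.infinitePi_pi _ (fun i _ => MeasurableSet.of_discrete)]
  have h2 : ∀ b : Bool, (PMF.uniformOfFintype Bool).toMeasure {b} = 1 / 2 := by
    intro b
    rw [PMF.toMeasure_apply_singleton _ _ (MeasurableSet.of_discrete)]
    simp
  simp only [h2, Finset.prod_const]
  rw [Finset.card_image_of_injective _ (add_right_injective off), Finset.card_range]

/-- The event lies in a finite union of cylinders of measure `2 ^ (-K)`, one for each favourable
outcome. An upper bound is enough, so countable subadditivity does it. -/
theorem IsSampler.coins_le [Fintype α] {K : ℕ} {f : (ℕ → Bool) → ℕ → α} (hf : IsSampler K f)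
    (off : ℕ) (P : α → Prop) : coins {r | P (f r off)} ≤ ENNReal.ofReal (prob P) := by
  classical
  obtain ⟨e, he, h1⟩ := hf
  have h2 : {r | P (f r off)} ⊆ ⋃ x ∈ Finset.univ.filter fun x => P (e x),
      {r : ℕ → Bool | (fun i : Fin K => r (off + i)) = x} := by
    intro r hr
    simp only [Set.mem_ofPred_eq, h1] at hr
    simp only [Set.mem_iUnion, Finset.mem_filter, Finset.mem_univ, true_and, exists_prop]
    exact ⟨_, hr, rfl⟩
  refine (MeasureTheory.measure_mono h2).trans ((MeasureTheory.measure_biUnion_finset_le _ _).trans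
    (le_of_eq ?_))
  simp only [coins_cylinder, Finset.sum_const, nsmul_eq_mul]
  have h3 : (Finset.univ.filter fun x => P (e x)).card = (Finset.univ.filter P).card := by
    refine Finset.card_bij (fun x _ => e x) (fun x hx => by simpa using hx)
      (fun x _ y _ h => he.1 h) fun a ha => ?_
    obtain ⟨x, rfl⟩ := he.2 a
    exact ⟨x, by simpa using ha, rfl⟩
  have h4 : Fintype.card α = 2 ^ K := by
    rw [← Fintype.card_of_bijective he]; simp
  rw [h3, prob_eq_card_div, h4, Nat.cast_pow, ENNReal.ofReal_div_of_pos (by positivity),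
    ENNReal.ofReal_natCast, ENNReal.ofReal_pow (by norm_num), div_eq_mul_inv,
    div_eq_mul_inv, one_mul, ENNReal.inv_pow]
  norm_num

/-- Consecutive blocks of coins are independent, so the probability that `P` holds in all of `k`
blocks is a power. The event is expressed on the finite space of all blocks to make
`IsSampler.coins_le` applicable. -/
theorem prob_readPow [Fintype α] (P : α → Prop) (k : ℕ) :
    ∃ Q : Pow α k → Prop, prob Q = prob P ^ k ∧ ∀ (f : (ℕ → Bool) → ℕ → α) (K : ℕ) r off,
      Q (readPow f K r off k) ↔ ∀ j < k, P (f r (off + j * K)) := by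
  induction k with
  | zero =>
    refine ⟨fun _ => True, ?_, by simp⟩
    rw [pow_zero, prob_eq_mean]
    simp only [if_true]
    have : Nonempty (Pow α 0) := inferInstanceAs (Nonempty Unit)
    exact mean_const (α := Pow α 0) 1
  | succ k ih =>
    obtain ⟨Q, h1, h2⟩ := ih
    refine ⟨fun x => Q x.1 ∧ P x.2, ?_, fun f K r off => ?_⟩
    · rw [pow_succ, ← h1]
      exact prob_prod_mul (α := Pow α k) (β := α) Q P
    · simp only [readPow, h2, Nat.forall_lt_succ_right]

theorem prob_not [Fintype α] [Nonempty α] (P : α → Prop) : prob (fun a => ¬ P a) = 1 - prob P := by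
  classical
  rw [eq_sub_iff_add_eq, prob_eq_mean, prob_eq_mean, ← mean_add, ← mean_const (α := α) 1]
  exact congrArg mean (funext fun a => by by_cases h : P a <;> simp [h])

end sampler

/-- All trials for the right size fail with probability at most `1 / 4`. -/
theorem coins_trials_fail_le {m n w : ℕ} {col ω : ℕ → ℕ} (hcol : ∀ i ≤ m, col i < 2 ^ n)
    {X : Finset ℕ} (hX : X ⊆ Finset.range m) (hsol : xorF col X = col m) (hind : Indep col X)
    (hw : 16 * w ≤ m + 15) (hw1 : X.card ≤ 16 * w) (hw2 : 16 * w ≤ X.card + 15) (off : ℕ) :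
    coins {r | ∀ j < trials m, ¬ ∃ z ∈ rootList col ω n m (m + 22) (budget m)
      (readHash r (off + j * trialCoins n (m + 22)) n (m + 22))
      (readTree r (m + 22) (off + j * trialCoins n (m + 22) + (m + 22) * n) 4) w,
      wsum ω m z ≤ ∑ i ∈ X, ω i} ≤ 1 / 4 := by
  have h := prob_trial_ge (ω := ω) hcol hX hsol hind hw hw1 hw2
  set P : Pow (Fin (2 ^ n)) (m + 22) × Tree (m + 22) 4 → Prop := fun x =>
    ∃ z ∈ rootList col ω n m (m + 22) (budget m) x.1 x.2 w, wsum ω m z ≤ ∑ i ∈ X, ω i with hP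
  obtain ⟨Q, h1, h2⟩ := prob_readPow (fun x => ¬ P x) (trials m)
  have h3 := ((isSampler_trial n (m + 22)).pow (trials m)).coins_le off Q
  simp only [h2, h1] at h3
  refine h3.trans ?_
  have h4 : (0 : ℝ) ≤ prob fun x => ¬ P x := prob_nonneg _
  have h5 : (prob fun x => ¬ P x) ≤ 1 - successRate m := by rw [prob_not]; linarith
  refine (ENNReal.ofReal_le_ofReal ((pow_le_pow_left₀ h4 h5 _).trans (pow_trials_le m))).trans ?_
  rw [ENNReal.ofReal_div_of_pos (by norm_num)]
  simp

end SplitSearch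

namespace RAM

open SplitSearch

/-! ### The parameters of the search -/

/-- The product of the entries of the input, increased by two. -/
def inputProd (inp : List ℕ) : ℕ := (inp.map (· + 2)).prod

/-- The modulus of the arithmetic. -/
@[irreducible] def modulus (inp : List ℕ) : ℕ := 2 ^ 600 * inputProd inp ^ 32

theorem two_pow_length_le (inp : List ℕ) : 2 ^ inp.length ≤ inputProd inp := by
  induction inp with
  | nil => simp [inputProd]
  | cons a l ih =>
    simp only [inputProd, List.map_cons, List.prod_cons, List.length_cons] at ih ⊢
    rw [pow_succ, mul_comm]
    exact Nat.mul_le_mul (by omega) ih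

theorem sum_lt_inputProd (inp : List ℕ) : inp.sum < inputProd inp := by
  induction inp with
  | nil => simp [inputProd]
  | cons a l ih =>
    simp only [inputProd, List.map_cons, List.prod_cons, List.sum_cons] at ih ⊢
    generalize (l.map (· + 2)).prod = P at ih ⊢
    have : a ≤ a * P := Nat.le_mul_of_pos_right _ (by omega)
    rw [add_mul]; omega

theorem inputProd_le (inp : List ℕ) : inputProd inp ≤ 2 ^ inputSize inp := by
  induction inp with
  | nil => simp [inputProd, inputSize]
  | cons a l ih =>
    simp only [inputProd, inputSize, List.map_cons, List.prod_cons, List.sum_cons] at ih ⊢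
    rw [pow_add]
    refine Nat.mul_le_mul ?_ ih
    have := Nat.lt_size_self a
    have := Nat.one_le_two_pow (n := a.size)
    rw [pow_succ]; omega

theorem length_lt_inputProd (inp : List ℕ) : inp.length < inputProd inp :=
  Nat.lt_two_pow_self.trans_le (two_pow_length_le inp)

theorem inputProd_pos (inp : List ℕ) : 0 < inputProd inp :=
  (Nat.zero_le _).trans_lt (length_lt_inputProd inp)

theorem length_le_inputSize (inp : List ℕ) : inp.length ≤ inputSize inp := by
  induction inp with
  | nil => simp
  | cons a l ih => simp only [inputSize, List.map_cons, List.sum_cons, List.length_cons] at ih ⊢; omega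

theorem size_modulus_le (inp : List ℕ) : (modulus inp).size ≤ 601 + 32 * inputSize inp := by
  rw [Nat.size_le, modulus]
  calc 2 ^ 600 * inputProd inp ^ 32 ≤ 2 ^ 600 * (2 ^ inputSize inp) ^ 32 := by
        gcongr; exact inputProd_le inp
    _ = 2 ^ (600 + 32 * inputSize inp) := by rw [← pow_mul, ← pow_add, mul_comm 32]
    _ < _ := Nat.pow_lt_pow_right (by norm_num) (by omega)

/-- The exponents 600 and 32 of the modulus leave ample room: every number in the computation is at
most a constant times a small power of `inputProd inp`. -/
theorem lt_modulus {inp : List ℕ} {x y k j : ℕ} (hx : x ≤ 2 ^ k) (hy : y ≤ 2 ^ k * inputProd inp ^ j)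
    (hk : k < 599) (hj : j ≤ 32) : x + y < modulus inp := by
  have hp := inputProd_pos inp
  have h1 : 1 ≤ inputProd inp ^ j := Nat.one_le_pow _ _ hp
  have h2 : inputProd inp ^ j ≤ inputProd inp ^ 32 := Nat.pow_le_pow_right hp hj
  have h3 : 2 ^ k * 1 ≤ 2 ^ k * inputProd inp ^ j := Nat.mul_le_mul_left _ h1
  rw [modulus]
  calc x + y ≤ 2 * (2 ^ k * inputProd inp ^ j) := by omega
    _ = 2 ^ (k + 1) * inputProd inp ^ j := by ring
    _ < 2 ^ 600 * inputProd inp ^ j :=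
        Nat.mul_lt_mul_of_pos_right (Nat.pow_lt_pow_right (by norm_num) (by omega)) (by omega)
    _ ≤ _ := Nat.mul_le_mul_left _ h2

/-- Every entry of the input contributes a factor of at least two to `inputProd`, so numbers
exponential in the length of the input also fit. This admits `2 ^ (n + m)`, while the modulus still
has only linearly many bits in the input size. -/
theorem lt_modulus_of_exp {inp : List ℕ} {l x a b : ℕ} (hl : l ≤ inp.length)
    (hx : x ≤ 2 ^ (a + b * l)) (ha : a < 599) (hb : b ≤ 32) : x < modulus inp := by
  have h1 : 2 ^ l ≤ inputProd inp :=
    (Nat.pow_le_pow_right (by norm_num) hl).trans (two_pow_length_le inp)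
  have h2 : x ≤ 2 ^ a * inputProd inp ^ b := by
    refine hx.trans ?_
    rw [pow_add, mul_comm b l, pow_mul]
    gcongr
  simpa using lt_modulus (x := 0) (Nat.zero_le _) h2 ha hb

theorem add_sixteen_le (m : ℕ) : m + 16 ≤ 2 ^ (4 + 1 * m) := by
  have : m < 2 ^ m := Nat.lt_two_pow_self
  rw [pow_add, one_mul]; omega

theorem pow_fifteen_le (m : ℕ) : (m + 16) ^ 15 ≤ 2 ^ (60 + 15 * m) := by
  calc (m + 16) ^ 15 ≤ (2 ^ (4 + 1 * m)) ^ 15 := Nat.pow_le_pow_left (add_sixteen_le m) _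
    _ = _ := by rw [← pow_mul]; congr 1; ring

theorem trials_le (m : ℕ) : trials m ≤ 2 ^ (460 + 15 * m) := by
  rw [trials, show 460 + 15 * m = 400 + (60 + 15 * m) by ring, pow_add]
  exact Nat.mul_le_mul_left _ (pow_fifteen_le m)

theorem quot_le (m : ℕ) : 81 ^ m / 64 ^ m + 1 ≤ 2 ^ (1 + 1 * m) := by
  have h : 81 ^ m / 64 ^ m ≤ 2 ^ m := by
    rw [Nat.div_le_iff_le_mul_add_pred (by positivity), ← mul_pow]
    exact (Nat.pow_le_pow_left (by norm_num) m).trans (Nat.le_add_right _ _)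
  have := Nat.one_le_two_pow (n := m)
  rw [pow_add, one_mul]; omega

theorem budget_le (m : ℕ) : budget m ≤ 2 ^ (461 + 16 * m) := by
  rw [budget, show 461 + 16 * m = (460 + 15 * m) + (1 + 1 * m) by ring, pow_add]
  exact Nat.mul_le_mul (trials_le m) (quot_le m)

/-- The parameters of the search. -/
def params (inp : List ℕ) (n m : ℕ) : Par → ℕ
  | .V => modulus inp
  | .n => n
  | .m => m
  | .m1 => m + 1
  | .L => m + 22
  | .nw => (m + 15) / 16 + 1
  | .q => trials m
  | .bud => budget m
  | .S => 2 ^ (n + (m + 22)) + 2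
  | .N => inp.length

/-- The parameters before the initial computation. -/
def params₀ (inp : List ℕ) (n m : ℕ) : Par → ℕ
  | .V => modulus inp
  | .n => n
  | .m => m
  | .m1 => m + 1
  | .N => inp.length
  | _ => 0

section

variable {inp : List ℕ} {n m : ℕ}

theorem length_lt_modulus (inp : List ℕ) (k : ℕ) (hk : k ≤ 2 ^ 500) : inp.length + k < modulus inp := by
  rw [add_comm]
  refine lt_modulus (k := 500) (j := 1) hk ?_ (by norm_num) (by norm_num)
  rw [pow_one]
  exact (length_lt_inputProd inp).le.trans (Nat.le_mul_of_pos_left _ (by positivity))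

theorem setting (h : n + m ≤ inp.length) : Setting (params inp n m) := by
  have hm : m ≤ inp.length := by omega
  have e1 : 2 ^ (n + (m + 22)) ≤ 2 ^ (22 + 1 * (n + m)) :=
    Nat.pow_le_pow_right (by norm_num) (by omega)
  have hN5 := length_lt_modulus inp 5 (by norm_num)
  have hN30 := length_lt_modulus inp 30 (by norm_num)
  have hS : 2 ^ (n + (m + 22)) + 2 ≤ 2 ^ (23 + 1 * (n + m)) := by
    have h2 : 2 ^ 1 ≤ 2 ^ (22 + 1 * (n + m)) :=
      Nat.pow_le_pow_right (by norm_num) (by omega)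
    calc _ ≤ 2 ^ (22 + 1 * (n + m)) * 2 := by
          generalize 2 ^ (22 + 1 * (n + m)) = d at *; omega
      _ = 2 ^ (22 + 1 * (n + m) + 1) := (pow_succ _ _).symm
      _ = _ := by congr 1; omega
  refine ⟨⟨fun k => ?_, ?_⟩, rfl, rfl, ?_, ?_, ?_, ?_, ?_⟩
  · cases k <;> simp only [params] <;> try exact le_rfl
    · omega
    · omega
    · omega
    · omega
    · omega
    · exact (lt_modulus_of_exp hm (trials_le m) (by norm_num) (by norm_num)).le
    · exact (lt_modulus_of_exp hm (budget_le m) (by norm_num) (by norm_num)).le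
    · exact (lt_modulus_of_exp h hS (by norm_num) (by norm_num)).le
    · omega
  · simp only [params]; omega
  · simp only [params]; have := length_lt_modulus inp 1000 (by norm_num); omega
  · simp only [params]
    exact lt_modulus_of_exp (a := 0) (b := 1) hm (by simp) (by norm_num) (by norm_num)
  · simp only [params]
    refine lt_modulus_of_exp (a := 25) (b := 1) h ?_ (by norm_num) (by norm_num)
    rw [show 25 + 1 * (n + m) = 2 + (23 + 1 * (n + m)) by ring, pow_add 2 2 (23 + 1 * (n + m))]
    generalize 2 ^ (23 + 1 * (n + m)) = d at *
    omega
  · simp only [params]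
    refine lt_modulus_of_exp (a := 463) (b := 16) hm ?_ (by norm_num) (by norm_num)
    have := budget_le m
    have h2 := Nat.one_le_two_pow (n := 461 + 16 * m)
    rw [show 463 + 16 * m = 2 + (461 + 16 * m) by ring, pow_add 2 2 (461 + 16 * m)]
    omega
  · exact hN5

/-- Memory is never reused, so the arrays of all trials together have to stay below the modulus: `nw
* q` trials with `nw + 16` blocks of `S` arrays each. -/
theorem search_space (h : n + m ≤ inp.length) :
    (inp.length + 4) + (((m + 15) / 16 + 1) * trials m + 1) *
      (((m + 15) / 16 + 1 + 16) * (2 ^ (n + (m + 22)) + 2)) < modulus inp := by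
  have hm : 2 ^ m ≤ inputProd inp :=
    (Nat.pow_le_pow_right (by norm_num) (by omega)).trans (two_pow_length_le inp)
  have hnm : 2 ^ (n + m) ≤ inputProd inp :=
    (Nat.pow_le_pow_right (by norm_num) h).trans (two_pow_length_le inp)
  have hp := inputProd_pos inp
  set Z := inputProd inp with hZ
  have h1 : (m + 15) / 16 + 1 ≤ 2 ^ 4 * Z := by
    have := add_sixteen_le m
    rw [pow_add, one_mul] at this
    have := Nat.mul_le_mul_left (2 ^ 4) hm
    omega
  have h2 : trials m ≤ 2 ^ 460 * Z ^ 15 := by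
    refine (trials_le m).trans ?_
    rw [pow_add, mul_comm 15, pow_mul]
    gcongr
  have h3 : 2 ^ (n + (m + 22)) + 2 ≤ 2 ^ 23 * Z := by
    have e : 2 ^ (n + (m + 22)) = 2 ^ 22 * 2 ^ (n + m) := by
      rw [show n + (m + 22) = 22 + (n + m) by omega, pow_add]
    have := Nat.mul_le_mul_left (2 ^ 22) hnm
    omega
  have hZ16 : 1 ≤ Z ^ 16 := Nat.one_le_pow _ _ hp
  have h4 : ((m + 15) / 16 + 1) * trials m + 1 ≤ 2 ^ 465 * Z ^ 16 := by
    have := Nat.mul_le_mul h1 h2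
    have e : 2 ^ 4 * Z * (2 ^ 460 * Z ^ 15) = 2 ^ 464 * Z ^ 16 := by ring
    rw [e] at this
    omega
  have h5 : (m + 15) / 16 + 1 + 16 ≤ 2 ^ 5 * Z := by omega
  have h6 : (((m + 15) / 16 + 1) * trials m + 1) *
      (((m + 15) / 16 + 1 + 16) * (2 ^ (n + (m + 22)) + 2)) ≤ 2 ^ 493 * Z ^ 18 := by
    refine (Nat.mul_le_mul h4 (Nat.mul_le_mul h5 h3)).trans (le_of_eq ?_)
    ring
  have h7 : inp.length < Z := length_lt_inputProd inp
  have h8 : Z ≤ Z ^ 18 := Nat.le_self_pow (by norm_num) Z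
  have := lt_modulus (inp := inp) (x := 4) (y := inp.length + (((m + 15) / 16 + 1) * trials m + 1) *
      (((m + 15) / 16 + 1 + 16) * (2 ^ (n + (m + 22)) + 2))) (k := 500) (j := 18) (by norm_num)
    (by rw [← hZ]; omega) (by norm_num) (by norm_num)
  omega

theorem paramsOK₀ (h : n + m ≤ inp.length) : ParOK (params₀ inp n m) := by
  have h1 := (setting h).ok
  refine ⟨fun k => ?_, h1.two_le⟩
  have h2 := h1.le k
  cases k <;> first | exact h2 | exact Nat.zero_le _

end

/-! ### Computing the parameters -/

/-- Parameters are read-only for commands, so the values are left in variables and copied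
afterwards. The constant `4194304` is `2 ^ 22`, from `L = m + 22`, and the powers of 81 and 64 are
built up in a loop. -/
def paramC : Cmd := .block
  [.set .oL (Par.m + 22), .set .oNw ((Par.m + 15) / 16 + 1), .set .x (Par.m + 16),
   .set .y (Var.x * Var.x), .set .z (Var.y * Var.y), .set .k (Var.z * Var.z),
   .set .oQ (.lit (2 ^ 400) * (Var.x * (Var.y * (Var.z * Var.k)))),
   .set .a 1, .set .bk 1, .set .s 1,
   .rep .m (.block [.set .a (81 * Var.a), .set .bk (64 * Var.bk), .set .s (2 * Var.s)]),
   .rep .n (.set .s (2 * Var.s)),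
   .set .oBud (Var.oQ * (Var.a / Var.bk + 1)), .set .oS (4194304 * Var.s + 2)]

theorem eval_lit_eq {π : Par → ℕ} {σ : St} (k : ℕ) : (Expr.lit k).eval π σ = k % π .V := rfl

theorem paramC_spec {inp : List ℕ} {n m : ℕ} (h : n + m ≤ inp.length) {r : ℕ → Bool} {σ : St} :
    let τ := paramC.run (params₀ inp n m) r σ
    τ.v .oL = m + 22 ∧ τ.v .oNw = (m + 15) / 16 + 1 ∧ τ.v .oQ = trials m ∧ τ.v .oBud = budget m ∧
      τ.v .oS = 2 ^ (n + (m + 22)) + 2 ∧ τ.mem = σ.mem ∧ τ.tossed = σ.tossed := by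
  have hm : m ≤ inp.length := by omega
  have hV : (params₀ inp n m) .V = modulus inp := rfl
  have hn' : (params₀ inp n m) .n = n := rfl
  have hm' : (params₀ inp n m) .m = m := rfl
  have lt : ∀ {x : ℕ} (a b : ℕ), x ≤ 2 ^ (a + b * m) → a < 599 → b ≤ 32 → x % modulus inp = x :=
    fun a b hx ha hb => Nat.mod_eq_of_lt (lt_modulus_of_exp hm hx ha hb)
  have lt' : ∀ {x : ℕ} (a b : ℕ), x ≤ 2 ^ (a + b * (n + m)) → a < 599 → b ≤ 32 →
      x % modulus inp = x := fun a b hx ha hb => Nat.mod_eq_of_lt (lt_modulus_of_exp h hx ha hb)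
  have cst : ∀ k, k ≤ 2 ^ 500 → k % modulus inp = k := fun k hk =>
    lt 500 0 (by simpa using hk) (by norm_num) (by norm_num)
  have hX := add_sixteen_le m
  have px : ∀ k ≤ 15, (m + 16) ^ k % modulus inp = (m + 16) ^ k := fun k hk => lt 60 15
    ((Nat.pow_le_pow_right (by omega) hk).trans (pow_fifteen_le m)) (by norm_num) (by norm_num)
  have e0 : m % modulus inp = m := lt 4 1 (by omega) (by norm_num) (by norm_num)
  have e1 : (m + 22) % modulus inp = m + 22 :=
    lt 5 1 (by rw [show 5 + 1 * m = (4 + 1 * m) + 1 by ring, pow_succ]; omega)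
      (by norm_num) (by norm_num)
  have e2 : (m + 15) % modulus inp = m + 15 := lt 4 1 (by omega) (by norm_num) (by norm_num)
  have e3 : (m + 15) / 16 % modulus inp = (m + 15) / 16 :=
    lt 4 1 (by omega) (by norm_num) (by norm_num)
  have e4 : ((m + 15) / 16 + 1) % modulus inp = (m + 15) / 16 + 1 :=
    lt 4 1 (by omega) (by norm_num) (by norm_num)
  have e5 : (m + 16) % modulus inp = m + 16 := lt 4 1 hX (by norm_num) (by norm_num)
  have f2 : (m + 16) * (m + 16) % modulus inp = (m + 16) ^ 2 := by
    rw [show (m + 16) * (m + 16) = (m + 16) ^ 2 by ring]; exact px 2 (by norm_num)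
  have f4 : (m + 16) ^ 2 * (m + 16) ^ 2 % modulus inp = (m + 16) ^ 4 := by
    rw [show (m + 16) ^ 2 * (m + 16) ^ 2 = (m + 16) ^ 4 by ring]; exact px 4 (by norm_num)
  have f8 : (m + 16) ^ 4 * (m + 16) ^ 4 % modulus inp = (m + 16) ^ 8 := by
    rw [show (m + 16) ^ 4 * (m + 16) ^ 4 = (m + 16) ^ 8 by ring]; exact px 8 (by norm_num)
  have f12 : (m + 16) ^ 4 * (m + 16) ^ 8 % modulus inp = (m + 16) ^ 12 := by
    rw [show (m + 16) ^ 4 * (m + 16) ^ 8 = (m + 16) ^ 12 by ring]; exact px 12 (by norm_num)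
  have f14 : (m + 16) ^ 2 * (m + 16) ^ 12 % modulus inp = (m + 16) ^ 14 := by
    rw [show (m + 16) ^ 2 * (m + 16) ^ 12 = (m + 16) ^ 14 by ring]; exact px 14 (by norm_num)
  have f15 : (m + 16) * (m + 16) ^ 14 % modulus inp = (m + 16) ^ 15 := by
    rw [show (m + 16) * (m + 16) ^ 14 = (m + 16) ^ 15 by ring]; exact px 15 (by norm_num)
  have fq : 2 ^ 400 * (m + 16) ^ 15 % modulus inp = trials m := by
    have : trials m = 2 ^ 400 * (m + 16) ^ 15 := by rw [trials]
    rw [← this]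
    exact lt 460 15 (trials_le m) (by norm_num) (by norm_num)
  have c400 : 2 ^ 400 % modulus inp = 2 ^ 400 :=
    cst _ (Nat.pow_le_pow_right (by norm_num) (by norm_num))
  have c81 := cst 81 (by norm_num)
  have c64 := cst 64 (by norm_num)
  have c2 := cst 2 (by norm_num)
  have c1 := cst 1 (by norm_num)
  have c22 := cst 22 (by norm_num)
  have c15 := cst 15 (by norm_num)
  have c16 := cst 16 (by norm_num)
  have cM := cst 4194304 (by norm_num)
  intro τ
  have hrun : τ = (Cmd.block [.rep .m (.block [.set .a (81 * Var.a), .set .bk (64 * Var.bk),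
      .set .s (2 * Var.s)]), .rep .n (.set .s (2 * Var.s)),
      .set .oBud (Var.oQ * (Var.a / Var.bk + 1)), .set .oS (4194304 * Var.s + 2)]).run
      (params₀ inp n m) r ((((((((((σ.setv .oL (m + 22)).setv .oNw ((m + 15) / 16 + 1)).setv .x
        (m + 16)).setv .y ((m + 16) ^ 2)).setv .z ((m + 16) ^ 4)).setv .k ((m + 16) ^ 8)).setv .oQ
        (trials m)).setv .a 1).setv .bk 1).setv .s 1) := by
    simp only [τ, paramC, run_block_cons, run_block_one, run_set, eval_add, eval_mul, eval_div,
      eval_par, eval_lit, eval_lit_eq, eval_var, hV, hm', setv_v, if_true, reduceCtorEq, if_false,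
      e0, c22, e1, c15, e2, c16, e3, c1, e4, e5, f2, f4, f8, f12, f14, f15, c400, fq]
  rw [hrun]
  set σ1 := (((((((((σ.setv .oL (m + 22)).setv .oNw ((m + 15) / 16 + 1)).setv .x
        (m + 16)).setv .y ((m + 16) ^ 2)).setv .z ((m + 16) ^ 4)).setv .k ((m + 16) ^ 8)).setv .oQ
        (trials m)).setv .a 1).setv .bk 1).setv .s 1 with hσ1
  have k1 := run_rep (π := params₀ inp n m) (r := r) (k := .m) (σ := σ1) (fun j τ =>
    τ.v .a = 81 ^ j ∧ τ.v .bk = 64 ^ j ∧ τ.v .s = 2 ^ j ∧ τ.v .oL = m + 22 ∧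
    τ.v .oNw = (m + 15) / 16 + 1 ∧ τ.v .oQ = trials m ∧ τ.mem = σ.mem ∧ τ.tossed = σ.tossed)
    (p := .block [.set .a (81 * Var.a), .set .bk (64 * Var.bk), .set .s (2 * Var.s)]) ?_ ?_
  rotate_left
  · simp [hσ1]
  · rintro j hj τ ⟨h1, h2, h3, h4, h5, h6, h7, h8⟩
    rw [hm'] at hj
    have b1 : 2 ^ (7 * (j + 1)) ≤ 2 ^ (0 + 7 * m) := Nat.pow_le_pow_right (by norm_num) (by omega)
    have g1 : 81 * 81 ^ j % modulus inp = 81 ^ (j + 1) := by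
      rw [← pow_succ']
      refine lt 0 7 (le_trans ?_ b1) (by norm_num) (by norm_num)
      rw [pow_mul]; exact Nat.pow_le_pow_left (by norm_num) _
    have g2 : 64 * 64 ^ j % modulus inp = 64 ^ (j + 1) := by
      rw [← pow_succ']
      refine lt 0 7 (le_trans ?_ b1) (by norm_num) (by norm_num)
      rw [pow_mul]; exact Nat.pow_le_pow_left (by norm_num) _
    have g3 : 2 * 2 ^ j % modulus inp = 2 ^ (j + 1) := by
      rw [← pow_succ']
      refine lt 0 7 (le_trans ?_ b1) (by norm_num) (by norm_num)
      rw [pow_mul]; exact Nat.pow_le_pow_left (by norm_num) _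
    simp [hV, c81, c64, c2, h1, h2, h3, g1, g2, g3, h4, h5, h6, h7, h8]
  rw [hm'] at k1
  rw [run_block_cons]
  set σ2 := (Cmd.rep .m (.block [.set .a (81 * Var.a), .set .bk (64 * Var.bk),
      .set .s (2 * Var.s)])).run (params₀ inp n m) r σ1 with hσ2
  obtain ⟨h1, h2, h3, h4, h5, h6, h7, h8⟩ := k1
  have k2 := run_rep (π := params₀ inp n m) (r := r) (k := .n) (σ := σ2) (fun j τ =>
    τ.v .s = 2 ^ (m + j) ∧ τ.v .a = 81 ^ m ∧ τ.v .bk = 64 ^ m ∧ τ.v .oL = m + 22 ∧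
    τ.v .oNw = (m + 15) / 16 + 1 ∧ τ.v .oQ = trials m ∧ τ.mem = σ.mem ∧ τ.tossed = σ.tossed)
    (p := .set .s (2 * Var.s)) ?_ ?_
  rotate_left
  · exact ⟨h3, h1, h2, h4, h5, h6, h7, h8⟩
  · rintro j hj τ ⟨h1, h2, h3, h4, h5, h6, h7, h8⟩
    rw [hn'] at hj
    have g3 : 2 * 2 ^ (m + j) % modulus inp = 2 ^ (m + (j + 1)) := by
      rw [← pow_succ']
      exact lt' 0 1 (Nat.pow_le_pow_right (by norm_num) (by omega)) (by norm_num) (by norm_num)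
    simp [hV, c2, h1, h2, h3, g3, h4, h5, h6, h7, h8]
  rw [hn'] at k2
  rw [run_block_cons]
  set σ3 := (Cmd.rep .n (.set .s (2 * Var.s))).run (params₀ inp n m) r σ2 with hσ3
  obtain ⟨h1, h2, h3, h4, h5, h6, h7, h8⟩ := k2
  have q0 := quot_le m
  have q1 : 81 ^ m / 64 ^ m % modulus inp = 81 ^ m / 64 ^ m :=
    lt 1 1 (by omega) (by norm_num) (by norm_num)
  have q2 : (81 ^ m / 64 ^ m + 1) % modulus inp = 81 ^ m / 64 ^ m + 1 :=
    lt 1 1 q0 (by norm_num) (by norm_num)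
  have q3 : trials m * (81 ^ m / 64 ^ m + 1) % modulus inp = budget m := by
    have : budget m = trials m * (81 ^ m / 64 ^ m + 1) := by rw [budget]
    rw [← this]
    exact lt 461 16 (budget_le m) (by norm_num) (by norm_num)
  have q4 : 4194304 * 2 ^ (m + n) = 2 ^ (n + (m + 22)) := by
    rw [show n + (m + 22) = 22 + (m + n) by ring, pow_add 2 22 (m + n)]
    norm_num
  have q5 : 2 ^ (n + (m + 22)) % modulus inp = 2 ^ (n + (m + 22)) :=
    lt' 22 1 (Nat.pow_le_pow_right (by norm_num) (by omega)) (by norm_num) (by norm_num)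
  have q6 : (2 ^ (n + (m + 22)) + 2) % modulus inp = 2 ^ (n + (m + 22)) + 2 := by
    refine lt' 23 1 ?_ (by norm_num) (by norm_num)
    have e : 2 ^ (n + (m + 22)) = 2 ^ 22 * 2 ^ (n + m) := by
      rw [show n + (m + 22) = 22 + (n + m) by omega, pow_add]
    have := Nat.one_le_two_pow (n := n + m)
    rw [e, one_mul, pow_add 2 23]
    omega
  refine ⟨?_, ?_, ?_, ?_, ?_, ?_, ?_⟩ <;>
    simp [hV, h1, h2, h3, h4, h5, h6, h7, h8, c1, c2, cM, q1, q2, q3, q4, q5, q6]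

end RAM

namespace RAM

open SplitSearch

/-! ### Assembling a program -/

/-- The program halts within the given time. -/
def ExecLe (r : ℕ → Bool) (p : Prog) (s s' : State) (B : ℕ) : Prop :=
  ∃ c, Exec r p s s' c ∧ c ≤ B

section

variable {r : ℕ → Bool} {V : ℕ}

theorem ExecLe.op {s : State} {o : BinOp} {x y z a b w : ℕ} (ha : s.reg y = a) (hb : s.reg z = b)
    (hw : o.eval a b = w) (ha' : a ≤ V) (hb' : b ≤ V) (hw' : w ≤ V) :
    ExecLe r (.op o x y z) s (s.setReg x w) (1 * unit V) := by
  subst ha hb hw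
  refine ⟨_, .op _ _ _ _ _, ?_⟩
  have := size_le_of_le ha'
  have := size_le_of_le hb'
  have := size_le_of_le hw'
  simp only [unit]; omega

theorem ExecLe.copy {s : State} {x y a : ℕ} (ha : s.reg y = a) (ha' : a ≤ V) :
    ExecLe r (.copy x y) s (s.setReg x a) (1 * unit V) :=
  .op ha ha (by simp [BinOp.eval]) ha' ha' ha'

theorem ExecLe.const {s : State} {x k : ℕ} (hk : k ≤ V) :
    ExecLe r (.const x k) s (s.setReg x k) (1 * unit V) := by
  refine ⟨_, .const _ _ _, ?_⟩
  have := size_le_of_le hk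
  simp only [unit]; omega

theorem ExecLe.load {s : State} {x y a w : ℕ} (ha : s.reg y = a) (hw : s.mem a = w) (ha' : a ≤ V)
    (hw' : w ≤ V) : ExecLe r (.load x y) s (s.setReg x w) (1 * unit V) := by
  subst ha hw
  refine ⟨_, .load _ _ _, ?_⟩
  have := size_le_of_le ha'
  have := size_le_of_le hw'
  simp only [unit]; omega

theorem ExecLe.seq {p q : Prog} {s s' s'' : State} {a b : ℕ} (h : ExecLe r p s s' (a * unit V))
    (h' : ExecLe r q s' s'' (b * unit V)) : ExecLe r (.seq p q) s s'' ((a + b) * unit V) := by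
  obtain ⟨c, e, hc⟩ := h
  obtain ⟨d, e', hd⟩ := h'
  exact ⟨c + d, e.seq e', by rw [add_mul]; omega⟩

end

theorem setReg_reg (s : State) (x y k : ℕ) :
    (s.setReg x k).reg y = if y = x then k else s.reg y := by
  simp [State.setReg, Function.update_apply]

@[simp] theorem setReg_mem (s : State) (x k : ℕ) : (s.setReg x k).mem = s.mem := rfl
@[simp] theorem setReg_tossed (s : State) (x k : ℕ) : (s.setReg x k).tossed = s.tossed := rfl

theorem inputProd_drop_le (inp : List ℕ) (j : ℕ) : inputProd (inp.drop j) ≤ inputProd inp := by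
  conv_rhs => rw [← List.take_append_drop j inp]
  have := inputProd_pos (inp.take j)
  simp only [inputProd, List.map_append, List.prod_append] at this ⊢
  exact Nat.le_mul_of_pos_left _ this

theorem inputProd_drop (inp : List ℕ) {j : ℕ} (hj : j < inp.length) :
    inputProd (inp.drop (j + 1)) * (inp.getD j 0 + 2) = inputProd (inp.drop j) := by
  rw [List.drop_eq_getElem_cons hj]
  simp only [inputProd, List.map_cons, List.prod_cons, List.getD_eq_getElem _ _ hj]
  ring

theorem pow_inputProd_le (inp : List ℕ) {j : ℕ} (hj : j ≤ 32) : inputProd inp ^ j ≤ modulus inp := by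
  have := lt_modulus (inp := inp) (x := 0) (y := inputProd inp ^ j) (k := 1) (j := j) (by norm_num)
    (Nat.le_mul_of_pos_left _ (by norm_num)) (by norm_num) hj
  omega

theorem getD_lt_modulus (inp : List ℕ) (j : ℕ) : inp.getD j 0 + 2 < modulus inp := by
  have h1 : inp.getD j 0 ≤ inp.sum := by
    by_cases h : j < inp.length
    · rw [List.getD_eq_getElem _ _ h]
      exact List.le_sum_of_mem (List.getElem_mem h)
    · rw [List.getD_eq_default _ _ (by omega)]; exact Nat.zero_le _
  have h2 := sum_lt_inputProd inp
  have := lt_modulus (inp := inp) (x := 2) (y := inputProd inp) (k := 1) (j := 1) (by norm_num)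
    (by rw [pow_one, pow_one]; omega) (by norm_num) (by norm_num)
  omega

/-! ### Machine code for the modulus -/

/-- Multiply register `5` by the product of the entries of the input, increased by two. -/
def prodLoop : Prog := .loop (regT 4) (.seq (.op .sub (regT 4) (regT 4) (regT 1))
  (.seq (.load (regT 7) (regT 4)) (.seq (.op .add (regT 7) (regT 7) (regT 6))
    (.op .mul (regT 5) (regT 5) (regT 7)))))

/-- The input is traversed from its end, so the accumulator always holds the product over a final
segment, which stays below the modulus that is being computed. -/
theorem prodLoop_exec {r : ℕ → Bool} {inp : List ℕ} : ∀ (j : ℕ) (s : State), j ≤ inp.length →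
    s.mem = (init inp).mem → s.reg (regT 4) = j → s.reg (regT 5) = inputProd (inp.drop j) →
    s.reg (regT 1) = 1 → s.reg (regT 6) = 2 → ∃ s', ExecLe r prodLoop s s'
      ((5 * j + 1) * unit (modulus inp)) ∧ s'.mem = s.mem ∧ s'.tossed = s.tossed ∧
      s'.reg (regT 5) = inputProd inp ∧
      ∀ x, x ≠ regT 4 → x ≠ regT 5 → x ≠ regT 7 → s'.reg x = s.reg x := by
  have hV2 := pow_inputProd_le inp (j := 1) (by norm_num)
  rw [pow_one] at hV2
  have hV := length_lt_modulus inp 2 (by norm_num)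
  intro j
  induction j with
  | zero =>
    intro s _ _ h4 h5 _ _
    refine ⟨s, ⟨_, .loop_false h4, by simp [h4, unit]⟩, rfl, rfl, by simpa using h5,
      fun _ _ _ _ => rfl⟩
  | succ j ih =>
    intro s hj hm h4 h5 h1 h6
    have hg := getD_lt_modulus inp j
    have hP : inputProd (inp.drop (j + 1)) * (inp.getD j 0 + 2) ≤ modulus inp := by
      rw [inputProd_drop inp (by omega)]
      exact (inputProd_drop_le inp j).trans hV2
    have hP2 := (inputProd_drop_le inp (j + 1)).trans hV2
    set s1 := (((s.setReg (regT 4) j).setReg (regT 7) (inp.getD j 0)).setReg (regT 7)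
        (inp.getD j 0 + 2)).setReg (regT 5) (inputProd (inp.drop (j + 1)) * (inp.getD j 0 + 2))
      with hs1
    have e : ExecLe r (.seq (.op .sub (regT 4) (regT 4) (regT 1))
        (.seq (.load (regT 7) (regT 4)) (.seq (.op .add (regT 7) (regT 7) (regT 6))
        (.op .mul (regT 5) (regT 5) (regT 7))))) s s1 ((1 + (1 + (1 + 1))) * unit (modulus inp)) := by
      refine .seq (.op h4 h1 (w := j) rfl (by omega) (by omega) (by omega)) (.seq (.load (setReg_self _ _ _)
        (by rw [setReg_mem, hm]; rfl) (by omega) (by omega)) (.seq (.op (setReg_self _ _ _)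
        (b := 2) (w := inp.getD j 0 + 2) ?_ rfl (by omega) (by omega) (by omega)) (.op (a := inputProd (inp.drop (j + 1)))
        (b := inp.getD j 0 + 2) (w := inputProd (inp.drop (j + 1)) * (inp.getD j 0 + 2)) ?_ ?_ rfl
        hP2 (by omega) hP)))
      · simp [setReg_reg, regT_inj, h6]
      · simp [setReg_reg, regT_inj, h5]
      · simp [setReg_reg]
    obtain ⟨s', ⟨c', e', hc'⟩, k1, k2, k3, k4⟩ := ih s1 (by omega) (by simp [hs1, hm])
      (by simp [hs1, setReg_reg, regT_inj]) (by rw [hs1, setReg_self, inputProd_drop inp (by omega)])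
      (by simp [hs1, setReg_reg, regT_inj, h1]) (by simp [hs1, setReg_reg, regT_inj, h6])
    obtain ⟨c, e, hc⟩ := e
    refine ⟨s', ⟨_, .loop_true (by omega) e e', ?_⟩, by simp [k1, hs1], by simp [k2, hs1], k3,
      fun x h4 h5 h7 => ?_⟩
    · have h0 := size_le_of_le (by omega : j + 1 ≤ modulus inp)
      rw [h4]
      have : 1 + (j + 1).size ≤ unit (modulus inp) := by simp only [unit]; omega
      have e2 : (5 * (j + 1) + 1) * unit (modulus inp) = 1 * unit (modulus inp) +
        (1 + (1 + (1 + 1))) * unit (modulus inp) + (5 * j + 1) * unit (modulus inp) := by ring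
      omega
    · rw [k4 x h4 h5 h7]; simp [hs1, setReg_reg, h4, h5, h7]

/-- Read `n` and `m`, and compute the modulus for an input of length `n * m + (n + m) * a + b`. -/
def modulusProg (a b : ℕ) : Prog :=
  .seq (.const (regT 0) 0) <| .seq (.const (regT 1) 1) <| .seq (.load (regP .n) (regT 0)) <|
  .seq (.load (regP .m) (regT 1)) <| .seq (.op .add (regP .m1) (regP .m) (regT 1)) <|
  .seq (.op .mul (regP .N) (regP .n) (regP .m)) <| .seq (.op .add (regT 2) (regP .n) (regP .m)) <|
  .seq (.const (regT 3) a) <| .seq (.op .mul (regT 2) (regT 2) (regT 3)) <|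
  .seq (.op .add (regP .N) (regP .N) (regT 2)) <| .seq (.const (regT 3) b) <|
  .seq (.op .add (regP .N) (regP .N) (regT 3)) <| .seq (.copy (regT 4) (regP .N)) <|
  .seq (.const (regT 5) 1) <| .seq (.const (regT 6) 2) <| .seq prodLoop <|
  .seq (.op .mul (regT 5) (regT 5) (regT 5)) <| .seq (.op .mul (regT 5) (regT 5) (regT 5)) <|
  .seq (.op .mul (regT 5) (regT 5) (regT 5)) <| .seq (.op .mul (regT 5) (regT 5) (regT 5)) <|
  .seq (.op .mul (regT 5) (regT 5) (regT 5)) <| .seq (.const (regT 7) (2 ^ 600)) <|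
  .op .mul (regP .V) (regT 7) (regT 5)

/-- The machine before the start of the computation, up to auxiliary registers. -/
structure Fresh (inp : List ℕ) (s : State) : Prop where
  mem : s.mem = (init inp).mem
  tossed : s.tossed = 0
  var : ∀ x, s.reg (regV x) = 0
  par : ∀ k, s.reg (regP k) = 0

/-- The initial state in the high-level language. -/
def start (inp : List ℕ) : St where
  v _ := 0
  mem i j := inp.getD (j * modulus inp + i) 0
  tossed := 0

/-- Compiled commands presuppose the modulus, so this prelude is written directly for the machine.
The length of the input is computed from `n` and `m`, and five squarings produce the power 32. -/
theorem modulusProg_exec {r : ℕ → Bool} {inp : List ℕ} {n m a b : ℕ} (hn : inp.getD 0 0 = n)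
    (hm : inp.getD 1 0 = m) (hlen : inp.length = n * m + (n + m) * a + b) (hnm : n + m ≤ inp.length)
    (ha : a ≤ 1) {s : State} (hs : Fresh inp s) :
    ∃ s', ExecLe r (modulusProg a b) s s' ((5 * inp.length + 30) * unit (modulus inp)) ∧
      Rep (params₀ inp n m) (start inp) s' := by
  set V := modulus inp with hVd
  have hV := length_lt_modulus inp 2 (by norm_num)
  have pw : ∀ j ≤ 32, inputProd inp ^ j ≤ V := fun j hj => pow_inputProd_le inp hj
  have hmem0 : s.mem 0 = n := by rw [hs.mem]; exact hn
  have hmem1 : s.mem 1 = m := by rw [hs.mem]; exact hm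
  have hna : (n + m) * a ≤ n + m := by
    calc (n + m) * a ≤ (n + m) * 1 := Nat.mul_le_mul_left _ ha
      _ = _ := mul_one _
  set N := inp.length with hN
  obtain ⟨b1, b2, b3, b4, b5, b6, b7, b8, b9, b10, b11, b12⟩ : 1 ≤ V ∧ 2 ≤ V ∧ n ≤ V ∧ m ≤ V ∧
      m + 1 ≤ V ∧ n * m ≤ V ∧ n + m ≤ V ∧ a ≤ V ∧ (n + m) * a ≤ V ∧ n * m + (n + m) * a ≤ V ∧
      b ≤ V ∧ N ≤ V := by
    refine ⟨?_, ?_, ?_, ?_, ?_, ?_, ?_, ?_, ?_, ?_, ?_, ?_⟩ <;> omega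
  have hB : 1 + (1 + (1 + (1 + (1 + (1 + (1 + (1 + (1 + (1 + (1 + (1 + (1 + (1 + (1 + ((5 * N + 1) +
      (1 + (1 + (1 + (1 + (1 + (1 + 1))))))))))))))))))))) ≤ 5 * N + 30 := by
    ring_nf
    exact Nat.add_le_add_right (by norm_num) _
  obtain ⟨K, hK⟩ : ∃ K, K = 2 ^ 600 := ⟨_, rfl⟩
  have h600 : K * inputProd inp ^ 32 = V := by rw [hVd, modulus, hK]
  have h600' : K ≤ V := by
    rw [← h600]
    exact Nat.le_mul_of_pos_right _ (Nat.pow_pos (inputProd_pos inp))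
  set s1 := ((((((((((((((s.setReg (regT 0) 0).setReg (regT 1) 1).setReg (regP .n) n).setReg
    (regP .m) m).setReg (regP .m1) (m + 1)).setReg (regP .N) (n * m)).setReg (regT 2) (n + m)).setReg
    (regT 3) a).setReg (regT 2) ((n + m) * a)).setReg (regP .N) (n * m + (n + m) * a)).setReg
    (regT 3) b).setReg (regP .N) N).setReg (regT 4) N).setReg (regT 5) 1).setReg (regT 6) 2 with hs1
  obtain ⟨s2, e2, k1, k2, k3, k4⟩ := prodLoop_exec (r := r) (inp := inp) N s1 le_rfl
    (by simp [hs1, hs.mem]) (by simp [hs1, setReg_reg, regT_inj])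
    (by simp [hs1, setReg_reg, regT_inj, hN, inputProd])
    (by simp [hs1, setReg_reg, regT_inj, (regP_ne_regT _ _).symm]) (by simp [hs1, setReg_reg])
  set Z := inputProd inp with hZ
  have hZ1 := pw 1 (by norm_num)
  rw [pow_one] at hZ1
  set s3 := ((((((s2.setReg (regT 5) (Z ^ 2)).setReg (regT 5) (Z ^ 4)).setReg (regT 5)
    (Z ^ 8)).setReg (regT 5) (Z ^ 16)).setReg (regT 5) (Z ^ 32)).setReg (regT 7) K).setReg
    (regP .V) V with hs3
  have mulZ : ∀ i j, i + i = j → BinOp.mul.eval (Z ^ i) (Z ^ i) = Z ^ j := by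
    rintro i _ rfl; exact (pow_add _ _ _).symm
  refine ⟨s3, ?_, ?_⟩
  · rw [modulusProg, ← hK]
    clear hK
    have key : ∀ {p B}, ExecLe r p s s3 (B * unit V) → B ≤ 5 * N + 30 →
        ExecLe r p s s3 ((5 * N + 30) * unit V) := by
      rintro p B ⟨c, e, hc⟩ hB
      exact ⟨c, e, hc.trans (Nat.mul_le_mul_right (unit V) hB)⟩
    refine key ?_ hB
    · refine .seq (.const (Nat.zero_le _)) <| .seq (.const b1) <|
        .seq (.load (a := 0) ?_ (by simpa using hmem0) (Nat.zero_le _) b3) <|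
        .seq (.load (a := 1) ?_ (by simpa using hmem1) b1 b4) <|
        .seq (.op (a := m) (b := 1) (w := m + 1) ?_ ?_ rfl b4 b1 b5) <|
        .seq (.op (a := n) (b := m) (w := n * m) ?_ ?_ rfl b3 b4 b6) <|
        .seq (.op (a := n) (b := m) (w := n + m) ?_ ?_ rfl b3 b4 b7) <|
        .seq (.const b8) <|
        .seq (.op (a := n + m) (b := a) (w := (n + m) * a) ?_ ?_ rfl b7 b8 b9) <|
        .seq (.op (a := n * m) (b := (n + m) * a) (w := n * m + (n + m) * a) ?_ ?_ rfl b6 b9 b10) <|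
        .seq (.const b11) <|
        .seq (.op (a := n * m + (n + m) * a) (b := b) (w := N) ?_ ?_ hlen.symm b10 b11 b12) <|
        .seq (.copy ?_ b12) <| .seq (.const b1) <| .seq (.const b2) <|
        .seq e2 <|
        .seq (.op (a := Z ^ 1) (b := Z ^ 1) ?_ ?_ (mulZ 1 2 rfl) (pw _ (by norm_num))
          (pw _ (by norm_num)) (pw _ (by norm_num))) <|
        .seq (.op (a := Z ^ 2) (b := Z ^ 2) ?_ ?_ (mulZ 2 4 rfl) (pw _ (by norm_num))
          (pw _ (by norm_num)) (pw _ (by norm_num))) <|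
        .seq (.op (a := Z ^ 4) (b := Z ^ 4) ?_ ?_ (mulZ 4 8 rfl) (pw _ (by norm_num))
          (pw _ (by norm_num)) (pw _ (by norm_num))) <|
        .seq (.op (a := Z ^ 8) (b := Z ^ 8) ?_ ?_ (mulZ 8 16 rfl) (pw _ (by norm_num))
          (pw _ (by norm_num)) (pw _ (by norm_num))) <|
        .seq (.op (a := Z ^ 16) (b := Z ^ 16) ?_ ?_ (mulZ 16 32 rfl) (pw _ (by norm_num))
          (pw _ (by norm_num)) (pw _ (by norm_num))) <|
        .seq (.const h600') <|
        .op (a := K) (b := Z ^ 32) ?_ ?_ h600 h600' (pw _ (by norm_num)) le_rfl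
      all_goals simp only [setReg_reg, regT_inj, regP_inj, (regP_ne_regT _ _).symm, regP_ne_regT,
        if_true, if_false, reduceCtorEq, k3, pow_one]
      all_goals norm_num
  · have hT : ∀ k, s2.reg (regP k) = s1.reg (regP k) := fun k =>
      k4 _ (regP_ne_regT _ _) (regP_ne_regT _ _) (regP_ne_regT _ _)
    have hT' : ∀ k, s2.reg (regV k) = s1.reg (regV k) := fun k =>
      k4 _ (regV_ne_regT _ _) (regV_ne_regT _ _) (regV_ne_regT _ _)
    refine ⟨fun x => ?_, fun k => ?_, fun i j hi => ?_, ?_⟩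
    · simp [hs3, hs1, setReg_reg, regV_ne_regT, regV_ne_regP, hT', hs.var, start]
    · cases k <;> simp [hs3, hs1, setReg_reg, regP_ne_regT, regP_inj, hT, hs.par, params₀, hVd, hN]
    · simp only [hs3, setReg_mem, k1, hs1, hs.mem]; rfl
    · simp only [hs3, setReg_tossed, k2, hs1, hs.tossed]; rfl

theorem start_bdd (inp : List ℕ) (n m : ℕ) : (start inp).Bdd (params₀ inp n m) := by
  refine ⟨fun x => ?_, fun i j => ?_⟩
  · have := length_lt_modulus inp 0 (by norm_num)
    simp only [start, params₀]; omega
  · have := getD_lt_modulus inp (j * modulus inp + i)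
    simp only [start, params₀]; omega

/-! ### The complete program around a command -/

/-- Move the computed parameters to their registers. -/
def paramCopies : Prog :=
  .seq (.copy (regP .L) (regV .oL)) <| .seq (.copy (regP .nw) (regV .oNw)) <|
  .seq (.copy (regP .q) (regV .oQ)) <| .seq (.copy (regP .bud) (regV .oBud)) <|
  .copy (regP .S) (regV .oS)

/-- The state of the high-level program after the computation of the parameters. -/
def ready (inp : List ℕ) (n m : ℕ) (r : ℕ → Bool) : St :=
  paramC.run (params₀ inp n m) r (start inp)

theorem ready_spec {inp : List ℕ} {n m : ℕ} (h : n + m ≤ inp.length) (r : ℕ → Bool) :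
    (ready inp n m r).Bdd (params inp n m) ∧ (ready inp n m r).mem = (start inp).mem ∧
      (ready inp n m r).tossed = 0 := by
  have h1 := Cmd.run_bdd (r := r) (paramsOK₀ h) paramC (start_bdd inp n m)
  obtain ⟨-, -, -, -, -, k1, k2⟩ := paramC_spec h (r := r) (σ := start inp)
  exact ⟨⟨h1.var, h1.mem⟩, k1, k2⟩

theorem paramCopies_exec {inp : List ℕ} {n m : ℕ} (h : n + m ≤ inp.length) {r : ℕ → Bool} {s : State}
    (hs : Rep (params₀ inp n m) (ready inp n m r) s) :
    ∃ s', ExecLe r paramCopies s s' (5 * unit (modulus inp)) ∧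
      Rep (params inp n m) (ready inp n m r) s' := by
  obtain ⟨hb, -, -⟩ := ready_spec h r
  obtain ⟨k1, k2, k3, k4, k5, -, -⟩ := paramC_spec h (r := r) (σ := start inp)
  have hv : ∀ x, s.reg (regV x) ≤ modulus inp := fun x => by
    rw [hs.var]; exact (hb.var x).le
  refine ⟨_, ExecLe.seq (.copy rfl ?_) <| .seq (.copy rfl ?_) <| .seq (.copy rfl ?_) <|
    .seq (.copy rfl ?_) (.copy rfl ?_), ?_⟩
  · exact hv _
  · simpa only [setReg_of_ne _ _ (regV_ne_regP _ _)] using hv _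
  · simpa only [setReg_of_ne _ _ (regV_ne_regP _ _)] using hv _
  · simpa only [setReg_of_ne _ _ (regV_ne_regP _ _)] using hv _
  · simpa only [setReg_of_ne _ _ (regV_ne_regP _ _)] using hv _
  · refine ⟨fun x => ?_, fun k => ?_, fun i j hi => hs.mem i j hi, hs.tossed⟩
    · simp only [setReg_of_ne _ _ (regV_ne_regP _ _)]; exact hs.var x
    · simp only [setReg_of_ne _ _ (regV_ne_regP _ _), hs.var, ready, setReg_reg, regP_inj, hs.par,
        k1, k2, k3, k4, k5]
      cases k <;> simp [params, params₀]

/-- A high-level program with its preparations. -/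
def mainProg (a b : ℕ) (P : Cmd) : Prog :=
  .seq (modulusProg a b) <| .seq (paramC.compile 0) <| .seq paramCopies (P.compile 0)

/-- The time for `mainProg`. -/
def mainTime (P : Cmd) (inp : List ℕ) (n m : ℕ) : ℕ :=
  (5 * inp.length + 35 + paramC.steps (params₀ inp n m) + P.steps (params inp n m)) *
    unit (modulus inp)

theorem mainProg_exec {r : ℕ → Bool} {inp : List ℕ} {n m a b : ℕ} (P : Cmd)
    (hn : inp.getD 0 0 = n) (hm : inp.getD 1 0 = m)
    (hlen : inp.length = n * m + (n + m) * a + b) (hnm : n + m ≤ inp.length)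
    (ha : a ≤ 1) {s : State} (hs : Fresh inp s) :
    ∃ s', ExecLe r (mainProg a b P) s s' (mainTime P inp n m) ∧
      Rep (params inp n m) (P.run (params inp n m) r (ready inp n m r)) s' := by
  obtain ⟨s1, ⟨c1, e1, h1⟩, r1⟩ := modulusProg_exec (r := r) hn hm hlen hnm ha hs
  obtain ⟨s2, c2, e2, h2, r2, -⟩ := Cmd.compile_exec (r := r) (paramsOK₀ hnm) paramC 0 _ s1
    (start_bdd inp n m) r1
  obtain ⟨s3, ⟨c3, e3, h3⟩, r3⟩ := paramCopies_exec hnm r2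
  obtain ⟨s4, c4, e4, h4, r4, -⟩ := Cmd.compile_exec (r := r) (setting hnm).ok P 0 _ s3
    (ready_spec hnm r).1 r3
  refine ⟨s4, ⟨_, e1.seq (e2.seq (e3.seq e4)), ?_⟩, r4⟩
  have u1 : unit (params₀ inp n m .V) = unit (modulus inp) := rfl
  have u2 : unit (params inp n m .V) = unit (modulus inp) := rfl
  rw [u1] at h2
  rw [u2] at h4
  simp only [mainTime, add_mul] at *
  omega

end RAM

namespace RAM

open SplitSearch

variable {π : Par → ℕ} {r : ℕ → Bool} {σ : St} {col ω : ℕ → ℕ}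

/-! ### Loading the columns and the weights -/

/-- The number with binary digits `f 0, …, f (n - 1)`. -/
def horner (f : ℕ → ℕ) : ℕ → ℕ
  | 0 => 0
  | n + 1 => 2 * horner f n + f n

theorem horner_lt {f : ℕ → ℕ} {n : ℕ} (hf : ∀ u < n, f u < 2) : horner f n < 2 ^ n := by
  induction n with
  | zero => simp [horner]
  | succ n ih =>
    have := ih fun u hu => hf u (by omega)
    have := hf n (by omega)
    rw [horner, pow_succ]; omega

theorem horner_inj {f g : ℕ → ℕ} {n : ℕ} (hf : ∀ u < n, f u < 2) (hg : ∀ u < n, g u < 2) :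
    horner f n = horner g n ↔ ∀ u < n, f u = g u := by
  induction n with
  | zero => simp [horner]
  | succ n ih =>
    have h := ih (fun u hu => hf u (by omega)) (fun u hu => hg u (by omega))
    have h1 := hf n (by omega)
    have h2 := hg n (by omega)
    rw [Nat.forall_lt_succ_right, ← h, horner, horner]
    omega

theorem xorF_lt_two {f : ℕ → ℕ} {S : Finset ℕ} (h : ∀ i ∈ S, f i < 2) : xorF f S < 2 :=
  xorF_lt f 1 S (by simpa using h)

/-- Exclusive or acts digit by digit, so a linear system over the field with two elements becomes
one equation between numbers. -/
theorem xorF_horner {A : ℕ → ℕ → ℕ} {n : ℕ} {S : Finset ℕ} (h : ∀ i ∈ S, ∀ u < n, A u i < 2) :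
    xorF (fun i => horner (fun u => A u i) n) S = horner (fun u => xorF (A u) S) n := by
  induction n with
  | zero =>
    simp only [horner]
    induction S using Finset.induction_on with
    | empty => rfl
    | insert i S hi ih =>
      rw [xorF_insert _ hi, ih fun i hi => h i (Finset.mem_insert_of_mem hi)]; rfl
  | succ n ih =>
    rw [horner, ← ih fun i hi u hu => h i hi u (by omega)]
    simp only [horner]
    clear ih
    induction S using Finset.induction_on with
    | empty => rfl
    | insert i S hi ih =>
      have h' : ∀ i ∈ S, A n i < 2 := fun i hi => h i (Finset.mem_insert_of_mem hi) n (by omega)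
      rw [xorF_insert _ hi, ih fun i hi => h i (Finset.mem_insert_of_mem hi), xorF_insert _ hi,
        xorF_insert _ hi, two_mul_add_xor (h i (Finset.mem_insert_self _ _) n (by omega))
          (xorF_lt_two h')]

theorem natCast_xorF (f : ℕ → ℕ) (S : Finset ℕ) :
    ((xorF f S : ℕ) : ZMod 2) = ∑ i ∈ S, (f i : ZMod 2) := by
  induction S using Finset.induction_on with
  | empty => simp
  | insert i S hi ih =>
    rw [xorF_insert _ hi, Finset.sum_insert hi, ← ih, ← Nat.cast_add, ZMod.natCast_eq_natCast_iff']
    exact Nat.xor_mod_two_eq ..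

/-- Read a column of digits, starting at address `ad`, and count the ones. -/
def readCol : Cmd := .block
  [.set .x 0, .set .cnt 0, .rep .n (.block
    [.set .x (2 * Var.x + .get Var.ad 0), .set .cnt (Var.cnt + .get Var.ad 0),
     .set .ad (Var.ad + Var.step)])]

/-- An input cell `a < V` is entry 0 of array `a`. The stride `b` serves both for matrices stored by
rows and for vectors stored contiguously. -/
theorem readCol_spec (hS : Setting π) {f : ℕ → ℕ} (hf : ∀ u < π .n, f u < 2) {a b : ℕ}
    (ha : σ.v .ad = a) (hb : σ.v .step = b) (hm : ∀ u < π .n, σ.mem (a + u * b) 0 = f u)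
    (hV : a + π .n * b < π .V) :
    (readCol.run π r σ).v .x = horner f (π .n) ∧
    (readCol.run π r σ).v .cnt = ∑ u ∈ Finset.range (π .n), f u ∧
    (readCol.run π r σ).mem = σ.mem ∧ (readCol.run π r σ).tossed = σ.tossed := by
  have hbig := hS.big
  have hsig := hS.sig
  have m0 : 0 % π .V = 0 := Nat.zero_mod _
  have m2 : 2 % π .V = 2 := Nat.mod_eq_of_lt (by omega)
  simp only [readCol, run_block_cons, run_block_one, run_set]
  set σ0 := (σ.setv .x _).setv .cnt _ with hσ0
  have key := run_rep (π := π) (r := r) (σ := σ0) (k := .n) (fun j τ =>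
    τ.v .x = horner f j ∧ τ.v .cnt = ∑ u ∈ Finset.range j, f u ∧ τ.mem = σ.mem ∧
    τ.tossed = σ.tossed ∧ τ.v .ad = a + j * b ∧ τ.v .step = b)
    (p := .block
    [.set .x (2 * Var.x + .get Var.ad 0), .set .cnt (Var.cnt + .get Var.ad 0),
     .set .ad (Var.ad + Var.step)]) ?_ ?_
  · exact ⟨key.1, key.2.1, key.2.2.1, key.2.2.2.1⟩
  · simp [hσ0, horner, ha, hb]
  · rintro j hj τ ⟨h1, h2, h3, h4, h5, h6⟩
    have hx : horner f (j + 1) < 2 ^ (π .n + π .L) :=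
      (horner_lt fun u hu => hf u (by omega)).trans_le
        (Nat.pow_le_pow_right (by norm_num) (by omega))
    have hc : ∑ u ∈ Finset.range (j + 1), f u ≤ j + 1 := by
      calc ∑ u ∈ Finset.range (j + 1), f u ≤ ∑ u ∈ Finset.range (j + 1), 1 :=
            Finset.sum_le_sum fun u hu => by
              have := hf u (by have := Finset.mem_range.1 hu; omega)
              omega
        _ = _ := by simp
    have hj2 : j + 1 < 2 ^ (π .n + π .L) :=
      Nat.lt_two_pow_self.trans_le (Nat.pow_le_pow_right (by norm_num) (by omega))
    rw [horner] at hx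
    rw [Finset.sum_range_succ] at hc
    have hjb : (j + 1) * b ≤ π .n * b := Nat.mul_le_mul_right _ hj
    rw [Nat.succ_mul] at hjb
    have e1 : 2 * horner f j % π .V = 2 * horner f j := Nat.mod_eq_of_lt (by omega)
    have e2 : (2 * horner f j + f j) % π .V = 2 * horner f j + f j := Nat.mod_eq_of_lt (by omega)
    have e3 : (∑ u ∈ Finset.range j, f u + f j) % π .V = ∑ u ∈ Finset.range j, f u + f j :=
      Nat.mod_eq_of_lt (by omega)
    have e4 : (a + (j * b + b)) % π .V = a + (j * b + b) := Nat.mod_eq_of_lt (by omega)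
    have e5 : (j + 1) * b = j * b + b := Nat.succ_mul _ _
    simp [h1, h2, h3, h4, h5, h6, m2, hm j hj, e1, e2, e3, e4, e5, horner,
      Finset.sum_range_succ, add_assoc]

/-- The value of `x` after running `A` in a state whose low arrays agree with `mem₀`. -/
def Loads (π : Par → ℕ) (r : ℕ → Bool) (mem₀ : ℕ → ℕ → ℕ) (A : Cmd) (x : Var) (i c : ℕ) : Prop :=
  ∀ τ : St, τ.Bdd π → τ.v .i = i → (∀ a < π .N, τ.mem a = mem₀ a) →
    (A.run π r τ).v x = c ∧ (A.run π r τ).mem = τ.mem ∧ (A.run π r τ).tossed = τ.tossed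

/-- Prepare the search, where `A` loads a column and its weight, and `B` loads the target. -/
def setupC (A B : Cmd) : Cmd := .block
  [.set .a 1, .set .i 0,
   .rep .m (.block [A, .put idCol Var.i Var.x, .put idWt Var.i Var.wt,
     .put idSing (Var.i + 2) Var.a, .set .a (2 * Var.a), .set .i (Var.i + 1)]),
   B, .put idCol Par.m Var.x, .put idSing 0 Par.m1, .set .flag 0, .set .F (idSing + 1)]

/-- The list of singletons is laid out with its length `m + 1` in entry 0, the empty set in the
untouched entry 1, and `2 ^ i` in entry `i + 2`. After the loop the index has the value `m`, which
is what the loader of the target expects. -/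
theorem setupC_spec (hS : Setting π) (hσ : σ.Bdd π) {A B : Cmd}
    (hfresh : ∀ i, π .N ≤ i → ∀ j, σ.mem i j = 0)
    (hA : ∀ i < π .m, Loads π r σ.mem A .x i (col i) ∧ Loads π r σ.mem A .wt i (ω i))
    (hB : Loads π r σ.mem B .x (π .m) (col (π .m))) (hAi : ¬ A.writes .i) (hAa : ¬ A.writes .a) :
    SearchInv π r col ω ((setupC A B).run π r σ) 0 ((setupC A B).run π r σ) ∧
    (∀ i < π .N, ((setupC A B).run π r σ).mem i = σ.mem i) ∧
    ((setupC A B).run π r σ).tossed = σ.tossed ∧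
    ((setupC A B).run π r σ).v .F = π .N + 4 := by
  have hbig := hS.big
  have hN := hS.N
  have hm := hS.m_lt
  have hmV := hS.m
  have hsig := hS.sig
  have hm1 := hS.m1
  have hbdd := Cmd.run_bdd (r := r) hS.ok (setupC A B) hσ
  have m0 : 0 % π .V = 0 := Nat.zero_mod _
  have m1 : 1 % π .V = 1 := Nat.mod_eq_of_lt (by omega)
  have m2 : 2 % π .V = 2 := Nat.mod_eq_of_lt (by omega)
  have m3 : 3 % π .V = 3 := Nat.mod_eq_of_lt (by omega)
  have mm : π .m % π .V = π .m := Nat.mod_eq_of_lt (by omega)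
  have mm1 : (π .m + 1) % π .V = π .m + 1 := Nat.mod_eq_of_lt (by omega)
  have mN : π .N % π .V = π .N := Nat.mod_eq_of_lt (by omega)
  have mN1 : (π .N + 1) % π .V = π .N + 1 := Nat.mod_eq_of_lt (by omega)
  have mN3 : (π .N + 3) % π .V = π .N + 3 := Nat.mod_eq_of_lt (by omega)
  have mN4 : (π .N + 3 + 1) % π .V = π .N + 3 + 1 := Nat.mod_eq_of_lt (by omega)
  obtain ⟨τ, hτ⟩ : ∃ τ, (setupC A B).run π r σ = τ := ⟨_, rfl⟩
  rw [hτ] at hbdd ⊢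
  simp only [setupC, run_block_cons, run_block_one, run_set, run_put] at hτ
  set body : Cmd := .block [A, .put idCol Var.i Var.x, .put idWt Var.i Var.wt,
     .put idSing (Var.i + 2) Var.a, .set .a (2 * Var.a), .set .i (Var.i + 1)] with hbody
  set σ0 := (σ.setv .a (Expr.eval π σ 1)).setv .i _ with hσ0
  have b0 : σ0.Bdd π := by
    rw [hσ0]
    refine (hσ.setv (Expr.eval_lt hS.ok hσ _)).setv ?_
    simp only [eval_lit, m0]; omega
  have key := run_rep (π := π) (r := r) (σ := σ0) (k := .m) (fun j τ =>
    τ.Bdd π ∧ τ.v .i = j ∧ τ.v .a = 2 ^ j ∧ τ.tossed = σ.tossed ∧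
    (∀ i < j, τ.mem (π .N) i = col i ∧ τ.mem (π .N + 1) i = ω i ∧ τ.mem (π .N + 3) (i + 2) = 2 ^ i) ∧
    τ.mem (π .N + 3) 1 = 0 ∧ (∀ i < π .N, τ.mem i = σ.mem i) ∧
    (∀ i, π .N + 4 ≤ i → τ.mem i = σ.mem i)) (p := body) ?_ ?_
  · set τ1 := (Cmd.rep .m body).run π r σ0 with hτ1
    obtain ⟨h1, h2, h3, h4, h5, h6, h7, h8⟩ := key
    obtain ⟨l1, l2, l3⟩ := hB τ1 h1 h2 h7
    set τ2 := B.run π r τ1 with hτ2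
    have E : τ = (((τ2.setm (π .N) (π .m) (col (π .m))).setm (π .N + 3) 0 (π .m + 1)).setv .flag
        0).setv .F (π .N + 4) := by
      rw [← hτ]
      simp [idCol, idSing, mN, mN3, mN4, mm, hm1, mm1, m0, m1, m3, l1]
    have hmem : ∀ i j, τ.mem i j = if i = π .N + 3 ∧ j = 0 then π .m + 1 else
        if i = π .N ∧ j = π .m then col (π .m) else τ1.mem i j := by
      intro i j
      rw [E]; simp [setm_mem, l2]
    have hlow : ∀ i < π .N, τ.mem i = τ1.mem i := fun i hi => by
      funext j; rw [hmem, if_neg (by omega), if_neg (by omega)]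
    refine ⟨⟨hbdd, by simp, fun i hi => ?_, fun i hi => ?_, ⟨?_, fun k hk => ?_⟩, ?_, by simp,
      fun i hi j => ?_, fun i hi => rfl, ?_, fun c hc => absurd hc (Nat.not_lt_zero _)⟩,
      fun i hi => (hlow i hi).trans (h7 i hi), ?_, ?_⟩
    · rw [hmem, if_neg (by omega)]
      by_cases h : i = π .m
      · simp [h]
      · rw [if_neg (by omega)]; exact (h5 i (by omega)).1
    · rw [hmem, if_neg (by omega), if_neg (by omega)]; exact (h5 i hi).2.1
    · rw [hmem]; simp [singles]
    · rw [hmem, if_neg (by omega), if_neg (by omega)]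
      rcases k with _ | k
      · simpa [singles] using h6
      · have hk' : k < π .m := by simpa [singles] using hk
        simpa [singles] using (h5 k hk').2.2
    · rw [E]; simp
    · have hi' : π .N + 4 ≤ i := by rw [E] at hi; simpa using hi
      rw [hmem, if_neg (by omega), if_neg (by omega), h8 i hi']
      exact hfresh i (by omega) j
    · rw [E]; simp
    · rw [E]; simp [l3, h4]
    · rw [E]; simp
  · refine ⟨b0, by simp [hσ0], by simp [hσ0, m1], rfl, fun i hi => absurd hi (Nat.not_lt_zero _),
      hfresh _ (by omega) _, fun i _ => rfl, fun i _ => rfl⟩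
  · rintro j hj τ' ⟨h1, h2, h3, h4, h5, h6, h7, h8⟩
    have hb := Cmd.run_bdd (r := r) hS.ok body h1
    obtain ⟨l1, l2, l3⟩ := (hA j hj).1 τ' h1 h2 h7
    obtain ⟨l4, -, -⟩ := (hA j hj).2 τ' h1 h2 h7
    have hAi' : (A.run π r τ').v .i = j := (A.run_of_not_writes hAi).trans h2
    have hAa' : (A.run π r τ').v .a = 2 ^ j := (A.run_of_not_writes hAa).trans h3
    have hp : 2 ^ (j + 1) ≤ 2 ^ π .m := Nat.pow_le_pow_right (by norm_num) hj
    have hl : 2 ≤ 2 ^ (π .n + π .L) ∨ π .L = 0 := by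
      rcases Nat.eq_zero_or_pos (π .L) with h | h
      · exact .inr h
      · left; calc 2 = 2 ^ 1 := rfl
          _ ≤ _ := Nat.pow_le_pow_right (by norm_num) (by omega)
    have hj2V : j + 2 < π .V := by
      have : j + 1 ≤ 2 ^ j := Nat.lt_two_pow_self
      have : π .m + 1 < π .V := hm
      omega
    have e1 : (j + 2) % π .V = j + 2 := Nat.mod_eq_of_lt hj2V
    have e2 : (j + 1) % π .V = j + 1 := Nat.mod_eq_of_lt (by omega)
    have e3 : 2 * 2 ^ j % π .V = 2 ^ (j + 1) := by
      rw [← pow_succ']; exact Nat.mod_eq_of_lt (by omega)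
    set τ3 := A.run π r τ' with hτ3
    have E : body.run π r τ' = ((((τ3.setm (π .N) j (col j)).setm (π .N + 1) j (ω j)).setm
        (π .N + 3) (j + 2) (2 ^ j)).setv .a (2 ^ (j + 1))).setv .i (j + 1) := by
      simp [hbody, ← hτ3, idCol, idWt, idSing, mN, mN1, mN3, m1, m2, m3, l1, l4, hAi', hAa', e1,
        e2, e3]
    have hmem : ∀ i k, (body.run π r τ').mem i k = if i = π .N + 3 ∧ k = j + 2 then 2 ^ j else
        if i = π .N + 1 ∧ k = j then ω j else if i = π .N ∧ k = j then col j else τ'.mem i k := by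
      intro i k
      rw [E]; simp [setm_mem, l2]
    refine ⟨hb, by rw [E]; simp, by rw [E]; simp, by rw [E]; simp [l3, h4], fun i hi => ?_, ?_,
      fun i hi => ?_, fun i hi => ?_⟩
    · simp only [hmem]
      by_cases h : i = j
      · subst h; simp
      · obtain ⟨h51, h52, h53⟩ := h5 i (by omega)
        simp [h, h51, h52, h53]
    · rw [hmem, if_neg (by omega), if_neg (by omega), if_neg (by omega), h6]
    · rw [← h7 i hi]; funext k
      rw [hmem, if_neg (by omega), if_neg (by omega), if_neg (by omega)]
    · rw [← h8 i hi]; funext k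
      rw [hmem, if_neg (by omega), if_neg (by omega), if_neg (by omega)]

/-! ### Writing the answer -/

/-- Write the best solution to the output cells. -/
def outC : Cmd := .block
  [.set .z Var.best, .set .i 0,
   .rep .m (.block [.put Var.i 0 (Var.z % 2), .set .z (Var.z / 2), .set .i (Var.i + 1)])]

theorem outC_spec (hS : Setting π) (hσ : σ.Bdd π) : ∀ i < π .m,
    (outC.run π r σ).mem i 0 = if (σ.v .best).testBit i then 1 else 0 := by
  have hbig := hS.big
  have hm := hS.m_lt
  have m0 : 0 % π .V = 0 := Nat.zero_mod _
  have m1 : 1 % π .V = 1 := Nat.mod_eq_of_lt (by omega)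
  have m2 : 2 % π .V = 2 := Nat.mod_eq_of_lt (by omega)
  simp only [outC, run_block_cons, run_block_one, run_set]
  set σ0 := (σ.setv .z _).setv .i _ with hσ0
  refine (run_rep (π := π) (r := r) (σ := σ0) (k := .m) (fun j τ =>
    (∀ i < j, τ.mem i 0 = if (σ.v .best).testBit i then 1 else 0) ∧ τ.v .z = σ.v .best / 2 ^ j ∧
    τ.v .i = j) (p := .block [.put Var.i 0 (Var.z % 2), .set .z (Var.z / 2),
    .set .i (Var.i + 1)]) ?_ ?_).1
  · simp [hσ0]
  · rintro j hj τ ⟨h1, h2, h3⟩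
    have hy : σ.v .best / 2 ^ j < π .V := (Nat.div_le_self _ _).trans_lt (hσ.var .best)
    have hy2 : σ.v .best / 2 ^ j / 2 % π .V = σ.v .best / 2 ^ (j + 1) := by
      rw [pow_succ, ← Nat.div_div_eq_div_mul]
      exact Nat.mod_eq_of_lt ((Nat.div_le_self _ _).trans_lt hy)
    have hj1 : (j + 1) % π .V = j + 1 := Nat.mod_eq_of_lt (by omega)
    have hz : σ.v .best / 2 ^ j % 2 % π .V = σ.v .best / 2 ^ j % 2 := Nat.mod_eq_of_lt (by omega)
    refine ⟨fun i hi => ?_, by simp [h2, m2, hy2], by simp [h3, m1, hj1]⟩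
    simp only [run_block_cons, run_block_one, run_set, run_put, setv_mem, setm_mem, eval_var,
      eval_lit, eval_mod, m0, m2, h2, h3, hz, and_true]
    by_cases h : i = j
    · subst h
      rw [if_pos rfl, testBit_eq_mod]
      simp only [decide_eq_true_eq]
      split_ifs <;> omega
    · rw [if_neg h]; exact h1 i (by omega)

theorem outC_frame {x : Var} (h1 : x ≠ .z) (h2 : x ≠ .i) : (outC.run π r σ).v x = σ.v x :=
  Cmd.run_of_not_writes _ (by simp [outC, Cmd.writes, h1, h2])

end RAM

namespace RAM

open SplitSearch

/-! ### The search finds a solution of least weight -/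

section

variable {inp : List ℕ} {n m : ℕ} {col ω : ℕ → ℕ} {A B : Cmd}

/-- The state after the search. -/
def searched (inp : List ℕ) (n m : ℕ) (A B : Cmd) (r : ℕ → Bool) : St :=
  searchC.run (params inp n m) r ((setupC A B).run (params inp n m) r (ready inp n m r))

/-- What the search needs: the columns fit into the modulus, the weights are positive with a
small sum, and the given commands load them. -/
structure Loader (inp : List ℕ) (n m : ℕ) (col ω : ℕ → ℕ) (A B : Cmd) : Prop where
  len : n + m ≤ inp.length
  col_lt : ∀ i ≤ m, col i < 2 ^ n
  pos : ∀ i < m, 0 < ω i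
  sum_lt : ∑ i ∈ Finset.range m, ω i < modulus inp
  load : ∀ r, ∀ i < m, Loads (params inp n m) r (start inp).mem A .x i (col i) ∧
    Loads (params inp n m) r (start inp).mem A .wt i (ω i)
  target : ∀ r, Loads (params inp n m) r (start inp).mem B .x m (col m)
  keep_i : ¬ A.writes .i
  keep_a : ¬ A.writes .a

/-- Arrays below the input length contain the input, and by `hfresh` all further arrays are empty,
so the search can allocate from there on. No coins have been tossed before the search. -/
theorem Loader.searchInv (h : Loader inp n m col ω A B) (r : ℕ → Bool) :
    ∃ σ : St, σ.tossed = 0 ∧ (∀ i < inp.length, σ.mem i = (start inp).mem i) ∧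
      SearchInv (params inp n m) r col ω σ (((m + 15) / 16 + 1) * trials m)
        (searched inp n m A B r) := by
  obtain ⟨k1, k2, k3⟩ := ready_spec h.len r
  have hS := setting h.len
  have hfresh : ∀ i, (params inp n m) .N ≤ i → ∀ j, (ready inp n m r).mem i j = 0 := by
    intro i hi j
    rw [k2]
    refine List.getD_eq_default _ _ ?_
    have : inp.length ≤ i := hi
    omega
  obtain ⟨h1, h2, h3, h4⟩ := setupC_spec (r := r) (σ := ready inp n m r) hS k1 hfresh
    (by rw [k2]; exact h.load r) (by rw [k2]; exact h.target r) h.keep_i h.keep_a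
  refine ⟨_, h3.trans k3, fun i hi => ?_, searchC_spec hS h.col_lt h.sum_lt ?_ ?_ h1⟩
  · rw [h2 i hi, k2]
  · simp only [params]; omega
  · rw [h4]; exact search_space h.len

/-- Take a solution `X` of least weight. A single successful trial for the size class of `X` yields
a set no heavier than `X`, and the best weight never increases afterwards; so failure means that all
trials of this class fail. -/
theorem Loader.coins_le (h : Loader inp n m col ω A B)
    (hsol : ∃ X ⊆ Finset.range m, xorF col X = col m) :
    coins {r | ¬ ((searched inp n m A B r).v .flag ≠ 0 ∧ ∀ X ⊆ Finset.range m,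
      xorF col X = col m → (searched inp n m A B r).v .bw ≤ ∑ i ∈ X, ω i)} ≤ 1 / 4 := by
  obtain ⟨X, hX, hmin⟩ := Finset.exists_min_image
    ((Finset.range m).powerset.filter fun X => xorF col X = col m) (fun X => ∑ i ∈ X, ω i)
    (by obtain ⟨X, h1, h2⟩ := hsol; exact ⟨X, by simp [h1, h2]⟩)
  simp only [Finset.mem_filter, Finset.mem_powerset] at hX hmin
  obtain ⟨hX1, hX2⟩ := hX
  -- Removing a nonempty set of column sum zero would give a lighter solution; this is where
  -- positive weights are needed.
  have hind : Indep col X := by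
    intro U hU h0
    by_contra hne
    obtain ⟨u, hu⟩ := Finset.nonempty_iff_ne_empty.2 hne
    have h1 := hmin (X \ U) ⟨Finset.sdiff_subset.trans hX1, by
      rw [xorF_sdiff _ hU, h0, Nat.xor_zero, hX2]⟩
    have h2 := Finset.sum_sdiff (f := ω) hU
    have h3 : 0 < ∑ i ∈ U, ω i := Finset.sum_pos'
      (fun _ _ => Nat.zero_le _) ⟨u, hu, h.pos u (Finset.mem_range.1 (hX1 (hU hu)))⟩
    omega
  have hcard : X.card ≤ m := by simpa using Finset.card_le_card hX1
  -- Rounding up, so that `X` fits into 16 parts of size `w` with a deficit of at most 15.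
  set w := (X.card + 15) / 16 with hw
  refine (MeasureTheory.measure_mono ?_).trans (coins_trials_fail_le (ω := ω) h.col_lt hX1 hX2 hind
    (w := w) (by omega) (by omega) (by omega) (w * trials m * trialCoins n (m + 22)))
  intro r hr j hj
  rintro ⟨z, hz, hz2⟩
  refine hr ?_
  obtain ⟨σ, h0, -, hI⟩ := h.searchInv r
  have hq : 0 < trials m := by omega
  have hc : w * trials m + j < ((m + 15) / 16 + 1) * trials m := by
    calc w * trials m + j < (w + 1) * trials m := by rw [Nat.succ_mul]; omega
      _ ≤ _ := Nat.mul_le_mul_right _ (by omega)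
  have hdiv : (w * trials m + j) / trials m = w := by
    rw [mul_comm, Nat.mul_add_div hq, Nat.div_eq_of_lt hj, Nat.add_zero]
  -- Trial `w * trials m + j` is the `j`-th one for size `w`; its coins start at a position that
  -- does not depend on earlier outcomes.
  have hoff : 0 + (w * trials m + j) * trialCoins n (m + 22) =
      w * trials m * trialCoins n (m + 22) + j * trialCoins n (m + 22) := by ring
  have key := hI.found (w * trials m + j) hc z (by
    rw [h0]
    simp only [params]
    rw [hdiv, hoff]
    exact hz)
  exact ⟨key.1, fun Y hY hY2 => (key.2.trans hz2).trans (hmin Y ⟨hY, hY2⟩)⟩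

end

/-! ### The running time -/

/-- Every parameter other than the modulus, the stride and the budget is polynomial in the input
size, and the budget is a polynomial times `81 ^ m / 64 ^ m + 1`. Without nested budget loops this
factor enters only once; the length of the modulus contributes another linear factor. -/
theorem mainTime_le (P : Cmd) (hP : P.ShortLoops) (hd : P.deg ≤ 1) : ∃ C k : ℕ,
    ∀ (inp : List ℕ) (n m : ℕ), n + m ≤ inp.length → 1 ≤ inp.length →
      mainTime P inp n m ≤ C * inputSize inp ^ k * (81 ^ m / 64 ^ m + 1) := by
  obtain ⟨C₁, k₁, h₁⟩ := Cmd.steps_le paramC (by simp [paramC, Cmd.block, Cmd.ShortLoops])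
  obtain ⟨C₂, k₂, h₂⟩ := Cmd.steps_le P hP
  obtain ⟨K, hK1, hK⟩ : ∃ K, 40 ≤ K ∧ ∀ m s, m ≤ s → 1 ≤ s → trials m ≤ K * s ^ 15 := by
    -- Here `m + 16 ≤ 17 * s`, because `1 ≤ s`.
    refine ⟨2 ^ 400 * 17 ^ 15, by norm_num, fun m s h1 h2 => ?_⟩
    rw [trials, mul_assoc, ← mul_pow]
    exact Nat.mul_le_mul_left _ (Nat.pow_le_pow_left (by omega) _)
  refine ⟨(40 + C₁ * K ^ k₁ + C₂ * K ^ k₂) * 7000, 15 * k₁ + 15 * k₂ + 2,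
    fun inp n m hnm hl => ?_⟩
  have hls := length_le_inputSize inp
  have hu : unit (modulus inp) ≤ 7000 * inputSize inp := by
    have := size_modulus_le inp
    simp only [unit]; omega
  set s := inputSize inp with hs
  set R := 81 ^ m / 64 ^ m + 1 with hR
  have hs1 : 1 ≤ s := by omega
  have hR1 : 1 ≤ R := Nat.le_add_left 1 _
  have hss : s ≤ s ^ 15 := Nat.le_self_pow (by norm_num) s
  have hT := hK m s (by omega) hs1
  have hX : 40 * s ≤ K * s ^ 15 := Nat.mul_le_mul hK1 hss
  have hX1 : 1 ≤ K * s ^ 15 := by omega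
  -- Before the initial computation the budget is zero, so `R = 1` will do.
  have g₁ := h₁ (params₀ inp n m) (K * s ^ 15) 1 hX1 le_rfl
    (fun k h1 h2 h3 => by cases k <;> simp only [params₀] <;> first | omega | contradiction)
    (Nat.zero_le _)
  have g₂ := h₂ (params inp n m) (K * s ^ 15) R hX1 hR1
    (fun k h1 h2 h3 => by cases k <;> simp only [params] <;> first | omega | contradiction)
    (by simp only [params]; rw [budget]; exact Nat.mul_le_mul_right _ hT)
  rw [one_pow, mul_one, mul_pow, ← pow_mul] at g₁
  rw [mul_pow, ← pow_mul] at g₂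
  have hRd : R ^ P.deg ≤ R := by
    calc R ^ P.deg ≤ R ^ 1 := Nat.pow_le_pow_right hR1 hd
      _ = R := pow_one R
  have a0 : 5 * inp.length + 35 ≤ 40 * s := by omega
  have p : ∀ {a}, a ≤ 15 * k₁ + 15 * k₂ + 1 → s ^ a ≤ s ^ (15 * k₁ + 15 * k₂ + 1) :=
    fun h => Nat.pow_le_pow_right hs1 h
  have t0 : 40 * s ≤ 40 * s ^ (15 * k₁ + 15 * k₂ + 1) * R := by
    calc 40 * s = 40 * s ^ 1 * 1 := by ring
      _ ≤ _ := Nat.mul_le_mul (Nat.mul_le_mul_left _ (p (by omega))) hR1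
  have t1 : C₁ * (K ^ k₁ * s ^ (15 * k₁)) ≤ C₁ * K ^ k₁ * s ^ (15 * k₁ + 15 * k₂ + 1) * R := by
    calc C₁ * (K ^ k₁ * s ^ (15 * k₁)) = C₁ * K ^ k₁ * s ^ (15 * k₁) * 1 := by ring
      _ ≤ _ := Nat.mul_le_mul (Nat.mul_le_mul_left _ (p (by omega))) hR1
  have t2 : C₂ * (K ^ k₂ * s ^ (15 * k₂)) * R ^ P.deg ≤
      C₂ * K ^ k₂ * s ^ (15 * k₁ + 15 * k₂ + 1) * R := by
    rw [← mul_assoc C₂]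
    exact Nat.mul_le_mul (Nat.mul_le_mul_left _ (p (by omega))) hRd
  calc mainTime P inp n m
      ≤ ((40 + C₁ * K ^ k₁ + C₂ * K ^ k₂) * s ^ (15 * k₁ + 15 * k₂ + 1) * R) * (7000 * s) := by
        refine Nat.mul_le_mul ?_ hu
        rw [add_mul, add_mul, add_mul, add_mul]
        omega
    _ = _ := by ring

theorem searchC_shortLoops : searchC.ShortLoops := by
  simp [searchC, roundC, moduC, trialC, updateC, keepC, baseC, baseStep, hashC, appendC, parityC,
    nodeC, drawC, mergeC, pairBody, insertC, bucketBody, pushC, analyze, Cmd.block, Cmd.ShortLoops]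

end RAM

namespace RAM

open SplitSearch

/-- The exponent comes from `(81 / 64) ^ 153 ≤ 2 ^ 52` and `52 / 153 < 0.3399`, which reduces the
comparison to integers. -/
theorem growth_le (m : ℕ) :
    ((81 ^ m / 64 ^ m + 1 : ℕ) : ℝ) ≤ 2 * (2 : ℝ) ^ (0.3399 * (m : ℝ)) := by
  have h1 : (81 / 64 : ℝ) ≤ (2 : ℝ) ^ (0.3399 : ℝ) := by
    have h2 : (81 / 64 : ℝ) ^ (153 : ℝ) ≤ ((2 : ℝ) ^ (0.3399 : ℝ)) ^ (153 : ℝ) := by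
      rw [← Real.rpow_mul (by norm_num)]
      calc (81 / 64 : ℝ) ^ (153 : ℝ) = (81 / 64 : ℝ) ^ 153 := by
            rw [← Real.rpow_natCast]; norm_num
        _ ≤ 2 ^ 52 := by norm_num
        _ = (2 : ℝ) ^ (52 : ℝ) := by rw [← Real.rpow_natCast]; norm_num
        _ ≤ _ := Real.rpow_le_rpow_of_exponent_le (by norm_num) (by norm_num)
    exact (Real.rpow_le_rpow_iff (by norm_num) (by positivity) (by norm_num)).1 h2
  have h3 : ((81 ^ m / 64 ^ m : ℕ) : ℝ) ≤ (2 : ℝ) ^ (0.3399 * (m : ℝ)) := by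
    calc ((81 ^ m / 64 ^ m : ℕ) : ℝ) ≤ ((81 ^ m : ℕ) : ℝ) / ((64 ^ m : ℕ) : ℝ) := Nat.cast_div_le
      _ = (81 / 64 : ℝ) ^ m := by push_cast; rw [div_pow]
      _ ≤ ((2 : ℝ) ^ (0.3399 : ℝ)) ^ m := pow_le_pow_left₀ (by norm_num) h1 m
      _ = _ := by rw [← Real.rpow_natCast, ← Real.rpow_mul (by norm_num)]
  have h4 : (1 : ℝ) ≤ (2 : ℝ) ^ (0.3399 * (m : ℝ)) :=
    Real.one_le_rpow (by norm_num) (by positivity)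
  push_cast at h3 ⊢
  linarith

theorem cast_time_le {C k s m c : ℕ} (h : c ≤ C * s ^ k * (81 ^ m / 64 ^ m + 1)) :
    (c : ℝ) ≤ (2 * C : ℕ) * (s : ℝ) ^ k * (2 : ℝ) ^ (0.3399 * (m : ℝ)) := by
  calc (c : ℝ) ≤ ((C * s ^ k * (81 ^ m / 64 ^ m + 1) : ℕ) : ℝ) := by exact_mod_cast h
    _ = C * (s : ℝ) ^ k * ((81 ^ m / 64 ^ m + 1 : ℕ) : ℝ) := by push_cast; ring
    _ ≤ C * (s : ℝ) ^ k * (2 * (2 : ℝ) ^ (0.3399 * (m : ℝ))) :=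
        mul_le_mul_of_nonneg_left (growth_le m) (by positivity)
    _ = _ := by push_cast; ring

theorem two_mul_lt_modulus {inp : List ℕ} {x y : ℕ} (hx : x ≤ inputProd inp)
    (hy : y ≤ inputProd inp) : x + y < modulus inp := by
  have := lt_modulus (inp := inp) (x := 0) (y := x + y) (k := 1) (j := 1)
    (by norm_num) (by rw [pow_one, pow_one]; omega) (by norm_num) (by norm_num)
  omega

/-! ### Lists -/

theorem getD_ofFn {m : ℕ} (f : Fin m → ℕ) (i : ℕ) (h : i < m) : (List.ofFn f).getD i 0 = f ⟨i, h⟩ := by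
  rw [List.getD_eq_getElem _ _ (by simpa using h)]; simp

theorem flatten_ofFn {n m : ℕ} (f : Fin n → Fin m → ℕ) :
    (List.ofFn fun i => List.ofFn fun j => f i j).flatten =
      List.ofFn fun k : Fin (n * m) => f k.divNat k.modNat := by
  rw [List.ofFn_mul]
  congr 2
  funext i
  congr 1
  funext j
  have hm : 0 < m := (Nat.zero_le _).trans_lt j.2
  congr 1
  · apply Fin.ext
    simp only [Fin.coe_divNat]
    rw [mul_comm, Nat.mul_add_div hm, Nat.div_eq_of_lt j.2, Nat.add_zero]
  · apply Fin.ext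
    simp only [Fin.coe_modNat]
    rw [Nat.mul_add_mod', Nat.mod_eq_of_lt j.2]

theorem getD_flatten {n m : ℕ} (f : Fin n → Fin m → ℕ) {u i : ℕ} (hu : u < n) (hi : i < m) :
    (List.ofFn fun i => List.ofFn fun j => f i j).flatten.getD (u * m + i) 0 = f ⟨u, hu⟩ ⟨i, hi⟩ := by
  have hm : 0 < m := by omega
  have h : u * m + i < n * m := by
    calc u * m + i < (u + 1) * m := by rw [Nat.succ_mul]; omega
      _ ≤ _ := Nat.mul_le_mul_right _ hu
  rw [flatten_ofFn, getD_ofFn _ _ h]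
  congr 1
  · apply Fin.ext
    simp only [Fin.coe_divNat]
    rw [mul_comm, Nat.mul_add_div hm, Nat.div_eq_of_lt hi, Nat.add_zero]
  · apply Fin.ext
    simp only [Fin.coe_modNat]
    rw [Nat.mul_add_mod', Nat.mod_eq_of_lt hi]

theorem sum_fin_ite {M : Type*} [AddCommMonoid M] {m : ℕ} {X : Finset ℕ} (hX : X ⊆ Finset.range m)
    (g : ℕ → M) : (∑ j : Fin m, if (j : ℕ) ∈ X then g j else 0) = ∑ i ∈ X, g i := by
  rw [Fin.sum_univ_eq_sum_range (fun i => if i ∈ X then g i else 0) m, Finset.sum_ite_mem,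
    Finset.inter_eq_right.2 hX]

theorem start_mem_zero (inp : List ℕ) (a : ℕ) : (start inp).mem a 0 = inp.getD a 0 := by
  simp [start]

theorem fresh_init (inp : List ℕ) : Fresh inp (init inp) :=
  ⟨rfl, rfl, fun _ => rfl, fun _ => rfl⟩

/-! ### Linear systems modulo two as equations between columns -/

/-- The matrix extended by zeros. -/
def extend {n m : ℕ} (f : Fin n → Fin m → ℕ) (u i : ℕ) : ℕ :=
  if h : u < n ∧ i < m then f ⟨u, h.1⟩ ⟨i, h.2⟩ else 0

/-- The vector extended by zeros. -/
def extend₁ {m : ℕ} (f : Fin m → ℕ) (i : ℕ) : ℕ := if h : i < m then f ⟨i, h⟩ else 0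

theorem extend_apply {n m : ℕ} (f : Fin n → Fin m → ℕ) (u : Fin n) (i : Fin m) :
    extend f u i = f u i := by simp [extend]

theorem extend₁_apply {m : ℕ} (f : Fin m → ℕ) (i : Fin m) : extend₁ f i = f i := by
  simp [extend₁]

theorem extend_lt {n m : ℕ} {f : Fin n → Fin m → ℕ} (hf : ∀ u i, f u i < 2) (u i : ℕ) :
    extend f u i < 2 := by
  unfold extend; split_ifs
  · exact hf _ _
  · norm_num

theorem extend₁_lt {m : ℕ} {f : Fin m → ℕ} (hf : ∀ i, f i < 2) (i : ℕ) : extend₁ f i < 2 := by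
  unfold extend₁; split_ifs
  · exact hf _
  · norm_num

/-- The columns of a matrix with entries `0` and `1`, and after them the target. -/
def columns (n m : ℕ) (A : ℕ → ℕ → ℕ) (b : ℕ → ℕ) (i : ℕ) : ℕ :=
  if i < m then horner (fun u => A u i) n else horner b n

theorem columns_lt {n m : ℕ} {A : ℕ → ℕ → ℕ} {b : ℕ → ℕ} (hA : ∀ u i, A u i < 2)
    (hb : ∀ u, b u < 2) (i : ℕ) : columns n m A b i < 2 ^ n := by
  unfold columns; split_ifs
  · exact horner_lt fun u _ => hA u i
  · exact horner_lt fun u _ => hb u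

/-- Digits are compared one at a time by `horner_inj`, and the exclusive or of zeros and ones is
their sum in `ZMod 2`. -/
theorem xorF_columns {n m : ℕ} {A : ℕ → ℕ → ℕ} {b : ℕ → ℕ} (hA : ∀ u i, A u i < 2)
    (hb : ∀ u, b u < 2) {X : Finset ℕ} (hX : X ⊆ Finset.range m) :
    xorF (columns n m A b) X = columns n m A b m ↔
      ∀ u < n, ∑ i ∈ X, (A u i : ZMod 2) = (b u : ZMod 2) := by
  have h1 : xorF (columns n m A b) X = horner (fun u => xorF (A u) X) n := by
    rw [← xorF_horner fun i _ u _ => hA u i]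
    exact xorF_congr fun i hi => if_pos (Finset.mem_range.1 (hX hi))
  have h2 : columns n m A b m = horner b n := if_neg (lt_irrefl m)
  have hx : ∀ u, xorF (A u) X < 2 := fun u => xorF_lt_two fun i _ => hA u i
  rw [h1, h2, horner_inj (fun u _ => hx u) fun u _ => hb u]
  refine forall₂_congr fun u _ => ?_
  rw [← natCast_xorF, ZMod.natCast_eq_natCast_iff', Nat.mod_eq_of_lt (hx u), Nat.mod_eq_of_lt (hb u)]

end RAM

/-! ### Linear Sat -/

namespace LinearSat

open RAM SplitSearch

variable (I : LinearSat)

/-- The matrix of an instance, with natural numbers as entries. -/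
def mat : ℕ → ℕ → ℕ := extend fun u i => (I.A u i).val

/-- The right-hand side of an instance. -/
def rhs : ℕ → ℕ := extend₁ fun u => (I.b u).val

/-- The weights of an instance. -/
def wt : ℕ → ℕ := extend₁ fun i => (I.ω i : ℕ)

theorem mat_lt (u i : ℕ) : I.mat u i < 2 := extend_lt (fun u i => ZMod.val_lt (I.A u i)) u i

theorem rhs_lt (u : ℕ) : I.rhs u < 2 := extend₁_lt (fun u => ZMod.val_lt (I.b u)) u

theorem length_input : I.input.length = I.n * I.m + (I.n + I.m) * 1 + 4 := by
  simp only [input, flatten_ofFn, List.length_append, List.length_cons, List.length_nil,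
    List.length_ofFn]
  ring

theorem input_wt {i : ℕ} (hi : i < I.m) : I.input.getD (i + 4) 0 = I.wt i := by
  rw [input, List.append_assoc, List.append_assoc, List.getD_append_right _ _ _ _ (by simp),
    List.getD_append _ _ _ _ (by simpa using hi)]
  simp only [List.length_cons, List.length_nil]
  rw [show i + 4 - (0 + 1 + 1 + 1 + 1) = i by omega, getD_ofFn _ _ hi]
  simp [wt, extend₁, hi]

theorem input_rhs {u : ℕ} (hu : u < I.n) : I.input.getD (I.m + 4 + u) 0 = I.rhs u := by
  rw [input, List.append_assoc, List.getD_append_right _ _ _ _ (by simp),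
    List.getD_append _ _ _ _ (by simp; omega)]
  simp only [List.length_append, List.length_cons, List.length_nil, List.length_ofFn]
  rw [show I.m + 4 + u - (0 + 1 + 1 + 1 + 1 + I.m) = u by omega, getD_ofFn _ _ hu]
  simp [rhs, extend₁, hu]

theorem input_mat {u i : ℕ} (hu : u < I.n) (hi : i < I.m) :
    I.input.getD (I.m + I.n + 4 + i + u * I.m) 0 = I.mat u i := by
  rw [input, List.getD_append_right _ _ _ _ (by simp; omega)]
  simp only [List.length_append, List.length_cons, List.length_nil, List.length_ofFn]
  rw [show I.m + I.n + 4 + i + u * I.m - (0 + 1 + 1 + 1 + 1 + I.m + I.n) = u * I.m + i by omega,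
    getD_flatten _ hu hi]
  simp [mat, extend, hu, hi]

theorem sum_wt_le : ∑ i ∈ Finset.range I.m, I.wt i ≤ I.input.sum := by
  have h : ∑ i ∈ Finset.range I.m, I.wt i = (List.ofFn fun j => (I.ω j : ℕ)).sum := by
    rw [List.sum_ofFn, ← Fin.sum_univ_eq_sum_range]
    exact Finset.sum_congr rfl fun i _ => extend₁_apply _ i
  rw [h, input]
  simp only [List.sum_append]
  omega

theorem isSolution_iff {X : Finset ℕ} (hX : X ⊆ Finset.range I.m) :
    I.IsSolution (fun j => if (j : ℕ) ∈ X then 1 else 0) ↔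
      xorF (columns I.n I.m I.mat I.rhs) X = columns I.n I.m I.mat I.rhs I.m ∧
      ((∑ i ∈ X, I.wt i : ℕ) : ℤ) ≤ I.t := by
  rw [IsSolution, xorF_columns I.mat_lt I.rhs_lt hX]
  refine and_congr ?_ ?_
  · have hb : ∀ u : Fin I.n, (I.rhs u : ZMod 2) = I.b u := fun u => by
      rw [rhs, extend₁_apply, ZMod.natCast_val, ZMod.cast_id]
    have hA : ∀ u : Fin I.n, (I.A *ᵥ fun j => if (j : ℕ) ∈ X then 1 else 0) u =
        ∑ i ∈ X, (I.mat u i : ZMod 2) := fun u => by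
      rw [← sum_fin_ite hX, Matrix.mulVec, dotProduct]
      refine Finset.sum_congr rfl fun j _ => ?_
      rw [mat, extend_apply, ZMod.natCast_val, ZMod.cast_id, mul_ite, mul_one, mul_zero]
    rw [funext_iff]
    constructor
    · intro h u hu
      have := h ⟨u, hu⟩
      rw [hA, ← hb] at this
      exact this
    · intro h u
      rw [hA, ← hb]
      exact h u u.2
  · have : ∑ j : Fin I.m, ((I.ω j : ℕ) : ℤ) * (((if (j : ℕ) ∈ X then 1 else 0 : ZMod 2)).val : ℤ) =
        ((∑ i ∈ X, I.wt i : ℕ) : ℤ) := by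
      push_cast
      rw [← sum_fin_ite hX]
      refine Finset.sum_congr rfl fun j _ => ?_
      rw [wt, extend₁_apply]
      split_ifs
      · simp [ZMod.val_one]
      · simp
    rw [this]

/-! ### The program for Linear Sat -/

/-- Load a column and its weight. -/
def colC : Cmd := .block [.set .wt (.get (Var.i + 4) 0), .set .ad (Par.m + Par.n + 4 + Var.i),
  .set .step Par.m, readCol]

/-- Load the right-hand side. -/
def rhsC : Cmd := .block [.set .ad (Par.m + 4), .set .step 1, readCol]

theorem loader : Loader I.input I.n I.m (columns I.n I.m I.mat I.rhs) I.wt colC rhsC := by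
  have hlen := I.length_input
  have hle : I.n + I.m ≤ I.input.length := by omega
  have hS := setting hle
  have hV := length_lt_modulus I.input 5 (by norm_num)
  have hV2 := two_mul_lt_modulus (length_lt_inputProd I.input).le (length_lt_inputProd I.input).le
  have mV : (params I.input I.n I.m) .V = modulus I.input := rfl
  have mn : (params I.input I.n I.m) .n = I.n := rfl
  have mm : (params I.input I.n I.m) .m = I.m := rfl
  have mN : (params I.input I.n I.m) .N = I.input.length := rfl
  have md : ∀ {x}, x ≤ I.input.length → x % modulus I.input = x :=
    fun h => Nat.mod_eq_of_lt (by omega)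
  have m4 := md (x := 4) (by omega)
  have m0 : 0 % modulus I.input = 0 := Nat.zero_mod _
  have e2 := md (x := I.m) (by omega)
  have e3 := md (x := I.n) (by omega)
  have e4 := md (x := I.m + I.n) (by omega)
  have e5 := md (x := I.m + I.n + 4) (by omega)
  have e6 := md (x := I.m + 4) (by omega)
  have e7 := md (x := 1) (by omega)
  refine ⟨hle, fun i _ => columns_lt I.mat_lt I.rhs_lt i, fun i hi => ?_,
    I.sum_wt_le.trans_lt ?_, fun r i hi => ?_, fun r τ hτ hτi hmem => ?_, ?_, ?_⟩
  · simp [wt, extend₁, hi]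
  · exact two_mul_lt_modulus (y := 0) (sum_lt_inputProd I.input).le (Nat.zero_le _)
  · have key : ∀ τ : St, τ.Bdd (params I.input I.n I.m) → τ.v .i = i →
        (∀ a < (params I.input I.n I.m) .N, τ.mem a = (start I.input).mem a) →
        (colC.run (params I.input I.n I.m) r τ).v .x = columns I.n I.m I.mat I.rhs i ∧
        (colC.run (params I.input I.n I.m) r τ).v .wt = I.wt i ∧
        (colC.run (params I.input I.n I.m) r τ).mem = τ.mem ∧
        (colC.run (params I.input I.n I.m) r τ).tossed = τ.tossed := by
      intro τ hτ hτi hmem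
      rw [mN] at hmem
      have e8 := md (x := i + 4) (by omega)
      have hmul : ∀ u < I.n, I.m + I.n + 4 + i + u * I.m < I.input.length := by
        intro u hu
        have := Nat.mul_le_mul_right I.m hu
        rw [Nat.succ_mul] at this
        omega
      have e9 : (I.m + I.n + 4 + i) % modulus I.input = I.m + I.n + 4 + i :=
        Nat.mod_eq_of_lt (by omega)
      have hw : τ.mem (i + 4) 0 = I.wt i := by
        rw [hmem _ (by omega), start_mem_zero, I.input_wt hi]
      have hrun : colC.run (params I.input I.n I.m) r τ = readCol.run (params I.input I.n I.m) r
          (((τ.setv .wt (I.wt i)).setv .ad (I.m + I.n + 4 + i)).setv .step I.m) := by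
        simp [colC, mV, mn, mm, hτi, m4, m0, e2, e3, e4, e5, e8, e9, hw]
      obtain ⟨k1, -, k3, k4⟩ := readCol_spec (r := r)
        (σ := ((τ.setv .wt (I.wt i)).setv .ad (I.m + I.n + 4 + i)).setv .step I.m) hS
        (f := fun u => I.mat u i) (fun u _ => I.mat_lt u i) (a := I.m + I.n + 4 + i) (b := I.m)
        (by simp) (by simp) (fun u hu => by
          simp only [setv_mem]
          rw [hmem _ (hmul u hu), start_mem_zero, I.input_mat hu hi])
        (by rw [mn, mV]; omega)
      rw [hrun]
      refine ⟨?_, ?_, k3, k4⟩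
      · rw [k1, mn, columns, if_pos hi]
      · rw [readCol.run_of_not_writes (by simp [readCol, Cmd.writes])]
        simp
    exact ⟨fun τ h1 h2 h3 => ⟨(key τ h1 h2 h3).1, (key τ h1 h2 h3).2.2⟩,
      fun τ h1 h2 h3 => (key τ h1 h2 h3).2⟩
  · rw [mN] at hmem
    have hrun : rhsC.run (params I.input I.n I.m) r τ = readCol.run (params I.input I.n I.m) r
        ((τ.setv .ad (I.m + 4)).setv .step 1) := by
      simp [rhsC, mV, mm, m4, e2, e6, e7]
    obtain ⟨k1, -, k3, k4⟩ := readCol_spec (r := r) (σ := (τ.setv .ad (I.m + 4)).setv .step 1) hS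
      (f := I.rhs) (fun u _ => I.rhs_lt u) (a := I.m + 4) (b := 1) (by simp) (by simp)
      (fun u hu => by
        rw [mn] at hu
        simp only [setv_mem, mul_one]
        rw [hmem _ (by omega), start_mem_zero, I.input_rhs hu])
      (by rw [mn, mV]; omega)
    rw [hrun]
    exact ⟨by rw [k1, mn, columns, if_neg (lt_irrefl _)], k3, k4⟩
  · simp [colC, readCol, Cmd.writes]
  · simp [colC, readCol, Cmd.writes]

/-- Discard a solution whose weight is too large. -/
def checkC : Cmd := .ite (.op .lt (.get 2 0) (Var.bw + .get 3 0)) (.set .flag 0) .skip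

/-- The program for Linear Sat. -/
def solveC : Cmd := .block [setupC colC rhsC, searchC, checkC, outC]

/-- The search minimizes the weight and ignores `t`; afterwards the best weight is compared with
`t`. As the best weight is never beaten by a solution when the search succeeds, this decides the
instance. -/
theorem solveC_spec (r : ℕ → Bool) :
    let σ := searched I.input I.n I.m colC rhsC r
    let τ := solveC.run (params I.input I.n I.m) r (ready I.input I.n I.m r)
    (τ.v .flag ≠ 0 ↔ σ.v .flag ≠ 0 ∧ (σ.v .bw : ℤ) ≤ I.t) ∧
    (σ.v .flag ≠ 0 → xorF (columns I.n I.m I.mat I.rhs) (supp I.m (σ.v .best)) =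
      columns I.n I.m I.mat I.rhs I.m ∧ σ.v .bw = ∑ i ∈ supp I.m (σ.v .best), I.wt i) ∧
    ∀ i < I.m, τ.mem i 0 = if i ∈ supp I.m (σ.v .best) then 1 else 0 := by
  intro σ τ
  have hL := I.loader
  have hS := setting hL.len
  have hlen := I.length_input
  obtain ⟨σ₀, -, hlow, hI⟩ := hL.searchInv r
  have hV := length_lt_modulus I.input 5 (by norm_num)
  have mV : (params I.input I.n I.m) .V = modulus I.input := rfl
  have m0 : 0 % modulus I.input = 0 := Nat.zero_mod _
  have m2 : 2 % modulus I.input = 2 := Nat.mod_eq_of_lt (by omega)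
  have m3 : 3 % modulus I.input = 3 := Nat.mod_eq_of_lt (by omega)
  have m1 : 1 % modulus I.input = 1 := Nat.mod_eq_of_lt (by omega)
  change SearchInv _ r _ _ σ₀ _ σ at hI
  have hτ : τ = outC.run (params I.input I.n I.m) r (checkC.run (params I.input I.n I.m) r σ) := rfl
  have hin : ∀ a < I.input.length, σ.mem a 0 = I.input.getD a 0 := fun a ha => by
    rw [hI.low a ha, hlow a ha, start_mem_zero]
  have h2 : σ.mem 2 0 = I.t.toNat := by rw [hin 2 (by omega)]; simp [input]
  have h3 : σ.mem 3 0 = (-I.t).toNat := by rw [hin 3 (by omega)]; simp [input]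
  have hbd := hI.flag
  refine ⟨?_, hbd, ?_⟩
  · rw [hτ, outC_frame (by simp) (by simp)]
    by_cases hf : σ.v .flag = 0
    · rw [checkC, run_ite]
      split_ifs <;> simp [hf]
    · have hbw := (hbd hf).2
      have hbw2 : σ.v .bw ≤ I.input.sum := by
        rw [hbw]
        exact (wsum_le_sum _ _ _).trans I.sum_wt_le
      have ht : (-I.t).toNat < inputProd I.input := by
        refine lt_of_le_of_lt (List.le_sum_of_mem ?_) (sum_lt_inputProd I.input)
        simp [input]
      have hsum := sum_lt_inputProd I.input
      have e : (σ.v .bw + (-I.t).toNat) % modulus I.input = σ.v .bw + (-I.t).toNat :=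
        Nat.mod_eq_of_lt (two_mul_lt_modulus (hbw2.trans hsum.le) ht.le)
      simp only [checkC, run_ite, eval_lt', eval_get, eval_add, eval_var, eval_lit, mV, m0, m2, m3,
        h2, h3, e]
      -- Since `t` is the difference of its two parts, this inequality of natural numbers says `t <
      -- bw`.
      by_cases hc : I.t.toNat < σ.v .bw + (-I.t).toNat
      · simp only [hc, if_true, m1, ne_eq, one_ne_zero, not_false_eq_true, run_set, setv_v, eval_lit,
          mV, m0]
        exact iff_of_false (by simp) fun h => by have := h.2; omega
      · simp only [hc, if_false, m0, ne_eq, not_true_eq_false, run_skip]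
        omega
  · intro i hi
    have hb : (checkC.run (params I.input I.n I.m) r σ).Bdd (params I.input I.n I.m) :=
      Cmd.run_bdd hS.ok _ hI.bdd
    have hbest : (checkC.run (params I.input I.n I.m) r σ).v .best = σ.v .best :=
      Cmd.run_of_not_writes _ (by simp [checkC, Cmd.writes])
    rw [hτ, outC_spec hS hb i hi, hbest]
    simp [mem_supp, hi]

theorem monteCarlo : ∃ (p : RAM.Prog) (C k : ℕ),
    RAM.IsMonteCarlo p LinearSat.input LinearSat.read
      LinearSat.IsSolution LinearSat.IsSolution
      (fun I => C * (RAM.inputSize I.input : ℝ) ^ k * (2 : ℝ) ^ (0.3399 * (I.m : ℝ))) := by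
  obtain ⟨C, k, hT⟩ := mainTime_le solveC
    (by
      have := searchC_shortLoops
      simp [solveC, setupC, colC, rhsC, readCol, checkC, outC, Cmd.block, Cmd.ShortLoops, this])
    (by decide)
  refine ⟨mainProg 1 4 solveC, 2 * C, k, fun I => ?_⟩
  have hL := I.loader
  have hlen := I.length_input
  have key : ∀ r, ∃ (s : State) (c : ℕ), Exec r (mainProg 1 4 solveC) (init I.input) s c ∧
      (c : ℝ) ≤ (2 * C : ℕ) * (RAM.inputSize I.input : ℝ) ^ k * (2 : ℝ) ^ (0.3399 * (I.m : ℝ)) ∧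
      (s.reg 0 ≠ 0 ↔ (searched I.input I.n I.m colC rhsC r).v .flag ≠ 0 ∧
        ((searched I.input I.n I.m colC rhsC r).v .bw : ℤ) ≤ I.t) ∧
      (s.reg 0 ≠ 0 → ∃ x, I.read s = some x ∧ I.IsSolution x) := by
    intro r
    obtain ⟨s, ⟨c, he, hc⟩, hR⟩ := mainProg_exec (r := r) (a := 1) (b := 4) solveC
      (n := I.n) (m := I.m) (by simp [input]) (by simp [input]) hlen hL.len le_rfl
      (fresh_init I.input)
    obtain ⟨h1, h2, h3⟩ := I.solveC_spec r
    have h0 : s.reg 0 = _ := hR.var .flag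
    refine ⟨s, c, he, cast_time_le (hc.trans (hT _ _ _ hL.len (by omega))), by rw [h0]; exact h1,
      fun hs => ?_⟩
    rw [h0] at hs
    obtain ⟨g1, g2⟩ := h1.1 hs
    obtain ⟨g3, g4⟩ := h2 g1
    refine ⟨_, by rw [read, if_neg (by rw [h0]; exact hs)],
      ?_⟩
    have hX : supp I.m ((searched I.input I.n I.m colC rhsC r).v .best) ⊆ Finset.range I.m :=
      Finset.filter_subset _ _
    have hx : (fun j : Fin I.m => (s.mem j : ZMod 2)) = fun j : Fin I.m =>
        if (j : ℕ) ∈ supp I.m ((searched I.input I.n I.m colC rhsC r).v .best) then 1 else 0 := by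
      funext j
      -- Entry 0 of array `j` is memory cell `j`, where the answer is read.
      have hm := hR.mem j 0 (by
        have := length_lt_modulus I.input 0 (by norm_num)
        have : (params I.input I.n I.m) .V = modulus I.input := rfl
        have := j.2
        omega)
      rw [Nat.zero_mul, Nat.zero_add] at hm
      rw [hm, h3 j j.2]
      split_ifs <;> simp
    rw [hx, I.isSolution_iff hX]
    exact ⟨g3, by rw [← g4]; exact g2⟩
  refine ⟨fun r => ?_, fun ⟨x, hx⟩ => ?_⟩
  · obtain ⟨s, c, he, hc, -, h⟩ := key r
    refine ⟨s, c, he, hc, fun a ha => ?_⟩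
    by_cases h0 : s.reg 0 = 0
    · simp [read, h0] at ha
    · obtain ⟨x, h1, h2⟩ := h h0
      rw [h1] at ha
      exact Option.some.inj ha ▸ h2
  · set X : Finset ℕ := (Finset.range I.m).filter fun i => ∃ h : i < I.m, x ⟨i, h⟩ ≠ 0 with hXd
    have hX : X ⊆ Finset.range I.m := Finset.filter_subset _ _
    have hxX : x = fun j : Fin I.m => if (j : ℕ) ∈ X then 1 else 0 := by
      funext j
      have : (j : ℕ) ∈ X ↔ x j ≠ 0 := by simp [hXd]
      by_cases h : x j = 0
      · simp [this, h]
      · rw [if_pos (this.2 h)]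
        exact Fin.eq_one_of_ne_zero _ h
    rw [hxX, I.isSolution_iff hX] at hx
    refine (MeasureTheory.measure_mono ?_).trans (hL.coins_le ⟨X, hX, hx.1⟩)
    intro r hr hgood
    refine hr ?_
    obtain ⟨s, c, he, -, h1, h2⟩ := key r
    obtain ⟨y, h3, h4⟩ := h2 (h1.2 ⟨hgood.1, le_trans (by exact_mod_cast hgood.2 X hX hx.1) hx.2⟩)
    exact ⟨s, c, y, he, h3, h4⟩

end LinearSat

/-! ### Further timed machine steps -/

namespace RAM

theorem ExecLe.cond_true {r : ℕ → Bool} {V x a b : ℕ} {p q : Prog} {s s' : State} (ha : s.reg x = a)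
    (h0 : a ≠ 0) (hV : a ≤ V) (h : ExecLe r p s s' (b * unit V)) :
    ExecLe r (.cond x p q) s s' ((1 + b) * unit V) := by
  subst ha
  obtain ⟨c, e, hc⟩ := h
  refine ⟨_, .cond_true h0 e, ?_⟩
  have := size_le_of_le hV
  rw [add_mul, one_mul]
  simp only [unit] at *; omega

theorem ExecLe.cond_false {r : ℕ → Bool} {V x b : ℕ} {p q : Prog} {s s' : State} (ha : s.reg x = 0)
    (h : ExecLe r q s s' (b * unit V)) : ExecLe r (.cond x p q) s s' ((1 + b) * unit V) := by
  obtain ⟨c, e, hc⟩ := h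
  refine ⟨_, .cond_false ha e, ?_⟩
  rw [add_mul, one_mul, ha]
  simp only [unit, Nat.size_zero] at *; omega

theorem ExecLe.store {r : ℕ → Bool} {V x y a b : ℕ} {s : State} (ha : s.reg x = a)
    (hb : s.reg y = b) (ha' : a ≤ V) (hb' : b ≤ V) :
    ExecLe r (.store x y) s (s.setMem a b) (1 * unit V) := by
  subst ha hb
  refine ⟨_, .store _ _ _, ?_⟩
  have := size_le_of_le ha'
  have := size_le_of_le hb'
  simp only [unit]; omega

end RAM

/-! ### Minimum Set Partition -/

namespace SetPartition

open RAM SplitSearch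

variable (G : SetPartition)

theorem isPartition_iff (S : Finset (Fin G.m)) :
    G.IsPartition S ↔ ∀ u, (S.filter fun f => u ∈ G.N f).card = 1 := by
  constructor
  · rintro ⟨h1, h2⟩ u
    have hu : u ∈ S.biUnion G.N := h1 ▸ Finset.mem_univ u
    obtain ⟨f, hf, hfu⟩ := Finset.mem_biUnion.1 hu
    refine Finset.card_eq_one.2 ⟨f, ?_⟩
    ext g
    simp only [Finset.mem_filter, Finset.mem_singleton]
    constructor
    · rintro ⟨hg, hgu⟩
      by_contra hne
      exact Finset.disjoint_left.1 (h2 g hg f hf hne) hgu hfu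
    · rintro rfl; exact ⟨hf, hfu⟩
  · intro h
    refine ⟨Finset.eq_univ_of_forall fun u => ?_, fun f hf g hg hne => ?_⟩
    · obtain ⟨f, hf⟩ := Finset.card_pos.1 (by rw [h u]; exact one_pos)
      rw [Finset.mem_filter] at hf
      exact Finset.mem_biUnion.2 ⟨f, hf⟩
    · refine Finset.disjoint_left.2 fun u hfu hgu => hne ?_
      exact Finset.card_le_one.1 (h u).le f (Finset.mem_filter.2 ⟨hf, hfu⟩) g
        (Finset.mem_filter.2 ⟨hg, hgu⟩)

theorem sum_card_filter (S : Finset (Fin G.m)) :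
    ∑ u, (S.filter fun f => u ∈ G.N f).card = ∑ f ∈ S, (G.N f).card := by
  simp only [Finset.card_filter]
  rw [Finset.sum_comm]
  refine Finset.sum_congr rfl fun f _ => ?_
  rw [← Finset.card_filter]
  congr 1
  ext u; simp

/-- The incidence matrix. -/
def inc : ℕ → ℕ → ℕ := extend fun (u : Fin G.n) (f : Fin G.m) => if u ∈ G.N f then 1 else 0

/-- The weight of a set: its size, and in the lower digit its number. -/
def wt : ℕ → ℕ := extend₁ fun f : Fin G.m => (G.N f).card * (G.m + 1) + 1

/-- The subfamily with the given indices. -/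
def family (X : Finset ℕ) : Finset (Fin G.m) := Finset.univ.filter fun f => (f : ℕ) ∈ X

theorem inc_lt (u i : ℕ) : G.inc u i < 2 := extend_lt (fun u f => by split_ifs <;> norm_num) u i

variable {G} in
theorem sum_family {M : Type*} [AddCommMonoid M] {X : Finset ℕ} (hX : X ⊆ Finset.range G.m)
    (g : ℕ → M) : ∑ f ∈ G.family X, g f = ∑ i ∈ X, g i := by
  rw [family, Finset.sum_filter, sum_fin_ite hX]

theorem sum_inc {X : Finset ℕ} (hX : X ⊆ Finset.range G.m) (u : Fin G.n) :
    ∑ i ∈ X, G.inc u i = ((G.family X).filter fun f => u ∈ G.N f).card := by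
  rw [← sum_family hX, Finset.card_filter]
  exact Finset.sum_congr rfl fun f _ => extend_apply _ u f

theorem sum_wt {X : Finset ℕ} (hX : X ⊆ Finset.range G.m) :
    ∑ i ∈ X, G.wt i = (∑ f ∈ G.family X, (G.N f).card) * (G.m + 1) + (G.family X).card := by
  rw [← sum_family hX, Finset.sum_mul, Finset.card_eq_sum_ones, ← Finset.sum_add_distrib]
  exact Finset.sum_congr rfl fun f _ => extend₁_apply _ f

/-- The congruences say that every element is covered an odd number of times. In the number system
with base `m + 1`, the weight has the sum of the set sizes as leading part and the number of sets as
last digit, so the weight bound says that the sizes sum to at most `n`. -/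
theorem isPartition_family_iff {X : Finset ℕ} (hX : X ⊆ Finset.range G.m) :
    G.IsPartition (G.family X) ↔
      xorF (columns G.n G.m G.inc fun _ => 1) X = columns G.n G.m G.inc (fun _ => 1) G.m ∧
      ∑ i ∈ X, G.wt i ≤ G.n * (G.m + 1) + G.m := by
  have hcard : (G.family X).card ≤ G.m := by
    simpa using Finset.card_le_univ (G.family X)
  rw [isPartition_iff, xorF_columns G.inc_lt (fun _ => by norm_num) hX, G.sum_wt hX,
    ← sum_card_filter]
  constructor
  · intro h
    refine ⟨fun u hu => ?_, ?_⟩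
    · have := G.sum_inc hX ⟨u, hu⟩
      rw [h] at this
      rw [← Nat.cast_sum, this]
    · simp only [h, Finset.sum_const, Finset.card_univ, Fintype.card_fin, smul_eq_mul, mul_one]
      omega
  · rintro ⟨h1, h2⟩
    -- An odd number is not zero.
    have h3 : ∀ u ∈ Finset.univ, 1 ≤ ((G.family X).filter fun f => u ∈ G.N f).card := by
      intro u _
      by_contra h0
      have h4 := h1 u u.2
      rw [← Nat.cast_sum, G.sum_inc hX u, Nat.lt_one_iff.1 (not_le.1 h0)] at h4
      exact absurd h4 (by decide)
    have h4 : ∑ u, ((G.family X).filter fun f => u ∈ G.N f).card ≤ G.n := by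
      by_contra! h5
      -- A total size of `n + 1` would already cost `(n + 1) * (m + 1) > n * (m + 1) + m`.
      have := Nat.mul_le_mul_right (G.m + 1) (Nat.succ_le_of_lt h5)
      rw [Nat.succ_mul] at this
      omega
    have h5 : ∑ _u : Fin G.n, 1 ≤ ∑ u, ((G.family X).filter fun f => u ∈ G.N f).card :=
      Finset.sum_le_sum h3
    have h6 := (Finset.sum_eq_sum_iff_of_le h3).1 (le_antisymm h5 (by simpa using h4))
    exact fun u => (h6 u (Finset.mem_univ u)).symm

-- Among partitions the leading part of the weight is constant, so least weight means fewest sets.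
variable {G} in
theorem sum_wt_of_isPartition {X : Finset ℕ} (hX : X ⊆ Finset.range G.m)
    (h : G.IsPartition (G.family X)) :
    ∑ i ∈ X, G.wt i = G.n * (G.m + 1) + (G.family X).card := by
  rw [G.sum_wt hX, ← sum_card_filter]
  simp [(G.isPartition_iff _).1 h]

theorem exists_family_eq (S : Finset (Fin G.m)) : ∃ X ⊆ Finset.range G.m, G.family X = S := by
  refine ⟨S.map Fin.valEmbedding, fun i hi => ?_, ?_⟩
  · obtain ⟨f, -, rfl⟩ := Finset.mem_map.1 hi
    exact Finset.mem_range.2 f.2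
  · ext f
    simp only [family, Finset.mem_filter, Finset.mem_univ, true_and, Finset.mem_map,
      Fin.valEmbedding_apply]
    exact ⟨fun ⟨g, hg, h⟩ => Fin.ext h ▸ hg, fun h => ⟨f, h, rfl⟩⟩

theorem length_input : G.input.length = G.n * G.m + (G.n + G.m) * 0 + 2 := by
  simp only [input, flatten_ofFn, List.length_append, List.length_cons, List.length_nil,
    List.length_ofFn]
  ring

theorem input_inc {u i : ℕ} (hu : u < G.n) (hi : i < G.m) :
    G.input.getD (2 + i * G.n + u) 0 = G.inc u i := by
  rw [input, List.getD_append_right _ _ _ _ (by simp; omega)]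
  simp only [List.length_cons, List.length_nil]
  rw [show 2 + i * G.n + u - (0 + 1 + 1) = i * G.n + u by omega, getD_flatten _ hi hu]
  simp [inc, extend, hu, hi]

/-- Load the incidence vector of a set and its weight. -/
def colC : Cmd := .block [.set .ad (2 + Var.i * Par.n), .set .step 1, readCol,
  .set .wt (Var.cnt * Par.m1 + 1)]

/-- Load the incidence vector of the universe. -/
def univC : Cmd := .block [.set .x 0, .rep .n (.set .x (2 * Var.x + 1))]

variable {G}

theorem add_le (h : G.n * G.m ≠ 0) : G.n + G.m ≤ G.n * G.m + 1 := by
  obtain ⟨h1, h2⟩ := Nat.mul_ne_zero_iff.1 h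
  obtain ⟨a, ha⟩ := Nat.exists_eq_succ_of_ne_zero h1
  obtain ⟨b, hb⟩ := Nat.exists_eq_succ_of_ne_zero h2
  rw [ha, hb]
  have := Nat.zero_le (a * b)
  simp only [Nat.succ_eq_add_one]
  nlinarith

/-- If `n` or `m` is zero, the input has only two entries while the other number may be huge, so `n
+ m` need not be bounded by the length of the input. For a nonzero product it is, by `add_le`. -/
theorem loader (h : G.n * G.m ≠ 0) :
    Loader G.input G.n G.m (columns G.n G.m G.inc fun _ => 1) G.wt colC univC := by
  have hlen := G.length_input
  have hadd := add_le h
  have hle : G.n + G.m ≤ G.input.length := by omega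
  have hS := setting hle
  have hV := length_lt_modulus G.input 5 (by norm_num)
  have hV2 := two_mul_lt_modulus (length_lt_inputProd G.input).le (length_lt_inputProd G.input).le
  have mV : (params G.input G.n G.m) .V = modulus G.input := rfl
  have mn : (params G.input G.n G.m) .n = G.n := rfl
  have mm1 : (params G.input G.n G.m) .m1 = G.m + 1 := rfl
  have mN : (params G.input G.n G.m) .N = G.input.length := rfl
  have md : ∀ {x}, x ≤ G.input.length → x % modulus G.input = x :=
    fun h => Nat.mod_eq_of_lt (by omega)
  have m0 : 0 % modulus G.input = 0 := Nat.zero_mod _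
  have e1 := md (x := 1) (by omega)
  have e2 := md (x := 2) (by omega)
  have e3 := md (x := G.n) (by omega)
  have e4 := md (x := G.m + 1) (by omega)
  have hcard : ∀ i, ∑ u ∈ Finset.range G.n, G.inc u i ≤ G.n := fun i => by
    calc ∑ u ∈ Finset.range G.n, G.inc u i ≤ ∑ u ∈ Finset.range G.n, 1 :=
          Finset.sum_le_sum fun u _ => Nat.le_of_lt_succ (G.inc_lt u i)
      _ = G.n := by simp
  have hwt : ∀ i < G.m, G.wt i = (∑ u ∈ Finset.range G.n, G.inc u i) * (G.m + 1) + 1 := by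
    intro i hi
    have h1 := extend₁_apply (fun f : Fin G.m => (G.N f).card * (G.m + 1) + 1) ⟨i, hi⟩
    have h2 : ∑ u ∈ Finset.range G.n, G.inc u i = (G.N ⟨i, hi⟩).card := by
      rw [← Fin.sum_univ_eq_sum_range (fun u => G.inc u i)]
      have : ∀ u : Fin G.n, G.inc u i = if u ∈ G.N ⟨i, hi⟩ then 1 else 0 :=
        fun u => extend_apply (fun (u : Fin G.n) (f : Fin G.m) => if u ∈ G.N f then 1 else 0) u ⟨i, hi⟩
      simp only [this]
      rw [← Finset.card_filter]
      congr 1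
      ext u; simp
    rw [h2]; exact h1
  refine ⟨hle, fun i _ => columns_lt G.inc_lt (fun _ => by norm_num) i, fun i hi => ?_, ?_,
    fun r i hi => ?_, fun r τ hτ hτi hmem => ?_, ?_, ?_⟩
  · rw [hwt i hi]; omega
  · have h1 : ∑ i ∈ Finset.range G.m, G.wt i ≤ G.input.length ^ 2 := by
      calc ∑ i ∈ Finset.range G.m, G.wt i ≤ ∑ i ∈ Finset.range G.m, (G.n * (G.m + 1) + 1) := by
            refine Finset.sum_le_sum fun i hi => ?_
            rw [hwt i (Finset.mem_range.1 hi)]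
            exact Nat.add_le_add_right (Nat.mul_le_mul_right _ (hcard i)) 1
        _ = (G.n * G.m) * (G.m + 1) + G.m := by simp; ring
        _ ≤ (G.n * G.m) * G.input.length + 2 * G.input.length := by
            have := Nat.mul_le_mul_left (G.n * G.m) (show G.m + 1 ≤ G.input.length by omega)
            omega
        _ = G.input.length ^ 2 := by rw [← add_mul, pow_two]; congr 1; omega
    have h2 : G.input.length ^ 2 ≤ inputProd G.input ^ 2 :=
      Nat.pow_le_pow_left (length_lt_inputProd _).le 2
    have := lt_modulus (inp := G.input) (x := 0) (y := inputProd G.input ^ 2) (k := 1) (j := 2)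
      (by norm_num) (Nat.le_mul_of_pos_left _ (by norm_num)) (by norm_num) (by norm_num)
    omega
  · have key : ∀ τ : St, τ.Bdd (params G.input G.n G.m) → τ.v .i = i →
        (∀ a < (params G.input G.n G.m) .N, τ.mem a = (start G.input).mem a) →
        (colC.run (params G.input G.n G.m) r τ).v .x = columns G.n G.m G.inc (fun _ => 1) i ∧
        (colC.run (params G.input G.n G.m) r τ).v .wt = G.wt i ∧
        (colC.run (params G.input G.n G.m) r τ).mem = τ.mem ∧
        (colC.run (params G.input G.n G.m) r τ).tossed = τ.tossed := by
      intro τ hτ hτi hmem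
      rw [mN] at hmem
      have hin : i * G.n + G.n ≤ G.n * G.m := by
        rw [← Nat.succ_mul, mul_comm]; exact Nat.mul_le_mul_left _ hi
      have e5 := md (x := i * G.n) (by omega)
      have e6 := md (x := 2 + i * G.n) (by omega)
      obtain ⟨k1, k2, k3, k4⟩ := readCol_spec (r := r)
        (σ := (τ.setv .ad (2 + i * G.n)).setv .step 1) hS
        (f := fun u => G.inc u i) (fun u _ => G.inc_lt u i) (a := 2 + i * G.n) (b := 1)
        (by simp) (by simp) (fun u hu => by
          rw [mn] at hu
          simp only [setv_mem, mul_one]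
          rw [hmem _ (by omega), start_mem_zero, G.input_inc hu hi])
        (by rw [mn, mV]; omega)
      have hc := hcard i
      have hc2 := Nat.mul_le_mul_right (G.m + 1) hc
      rw [mul_add G.n, mul_one] at hc2
      have e7 := Nat.mod_eq_of_lt (a := (∑ u ∈ Finset.range G.n, G.inc u i) * (G.m + 1))
        (b := modulus G.input) (by omega)
      have e8 := Nat.mod_eq_of_lt (a := (∑ u ∈ Finset.range G.n, G.inc u i) * (G.m + 1) + 1)
        (b := modulus G.input) (by omega)
      have hrun : colC.run (params G.input G.n G.m) r τ = (readCol.run (params G.input G.n G.m) r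
          ((τ.setv .ad (2 + i * G.n)).setv .step 1)).setv .wt (G.wt i) := by
        rw [hwt i hi]
        simp [colC, mV, mn, mm1, hτi, e1, e2, e3, e4, e5, e6, k2, e7, e8]
      rw [hrun]
      exact ⟨by rw [setv_v, if_neg (by simp), k1, mn, columns, if_pos hi], by simp, k3, k4⟩
    exact ⟨fun τ h1 h2 h3 => ⟨(key τ h1 h2 h3).1, (key τ h1 h2 h3).2.2⟩,
      fun τ h1 h2 h3 => (key τ h1 h2 h3).2⟩
  · rw [columns, if_neg (lt_irrefl _)]
    simp only [univC, run_block_cons, run_block_one]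
    refine run_rep (π := params G.input G.n G.m) (r := r) (k := .n) (fun j τ' =>
      τ'.v .x = horner (fun _ => 1) j ∧ τ'.mem = τ.mem ∧ τ'.tossed = τ.tossed) ?_ ?_
    · simp [horner]
    · rintro j hj τ' ⟨k1, k2, k3⟩
      rw [mn] at hj
      have hlt : horner (fun _ => 1) (j + 1) < modulus G.input := by
        refine (horner_lt fun u _ => by norm_num).trans_le ?_
        exact (lt_modulus_of_exp (inp := G.input) (l := G.n) (a := 0) (b := 1) (by omega)
          (Nat.pow_le_pow_right (by norm_num) (by omega)) (by norm_num) (by norm_num)).le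
      rw [horner] at hlt
      have g1 := Nat.mod_eq_of_lt (a := 2 * horner (fun _ => 1) j) (b := modulus G.input) (by omega)
      have g2 := Nat.mod_eq_of_lt hlt
      simp [mV, k1, k2, k3, e1, e2, g1, g2, horner]
  · simp [colC, readCol, Cmd.writes]
  · simp [colC, readCol, Cmd.writes]

/-- Discard a family that is not a partition. -/
def checkC : Cmd :=
  .ite (.op .lt (Par.n * Par.m1 + Par.m) Var.bw) (.set .flag 0) .skip

/-- The program for Set Partition. The size of the partition is left in `y`. -/
def solveC : Cmd := .block
  [setupC colC univC, searchC, checkC, outC, .set .y (Var.bw - Par.n * Par.m1)]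

/-- The weight test alone separates partitions from other solutions modulo two, and subtracting `n *
(m + 1)` from the weight leaves the size. -/
theorem solveC_spec (h : G.n * G.m ≠ 0) (r : ℕ → Bool) :
    let σ := searched G.input G.n G.m colC univC r
    let τ := solveC.run (params G.input G.n G.m) r (ready G.input G.n G.m r)
    (τ.v .flag ≠ 0 ↔ σ.v .flag ≠ 0 ∧ σ.v .bw ≤ G.n * (G.m + 1) + G.m) ∧
    (σ.v .flag ≠ 0 → xorF (columns G.n G.m G.inc fun _ => 1) (supp G.m (σ.v .best)) =
      columns G.n G.m G.inc (fun _ => 1) G.m ∧ σ.v .bw = ∑ i ∈ supp G.m (σ.v .best), G.wt i) ∧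
    (∀ i < G.m, τ.mem i 0 = if i ∈ supp G.m (σ.v .best) then 1 else 0) ∧
    τ.v .y = σ.v .bw - G.n * (G.m + 1) := by
  intro σ τ
  have hL := loader h
  have hS := setting hL.len
  have hlen := G.length_input
  have hadd := add_le h
  obtain ⟨σ₀, -, -, hI⟩ := hL.searchInv r
  have hV := length_lt_modulus G.input 5 (by norm_num)
  have hV2 := two_mul_lt_modulus (length_lt_inputProd G.input).le (length_lt_inputProd G.input).le
  have mV : (params G.input G.n G.m) .V = modulus G.input := rfl
  have mn : (params G.input G.n G.m) .n = G.n := rfl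
  have mm : (params G.input G.n G.m) .m = G.m := rfl
  have mm1 : (params G.input G.n G.m) .m1 = G.m + 1 := rfl
  have m0 : 0 % modulus G.input = 0 := Nat.zero_mod _
  have m1 : 1 % modulus G.input = 1 := Nat.mod_eq_of_lt (by omega)
  have hmul : G.n * (G.m + 1) = G.n * G.m + G.n := by ring
  have e1 := Nat.mod_eq_of_lt (a := G.n) (b := modulus G.input) (by omega)
  have e2 := Nat.mod_eq_of_lt (a := G.m) (b := modulus G.input) (by omega)
  have e3 := Nat.mod_eq_of_lt (a := G.m + 1) (b := modulus G.input) (by omega)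
  have e4 := Nat.mod_eq_of_lt (a := G.n * (G.m + 1)) (b := modulus G.input) (by omega)
  have e5 := Nat.mod_eq_of_lt (a := G.n * (G.m + 1) + G.m) (b := modulus G.input) (by omega)
  change SearchInv _ r _ _ σ₀ _ σ at hI
  have hτ : τ = (outC.run (params G.input G.n G.m) r (checkC.run (params G.input G.n G.m) r σ)).setv
      .y ((Var.bw - Par.n * Par.m1 : Expr).eval (params G.input G.n G.m)
        (outC.run (params G.input G.n G.m) r (checkC.run (params G.input G.n G.m) r σ))) := rfl
  have hbw : (outC.run (params G.input G.n G.m) r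
      (checkC.run (params G.input G.n G.m) r σ)).v .bw = σ.v .bw := by
    rw [outC_frame (by simp) (by simp)]
    exact Cmd.run_of_not_writes _ (by simp [checkC, Cmd.writes])
  refine ⟨?_, hI.flag, fun i hi => ?_, ?_⟩
  · rw [hτ, setv_v, if_neg (by simp), outC_frame (by simp) (by simp)]
    simp only [checkC, run_ite, eval_lt', eval_mul, eval_add, eval_var, eval_par, mV, mn, mm, mm1,
      e1, e2, e3, e4, e5]
    by_cases hc : G.n * (G.m + 1) + G.m < σ.v .bw
    · simp only [hc, if_true, m1, ne_eq, one_ne_zero, not_false_eq_true, run_set, setv_v, eval_lit,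
        mV, m0]
      exact iff_of_false (by simp) fun h => absurd h.2 (by omega)
    · simp only [hc, if_false, m0, ne_eq, not_true_eq_false, run_skip]
      exact ⟨fun h => ⟨h, by omega⟩, fun h => h.1⟩
  · have hb : (checkC.run (params G.input G.n G.m) r σ).Bdd (params G.input G.n G.m) :=
      Cmd.run_bdd hS.ok _ hI.bdd
    have hbest : (checkC.run (params G.input G.n G.m) r σ).v .best = σ.v .best :=
      Cmd.run_of_not_writes _ (by simp [checkC, Cmd.writes])
    rw [hτ, setv_mem, outC_spec hS hb i hi, hbest]
    simp [mem_supp, hi]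
  · rw [hτ, setv_v, if_pos rfl]
    simp only [eval_sub, eval_mul, eval_var, eval_par, mV, mn, mm1, e1, e3, e4, hbw]
    exact Nat.mod_eq_of_lt ((Nat.sub_le _ _).trans_lt (hI.bdd.var .bw))

/-! ### Degenerate instances, and the program for Set Partition -/

/-- The program for instances with an empty universe or an empty family. -/
def trivialProg : Prog := .seq (.op .eq 0 (regT 2) (regT 0)) (.store (regT 1) (regT 0))

/-- The program for Set Partition. -/
def prog : Prog :=
  .seq (.const (regT 0) 0) <| .seq (.const (regT 1) 1) <| .seq (.load (regT 2) (regT 0)) <|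
  .seq (.load (regT 3) (regT 1)) <| .seq (.op .mul (regT 4) (regT 2) (regT 3)) <|
  .cond (regT 4) (.seq (mainProg 0 2 solveC) (.copy 1 (regV .y))) trivialProg

/-- The state before the case distinction. -/
def midState (G : SetPartition) : State :=
  (((((init G.input).setReg (regT 0) 0).setReg (regT 1) 1).setReg (regT 2) G.n).setReg
    (regT 3) G.m).setReg (regT 4) (G.n * G.m)

theorem prog_exec {r : ℕ → Bool} {s : State} {a : ℕ}
    (h : ExecLe r (.cond (regT 4) (.seq (mainProg 0 2 solveC) (.copy 1 (regV .y))) trivialProg)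
      G.midState s (a * unit (modulus G.input))) :
    ExecLe r prog (init G.input) s ((a + 5) * unit (modulus G.input)) := by
  have hn := getD_lt_modulus G.input 0
  have hm := getD_lt_modulus G.input 1
  have hnV : G.n + 2 < modulus G.input := hn
  have hmV : G.m + 2 < modulus G.input := hm
  have hlen := G.length_input
  have hV := length_lt_modulus G.input 5 (by norm_num)
  have e := ExecLe.seq (r := r) (s := init G.input) (V := modulus G.input)
    (ExecLe.const (x := regT 0) (k := 0) (by omega)) <| .seq (.const (x := regT 1) (k := 1) (by omega)) <|
    .seq (.load (x := regT 2) (y := regT 0) (a := 0) (w := G.n) (by simp [setReg_reg, regT_inj]) rfl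
      (by omega) (by omega)) <|
    .seq (.load (x := regT 3) (y := regT 1) (a := 1) (w := G.m) (by simp [setReg_reg, regT_inj]) rfl
      (by omega) (by omega)) <|
    .seq (.op (o := .mul) (x := regT 4) (y := regT 2) (z := regT 3) (a := G.n) (b := G.m)
      (w := G.n * G.m) (by simp [setReg_reg, regT_inj]) (by simp [setReg_reg]) rfl
      (by omega) (by omega) (by omega)) h
  rwa [show 1 + (1 + (1 + (1 + (1 + a)))) = a + 5 by ring] at e

/-- For an empty universe the empty family is the minimum; for an empty family and a nonempty
universe there is no partition. In either case the answer is exact and takes a bounded number of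
steps. -/
theorem read_trivial (h : G.n * G.m = 0) (r : ℕ → Bool) : ∃ s : State,
    ExecLe r prog (init G.input) s (8 * unit (modulus G.input)) ∧
      (∀ a, G.read s = some a → G.IsSizedPartition a) ∧
      ((∃ a, G.IsMinimum a) → ∃ a, G.read s = some a ∧ G.IsMinimum a) := by
  have hnV : G.n + 2 < modulus G.input := getD_lt_modulus G.input 0
  have hlen := G.length_input
  have e : ExecLe r trivialProg G.midState ((G.midState.setReg 0 (if G.n = 0 then 1 else 0)).setMem
      1 0) ((1 + 1) * unit (modulus G.input)) :=
    .seq (.op (a := G.n) (b := 0) (w := if G.n = 0 then 1 else 0) (by simp [midState, setReg_reg, regT_inj])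
      (by simp [midState, setReg_reg, regT_inj]) rfl (by omega) (by omega) (by split_ifs <;> omega))
      (.store (by simp [midState, setReg_reg, regT])
        (by simp [midState, setReg_reg, regT]) (by omega) (by omega))
  refine ⟨_, prog_exec (.cond_false (by simp [midState, setReg_reg, h]) e), ?_⟩
  set s := (G.midState.setReg 0 (if G.n = 0 then 1 else 0)).setMem 1 0 with hs
  have h0 : s.reg 0 = if G.n = 0 then 1 else 0 := by simp [hs, State.setMem, setReg_reg]
  by_cases hn : G.n = 0
  · have h1 : s.reg 1 = 0 := by
      simp [hs, State.setMem, midState, setReg_reg, regT, init]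
    have hmem : ∀ i, s.mem i = 0 := by
      intro i
      have : s.mem i = if i = 1 then 0 else G.input.getD i 0 := by
        simp [hs, State.setMem, Function.update_apply, midState, init]
      rw [this]
      split_ifs with hi
      · rfl
      -- All marks have to be zero: cell 0 holds `n = 0`, cell 1 held `m` and has been overwritten,
      -- and the input ends there.
      · rcases i with _ | _ | i
        · exact hn
        · exact absurd rfl hi
        · exact List.getD_eq_default _ _ (by omega)
    have hread : G.read s = some (0, ∅) := by
      rw [read, if_neg (by rw [h0, if_pos hn]; exact one_ne_zero), h1]
      simp [hmem]
    have hp : G.IsSizedPartition (0, ∅) := by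
      refine ⟨(G.isPartition_iff _).2 fun u => ?_, rfl⟩
      exact absurd u.2 (by omega)
    rw [hread]
    exact ⟨fun a ha => Option.some.inj ha ▸ hp, fun _ => ⟨_, rfl, hp, fun _ _ => Nat.zero_le _⟩⟩
  · have hread : G.read s = none := by rw [read, if_pos (by rw [h0, if_neg hn])]
    have hm : G.m = 0 := by
      rcases Nat.mul_eq_zero.1 h with h | h
      · exact absurd h hn
      · exact h
    rw [hread]
    refine ⟨fun a ha => by simp at ha, fun ⟨a, ha⟩ => ?_⟩
    have h2 := (G.isPartition_iff _).1 ha.1.1 ⟨0, Nat.pos_of_ne_zero hn⟩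
    obtain ⟨f, -⟩ := Finset.card_pos.1 (by rw [h2]; exact one_pos)
    exact absurd f.2 (by omega)

/-- Register 1 holds the modulus during the computation, so the size is kept in the variable `y` and
moved there at the very end. -/
theorem read_search (h : G.n * G.m ≠ 0) (r : ℕ → Bool) : ∃ s : State,
    ExecLe r prog (init G.input) s (mainTime solveC G.input G.n G.m + 7 * unit (modulus G.input)) ∧
      (∀ a, G.read s = some a → G.IsSizedPartition a) ∧
      ((searched G.input G.n G.m colC univC r).v .flag ≠ 0 →
        (searched G.input G.n G.m colC univC r).v .bw ≤ G.n * (G.m + 1) + G.m →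
        ∃ a, G.read s = some a ∧
          G.n * (G.m + 1) + a.1 = (searched G.input G.n G.m colC univC r).v .bw) := by
  have hL := loader h
  have hlen := G.length_input
  have hV := length_lt_modulus G.input 5 (by norm_num)
  have hfresh : Fresh G.input G.midState := by
    refine ⟨rfl, rfl, fun x => ?_, fun k => ?_⟩
    · simp [midState, setReg_reg, regV_ne_regT, init]
    · simp [midState, setReg_reg, regP_ne_regT, init]
  obtain ⟨s, he, hR⟩ := mainProg_exec (r := r) (a := 0) (b := 2) solveC
    (n := G.n) (m := G.m) (by simp [input]) (by simp [input]) hlen hL.len (Nat.zero_le _) hfresh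
  obtain ⟨h1, h2, h3, h4⟩ := solveC_spec h r
  set σ := searched G.input G.n G.m colC univC r with hσ
  set τ := solveC.run (params G.input G.n G.m) r (ready G.input G.n G.m r) with hτ
  have hy : τ.v .y ≤ modulus G.input := by
    have := Cmd.run_bdd (r := r) (setting hL.len).ok solveC (ready_spec hL.len r).1
    exact (this.var .y).le
  have e := prog_exec (.cond_true (a := G.n * G.m) (setReg_self _ _ _) h (by omega)
    (.seq he (.copy (x := 1) (hR.var .y) hy)))
  refine ⟨s.setReg 1 (τ.v .y), ?_, ?_⟩
  · obtain ⟨c, e, hc⟩ := e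
    refine ⟨c, e, hc.trans (le_of_eq ?_)⟩
    rw [mainTime]; ring
  · have hreg0 : (s.setReg 1 (τ.v .y)).reg 0 = τ.v .flag := by
      rw [setReg_of_ne _ _ (by norm_num)]; exact hR.var .flag
    have hreg1 : (s.setReg 1 (τ.v .y)).reg 1 = τ.v .y := setReg_self _ _ _
    set X := supp G.m (σ.v .best) with hXd
    have hX : X ⊆ Finset.range G.m := Finset.filter_subset _ _
    have hread : τ.v .flag ≠ 0 →
        G.read (s.setReg 1 (τ.v .y)) = some (τ.v .y, G.family X) := by
      intro hf
      rw [read, if_neg (by rw [hreg0]; exact hf), hreg1]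
      congr 2
      refine Finset.filter_congr fun f _ => ?_
      have hm := hR.mem f 0 (by
        have : (params G.input G.n G.m) .V = modulus G.input := rfl
        have := f.2
        have := add_le h
        omega)
      rw [Nat.zero_mul, Nat.zero_add] at hm
      rw [setReg_mem, hm, h3 f f.2]
      split_ifs with hf <;> simp [hf]
    have hpart : τ.v .flag ≠ 0 → G.IsPartition (G.family X) ∧
        σ.v .bw = G.n * (G.m + 1) + (G.family X).card := by
      intro hf
      obtain ⟨g1, g2⟩ := h1.1 hf
      obtain ⟨g3, g4⟩ := h2 g1
      have := (G.isPartition_family_iff hX).2 ⟨g3, by rw [← g4]; exact g2⟩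
      exact ⟨this, g4.trans (sum_wt_of_isPartition hX this)⟩
    refine ⟨fun a ha => ?_, fun g1 g2 => ?_⟩
    · by_cases hf : τ.v .flag = 0
      · rw [read, if_pos (by rw [hreg0]; exact hf)] at ha
        simp at ha
      · rw [hread hf] at ha
        obtain rfl := Option.some.inj ha
        obtain ⟨g3, g4⟩ := hpart hf
        exact ⟨g3, by rw [h4, g4]; simp⟩
    · have hf := h1.2 ⟨g1, g2⟩
      obtain ⟨g3, g4⟩ := hpart hf
      exact ⟨_, hread hf, by rw [h4, g4]; simp⟩

theorem monteCarlo : ∃ (p : RAM.Prog) (C k : ℕ),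
    RAM.IsMonteCarlo p SetPartition.input SetPartition.read
      SetPartition.IsSizedPartition SetPartition.IsMinimum
      (fun G => C * (RAM.inputSize G.input : ℝ) ^ k * (2 : ℝ) ^ (0.3399 * (G.m : ℝ))) := by
  obtain ⟨C, k, hT⟩ := mainTime_le solveC
    (by
      have := searchC_shortLoops
      simp [solveC, setupC, colC, univC, readCol, checkC, outC, Cmd.block, Cmd.ShortLoops, this])
    (by decide)
  refine ⟨prog, 2 * (2 * C), k, fun G => ?_⟩
  have hlen := G.length_input
  have hunit : ∀ n m, 35 * unit (modulus G.input) ≤ mainTime solveC G.input n m := fun n m =>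
    Nat.mul_le_mul_right _ (by omega)
  by_cases h : G.n * G.m = 0
  · have hc : ∀ {c}, c ≤ 8 * unit (modulus G.input) →
        c ≤ 2 * C * inputSize G.input ^ k * (81 ^ G.m / 64 ^ G.m + 1) := by
      intro c hc
      -- The time bound for zero in place of `n` and `m`, with the same input, already pays for the
      -- few steps of the degenerate case.
      have h1 := hunit 0 0
      have h2 := hT G.input 0 0 (Nat.zero_le _) (by omega)
      have h3 : C * inputSize G.input ^ k * (81 ^ 0 / 64 ^ 0 + 1) =
        2 * C * inputSize G.input ^ k * 1 := by norm_num; ring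
      have h4 : 2 * C * inputSize G.input ^ k * 1 ≤
          2 * C * inputSize G.input ^ k * (81 ^ G.m / 64 ^ G.m + 1) :=
        Nat.mul_le_mul_left _ (Nat.le_add_left 1 _)
      omega
    refine ⟨fun r => ?_, fun hg => ?_⟩
    · obtain ⟨s, ⟨c, e, hle⟩, hv, -⟩ := read_trivial h r
      exact ⟨s, c, e, cast_time_le (hc hle), hv⟩
    -- The degenerate case never fails, so the event is empty.
    · refine le_of_eq_of_le ?_ zero_le
      rw [← MeasureTheory.measure_empty (μ := coins)]
      congr 1
      refine Set.eq_empty_of_forall_notMem fun r hr => hr ?_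
      obtain ⟨s, ⟨c, e, -⟩, -, hm⟩ := read_trivial h r
      obtain ⟨a, h1, h2⟩ := hm hg
      exact ⟨s, c, a, e, h1, h2⟩
  · have hL := loader h
    refine ⟨fun r => ?_, fun ⟨a, ha⟩ => ?_⟩
    · obtain ⟨s, ⟨c, e, hle⟩, hv, -⟩ := read_search h r
      refine ⟨s, c, e, cast_time_le ?_, hv⟩
      have h1 := hunit G.n G.m
      have h2 := hT G.input G.n G.m hL.len (by omega)
      calc c ≤ 2 * (C * inputSize G.input ^ k * (81 ^ G.m / 64 ^ G.m + 1)) := by omega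
        _ = _ := by ring
    · obtain ⟨X, hX, hXa⟩ := G.exists_family_eq a.2
      have hp : G.IsPartition (G.family X) := hXa ▸ ha.1.1
      obtain ⟨h1, h2⟩ := (G.isPartition_family_iff hX).1 hp
      refine (MeasureTheory.measure_mono ?_).trans (hL.coins_le ⟨X, hX, h1⟩)
      rintro r hr ⟨g1, g2⟩
      refine hr ?_
      obtain ⟨s, ⟨c, e, -⟩, hv, hs⟩ := read_search h r
      -- The given partition is itself a solution of admissible weight, so the best weight found
      -- passes the test.
      obtain ⟨b, h3, h4⟩ := hs g1 ((g2 X hX h1).trans h2)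
      refine ⟨s, c, b, e, h3, hv b h3, fun S hS => ?_⟩
      obtain ⟨Y, hY, rfl⟩ := G.exists_family_eq S
      have h5 := g2 Y hY ((G.isPartition_family_iff hY).1 hS).1
      rw [sum_wt_of_isPartition hY hS, ← h4] at h5
      omega

end SetPartition

theorem mainTheorem7 :
    (∃ (p : RAM.Prog) (C k : ℕ),
      RAM.IsMonteCarlo p LinearSat.input LinearSat.read
        LinearSat.IsSolution LinearSat.IsSolution
        (fun I => C * (RAM.inputSize I.input : ℝ) ^ k * (2 : ℝ) ^ (0.3399 * (I.m : ℝ)))) ∧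
    (∃ (p : RAM.Prog) (C k : ℕ),
      RAM.IsMonteCarlo p SetPartition.input SetPartition.read
        SetPartition.IsSizedPartition SetPartition.IsMinimum
        (fun G => C * (RAM.inputSize G.input : ℝ) ^ k * (2 : ℝ) ^ (0.3399 * (G.m : ℝ)))) :=
  ⟨LinearSat.monteCarlo, SetPartition.monteCarlo⟩
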